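/- Let $k$ be a field, $V$ a finite dimensional $k$-vector space, $N\ge 2$, $R\subseteq V^{\otimes N}$ a subspace, and suppose that $A=T(V)/(R)$ is an $N$-Koszul algebra: the residue field $k$ has a graded right $A$-module resolution $k\leftarrow A\leftarrow V_1\otimes A(-n(1))\leftarrow V_2\otimes A(-n(2))\leftarrow\cdots$ with $V_i$ vector spaces and $n(2q)=Nq$, $n(2q+1)=Nq+1$. A PBW-deformation of $A$ is given by a subspace $P\subseteq\bigoplus_{i\le N}V^{\otimes i}$ with $P\cap\bigoplus_{i<N}V^{\otimes i}=0$, whose projection to $V^{\otimes N}$ is $R$, and such that for the filtered algebra $U=T(V)/(P)$ the natural map $A\to\operatorname{gr}U$ is an isomorphism. Write $P=\{r+\alpha_1(r)+\cdots+\alpha_N(r)\mid r\in R\}$ with linear maps $\alpha_i:R\to V^{\otimes N-i}$; the deformation is augmented if $\alpha_N=0$. Let $W=V^*$, let $S\subseteq W^{\otimes N}$ be the orthogonal complement of $R$ for the pairing $\langle w_1\otimes\cdots\otimes w_N,v_1\otimes\cdots\otimes v_N\rangle=\prod_i w_i(v_i)$, put $A^!=T(W)/(S)$, and let $B=\bigoplus_{i\ge0}B_i$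 be the Yoneda algebra of $A$ in its explicit form $B_{2p}=(A^!)_{Np}$, $B_{2p+1}=(A^!)_{Np+1}$. An element of $B$ is called even (odd) if it lies in $\bigoplus_p B_{2p}$ (in $\bigoplus_p B_{2p+1}$), and "ordinary product" means the product of $A^!$. An $A_\infty$-structure on $B$ consists of maps $m_n:B^{\otimes n}\to B$ of degree $2-n$, $n\ge1$, with $\sum_{r+s+t=n}(-1)^{r+st}m_{r+1+t}(\mathbf 1^{\otimes r}\otimes m_s\otimes\mathbf 1^{\otimes t})=0$ for all $n\ge1$ (with the Koszul sign rule on elements). Then there is a one-to-one correspondence between the augmented PBW-deformations of $A$ and the $A_\infty$-structures on $B$ such that 1. $m_n=0$ for $n>N$; 2. $m_N$ is the ordinary product of $N$ elements when all arguments are odd; 3. $m_n$ vanishes for $3\le n\le N$ if some argument is even; 4. $m_2$ is the ordinary product when some argument is even. Explicitly, $P$ and $(m_n)$ correspond to each other if and only if, for $1\le i\le N-1$, $\alpha_i:R\to V^{\otimes N-i}$ is $\varepsilon_i$ times the transpose of $m_{N-i}:W^{\otimes N-i}=B_1^{\otimes N-i}\to B_2=W^{\otimes N}/S=R^*$, where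 $\varepsilon_0=1$, $\varepsilon_1=(-1)^{N-1}$ and $\varepsilon_{i+2}=-\varepsilon_i$. -/

import Mathlib

open scoped TensorProduct DirectSum

noncomputable section

namespace NKoszul

universe u v

/-! ### Tensor algebras, their quotients, gradings and filtrations -/

section TensorAlg

variable {k : Type u} {V : Type v} [Field k] [AddCommGroup V] [Module k V]

variable (k V) in
/-- `V^{⊗ n}`, as the degree `n` part of the tensor algebra `T(V)`. -/
abbrev tensorDeg (n : ℕ) : Submodule k (TensorAlgebra k V) :=
  LinearMap.range (TensorAlgebra.ι k : V →ₗ[k] TensorAlgebra k V) ^ n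

variable (k V) in
/-- `⨁_{j < l} V^{⊗ j}`, that is `F^{l-1} T(V)`. -/
def tensorFilLT (l : ℕ) : Submodule k (TensorAlgebra k V) :=
  ⨆ j : Fin l, tensorDeg k V j

variable (k V) in
/-- The projection of `T(V)` onto its degree `n` part, as an endomorphism of `T(V)`. -/
def tensorProj (n : ℕ) : TensorAlgebra k V →ₗ[k] TensorAlgebra k V :=
  GradedAlgebra.proj (tensorDeg k V) n

/-- The quotient `T(V)/(P)` of the tensor algebra by the two-sided ideal generated by `P`. -/
abbrev QuotAlg (P : Submodule k (TensorAlgebra k V)) : Type (max u v) :=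
  TensorAlgebra k V ⧸ (TwoSidedIdeal.span (P : Set (TensorAlgebra k V))).asIdeal

/-- The projection `T(V) → T(V)/(P)`. -/
def quotHom (P : Submodule k (TensorAlgebra k V)) : TensorAlgebra k V →ₐ[k] QuotAlg P :=
  Ideal.Quotient.mkₐ k _

/-- The image of `V^{⊗ n}` in `T(V)/(P)`; the degree `n` part if `P` is homogeneous. -/
def quotDeg (P : Submodule k (TensorAlgebra k V)) (n : ℕ) : Submodule k (QuotAlg P) :=
  (tensorDeg k V n).map (quotHom P).toLinearMap

/-- `F^{l-1} U` for `U = T(V)/(P)`: the image of `F^{l-1} T(V)`. -/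
def quotFilLT (P : Submodule k (TensorAlgebra k V)) (l : ℕ) : Submodule k (QuotAlg P) :=
  (tensorFilLT k V l).map (quotHom P).toLinearMap

/-- The degree `l` part `F^l U / F^{l-1} U` of `gr U`, where `U = T(V)/(P)`. -/
abbrev GrPiece (P : Submodule k (TensorAlgebra k V)) (l : ℕ) : Type (max u v) :=
  ↥(quotFilLT P (l + 1)) ⧸ (quotFilLT P l).submoduleOf (quotFilLT P (l + 1))

/-- The surjection `V^{⊗ l} → (T(V)/(R))_l`. -/
def toQuotDeg (R : Submodule k (TensorAlgebra k V)) (l : ℕ) :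
    ↥(tensorDeg k V l) →ₗ[k] ↥(quotDeg R l) :=
  (quotHom R).toLinearMap.submoduleMap (tensorDeg k V l)

theorem tensorDeg_le_tensorFilLT (l : ℕ) : tensorDeg k V l ≤ tensorFilLT k V (l + 1) :=
  le_iSup (fun j : Fin (l + 1) => tensorDeg k V j) (Fin.last l)

/-- The map `V^{⊗ l} → F^l U / F^{l-1} U`, where `U = T(V)/(P)`. -/
def toGrPiece (P : Submodule k (TensorAlgebra k V)) (l : ℕ) :
    ↥(tensorDeg k V l) →ₗ[k] GrPiece P l :=
  ((quotFilLT P l).submoduleOf (quotFilLT P (l + 1))).mkQ ∘ₗ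
    (quotHom P).toLinearMap.submoduleMap (tensorFilLT k V (l + 1)) ∘ₗ
      Submodule.inclusion (tensorDeg_le_tensorFilLT l)

/-- `U = T(V)/(P)` is a PBW-deformation of `A = T(V)/(R)`, where `R ⊆ V^{⊗ N}`: the space of
relations `P` lies in `⨁_{j ≤ N} V^{⊗ j}`, meets `⨁_{j < N} V^{⊗ j}` trivially, projects onto `R`
in degree `N`, and the natural map `A → gr U` (in degree `l` it sends the class of a tensor
`t ∈ V^{⊗ l}` to the class of `t`) is an isomorphism. -/
structure IsPBWDeformation (N : ℕ) (R P : Submodule k (TensorAlgebra k V)) : Prop where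
  le_fil : P ≤ tensorFilLT k V (N + 1)
  inf_eq_bot : P ⊓ tensorFilLT k V N = ⊥
  map_proj : P.map (tensorProj k V N) = R
  gr_iso : ∀ l : ℕ, ∃ e : ↥(quotDeg R l) ≃ₗ[k] GrPiece P l,
    ∀ t : ↥(tensorDeg k V l), e (toQuotDeg R l t) = toGrPiece P l t

/-- An augmented PBW-deformation: the elements of `P` have no constant term. (If
`P = {r + α₁(r) + ⋯ + α_N(r)}`, this says `α_N = 0`.) -/
structure IsAugmentedPBWDeformation (N : ℕ) (R P : Submodule k (TensorAlgebra k V)) : Prop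
    extends IsPBWDeformation N R P where
  proj_zero : ∀ p ∈ P, tensorProj k V 0 p = 0

end TensorAlg

/-! ### `N`-Koszul algebras -/

/-- `n(2q) = Nq` and `n(2q+1) = Nq + 1`. -/
def koszulDeg (N i : ℕ) : ℕ := N * (i / 2) + i % 2

section Koszul

variable {k : Type u} {V : Type v} [Field k] [AddCommGroup V] [Module k V]

/-- A resolution of the residue field `k` by graded right modules over `A = T(V)/(R)`, of the form
`k ← A ← X₁ ⊗ A(-n(1)) ← X₂ ⊗ A(-n(2)) ← ⋯`, where `A = X₀ ⊗ A` with `X₀ = k`. -/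
structure KoszulResolution (N : ℕ) (R : Submodule k (TensorAlgebra k V)) where
  X : ℕ → Type (max u v)
  [addCommGroup : ∀ i, AddCommGroup (X i)]
  [module : ∀ i, Module k (X i)]
  /-- the term in homological degree zero is `A` -/
  e₀ : X 0 ≃ₗ[k] k
  /-- the augmentation `A → k`, through which `k` is the residue field of `A` -/
  aug : QuotAlg R →ₐ[k] k
  aug_ι : ∀ v : V, aug (quotHom R (TensorAlgebra.ι k v)) = 0
  d : ∀ i, X (i + 1) ⊗[k] QuotAlg R →ₗ[k] X i ⊗[k] QuotAlg R
  /-- the differentials commute with right multiplication by elements of `A` -/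
  right_linear : ∀ i (b : QuotAlg R) (z : X (i + 1) ⊗[k] QuotAlg R),
    d i (LinearMap.lTensor (X (i + 1)) (LinearMap.mulRight k b) z) =
      LinearMap.lTensor (X i) (LinearMap.mulRight k b) (d i z)
  /-- the differentials preserve degrees, where `Xᵢ` is placed in degree `n(i)` -/
  graded : ∀ i j,
    (LinearMap.range (LinearMap.lTensor (X (i + 1)) (quotDeg R j).subtype)).map (d i) ≤
      LinearMap.range (LinearMap.lTensor (X i)
        (quotDeg R (j + (koszulDeg N (i + 1) - koszulDeg N i))).subtype)
  exact_zero : Function.Exact (d 0)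
    (aug.toLinearMap ∘ₗ (TensorProduct.lid k (QuotAlg R)).toLinearMap ∘ₗ
      LinearMap.rTensor (QuotAlg R) e₀.toLinearMap)
  exact_succ : ∀ i, Function.Exact (d (i + 1)) (d i)

/-- `A = T(V)/(R)` is an `N`-Koszul algebra. -/
def IsNKoszul (N : ℕ) (R : Submodule k (TensorAlgebra k V)) : Prop :=
  Nonempty (KoszulResolution N R)

end Koszul

/-! ### The pairing of `T(V^*)` with `T(V)`, and the graded space `B` -/

section Dual

variable {k : Type u} {V : Type v} [Field k] [AddCommGroup V] [Module k V]

variable (k V) in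
/-- The pairing of `T(V^*)` with `T(V)`: distinct degrees are orthogonal and
`⟨w₁ ⊗ ⋯ ⊗ wₙ, v₁ ⊗ ⋯ ⊗ vₙ⟩ = w₁(v₁) ⋯ wₙ(vₙ)`. -/
def tensorPairing : TensorAlgebra k (Module.Dual k V) →ₗ[k] Module.Dual k (TensorAlgebra k V) :=
  (DirectSum.toModule k ℕ (Module.Dual k (TensorAlgebra k V)) fun n =>
      (DirectSum.component k ℕ (fun i => ⨂[k]^i V) n ∘ₗ
        TensorAlgebra.equivDirectSum.toLinearMap).dualMap ∘ₗ
      (PiTensorProduct.dualDistrib :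
        (⨂[k] _ : Fin n, Module.Dual k V) →ₗ[k] Module.Dual k (⨂[k] _ : Fin n, V))) ∘ₗ
    (TensorAlgebra.equivDirectSum (R := k) (M := Module.Dual k V)).toLinearMap

theorem tensorPairing_tprod_apply {n : ℕ} (w : Fin n → Module.Dual k V)
    (z : TensorAlgebra k V) :
    tensorPairing k V (TensorAlgebra.tprod k _ n w) z =
      PiTensorProduct.dualDistrib (⨂ₜ[k] i, w i)
        (DirectSum.component k ℕ (fun i => ⨂[k]^i V) n (TensorAlgebra.toDirectSum z)) := by
  have h : TensorAlgebra.toDirectSum (TensorAlgebra.tprod k (Module.Dual k V) n w) =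
      DirectSum.lof k ℕ (fun i => ⨂[k]^i (Module.Dual k V)) n (PiTensorProduct.tprod k w) :=
    TensorAlgebra.toDirectSum_tensorPower_tprod w
  simp only [tensorPairing, TensorAlgebra.equivDirectSum, LinearMap.comp_apply,
    AlgEquiv.toLinearMap_apply, AlgEquiv.ofAlgHom_apply, h, DirectSum.toModule_lof,
    LinearMap.dualMap_apply]

theorem tensorPairing_tprod {n : ℕ} (w : Fin n → Module.Dual k V) (x : Fin n → V) :
    tensorPairing k V (TensorAlgebra.tprod k _ n w) (TensorAlgebra.tprod k _ n x) =
      ∏ i, w i (x i) := by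
  have h : TensorAlgebra.toDirectSum (TensorAlgebra.tprod k V n x) =
      DirectSum.lof k ℕ (fun i => ⨂[k]^i V) n (PiTensorProduct.tprod k x) :=
    TensorAlgebra.toDirectSum_tensorPower_tprod x
  rw [tensorPairing_tprod_apply, h, DirectSum.component.lof_self,
    PiTensorProduct.dualDistrib_apply]

theorem tensorPairing_tprod_of_ne {n m : ℕ} (hnm : n ≠ m) (w : Fin n → Module.Dual k V)
    (x : Fin m → V) :
    tensorPairing k V (TensorAlgebra.tprod k _ n w) (TensorAlgebra.tprod k _ m x) = 0 := by
  have h : TensorAlgebra.toDirectSum (TensorAlgebra.tprod k V m x) =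
      DirectSum.lof k ℕ (fun i => ⨂[k]^i V) m (PiTensorProduct.tprod k x) :=
    TensorAlgebra.toDirectSum_tensorPower_tprod x
  rw [tensorPairing_tprod_apply, h, DirectSum.component.of, dif_neg hnm.symm, map_zero]

/-- `S ⊆ (V^*)^{⊗ N}`, the orthogonal complement of `R ⊆ V^{⊗ N}`. -/
def perp (N : ℕ) (R : Submodule k (TensorAlgebra k V)) :
    Submodule k (TensorAlgebra k (Module.Dual k V)) where
  carrier := {s | s ∈ tensorDeg k (Module.Dual k V) N ∧ ∀ r ∈ R, tensorPairing k V s r = 0}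
  add_mem' := fun ha hb => ⟨add_mem ha.1 hb.1, fun r hr => by simp [ha.2 r hr, hb.2 r hr]⟩
  zero_mem' := ⟨zero_mem _, fun r _ => by simp⟩
  smul_mem' := fun c _ ha => ⟨Submodule.smul_mem _ c ha.1, fun r hr => by simp [ha.2 r hr]⟩

/-- The algebra `A^! = T(V^*)/(S)`. -/
abbrev DualAlg (N : ℕ) (R : Submodule k (TensorAlgebra k V)) : Type (max u v) :=
  QuotAlg (perp N R)

/-- The graded vector space `B`: `B_{2p} = (A^!)_{Np}` and `B_{2p+1} = (A^!)_{Np+1}`. -/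
abbrev BPiece (N : ℕ) (R : Submodule k (TensorAlgebra k V)) (i : ℕ) : Type (max u v) :=
  ↥(quotDeg (perp N R) (koszulDeg N i))

/-- The inclusion of `B = ⨁ Bᵢ` in `A^!`. -/
def toDualAlg (N : ℕ) (R : Submodule k (TensorAlgebra k V)) :
    (⨁ i, BPiece N R i) →ₗ[k] DualAlg N R :=
  DirectSum.coeLinearMap fun i => quotDeg (perp N R) (koszulDeg N i)

/-- The class in `B₁ = V^*` of a linear form `w`. -/
def linearClass (N : ℕ) (R : Submodule k (TensorAlgebra k V)) (w : Module.Dual k V) :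
    BPiece N R 1 :=
  ⟨quotHom (perp N R) (TensorAlgebra.ι k w),
    Submodule.mem_map_of_mem (by simp [koszulDeg, tensorDeg])⟩

end Dual

/-! ### `A∞`-structures -/

/-- The arguments `x₀, …, x_{r-1}, y, x_{r+s}, x_{r+s+1}, …` of the outer operation in a Stasheff
identity (with `s ≥ 1`). -/
def insertArg {M : Type*} (x : ℕ → M) (r s : ℕ) (y : M) (j : ℕ) : M :=
  if j < r then x j else if j = r then y else x (j + s - 1)

/-- An `A∞`-structure on the graded vector space `B = ⨁_{i ≥ 0} Bᵢ`: operations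
`mₙ : B^{⊗ n} → B` of degree `2 - n` for `n ≥ 1`, with
`∑_{r+s+t=n} (-1)^{r+st} m_{r+1+t} (1^{⊗ r} ⊗ m_s ⊗ 1^{⊗ t}) = 0` for all `n ≥ 1`.
Applying the left hand side to homogeneous elements produces, by the Koszul sign rule, the further
sign `(-1)^{s (|x₀| + ⋯ + |x_{r-1}|)}`. -/
@[ext]
structure AInfinityStructure (k : Type*) [Field k] (B : ℕ → Type*)
    [∀ i, AddCommGroup (B i)] [∀ i, Module k (B i)] where
  m : ∀ n : ℕ, MultilinearMap k (fun _ : Fin n => ⨁ i, B i) (⨁ i, B i)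
  /-- there is no operation of arity zero -/
  m_zero : m 0 = 0
  degree : ∀ (n : ℕ) (d : Fin n → ℕ) (x : ∀ j, B (d j)) (e : ℕ),
    (e : ℤ) ≠ (∑ j, (d j : ℤ)) + 2 - n → m n (fun j => DirectSum.lof k ℕ B (d j) (x j)) e = 0
  /-- only the first `n` of the elements `x₀, x₁, …` occur -/
  stasheff : ∀ (n : ℕ), 1 ≤ n → ∀ (d : ℕ → ℕ) (x : ∀ j, B (d j)),
    ∑ r ∈ Finset.range n, ∑ s ∈ Finset.Icc 1 (n - r),
      (-1 : k) ^ (r + s * (n - r - s) + s * ∑ j ∈ Finset.range r, d j) •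
        m (n - s + 1) (fun j : Fin (n - s + 1) =>
          insertArg (fun i => DirectSum.lof k ℕ B (d i) (x i)) r s
            (m s fun i : Fin s => DirectSum.lof k ℕ B (d (r + i)) (x (r + i))) j) = 0

section Correspondence

variable {k : Type u} {V : Type v} [Field k] [AddCommGroup V] [Module k V]

/-- The required properties of an `A∞`-structure on `B`; all products are those of `A^!`. By
multilinearity they are stated on homogeneous arguments. -/
structure IsAdmissible (N : ℕ) (R : Submodule k (TensorAlgebra k V))
    (μ : AInfinityStructure k (BPiece N R)) : Prop where
  vanish_of_lt : ∀ n, N < n → μ.m n = 0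
  odd_product : ∀ (d : Fin N → ℕ) (x : ∀ j, BPiece N R (d j)), (∀ j, Odd (d j)) →
    toDualAlg N R (μ.m N fun j => DirectSum.lof k ℕ (BPiece N R) (d j) (x j)) =
      (List.ofFn fun j => (x j : DualAlg N R)).prod
  vanish_of_even : ∀ n, 3 ≤ n → n ≤ N → ∀ (d : Fin n → ℕ) (x : ∀ j, BPiece N R (d j)),
    (∃ j, Even (d j)) → μ.m n (fun j => DirectSum.lof k ℕ (BPiece N R) (d j) (x j)) = 0
  two_product : ∀ (d : Fin 2 → ℕ) (x : ∀ j, BPiece N R (d j)), (∃ j, Even (d j)) →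
    toDualAlg N R (μ.m 2 fun j => DirectSum.lof k ℕ (BPiece N R) (d j) (x j)) =
      (x 0 : DualAlg N R) * (x 1 : DualAlg N R)

/-- The signs `ε₀ = 1`, `ε₁ = (-1)^{N-1}`, `ε_{i+2} = -ε_i`. -/
def dualSign (N : ℕ) : ℕ → ℤ
  | 0 => 1
  | 1 => (-1) ^ (N - 1)
  | i + 2 => -dualSign N i

/-- The space of relations `P` and the operations `mₙ` determine each other: writing
`P = {r + α₁(r) + ⋯ + α_{N-1}(r)}`, the map `αᵢ : R → V^{⊗ N-i}` is `εᵢ` times the transpose of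
`m_{N-i} : (V^*)^{⊗ N-i} = B₁^{⊗ N-i} → B₂ = (V^*)^{⊗ N}/S = R^*`. Here `p ∈ P` has the leading
term `r`, and `t ∈ (V^*)^{⊗ N}` represents the value of `m_{N-i}`; as distinct degrees are
orthogonal, `⟨w₁ ⊗ ⋯ ⊗ w_{N-i}, p⟩ = ⟨w₁ ⊗ ⋯ ⊗ w_{N-i}, αᵢ(r)⟩` and `⟨t, p⟩ = ⟨t, r⟩`. -/
def Corresponds (N : ℕ) (R P : Submodule k (TensorAlgebra k V))
    (μ : AInfinityStructure k (BPiece N R)) : Prop :=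
  ∀ i, 1 ≤ i → i < N → ∀ (w : Fin (N - i) → Module.Dual k V),
    ∀ t ∈ tensorDeg k (Module.Dual k V) N,
      quotHom (perp N R) t = toDualAlg N R
        (μ.m (N - i) fun j => DirectSum.lof k ℕ (BPiece N R) 1 (linearClass N R (w j))) →
      ∀ p ∈ P, tensorPairing k V (TensorAlgebra.tprod k _ (N - i) w) p =
        dualSign N i • tensorPairing k V t p

end Correspondence

end NKoszul

end

/-! Dualizing and shifting degrees turns operations on `B` into derivations. After the choice of a
basis of `V`, both `T(V)` and `T(V^*)` become a free algebra `F` in which words are orthonormal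
(`tensorPairing_eq`), and the dual of `(A^!)_n` becomes `orthPart K n`, where `K` is the ideal of
relations of `A^!`. Let `Γ` index bases `c x` of the duals of the `B_i`, `i ≥ 1`, with dual
representatives `t x` in `T(V^*)`. The free algebra on `Γ` is the cobar construction of the dual of
the positive part of `B`. A letter of index `i` has degree `i - 1` and weight `n(i)`. Suspension
signs turn the Stasheff identities into the equation that an odd derivation has square zero
(`suspSign_stasheff`, `GradedBasis.repr_stasheff_sum`).

The ordinary products give a derivation `d₀` that preserves weight; it has square zero because the
terms of each identity cancel in pairs (`stasheff_sign_sum`, `DualLetters.der_d₀`). A count of even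
and odd letters shows that conditions 1-4 say precisely that the derivation is `d₀` plus terms of
smaller weight (`count_of_wtW_le`, `wtW_lt_of_not_isProductShape`). The unit of `B` is an additional
letter on which everything is forced (`DualLetters.exists_eq_unitDer`). Hence admissible structures
are the same as filtered differentials `d` deforming `d₀`.

Koszulness enters as acyclicity. The terms of the resolution embed in `T(V)`, and the images are the
intersections of the spaces `V^{⊗a} R V^{⊗b}` (`exists_koszulSpaces`, `KoszulSpaces.eq_orthPart`).
The resulting exactness, used on the first letters of words, shows that `d₀` has no homology in
positive degrees (`DualLetters.isAcyclic`). A filtered deformation of an acyclic differential is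
acyclic as well (`IsFiltered.acyclic`). Since the lightest words of degree `i - 1` have weight
`n(i)`, a filtered differential is determined by its values on letters of index two
(`IsFiltered.unique`), and such values extend as soon as they extend to index three
(`IsFiltered.exists_extension`).

In degree zero the free algebra on `Γ` is `T(V)`. The boundaries there form the ideal generated by
the values of `d` on letters of index two, and the span of these values is `P`. If `P` is PBW, the
obstruction at index three lies in the ideal of `P` and in filtration at most `N`, hence in `P`
itself, and the extension exists (`DualLetters.exists_isFiltered`). Conversely, given `d`,
acyclicity of `d₀` in degree one removes excess leading terms, so leading parts of elements of the
ideal of `P` are relations of `A` (`DualLetters.mem_relIdeal_of_isFiltered`). Reading the values on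
letters of index two as transposed operations produces the signs `εᵢ` (`cast_dualSign`,
`DualLetters.corresponds_iff`). -/

open scoped TensorProduct DirectSum

noncomputable section

namespace NKoszul

/-! ### Words in free algebras -/

section Words

variable {k : Type*} [Field k] {X : Type*}

/-- The word `l`, as an element of the free algebra. -/
def wd (k : Type*) [Field k] {X : Type*} (l : List X) : FreeAlgebra k X :=
  (l.map (FreeAlgebra.ι k)).prod

@[simp] theorem wd_nil : wd k ([] : List X) = 1 := rfl

theorem wd_cons (x : X) (l : List X) : wd k (x :: l) = FreeAlgebra.ι k x * wd k l := by
  simp [wd]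

theorem wd_append (l m : List X) : wd k (l ++ m) = wd k l * wd k m := by simp [wd]

theorem wd_singleton (x : X) : wd k [x] = FreeAlgebra.ι k x := by simp [wd]

variable (k X) in
/-- The basis of the free algebra that consists of the words. -/
def wordBasis : Module.Basis (List X) k (FreeAlgebra k X) :=
  (FreeAlgebra.basisFreeMonoid k X).reindex FreeMonoid.toList

theorem wordBasis_apply (l : List X) : wordBasis k X l = wd k l := by
  have h : wordBasis k X l = FreeMonoid.lift (FreeAlgebra.ι k) (FreeMonoid.ofList l) := by
    simp [wordBasis, FreeAlgebra.basisFreeMonoid, FreeAlgebra.equivMonoidAlgebraFreeMonoid,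
      MonoidAlgebra.lift_single]
  rw [h, FreeMonoid.lift_apply]
  rfl

/-- The coefficient of the word `l`. -/
def co (l : List X) : FreeAlgebra k X →ₗ[k] k := (wordBasis k X).coord l

open scoped Classical in
theorem co_wd (l m : List X) : co l (wd k m) = if l = m then 1 else 0 := by
  rw [co, ← wordBasis_apply, Module.Basis.coord_apply, Module.Basis.repr_self,
    Finsupp.single_apply]
  simp [eq_comm]

@[simp] theorem co_wd_self (l : List X) : co l (wd k l) = 1 := by simp [co_wd]

theorem co_wd_ne {l m : List X} (h : l ≠ m) : co l (wd k m) = 0 := by simp [co_wd, h]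

theorem ext_co {a b : FreeAlgebra k X} (h : ∀ l, co l a = co l b) : a = b :=
  (wordBasis k X).ext_elem h

theorem lin_ext {M : Type*} [AddCommGroup M] [Module k M] {f g : FreeAlgebra k X →ₗ[k] M}
    (h : ∀ l, f (wd k l) = g (wd k l)) : f = g :=
  (wordBasis k X).ext fun l => by rw [wordBasis_apply, h]

theorem sum_co (y : FreeAlgebra k X) :
    ∑ l ∈ ((wordBasis k X).repr y).support, co l y • wd k l = y := by
  conv_rhs => rw [← (wordBasis k X).linearCombination_repr y, Finsupp.linearCombination_apply,
    Finsupp.sum]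
  exact Finset.sum_congr rfl fun l _ => by rw [wordBasis_apply]; rfl

theorem mem_support_iff {y : FreeAlgebra k X} {l : List X} :
    l ∈ ((wordBasis k X).repr y).support ↔ co l y ≠ 0 := Finsupp.mem_support_iff

/-- A linear map defined on words. -/
def wordLift {M : Type*} [AddCommGroup M] [Module k M] (f : List X → M) :
    FreeAlgebra k X →ₗ[k] M :=
  (wordBasis k X).constr k f

@[simp] theorem wordLift_wd {M : Type*} [AddCommGroup M] [Module k M] (f : List X → M)
    (l : List X) : wordLift (k := k) f (wd k l) = f l := by
  rw [wordLift, ← wordBasis_apply, Module.Basis.constr_basis]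

/-- The element with given coefficients. -/
def ofCo (f : List X →₀ k) : FreeAlgebra k X := (wordBasis k X).repr.symm f

@[simp] theorem co_ofCo (f : List X →₀ k) (l : List X) : co l (ofCo f) = f l := by
  simp [co, ofCo]

variable (k) in
/-- The elements all of whose words satisfy `p`. -/
def supp (p : List X → Prop) : Submodule k (FreeAlgebra k X) where
  carrier := {y | ∀ l, ¬ p l → co l y = 0}
  add_mem' := fun ha hb l hl => by simp [ha l hl, hb l hl]
  zero_mem' := fun l _ => by simp
  smul_mem' := fun c _ ha l hl => by simp [ha l hl]

theorem wd_mem_supp {p : List X → Prop} {l : List X} (h : p l) : wd k l ∈ supp k p :=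
  fun _ hm => co_wd_ne fun e => hm (e ▸ h)

theorem supp_mono {p q : List X → Prop} (h : ∀ l, p l → q l) : supp k p ≤ supp k q :=
  fun _ hy l hl => hy l fun hp => hl (h l hp)

theorem supp_map_mem {M : Type*} [AddCommGroup M] [Module k M] {p : List X → Prop}
    (f : FreeAlgebra k X →ₗ[k] M) (q : Submodule k M) (h : ∀ l, p l → f (wd k l) ∈ q)
    {y : FreeAlgebra k X} (hy : y ∈ supp k p) : f y ∈ q := by
  rw [← sum_co y, map_sum]
  refine q.sum_mem fun l hl => ?_
  rw [map_smul]
  refine q.smul_mem _ (h l ?_)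
  by_contra hp
  exact mem_support_iff.1 hl (hy l hp)

theorem supp_le {p : List X → Prop} {q : Submodule k (FreeAlgebra k X)}
    (h : ∀ l, p l → wd k l ∈ q) : supp k p ≤ q :=
  fun _ hy => supp_map_mem LinearMap.id q h hy

theorem supp_ext {M : Type*} [AddCommGroup M] [Module k M] {p : List X → Prop}
    {f g : FreeAlgebra k X →ₗ[k] M} (h : ∀ l, p l → f (wd k l) = g (wd k l))
    {y : FreeAlgebra k X} (hy : y ∈ supp k p) : f y = g y := by
  have := supp_map_mem (f - g) ⊥ (fun l hl => by simp [h l hl]) hy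
  simpa [sub_eq_zero] using this

theorem supp_mul {p q r : List X → Prop} (h : ∀ l m, p l → q m → r (l ++ m))
    {a b : FreeAlgebra k X} (ha : a ∈ supp k p) (hb : b ∈ supp k q) : a * b ∈ supp k r := by
  refine supp_map_mem (LinearMap.mulRight k b) _ (fun l hl => ?_) ha
  refine supp_map_mem (LinearMap.mulLeft k (wd k l)) _ (fun m hm => ?_) hb
  rw [LinearMap.mulLeft_apply, ← wd_append]
  exact wd_mem_supp (h l m hl hm)

theorem supp_inf_eq_zero {p q : List X → Prop} (h : ∀ l, p l → ¬ q l)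
    {a : FreeAlgebra k X} (ha : a ∈ supp k p) (hb : a ∈ supp k q) : a = 0 :=
  ext_co fun l => by
    rw [map_zero]
    by_cases hp : p l
    · exact hb l (h l hp)
    · exact ha l hp

open scoped Classical in
/-- The part of an element that consists of the words that satisfy `p`. -/
def part (p : List X → Prop) : FreeAlgebra k X →ₗ[k] FreeAlgebra k X :=
  wordLift fun l => if p l then wd k l else 0

theorem part_wd_of {p : List X → Prop} {l : List X} (h : p l) : part p (wd k l) = wd k l := by
  simp [part, h]

theorem part_wd_of_not {p : List X → Prop} {l : List X} (h : ¬ p l) :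
    part p (wd k l) = 0 := by simp [part, h]

theorem co_part_of {p : List X → Prop} {l : List X} (h : p l) (y : FreeAlgebra k X) :
    co l (part p y) = co l y := by
  refine LinearMap.congr_fun (f := co l ∘ₗ part p) (lin_ext fun m => ?_) y
  by_cases hm : p m
  · simp [part_wd_of hm]
  · rw [LinearMap.comp_apply, part_wd_of_not hm, map_zero, co_wd_ne]
    rintro rfl
    exact hm h

theorem co_part_of_not {p : List X → Prop} {l : List X} (h : ¬ p l) (y : FreeAlgebra k X) :
    co l (part p y) = 0 := by
  refine LinearMap.congr_fun (f := co l ∘ₗ part p) (g := 0) (lin_ext fun m => ?_) y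
  by_cases hm : p m
  · rw [LinearMap.comp_apply, part_wd_of hm, LinearMap.zero_apply, co_wd_ne]
    rintro rfl
    exact h hm
  · simp [part_wd_of_not hm]

theorem part_mem (p : List X → Prop) (y : FreeAlgebra k X) : part p y ∈ supp k p :=
  fun _ hl => co_part_of_not hl y

theorem part_of_mem {p : List X → Prop} {y : FreeAlgebra k X} (h : y ∈ supp k p) :
    part p y = y :=
  ext_co fun l => by
    by_cases hl : p l
    · rw [co_part_of hl]
    · rw [co_part_of_not hl, h l hl]

theorem part_of_disjoint {p q : List X → Prop} {y : FreeAlgebra k X} (h : y ∈ supp k q)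
    (hpq : ∀ l, q l → ¬ p l) : part p y = 0 :=
  ext_co fun l => by
    rw [map_zero]
    by_cases hl : p l
    · rw [co_part_of hl, h l fun hq => hpq l hq hl]
    · rw [co_part_of_not hl]

theorem part_mul_left {p q : List X → Prop} {r : List X → Prop} {a b : FreeAlgebra k X}
    (ha : a ∈ supp k r) (h : ∀ l m, r l → (p (l ++ m) ↔ q m)) :
    part p (a * b) = a * part q b := by
  refine supp_ext (f := part p ∘ₗ LinearMap.mulRight k b)
    (g := LinearMap.mulRight k (part q b)) (fun l hl => ?_) ha
  refine LinearMap.congr_fun (f := part p ∘ₗ LinearMap.mulLeft k (wd k l))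
    (g := LinearMap.mulLeft k (wd k l) ∘ₗ part q) (lin_ext fun m => ?_) b
  simp only [LinearMap.comp_apply, LinearMap.mulLeft_apply, ← wd_append]
  by_cases hm : q m
  · rw [part_wd_of ((h l m hl).2 hm), part_wd_of hm, wd_append]
  · rw [part_wd_of_not (fun hp => hm ((h l m hl).1 hp)), part_wd_of_not hm, mul_zero]

/-- The coefficients of the words that begin with `u` and end with `v`. -/
def slice (u v : List X) : FreeAlgebra k X →ₗ[k] FreeAlgebra k X :=
  (wordBasis k X).repr.symm.toLinearMap ∘ₗ
    Finsupp.lcomapDomain (fun l => u ++ l ++ v) (fun l m h => by simpa using h) ∘ₗ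
      (wordBasis k X).repr.toLinearMap

@[simp] theorem co_slice (u v l : List X) (y : FreeAlgebra k X) :
    co l (slice u v y) = co (u ++ l ++ v) y := by
  simp [co, slice, Finsupp.lcomapDomain]

variable (k X) in
/-- The homogeneous elements of degree `n`. -/
def len (n : ℕ) : Submodule k (FreeAlgebra k X) := supp k fun l => l.length = n

theorem wd_mem_len (l : List X) : wd k l ∈ len k X l.length := wd_mem_supp rfl

theorem len_mul {a b : FreeAlgebra k X} {m n : ℕ} (ha : a ∈ len k X m) (hb : b ∈ len k X n) :
    a * b ∈ len k X (m + n) :=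
  supp_mul (fun l l' h h' => by simp [h, h']) ha hb

theorem co_mul_append {a b : FreeAlgebra k X} {u v : List X} (ha : a ∈ len k X u.length) :
    co (u ++ v) (a * b) = co u a * co v b := by
  refine supp_ext (f := co (u ++ v) ∘ₗ LinearMap.mulRight k b)
    (g := LinearMap.mulRight k (co v b) ∘ₗ co u) (fun l hl => ?_) ha
  refine LinearMap.congr_fun (f := co (u ++ v) ∘ₗ LinearMap.mulLeft k (wd k l))
    (g := LinearMap.mulLeft k (co u (wd k l)) ∘ₗ co v) (lin_ext fun m => ?_) b
  classical
  simp only [LinearMap.comp_apply, LinearMap.mulLeft_apply, ← wd_append, co_wd]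
  have : u ++ v = l ++ m ↔ u = l ∧ v = m :=
    ⟨fun h => List.append_inj h hl.symm, fun h => by rw [h.1, h.2]⟩
  by_cases h1 : u = l <;> by_cases h2 : v = m <;> simp [this, h1, h2]

theorem co_mul_append' {a b : FreeAlgebra k X} {u v : List X} (hb : b ∈ len k X v.length) :
    co (u ++ v) (a * b) = co u a * co v b := by
  refine supp_ext (f := co (u ++ v) ∘ₗ LinearMap.mulLeft k a)
    (g := LinearMap.mulLeft k (co u a) ∘ₗ co v) (fun m hm => ?_) hb
  refine LinearMap.congr_fun (f := co (u ++ v) ∘ₗ LinearMap.mulRight k (wd k m))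
    (g := LinearMap.mulRight k (co v (wd k m)) ∘ₗ co u) (lin_ext fun l => ?_) a
  classical
  simp only [LinearMap.comp_apply, LinearMap.mulRight_apply, ← wd_append, co_wd]
  have : u ++ v = l ++ m ↔ u = l ∧ v = m :=
    ⟨fun h => List.append_inj' h hm.symm, fun h => by rw [h.1, h.2]⟩
  by_cases h1 : u = l <;> by_cases h2 : v = m <;> simp [this, h1, h2]

theorem slice_nil_nil (y : FreeAlgebra k X) : slice [] [] y = y := ext_co fun l => by simp

theorem slice_slice (u v u' v' : List X) (y : FreeAlgebra k X) :
    slice u' v' (slice u v y) = slice (u ++ u') (v' ++ v) y := ext_co fun l => by simp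

theorem slice_mem_len {u v : List X} {n : ℕ} {y : FreeAlgebra k X}
    (hy : y ∈ len k X (u.length + n + v.length)) : slice u v y ∈ len k X n := fun l hl => by
  rw [co_slice]
  exact hy _ (by simp; omega)

theorem slice_mul_left {a b : FreeAlgebra k X} {u : List X} (ha : a ∈ len k X u.length) :
    slice u [] (a * b) = co u a • b :=
  ext_co fun l => by simp [co_mul_append ha]

theorem slice_mul_right {a b : FreeAlgebra k X} {v : List X} (hb : b ∈ len k X v.length) :
    slice [] v (a * b) = co v b • a :=
  ext_co fun l => by simp [co_mul_append' hb, mul_comm]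

/-- An element all of whose initial slices vanish is zero. -/
theorem eq_zero_of_slice {y : FreeAlgebra k X} (h0 : co [] y = 0)
    (h : ∀ x, slice [x] [] y = 0) : y = 0 :=
  ext_co fun l => by
    cases l with
    | nil => simpa using h0
    | cons x l => simpa using congrArg (co l) (h x)

theorem slice_ι_mul_self (x : X) (b : FreeAlgebra k X) :
    slice [x] [] (FreeAlgebra.ι k x * b) = b := by
  rw [slice_mul_left (by rw [← wd_singleton]; exact wd_mem_len [x]), ← wd_singleton, co_wd_self,
    one_smul]

theorem slice_ι_mul_ne {x x' : X} (hx : x ≠ x') (b : FreeAlgebra k X) :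
    slice [x] [] (FreeAlgebra.ι k x' * b) = 0 := by
  rw [slice_mul_left (by rw [← wd_singleton]; exact wd_mem_len [x']), ← wd_singleton, co_wd_ne,
    zero_smul]
  simpa using hx

/-- Removing a first letter is a Fox derivative: the first letter of a product belongs to the left
factor, unless that factor contributes the empty word. -/
theorem slice_mul (x : X) (a b : FreeAlgebra k X) :
    slice [x] [] (a * b) = slice [x] [] a * b + co [] a • slice [x] [] b := by
  refine LinearMap.congr_fun (f := slice [x] [] ∘ₗ LinearMap.mulRight k b)
    (g := LinearMap.mulRight k b ∘ₗ slice [x] [] + (co []).smulRight (slice [x] [] b))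
    (lin_ext fun l => ?_) a
  simp only [LinearMap.comp_apply, LinearMap.add_apply, LinearMap.mulRight_apply,
    LinearMap.smulRight_apply]
  cases l with
  | nil =>
    have : slice [x] [] (1 : FreeAlgebra k X) = 0 := ext_co fun l => by
      rw [co_slice, ← wd_nil, co_wd_ne (by simp), map_zero]
    simp only [wd_nil, one_mul, this, zero_mul, zero_add]
    rw [← wd_nil, co_wd_self, one_smul]
  | cons x' l =>
    rw [co_wd_ne (by simp), zero_smul, add_zero, wd_cons, mul_assoc]
    by_cases h : x = x'
    · subst h
      rw [slice_ι_mul_self, slice_ι_mul_self]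
    · rw [slice_ι_mul_ne h, slice_ι_mul_ne h, zero_mul]

/-- Every element of degree `≥ 1` is the sum of its initial slices. -/
theorem sum_slice_left [Fintype X] {y : FreeAlgebra k X} {s n : ℕ} (hy : y ∈ len k X (s + n)) :
    y = ∑ f : Fin s → X, wd k (List.ofFn f) * slice (List.ofFn f) [] y := by
  classical
  refine ext_co fun l => ?_
  rw [map_sum]
  by_cases hl : l.length = s + n
  · obtain ⟨u, v, rfl, hu⟩ : ∃ u v, l = u ++ v ∧ u.length = s :=
      ⟨l.take s, l.drop s, by simp, by simp; omega⟩
    subst hu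
    rw [Finset.sum_eq_single (fun i : Fin u.length => u.get i)]
    · rw [List.ofFn_get, co_mul_append (wd_mem_len u)]
      simp
    · intro f _ hf
      have hm : wd k (List.ofFn f) ∈ len k X u.length := by
        simpa using wd_mem_len (k := k) (List.ofFn f)
      rw [co_mul_append hm, co_wd_ne, zero_mul]
      rintro h
      apply hf
      rw [← List.ofFn_inj, ← h, List.ofFn_get]
    · simp
  · rw [hy l hl, eq_comm]
    refine Finset.sum_eq_zero fun f _ => ?_
    refine len_mul (m := s) (n := n) ?_ (slice_mem_len (by simpa using hy)) l hl
    simpa using wd_mem_len (k := k) (List.ofFn f)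

theorem sum_slice_right [Fintype X] {y : FreeAlgebra k X} {s n : ℕ}
    (hy : y ∈ len k X (n + s)) :
    y = ∑ f : Fin s → X, slice [] (List.ofFn f) y * wd k (List.ofFn f) := by
  classical
  refine ext_co fun l => ?_
  rw [map_sum]
  by_cases hl : l.length = n + s
  · obtain ⟨u, v, rfl, hu⟩ : ∃ u v, l = u ++ v ∧ v.length = s :=
      ⟨l.take n, l.drop n, by simp, by simp; omega⟩
    subst hu
    rw [Finset.sum_eq_single (fun i : Fin v.length => v.get i)]
    · rw [List.ofFn_get, co_mul_append' (wd_mem_len v)]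
      simp
    · intro f _ hf
      have hm : wd k (List.ofFn f) ∈ len k X v.length := by
        simpa using wd_mem_len (k := k) (List.ofFn f)
      rw [co_mul_append' hm, co_wd_ne, mul_zero]
      rintro h
      apply hf
      rw [← List.ofFn_inj, ← h, List.ofFn_get]
    · simp
  · rw [hy l hl, eq_comm]
    refine Finset.sum_eq_zero fun f _ => ?_
    refine len_mul (m := n) (n := s) (slice_mem_len (by simpa using hy)) ?_ l hl
    simpa using wd_mem_len (k := k) (List.ofFn f)

/-! ### The pairing of a free algebra with itself -/

variable (k X) in
/-- The bilinear form for which the words are orthonormal. -/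
def pair : FreeAlgebra k X →ₗ[k] FreeAlgebra k X →ₗ[k] k := wordLift co

@[simp] theorem pair_wd_left (l : List X) (b : FreeAlgebra k X) : pair k X (wd k l) b = co l b := by
  simp [pair]

@[simp] theorem pair_wd_right (a : FreeAlgebra k X) (l : List X) :
    pair k X a (wd k l) = co l a := by
  refine LinearMap.congr_fun (f := (pair k X).flip (wd k l)) (lin_ext fun m => ?_) a
  classical
  simp [co_wd, eq_comm]

theorem pair_mul {a b c d : FreeAlgebra k X} {n : ℕ} (ha : a ∈ len k X n) (hc : c ∈ len k X n) :
    pair k X (a * b) (c * d) = pair k X a c * pair k X b d := by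
  refine supp_ext (f := (pair k X).flip (c * d) ∘ₗ LinearMap.mulRight k b)
    (g := LinearMap.mulRight k (pair k X b d) ∘ₗ (pair k X).flip c) (fun l hl => ?_) ha
  refine LinearMap.congr_fun
    (f := (pair k X).flip (c * d) ∘ₗ LinearMap.mulLeft k (wd k l))
    (g := LinearMap.mulLeft k (pair k X (wd k l) c) ∘ₗ (pair k X).flip d) (lin_ext fun m => ?_) b
  subst hl
  simp only [LinearMap.comp_apply, LinearMap.flip_apply, LinearMap.mulLeft_apply, ← wd_append,
    pair_wd_left, co_mul_append hc]

theorem pair_eq_zero_of_supp {p q : List X → Prop} {a b : FreeAlgebra k X}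
    (ha : a ∈ supp k p) (hb : b ∈ supp k q) (h : ∀ l, p l → ¬ q l) : pair k X a b = 0 := by
  refine supp_ext (f := (pair k X).flip b) (g := 0) (fun l hl => ?_) ha
  simpa using hb l (h l hl)

theorem pair_eq_zero_of_len {a b : FreeAlgebra k X} {m n : ℕ} (ha : a ∈ len k X m)
    (hb : b ∈ len k X n) (h : m ≠ n) : pair k X a b = 0 :=
  pair_eq_zero_of_supp ha hb fun _ e e' => h (e.symm.trans e')

theorem pair_slice (u v : List X) (a b : FreeAlgebra k X) :
    pair k X a (slice u v b) = pair k X (wd k u * a * wd k v) b := by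
  refine LinearMap.congr_fun (f := (pair k X).flip (slice u v b))
    (g := (pair k X).flip b ∘ₗ LinearMap.mulRight k (wd k v) ∘ₗ LinearMap.mulLeft k (wd k u))
    (lin_ext fun m => ?_) a
  simp [← wd_append]

/-- Contraction with `s` on the left, the transpose of left multiplication by `s`. -/
def contrL (s : FreeAlgebra k X) (y : FreeAlgebra k X) : FreeAlgebra k X :=
  wordLift (k := k) (fun u => slice u [] y) s

theorem pair_contrL (s t y : FreeAlgebra k X) :
    pair k X t (contrL s y) = pair k X (s * t) y := by
  refine LinearMap.congr_fun (f := pair k X t ∘ₗ wordLift (k := k) (fun u => slice u [] y))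
    (g := (pair k X).flip y ∘ₗ LinearMap.mulRight k t) (lin_ext fun u => ?_) s
  simp [pair_slice]

/-- Contraction with `s` on the right, the transpose of right multiplication by `s`. -/
def contrR (s : FreeAlgebra k X) (y : FreeAlgebra k X) : FreeAlgebra k X :=
  wordLift (k := k) (fun u => slice [] u y) s

theorem pair_contrR (s t y : FreeAlgebra k X) :
    pair k X t (contrR s y) = pair k X (t * s) y := by
  refine LinearMap.congr_fun (f := pair k X t ∘ₗ wordLift (k := k) (fun u => slice [] u y))
    (g := (pair k X).flip y ∘ₗ LinearMap.mulLeft k t) (lin_ext fun u => ?_) s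
  simp [pair_slice]

/-- Every linear form on a free algebra on finitely many letters agrees in degree `n` with the
pairing with an element of degree `n`. -/
theorem exists_pair_eq [Fintype X] (n : ℕ) (φ : FreeAlgebra k X →ₗ[k] k) :
    ∃ t ∈ len k X n, ∀ s ∈ len k X n, pair k X s t = φ s := by
  classical
  -- Only finitely many words have length `n`, so the values of `φ` on them are the coefficients of
  -- an actual element.
  refine ⟨∑ f : Fin n → X, φ (wd k (List.ofFn f)) • wd k (List.ofFn f), ?_, fun s hs => ?_⟩
  · refine Submodule.sum_mem _ fun f _ => Submodule.smul_mem _ _ ?_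
    simpa using wd_mem_len (k := k) (List.ofFn f)
  · have h := congrArg φ (sum_slice_left (s := n) (n := 0) (by simpa using hs))
    rw [h, map_sum, map_sum]
    refine Finset.sum_congr rfl fun f _ => ?_
    have hs' : slice (List.ofFn f) [] s ∈ len k X 0 := slice_mem_len (by simpa using hs)
    have : slice (List.ofFn f) [] s = co (List.ofFn f) s • 1 := by
      refine ext_co fun l => ?_
      by_cases hl : l = []
      · subst hl
        rw [map_smul, ← wd_nil, co_wd_self]
        simp
      · rw [hs' l (by simpa using hl), map_smul, ← wd_nil, co_wd_ne hl, smul_zero]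
    rw [this, mul_smul_comm, mul_one, map_smul, map_smul, pair_wd_right, smul_eq_mul, smul_eq_mul,
      mul_comm]

end Words

/-! ### Signed derivations of free algebras -/

section Derivations

variable {k : Type*} [Field k] {X : Type*}

/-- The sign of a word. -/
def sgn (σ : X → k) (l : List X) : k := (l.map σ).prod

@[simp] theorem sgn_nil (σ : X → k) : sgn σ [] = 1 := rfl

@[simp] theorem sgn_cons (σ : X → k) (x : X) (l : List X) : sgn σ (x :: l) = σ x * sgn σ l := by
  simp [sgn]

theorem sgn_append (σ : X → k) (l m : List X) : sgn σ (l ++ m) = sgn σ l * sgn σ m := by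
  simp [sgn]

/-- The values on words of the signed derivation with given values on the letters. -/
def derWord (σ : X → k) (f : X → FreeAlgebra k X) : List X → FreeAlgebra k X
  | [] => 0
  | x :: l => f x * wd k l + σ x • (FreeAlgebra.ι k x * derWord σ f l)

/-- The signed derivation with given values on the letters. -/
def der (σ : X → k) (f : X → FreeAlgebra k X) : FreeAlgebra k X →ₗ[k] FreeAlgebra k X :=
  wordLift (derWord σ f)

variable (σ : X → k) (f : X → FreeAlgebra k X)

@[simp] theorem der_one : der σ f 1 = 0 := by
  rw [← wd_nil, der, wordLift_wd, derWord]

theorem der_ι_mul (x : X) (b : FreeAlgebra k X) :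
    der σ f (FreeAlgebra.ι k x * b) = f x * b + σ x • (FreeAlgebra.ι k x * der σ f b) := by
  refine LinearMap.congr_fun (f := der σ f ∘ₗ LinearMap.mulLeft k (FreeAlgebra.ι k x))
    (g := LinearMap.mulLeft k (f x) + σ x • (LinearMap.mulLeft k (FreeAlgebra.ι k x) ∘ₗ der σ f))
    (lin_ext fun l => ?_) b
  simp only [LinearMap.comp_apply, LinearMap.mulLeft_apply, ← wd_cons, LinearMap.add_apply,
    LinearMap.smul_apply]
  rw [der, wordLift_wd, wordLift_wd, derWord]

@[simp] theorem der_ι (x : X) : der σ f (FreeAlgebra.ι k x) = f x := by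
  simpa using der_ι_mul σ f x 1

theorem der_wd_mul (l : List X) (b : FreeAlgebra k X) :
    der σ f (wd k l * b) = der σ f (wd k l) * b + sgn σ l • (wd k l * der σ f b) := by
  induction l with
  | nil => simp
  | cons x l ih =>
    rw [wd_cons, mul_assoc, der_ι_mul, der_ι_mul, ih, sgn_cons]
    simp only [mul_add, add_mul, smul_add, smul_smul, mul_smul_comm, smul_mul_assoc, mul_assoc]
    abel

theorem der_mul {c : k} {a : FreeAlgebra k X} (ha : a ∈ supp k fun l => sgn σ l = c)
    (b : FreeAlgebra k X) : der σ f (a * b) = der σ f a * b + c • (a * der σ f b) := by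
  refine supp_ext (f := der σ f ∘ₗ LinearMap.mulRight k b)
    (g := LinearMap.mulRight k b ∘ₗ der σ f + c • LinearMap.mulRight k (der σ f b))
    (fun l hl => ?_) ha
  simp only [LinearMap.comp_apply, LinearMap.mulRight_apply, LinearMap.add_apply,
    LinearMap.smul_apply, der_wd_mul, hl]

theorem der_congr {σ : X → k} {f g : X → FreeAlgebra k X} {y : FreeAlgebra k X}
    (hy : y ∈ supp k fun l => ∀ x ∈ l, f x = g x) : der σ f y = der σ g y := by
  refine supp_ext (fun l => ?_) hy
  induction l with
  | nil => simp
  | cons x l ih =>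
    intro h
    rw [wd_cons, der_ι_mul, der_ι_mul, h x (by simp), ih fun z hz => h z (by simp [hz])]

/-- The square of an odd derivation is again a derivation; by `hf`, the two mixed terms of the
Leibniz rule cancel. Only the letters that occur in `y` are constrained, which allows a differential
to be constructed one index at a time. -/
theorem der_der {σ : X → k} {f : X → FreeAlgebra k X}
    (hf : ∀ x, f x ∈ supp k fun l => sgn σ l = -σ x) {y : FreeAlgebra k X}
    (hy : y ∈ supp k fun l => ∀ x ∈ l, der σ f (f x) = 0) : der σ f (der σ f y) = 0 := by
  refine supp_ext (f := der σ f ∘ₗ der σ f) (g := 0) (fun l => ?_) hy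
  induction l with
  | nil => simp
  | cons x l ih =>
    intro h
    have h1 := ih fun z hz => h z (by simp [hz])
    simp only [LinearMap.comp_apply, LinearMap.zero_apply] at h1 ⊢
    rw [wd_cons, der_ι_mul, map_add, map_smul, der_mul σ f (hf x), h x (by simp), der_ι_mul, h1]
    simp

/-- If the values on the letters change the words as prescribed by `p` and `q`, then so does the
derivation. -/
theorem der_mem_supp {p q : List X → Prop} {y : FreeAlgebra k X} (hy : y ∈ supp k p)
    (h : ∀ u x v, p (u ++ x :: v) → f x ∈ supp k fun l => q (u ++ l ++ v)) :
    der σ f y ∈ supp k q := by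
  refine supp_map_mem _ _ (fun l hl => ?_) hy
  suffices H : ∀ u, p (u ++ l) → wd k u * der σ f (wd k l) ∈ supp k q by simpa using H [] hl
  clear hl
  induction l with
  | nil => intro u _; simp
  | cons x l ih =>
    intro u hu
    rw [wd_cons, der_ι_mul, mul_add]
    refine add_mem ?_ ?_
    · rw [← mul_assoc]
      refine supp_mul (p := fun m => q (m ++ l)) (q := fun m => m = l) ?_ ?_ (wd_mem_supp rfl)
      · rintro m _ h rfl
        exact h
      · exact supp_mul (p := fun m => m = u) (q := fun m => q (u ++ m ++ l))
          (by rintro _ m rfl h; exact h) (wd_mem_supp rfl) (h u x l hu)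
    · rw [mul_smul_comm, ← mul_assoc, ← wd_singleton, ← wd_append]
      exact Submodule.smul_mem _ _ (ih (u ++ [x]) (by simpa using hu))

/-! ### The transpose of a signed derivation -/

theorem co_nil_mul (a b : FreeAlgebra k X) : co [] (a * b) = co [] a * co [] b := by
  refine LinearMap.congr_fun (f := co [] ∘ₗ LinearMap.mulLeft k a)
    (g := LinearMap.mulLeft k (co [] a) ∘ₗ co []) (lin_ext fun m => ?_) b
  refine LinearMap.congr_fun (f := co [] ∘ₗ LinearMap.mulRight k (wd k m))
    (g := LinearMap.mulRight k (co [] (wd k m)) ∘ₗ co []) (lin_ext fun l => ?_) a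
  classical
  simp only [LinearMap.comp_apply, LinearMap.mulRight_apply, ← wd_append, co_wd]
  cases l <;> cases m <;> simp

theorem co_mul_wd (l m : List X) (a : FreeAlgebra k X) :
    co l (a * wd k m) =
      ∑ s ∈ Finset.range (l.length + 1), co (l.take s) a * co m (wd k (l.drop s)) := by
  refine (LinearMap.congr_fun (f := co l ∘ₗ LinearMap.mulRight k (wd k m))
    (g := ∑ s ∈ Finset.range (l.length + 1), (co m (wd k (l.drop s))) • co (l.take s))
    (lin_ext fun p => ?_) a).trans ?_
  · classical
    simp only [LinearMap.comp_apply, LinearMap.mulRight_apply, ← wd_append, LinearMap.sum_apply,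
      LinearMap.smul_apply, smul_eq_mul]
    by_cases h : l = p ++ m
    · subst h
      rw [co_wd_self, Finset.sum_eq_single p.length]
      · simp
      · intro s hs hsp
        rw [co_wd_ne, zero_mul]
        intro h
        have := congrArg List.length h
        simp at this hs
        omega
      · simp
    · rw [co_wd_ne h, eq_comm]
      refine Finset.sum_eq_zero fun s _ => ?_
      by_cases h1 : m = l.drop s
      · rw [co_wd_ne (l := l.take s), mul_zero]
        rintro rfl
        exact h (by rw [h1, List.take_append_drop])
      · rw [co_wd_ne h1, zero_mul]
  · simp only [LinearMap.sum_apply, LinearMap.smul_apply, smul_eq_mul, mul_comm]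

/-- The transpose of `f`, where `T l` contains all letters `x` such that `l` occurs in `f x`. -/
def transLetter (T : List X → Finset X) (l : List X) : FreeAlgebra k X :=
  ∑ x ∈ T l, co l (f x) • FreeAlgebra.ι k x

theorem transLetter_mem_len (T : List X → Finset X) (l : List X) :
    transLetter f T l ∈ len k X 1 :=
  Submodule.sum_mem _ fun x _ => Submodule.smul_mem _ _ (by
    rw [← wd_singleton]; exact wd_mem_len [x])

theorem co_transLetter {T : List X → Finset X} (hT : ∀ l x, co l (f x) ≠ 0 → x ∈ T l)
    (l : List X) (x : X) : co [x] (transLetter f T l) = co l (f x) := by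
  classical
  rw [transLetter, map_sum]
  by_cases hx : x ∈ T l
  · rw [Finset.sum_eq_single_of_mem x hx]
    · rw [map_smul, ← wd_singleton, co_wd_self, smul_eq_mul, mul_one]
    · intro z _ hz
      rw [map_smul, ← wd_singleton, co_wd_ne (by simpa using hz.symm), smul_zero]
  · rw [Finset.sum_eq_zero]
    · by_contra h
      exact hx (hT l x (Ne.symm h))
    · intro z hz
      rw [map_smul, ← wd_singleton, co_wd_ne, smul_zero]
      rintro h
      simp only [List.cons.injEq, and_true] at h
      exact hx (h ▸ hz)

/-- The transpose of a signed derivation, applied to a word. -/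
def bar (T : List X → Finset X) (l : List X) : FreeAlgebra k X :=
  ∑ r ∈ Finset.range l.length, ∑ s ∈ Finset.Icc 1 (l.length - r),
    sgn σ (l.take r) • (wd k (l.take r) * transLetter f T ((l.drop r).take s) *
      wd k (l.drop (r + s)))

theorem bar_cons (T : List X → Finset X) (x : X) (l : List X) :
    bar σ f T (x :: l) = ∑ s ∈ Finset.range (l.length + 1),
      transLetter f T (x :: l.take s) * wd k (l.drop s) +
        σ x • (FreeAlgebra.ι k x * bar σ f T l) := by
  rw [bar, List.length_cons, Finset.sum_range_succ', add_comm]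
  congr 1
  · rw [Nat.sub_zero, Finset.range_eq_Ico, ← Finset.Ico_add_one_right_eq_Icc,
      Finset.sum_Ico_eq_sum_range, Finset.sum_Ico_eq_sum_range]
    refine Finset.sum_congr (by simp) fun s _ => ?_
    simp [add_comm 1 s]
  · rw [bar, Finset.mul_sum, Finset.smul_sum]
    refine Finset.sum_congr rfl fun r _ => ?_
    rw [Finset.mul_sum, Finset.smul_sum, Nat.add_sub_add_right]
    refine Finset.sum_congr rfl fun s _ => ?_
    rw [add_right_comm]
    simp only [List.take_succ_cons, sgn_cons, wd_cons, List.drop_succ_cons, mul_smul_comm,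
      smul_smul, mul_assoc]

theorem co_nil_bar (T : List X → Finset X) (l : List X) : co [] (bar σ f T l) = 0 := by
  rw [bar, map_sum]
  refine Finset.sum_eq_zero fun r _ => ?_
  rw [map_sum]
  refine Finset.sum_eq_zero fun s _ => ?_
  rw [map_smul, co_nil_mul, co_nil_mul, transLetter_mem_len f T _ [] (by simp)]
  simp

/-- A derivation replaces one letter by a word; read backwards, it contracts a subword of `l` to a
letter, as the inner operation of a Stasheff identity does. The sum `bar` contracts nonempty
subwords only, whence `h0`; by `hT` the finite sets `T` miss no letter. -/
theorem co_der {T : List X → Finset X} (hT : ∀ l x, co l (f x) ≠ 0 → x ∈ T l)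
    (h0 : ∀ x, co [] (f x) = 0) (l : List X) (y : FreeAlgebra k X) :
    co l (der σ f y) = pair k X (bar σ f T l) y := by
  refine LinearMap.congr_fun (f := co l ∘ₗ der σ f) (lin_ext fun m => ?_) y
  rw [LinearMap.comp_apply, pair_wd_right]
  induction m generalizing l with
  | nil => rw [wd_nil, der_one, map_zero, co_nil_bar]
  | cons x m ih =>
    rw [wd_cons, der_ι_mul, map_add, map_smul]
    cases l with
    | nil =>
      rw [co_nil_mul, h0, ← wd_singleton, co_nil_mul, co_wd_ne (l := []) (m := [x]) (by simp)]
      simp [bar]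
    | cons z l =>
      have key : ∀ y : FreeAlgebra k X, ∀ w : X, ∀ u : List X,
          co (w :: u) (FreeAlgebra.ι k x * y) = co [w] (wd k [x]) * co u y := by
        intro y w u
        rw [← wd_singleton, ← List.singleton_append,
          co_mul_append (show wd k [x] ∈ len k X [w].length from wd_mem_len [x])]
      have key' : ∀ y : FreeAlgebra k X,
          co (x :: m) (FreeAlgebra.ι k z * y) = co [x] (wd k [z]) * co m y := by
        intro y
        rw [← wd_singleton, ← List.singleton_append,
          co_mul_append (show wd k [z] ∈ len k X [x].length from wd_mem_len [z])]
      rw [bar_cons, map_add, map_smul, key, ih, co_mul_wd, map_sum, key', List.length_cons,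
        Finset.sum_range_succ']
      congr 1
      · rw [List.take_zero, h0, zero_mul, add_zero]
        refine Finset.sum_congr rfl fun s _ => ?_
        rw [← List.singleton_append (x := x), co_mul_append (u := [x]) (transLetter_mem_len f T _),
          co_transLetter f hT]
        rfl
      · by_cases h : z = x
        · subst h
          rfl
        · rw [co_wd_ne (by simpa using h), co_wd_ne (by simpa using Ne.symm h)]
          simp

end Derivations

/-! ### Filtered deformations of acyclic free differential algebras -/

section Deformation

variable {k : Type*} [Field k] {Γ : Type*}

theorem der_sub {X : Type*} (σ : X → k) (f g : X → FreeAlgebra k X) (y : FreeAlgebra k X) :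
    der σ (fun x => f x - g x) y = der σ f y - der σ g y := by
  refine LinearMap.congr_fun (g := der σ f - der σ g) (lin_ext fun l => ?_) y
  induction l with
  | nil => simp
  | cons x l ih =>
    simp only [LinearMap.sub_apply] at ih ⊢
    rw [wd_cons, der_ι_mul, der_ι_mul, der_ι_mul, ih, sub_mul, mul_sub, smul_sub]
    abel

/-- The homological degree of a word, where a letter of index `i` has degree `i - 1`. -/
def degW (idx : Γ → ℕ) (l : List Γ) : ℕ := (l.map fun x => idx x - 1).sum

/-- The weight of a word, where a letter of index `i` has weight `n(i)`. -/
def wtW (N : ℕ) (idx : Γ → ℕ) (l : List Γ) : ℕ := (l.map fun x => koszulDeg N (idx x)).sum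

@[simp] theorem degW_nil (idx : Γ → ℕ) : degW idx [] = 0 := rfl
@[simp] theorem wtW_nil (N : ℕ) (idx : Γ → ℕ) : wtW N idx [] = 0 := rfl
@[simp] theorem degW_cons (idx : Γ → ℕ) (x : Γ) (l : List Γ) :
    degW idx (x :: l) = idx x - 1 + degW idx l := by simp [degW]
@[simp] theorem wtW_cons (N : ℕ) (idx : Γ → ℕ) (x : Γ) (l : List Γ) :
    wtW N idx (x :: l) = koszulDeg N (idx x) + wtW N idx l := by simp [wtW]
@[simp] theorem degW_append (idx : Γ → ℕ) (l m : List Γ) :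
    degW idx (l ++ m) = degW idx l + degW idx m := by simp [degW]
@[simp] theorem wtW_append (N : ℕ) (idx : Γ → ℕ) (l m : List Γ) :
    wtW N idx (l ++ m) = wtW N idx l + wtW N idx m := by simp [wtW]

theorem idx_le_of_mem {idx : Γ → ℕ} {l : List Γ} {x : Γ} (hx : x ∈ l) :
    idx x ≤ degW idx l + 1 := by
  have : idx x - 1 ≤ degW idx l :=
    List.single_le_sum (by simp) _ (List.mem_map_of_mem (f := fun x => idx x - 1) hx)
  omega

theorem le_koszulDeg {N : ℕ} (hN : 2 ≤ N) (i : ℕ) : i ≤ koszulDeg N i := by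
  have : 2 * (i / 2) ≤ N * (i / 2) := Nat.mul_le_mul_right _ hN
  unfold koszulDeg
  omega

theorem koszulDeg_two_mul (N p : ℕ) : koszulDeg N (2 * p) = N * p := by
  simp [koszulDeg]

theorem koszulDeg_two_mul_add_one (N p : ℕ) : koszulDeg N (2 * p + 1) = N * p + 1 := by
  rw [koszulDeg]
  congr 1
  · congr 1
    omega
  · omega

theorem koszulDeg_lt_succ {N : ℕ} (hN : 2 ≤ N) (i : ℕ) :
    koszulDeg N i < koszulDeg N (i + 1) := by
  rcases Nat.even_or_odd' i with ⟨p, rfl | rfl⟩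
  · rw [koszulDeg_two_mul, koszulDeg_two_mul_add_one]
    omega
  · rw [show 2 * p + 1 + 1 = 2 * (p + 1) by ring, koszulDeg_two_mul, koszulDeg_two_mul_add_one,
      mul_add]
    omega

theorem length_le_wtW {N : ℕ} (hN : 2 ≤ N) {idx : Γ → ℕ} (hidx : ∀ x, 1 ≤ idx x) (l : List Γ) :
    l.length ≤ wtW N idx l := by
  induction l with
  | nil => simp
  | cons x l ih =>
    have := le_koszulDeg hN (idx x)
    have := hidx x
    simp
    omega

/-- The signs that belong to the homological degree. -/
def degSign (k : Type*) [Field k] (idx : Γ → ℕ) (x : Γ) : k := (-1) ^ (idx x + 1)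

theorem sgn_degSign {idx : Γ → ℕ} (hidx : ∀ x, 1 ≤ idx x) (l : List Γ) :
    sgn (degSign k idx) l = (-1) ^ degW idx l := by
  induction l with
  | nil => simp
  | cons x l ih =>
    obtain ⟨i, hi⟩ := Nat.exists_eq_add_of_le' (hidx x)
    rw [sgn_cons, ih, degW_cons, pow_add, degSign, hi]
    simp [pow_add]

theorem degSign_mul_self {idx : Γ → ℕ} (x : Γ) : degSign k idx x * degSign k idx x = 1 := by
  rw [degSign, ← mul_pow]
  simp

/-- Of the words of homological degree `i - 1`, those of least weight have weight `n(i)`. -/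
theorem koszulDeg_le_wtW {N : ℕ} (hN : 2 ≤ N) {idx : Γ → ℕ} (hidx : ∀ x, 1 ≤ idx x)
    (l : List Γ) (hl : l ≠ []) : koszulDeg N (degW idx l + 1) ≤ wtW N idx l := by
  induction l with
  | nil => exact absurd rfl hl
  | cons x l ih =>
    have h1 := hidx x
    by_cases hm : l = []
    · subst hm
      simp only [degW_cons, degW_nil, wtW_cons, wtW_nil, add_zero]
      rw [Nat.sub_add_cancel h1]
    · have h2 := ih hm
      rw [degW_cons, wtW_cons]
      refine le_trans ?_ (Nat.add_le_add_left h2 _)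
      -- What remains is `n(a + b + 1) ≤ n(a + 1) + n(b + 1)`, where `a` is the degree of the letter
      -- and `b` that of the rest: fusing the two into one letter never increases the weight. The
      -- four cases are the parities of `a` and `b`.
      generalize degW idx l = b
      generalize idx x = a at h1
      obtain ⟨a, rfl⟩ := Nat.exists_eq_add_of_le' h1
      rw [Nat.add_sub_cancel]
      rcases Nat.even_or_odd' a with ⟨p, rfl | rfl⟩ <;>
        rcases Nat.even_or_odd' b with ⟨q, rfl | rfl⟩
      · rw [← mul_add, koszulDeg_two_mul_add_one, koszulDeg_two_mul_add_one,
          koszulDeg_two_mul_add_one, mul_add]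
        omega
      · rw [show 2 * p + (2 * q + 1) + 1 = 2 * (p + q + 1) by ring,
          show 2 * q + 1 + 1 = 2 * (q + 1) by ring, koszulDeg_two_mul_add_one,
          koszulDeg_two_mul, koszulDeg_two_mul]
        nlinarith
      · rw [show 2 * p + 1 + 2 * q + 1 = 2 * (p + q + 1) by ring,
          show 2 * p + 1 + 1 = 2 * (p + 1) by ring, koszulDeg_two_mul_add_one,
          koszulDeg_two_mul, koszulDeg_two_mul]
        nlinarith
      · rw [show 2 * p + 1 + (2 * q + 1) + 1 = 2 * (p + q + 1) + 1 by ring,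
          show 2 * p + 1 + 1 = 2 * (p + 1) by ring, show 2 * q + 1 + 1 = 2 * (q + 1) by ring,
          koszulDeg_two_mul_add_one, koszulDeg_two_mul, koszulDeg_two_mul]
        nlinarith

/-- The values on the letters of a filtered deformation of the derivation given by `d₀`. -/
structure IsFiltered (N : ℕ) (idx : Γ → ℕ) (d₀ d : Γ → FreeAlgebra k Γ) : Prop where
  deg : ∀ x, d x ∈ supp k fun l => degW idx l + 2 = idx x
  wt : ∀ x, d x - d₀ x ∈ supp k fun l => wtW N idx l < koszulDeg N (idx x)
  co_nil : ∀ x, co [] (d x) = 0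

/-- The values on the letters of a homogeneous derivation. -/
def IsHomogeneous (N : ℕ) (idx : Γ → ℕ) (d₀ : Γ → FreeAlgebra k Γ) : Prop :=
  ∀ x, d₀ x ∈ supp k fun l => degW idx l + 2 = idx x ∧ wtW N idx l = koszulDeg N (idx x)

/-- Acyclicity of a homogeneous differential in positive homological degrees. -/
def IsAcyclic (N : ℕ) (idx : Γ → ℕ) (d₀ : Γ → FreeAlgebra k Γ) : Prop :=
  ∀ j, 1 ≤ j → ∀ w, ∀ y ∈ supp k fun l => degW idx l = j ∧ wtW N idx l = w,
    der (degSign k idx) d₀ y = 0 →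
      ∃ z ∈ supp k fun l => degW idx l = j + 1 ∧ wtW N idx l = w, der (degSign k idx) d₀ z = y

variable {N : ℕ} {idx : Γ → ℕ} {d₀ d d' : Γ → FreeAlgebra k Γ}

theorem supp_and {X : Type*} {p q : List X → Prop} {y : FreeAlgebra k X} (hp : y ∈ supp k p)
    (hq : y ∈ supp k q) : y ∈ supp k fun l => p l ∧ q l := fun l hl => by
  by_cases h : p l
  · exact hq l fun h' => hl ⟨h, h'⟩
  · exact hp l h

theorem der_mem_of_wt_le {f : Γ → FreeAlgebra k Γ} (hidx : ∀ x, 1 ≤ idx x)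
    (hf : ∀ x, f x ∈ supp k fun l => degW idx l + 2 = idx x ∧ wtW N idx l ≤ koszulDeg N (idx x))
    {j w : ℕ} {y : FreeAlgebra k Γ}
    (hy : y ∈ supp k fun l => degW idx l = j + 1 ∧ wtW N idx l < w) :
    der (degSign k idx) f y ∈ supp k fun l => degW idx l = j ∧ wtW N idx l < w := by
  refine der_mem_supp _ _ hy fun u x v ⟨h1, h2⟩ => ?_
  refine supp_mono (fun l hl => ?_) (hf x)
  have := hidx x
  simp at h1 h2 ⊢
  omega

theorem der_mem_of_wt_lt {f : Γ → FreeAlgebra k Γ} (hidx : ∀ x, 1 ≤ idx x)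
    (hf : ∀ x, f x ∈ supp k fun l => degW idx l + 2 = idx x ∧ wtW N idx l < koszulDeg N (idx x))
    {j w : ℕ} {y : FreeAlgebra k Γ}
    (hy : y ∈ supp k fun l => degW idx l = j + 1 ∧ wtW N idx l = w) :
    der (degSign k idx) f y ∈ supp k fun l => degW idx l = j ∧ wtW N idx l < w := by
  refine der_mem_supp _ _ hy fun u x v ⟨h1, h2⟩ => ?_
  refine supp_mono (fun l hl => ?_) (hf x)
  have := hidx x
  simp at h1 h2 ⊢
  omega

theorem der_mem_of_homogeneous (hidx : ∀ x, 1 ≤ idx x) (hd : IsHomogeneous N idx d₀)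
    {j w : ℕ} {y : FreeAlgebra k Γ}
    (hy : y ∈ supp k fun l => degW idx l = j + 1 ∧ wtW N idx l = w) :
    der (degSign k idx) d₀ y ∈ supp k fun l => degW idx l = j ∧ wtW N idx l = w := by
  refine der_mem_supp _ _ hy fun u x v ⟨h1, h2⟩ => ?_
  refine supp_mono (fun l hl => ?_) (hd x)
  have := hidx x
  simp at h1 h2 ⊢
  omega

theorem der_eq_zero_of_deg_zero {f : Γ → FreeAlgebra k Γ} (hidx : ∀ x, 1 ≤ idx x)
    (hf : ∀ x, f x ∈ supp k fun l => degW idx l + 2 = idx x)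
    {y : FreeAlgebra k Γ} (hy : y ∈ supp k fun l => degW idx l = 0) :
    der (degSign k idx) f y = 0 := by
  have : der (degSign k idx) f y ∈ supp k fun _ => False := by
    refine der_mem_supp _ _ hy fun u x v h => ?_
    refine supp_mono (fun l hl => ?_) (hf x)
    have := hidx x
    simp at h
    omega
  exact ext_co fun l => by simpa using this l (by simp)

namespace IsFiltered

variable (hd₀ : IsHomogeneous N idx d₀)

include hd₀ in
theorem deg_wt (hd : IsFiltered N idx d₀ d) (x : Γ) :
    d x ∈ supp k fun l => degW idx l + 2 = idx x ∧ wtW N idx l ≤ koszulDeg N (idx x) := by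
  refine supp_and (hd.deg x) ?_
  rw [← sub_add_cancel (d x) (d₀ x)]
  exact add_mem (supp_mono (fun _ h => h.le) (hd.wt x)) (supp_mono (fun _ h => h.2.le) (hd₀ x))

include hd₀ in
theorem diff_mem (hd : IsFiltered N idx d₀ d) (x : Γ) :
    d x - d₀ x ∈ supp k fun l => degW idx l + 2 = idx x ∧ wtW N idx l < koszulDeg N (idx x) :=
  supp_and (sub_mem (hd.deg x) (supp_mono (fun _ h => h.1) (hd₀ x))) (hd.wt x)

theorem sgn (hidx : ∀ x, 1 ≤ idx x) (hd : IsFiltered N idx d₀ d) (x : Γ) :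
    d x ∈ supp k fun l => NKoszul.sgn (degSign k idx) l = -degSign k idx x := by
  refine supp_mono (fun l hl => ?_) (hd.deg x)
  rw [sgn_degSign hidx, degSign, ← hl]
  simp [pow_succ]

theorem der_der (hidx : ∀ x, 1 ≤ idx x) (hd : IsFiltered N idx d₀ d) {i : ℕ}
    (hi : ∀ x, idx x ≤ i → der (degSign k idx) d (d x) = 0) {y : FreeAlgebra k Γ}
    (hy : y ∈ supp k fun l => degW idx l < i) :
    der (degSign k idx) d (der (degSign k idx) d y) = 0 :=
  NKoszul.der_der (hd.sgn hidx) (supp_mono (fun _ hl x hx => hi x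
    ((idx_le_of_mem hx).trans hl)) hy)

include hd₀ in
/-- A filtered deformation of an acyclic differential is acyclic. -/
theorem acyclic (hidx : ∀ x, 1 ≤ idx x) (hac : IsAcyclic N idx d₀) (hd : IsFiltered N idx d₀ d)
    {j : ℕ} (hj : 1 ≤ j) (hi : ∀ x, idx x ≤ j + 2 → der (degSign k idx) d (d x) = 0) (w : ℕ)
    {y : FreeAlgebra k Γ} (hy : y ∈ supp k fun l => degW idx l = j ∧ wtW N idx l < w)
    (hy0 : der (degSign k idx) d y = 0) :
    ∃ z ∈ supp k fun l => degW idx l = j + 1 ∧ wtW N idx l < w,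
      der (degSign k idx) d z = y := by
  obtain ⟨j, rfl⟩ := Nat.exists_eq_add_of_le' hj
  induction w generalizing y with
  | zero =>
    refine ⟨0, zero_mem _, ?_⟩
    rw [map_zero]
    exact ext_co fun l => by rw [map_zero, hy l (by simp)]
  | succ w ih =>
    set t := part (fun l => wtW N idx l = w) y with ht
    have ht1 : t ∈ supp k fun l => degW idx l = j + 1 ∧ wtW N idx l = w := by
      refine supp_and (fun l hl => ?_) (part_mem _ _)
      by_cases h : wtW N idx l = w
      · rw [ht, co_part_of h, hy l (fun h' => hl h'.1)]
      · rw [ht, co_part_of_not h]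
    have ht2 : y - t ∈ supp k fun l => degW idx l = j + 1 ∧ wtW N idx l < w := fun l hl => by
      rw [map_sub]
      by_cases h : wtW N idx l = w
      · rw [ht, co_part_of h, sub_self]
      · rw [ht, co_part_of_not h, sub_zero, hy l (by omega)]
    have hs : ∀ {i : ℕ} {z : FreeAlgebra k Γ},
        z ∈ (supp k fun l => degW idx l = i + 1 ∧ wtW N idx l = w) →
        der (degSign k idx) d z - der (degSign k idx) d₀ z ∈
          supp k fun l => degW idx l = i ∧ wtW N idx l < w := fun hz => by
      rw [← der_sub]
      exact der_mem_of_wt_lt hidx (hd.diff_mem hd₀) hz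
    -- The part of top weight of a `d`-cycle is a `d₀`-cycle: `d` agrees with `d₀` up to smaller
    -- weight, and `d₀` preserves weight.
    have ht3 : der (degSign k idx) d₀ t = 0 := by
      have h1 := der_mem_of_wt_le hidx (hd.deg_wt hd₀) ht2
      have h2 := add_mem (hs ht1) h1
      rw [map_sub, hy0] at h2
      have h3 : der (degSign k idx) d₀ t ∈ supp k fun l => degW idx l = j ∧ wtW N idx l < w := by
        have : der (degSign k idx) d t - der (degSign k idx) d₀ t +
          (0 - der (degSign k idx) d t) = - der (degSign k idx) d₀ t := by abel
        rw [this] at h2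
        simpa using neg_mem h2
      refine supp_inf_eq_zero (fun l hl hl' => ?_) h3 (der_mem_of_homogeneous hidx hd₀ ht1)
      omega
    obtain ⟨z, hz, hzt⟩ := hac (j + 1) hj w t ht1 ht3
    -- A primitive for `d₀` of the top part, differentiated with `d`, cancels the top weight; what
    -- is left is again a cycle because `d` has square zero on the letters involved.
    have hyz : y - der (degSign k idx) d z ∈
        supp k fun l => degW idx l = j + 1 ∧ wtW N idx l < w := by
      have := sub_mem ht2 (hs hz)
      rw [hzt] at this
      simpa using this
    obtain ⟨z', hz', hzy⟩ := ih (by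
      rw [map_sub, hy0, hd.der_der hidx hi (supp_mono (fun l hl => by omega) hz), sub_zero]) hyz
    refine ⟨z + z', add_mem (supp_mono (fun l hl => by omega) hz)
      (supp_mono (fun l hl => by omega) hz'), ?_⟩
    rw [map_add, hzy, add_sub_cancel]

include hd₀ in
/-- A filtered differential is determined by its values on the letters of index at most two. -/
theorem unique (hN : 2 ≤ N) (hidx : ∀ x, 1 ≤ idx x) (hac : IsAcyclic N idx d₀)
    (hd : IsFiltered N idx d₀ d) (hd' : IsFiltered N idx d₀ d')
    (h : ∀ x, der (degSign k idx) d (d x) = 0) (h' : ∀ x, der (degSign k idx) d' (d' x) = 0)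
    (h2 : ∀ x, idx x ≤ 2 → d x = d' x) (x : Γ) : d x = d' x := by
  induction hi : idx x using Nat.strong_induction_on generalizing x with
  | _ i ih =>
    by_cases hi2 : i ≤ 2
    · exact h2 x (hi ▸ hi2)
    push Not at hi2
    have hv : d x - d' x ∈ supp k fun l => degW idx l = i - 2 ∧ wtW N idx l < koszulDeg N i := by
      have := sub_mem (hd.diff_mem hd₀ x) (hd'.diff_mem hd₀ x)
      rw [sub_sub_sub_cancel_right] at this
      exact supp_mono (fun l hl => ⟨by omega, by rw [← hi]; exact hl.2⟩) this
    have hv0 : der (degSign k idx) d (d x - d' x) = 0 := by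
      rw [map_sub, h, der_congr (g := d'), h', sub_zero]
      refine supp_mono (fun l hl z hz => ih (idx z) ?_ z rfl) (hd'.deg x)
      have := idx_le_of_mem (idx := idx) hz
      omega
    obtain ⟨z, hz, hzv⟩ := hd.acyclic hd₀ hidx hac (by omega) (fun x _ => h x) _ hv hv0
    -- The primitive has degree `i - 1` and weight below `n(i)`, the least weight that occurs in
    -- that degree.
    have : z = 0 := ext_co fun l => by
      rw [map_zero]
      refine hz l fun hl => ?_
      have hne : l ≠ [] := by
        rintro rfl
        simp at hl
      have := koszulDeg_le_wtW hN hidx l hne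
      rw [show degW idx l + 1 = i by omega] at this
      omega
    rw [this, map_zero] at hzv
    exact (sub_eq_zero.1 hzv.symm)

-- For `x` of index `i + 1`, `d (d₀ x)` is a cycle of weight below `n(i + 1)`, since `d₀` has square
-- zero. For `i > 2` acyclicity makes it the boundary of some `u` of smaller weight, and `d₀ x - u`
-- is the new value at `x`. For `i = 2` the cycle has degree zero, where acyclicity says nothing;
-- there `h3` supplies the primitive.
include hd₀ in
theorem exists_step (hN : 2 ≤ N) (hidx : ∀ x, 1 ≤ idx x) (hac : IsAcyclic N idx d₀)
    (h₀ : ∀ x, der (degSign k idx) d₀ (d₀ x) = 0) (hd : IsFiltered N idx d₀ d) {i : ℕ}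
    (hi2 : 2 ≤ i) (hi : ∀ x, idx x ≤ i → der (degSign k idx) d (d x) = 0)
    (h3 : i = 2 → ∀ x, idx x = 3 →
      ∃ u ∈ supp k fun l => degW idx l = 1 ∧ wtW N idx l < koszulDeg N 3,
        der (degSign k idx) d u = der (degSign k idx) d (d₀ x)) :
    ∃ d', IsFiltered N idx d₀ d' ∧ (∀ x, idx x ≤ i + 1 → der (degSign k idx) d' (d' x) = 0) ∧
      ∀ x, idx x ≤ i → d' x = d x := by
  have key : ∀ x, idx x = i + 1 →
      ∃ u ∈ supp k fun l => degW idx l = i - 1 ∧ wtW N idx l < koszulDeg N (i + 1),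
        der (degSign k idx) d u = der (degSign k idx) d (d₀ x) := by
    intro x hx
    by_cases h : i = 2
    · subst h
      exact h3 rfl x hx
    · have hx1 : d₀ x ∈ supp k fun l => degW idx l = (i - 2) + 1 ∧
          wtW N idx l = koszulDeg N (i + 1) :=
        supp_mono (fun l hl => ⟨by omega, by rw [← hx]; exact hl.2⟩) (hd₀ x)
      have h1 : der (degSign k idx) d (d₀ x) ∈
          supp k fun l => degW idx l = i - 2 ∧ wtW N idx l < koszulDeg N (i + 1) := by
        have := der_mem_of_wt_lt hidx (hd.diff_mem hd₀) hx1
        rw [der_sub, h₀, sub_zero] at this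
        exact this
      obtain ⟨u, hu, hu'⟩ := hd.acyclic hd₀ hidx hac (by omega)
        (fun x hx => hi x (by omega)) _ h1
        (hd.der_der hidx hi (supp_mono (fun l hl => by omega) hx1))
      exact ⟨u, supp_mono (fun l hl => ⟨by omega, hl.2⟩) hu, hu'⟩
  choose u hu hu' using key
  classical
  refine ⟨fun x => if hx : idx x = i + 1 then d₀ x - u x hx else d x, ⟨fun x => ?_, fun x => ?_,
    fun x => ?_⟩, fun x hx => ?_, fun x hx => dif_neg (by omega)⟩
  · split_ifs with hx
    · exact sub_mem (supp_mono (fun l hl => hl.1) (hd₀ x))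
        (supp_mono (fun l hl => by omega) (hu x hx))
    · exact hd.deg x
  · split_ifs with hx
    · rw [sub_sub_cancel_left]
      exact neg_mem (supp_mono (fun l hl => by rw [hx]; exact hl.2) (hu x hx))
    · exact hd.wt x
  · split_ifs with hx
    · rw [map_sub, hu x hx [] (by simp; omega), hd₀ x [] (by
        have := le_koszulDeg hN (idx x)
        simp
        omega), sub_zero]
    · exact hd.co_nil x
  · have hcongr : ∀ y ∈ supp k fun l => degW idx l < i,
        der (degSign k idx) (fun x => if hx : idx x = i + 1 then d₀ x - u x hx else d x) y =
          der (degSign k idx) d y := fun y hy =>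
      der_congr (supp_mono (fun l hl z hz => dif_neg (by
        have := idx_le_of_mem (idx := idx) hz
        omega)) hy)
    beta_reduce
    split_ifs with hx'
    · rw [hcongr, map_sub, hu', sub_self]
      exact sub_mem (supp_mono (fun l hl => by omega) (hd₀ x))
        (supp_mono (fun l hl => by omega) (hu x hx'))
    · rw [hcongr, hi x (by omega)]
      exact supp_mono (fun l hl => by omega) (hd.deg x)

include hd₀ in
/-- Values on the letters of index two extend to a filtered differential as soon as they extend to
the letters of index three. -/
theorem exists_extension (hN : 2 ≤ N) (hidx : ∀ x, 1 ≤ idx x) (hac : IsAcyclic N idx d₀)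
    (h₀ : ∀ x, der (degSign k idx) d₀ (d₀ x) = 0) (hd : IsFiltered N idx d₀ d)
    (h3 : ∀ x, idx x = 3 →
      ∃ u ∈ supp k fun l => degW idx l = 1 ∧ wtW N idx l < koszulDeg N 3,
        der (degSign k idx) d u = der (degSign k idx) d (d₀ x)) :
    ∃ d', IsFiltered N idx d₀ d' ∧ (∀ x, der (degSign k idx) d' (d' x) = 0) ∧
      ∀ x, idx x ≤ 2 → d' x = d x := by
  -- A stage is a filtered derivation whose square vanishes up to index `i + 2`. Later stages change
  -- only letters of larger index, so stage `idx x` evaluated at `x` gives the limit.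
  let T (i : ℕ) := {e : Γ → FreeAlgebra k Γ // IsFiltered N idx d₀ e ∧
    (∀ x, idx x ≤ i + 2 → der (degSign k idx) e (e x) = 0) ∧ ∀ x, idx x ≤ 2 → e x = d x}
  have step : ∀ i, ∀ e : T i, ∃ e' : T (i + 1), ∀ x, idx x ≤ i + 2 → e'.1 x = e.1 x := by
    rintro i ⟨e, he, he1, he2⟩
    obtain ⟨e', h1, h2, h4⟩ := he.exists_step hd₀ hN hidx hac h₀ (by omega) he1 (by
      intro _ x hx
      obtain ⟨u, hu, hu'⟩ := h3 x hx
      refine ⟨u, hu, ?_⟩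
      have h1 : u ∈ supp k fun l => ∀ z ∈ l, e z = d z :=
        supp_mono (fun l hl z hz => he2 z (by
          have := idx_le_of_mem (idx := idx) hz
          omega)) hu
      have h2 : d₀ x ∈ supp k fun l => ∀ z ∈ l, e z = d z :=
        supp_mono (fun l hl z hz => he2 z (by
          have := idx_le_of_mem (idx := idx) hz
          omega)) (hd₀ x)
      rw [der_congr h1, hu', der_congr h2])
    exact ⟨⟨e', h1, h2, fun x hx => (h4 x (by omega)).trans (he2 x hx)⟩, h4⟩
  choose next hnext using step
  have hbase : ∀ x, idx x ≤ 0 + 2 → der (degSign k idx) d (d x) = 0 := fun x hx =>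
    der_eq_zero_of_deg_zero hidx hd.deg (supp_mono (fun l hl => by omega) (hd.deg x))
  let e : ∀ i, T i := fun i => Nat.rec ⟨d, hd, hbase, fun _ _ => rfl⟩ next i
  have he : ∀ i j x, idx x ≤ i + 2 → (e (i + j)).1 x = (e i).1 x := by
    intro i j x hx
    induction j with
    | zero => rfl
    | succ j ih => exact (hnext (i + j) (e (i + j)) x (by omega)).trans ih
  have he' : ∀ i x, idx x ≤ i + 2 → (e (idx x)).1 x = (e i).1 x := by
    intro i x hx
    rcases le_total i (idx x) with h | h
    · obtain ⟨j, hj⟩ := Nat.exists_eq_add_of_le h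
      rw [hj]
      exact he i j x hx
    · obtain ⟨j, rfl⟩ := Nat.exists_eq_add_of_le h
      exact (he (idx x) j x (by omega)).symm
  refine ⟨fun x => (e (idx x)).1 x, ⟨fun x => (e (idx x)).2.1.deg x, fun x => (e (idx x)).2.1.wt x,
    fun x => (e (idx x)).2.1.co_nil x⟩, fun x => ?_, fun x hx => he' 0 x hx⟩
  rw [der_congr (g := (e (idx x)).1)]
  · exact (e (idx x)).2.2.1 x (by omega)
  · refine supp_mono (fun l hl z hz => he' _ z ?_) ((e (idx x)).2.1.deg x)
    have := idx_le_of_mem (idx := idx) hz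
    omega

end IsFiltered

end Deformation

/-! ### Signs -/

section Signs

/-- The exponent of the sign that relates the operation `mₙ` to its suspension. -/
def suspExp : List ℕ → ℕ
  | [] => 0
  | d :: l => l.length * d + suspExp l

theorem suspExp_append (l m : List ℕ) :
    suspExp (l ++ m) = suspExp l + m.length * l.sum + suspExp m := by
  induction l with
  | nil => simp [suspExp]
  | cons d l ih =>
    simp only [List.cons_append, suspExp, ih, List.length_append, List.sum_cons]
    ring

variable (k : Type*) [Field k]

/-- The sign that relates the operation `mₙ` to its suspension. -/
def suspSign (l : List ℕ) : k := (-1) ^ suspExp l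

theorem suspSign_mul_self (l : List ℕ) : suspSign k l * suspSign k l = 1 := by
  rw [suspSign, ← mul_pow]
  simp

theorem neg_one_pow_congr {a b : ℕ} (h : a % 2 = b % 2) : (-1 : k) ^ a = (-1) ^ b := by
  rw [neg_one_pow_eq_pow_mod_two, h, ← neg_one_pow_eq_pow_mod_two]

theorem sgn_eq_pow (p : List ℕ) :
    sgn (fun d : ℕ => (-1 : k) ^ (d + 1)) p = (-1) ^ (p.sum + p.length) := by
  induction p with
  | nil => simp
  | cons d p ih =>
    rw [sgn_cons, ih, ← pow_add]
    congr 1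
    simp
    ring

/-- The signs in a Stasheff identity become Koszul signs after suspension. -/
theorem suspSign_stasheff (p m q : List ℕ) (j : ℕ) (hj : j + m.length = m.sum + 2) :
    sgn (fun d : ℕ => (-1 : k) ^ (d + 1)) p * suspSign k m * suspSign k (p ++ j :: q) =
      suspSign k (p ++ m ++ q) *
        (-1) ^ (p.length + m.length * q.length + m.length * p.sum) := by
  rw [sgn_eq_pow, suspSign, suspSign, suspSign, ← pow_add, ← pow_add, ← pow_add]
  refine neg_one_pow_congr k ?_
  rw [suspExp_append, suspExp_append, suspExp_append]
  simp only [suspExp, List.length_cons, List.sum_append]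
  -- The degree `j` of the inner value enters the parity comparison only through this multiple of
  -- `hj`.
  have h : q.length * j + q.length * m.length = q.length * m.sum + 2 * q.length := by
    rw [← mul_add, hj]
    ring
  ring_nf at h ⊢
  omega

end Signs

/-! ### Shapes of words allowed by degree and weight, and cancellation of signs -/

section Shapes

/-- The numbers of even and of odd entries determine the weight in terms of the degree. -/
theorem exists_wtW_degW (N : ℕ) (l : List ℕ) (hl : ∀ x ∈ l, 1 ≤ x) :
    ∃ q, wtW N id l = N * q + l.countP (fun x => ¬ Even x) ∧
      degW id l + l.countP (fun x => Even x) = 2 * q := by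
  induction l with
  | nil => exact ⟨0, by simp⟩
  | cons x l ih =>
    obtain ⟨q, h1, h2⟩ := ih fun z hz => hl z (by simp [hz])
    have hx := hl x (by simp)
    rcases Nat.even_or_odd' x with ⟨p, rfl | rfl⟩
    · refine ⟨q + p, ?_, ?_⟩
      · simp only [wtW_cons, id, koszulDeg_two_mul, h1, List.countP_cons]
        simp
        ring
      · simp only [degW_cons, id, List.countP_cons]
        simp at hx ⊢
        omega
    · refine ⟨q + p, ?_, ?_⟩
      · simp only [wtW_cons, id, koszulDeg_two_mul_add_one, h1, List.countP_cons]
        simp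
        ring
      · simp only [degW_cons, id, List.countP_cons]
        simp at hx ⊢
        omega

theorem length_eq_countP_even (l : List ℕ) :
    l.length = l.countP (fun x => Even x) + l.countP (fun x => ¬ Even x) := by
  simpa using List.length_eq_countP_add_countP (fun x => decide (Even x)) (l := l)

/-- The words that occur in the values of a filtered derivation, by their numbers of even and odd
letters. -/
theorem count_of_wtW_le {N : ℕ} (hN : 2 ≤ N) (l : List ℕ) (hl : ∀ x ∈ l, 1 ≤ x)
    (h : wtW N id l ≤ koszulDeg N (degW id l + 2)) :
    (l.countP (fun x => Even x) = 0 ∧ l.countP (fun x => ¬ Even x) ≤ N ∧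
      (wtW N id l = koszulDeg N (degW id l + 2) ↔ l.countP (fun x => ¬ Even x) = N)) ∨
    (l.countP (fun x => Even x) = 2 ∧ l.countP (fun x => ¬ Even x) = 0 ∧
      wtW N id l = koszulDeg N (degW id l + 2)) ∨
    (l.countP (fun x => Even x) = 1 ∧ l.countP (fun x => ¬ Even x) ≤ 1 ∧
      (wtW N id l = koszulDeg N (degW id l + 2) ↔ l.countP (fun x => ¬ Even x) = 1)) := by
  obtain ⟨q, h1, h2⟩ := exists_wtW_degW N l hl
  generalize l.countP (fun x => Even x) = e at *
  generalize l.countP (fun x => ¬ Even x) = o at *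
  generalize degW id l = g at *
  rw [h1] at h ⊢
  -- The number `e` of even letters has the parity of the degree, which selects the formula for `n`.
  -- With `e = 2f` or `e = 2f + 1`, the bound becomes `N * f + o ≤ N` or `N * f + o ≤ 1`.
  rcases Nat.even_or_odd' e with ⟨f, rfl | rfl⟩
  · obtain ⟨p, hp⟩ : ∃ p, q = p + f := ⟨q - f, by omega⟩
    subst hp
    have : g + 2 = 2 * (p + 1) := by omega
    rw [this, koszulDeg_two_mul] at h ⊢
    have hf : N * f + o ≤ N := by nlinarith
    rcases Nat.lt_or_ge f 2 with hf2 | hf2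
    · interval_cases f
      · left
        refine ⟨rfl, by omega, ?_⟩
        rw [mul_add, mul_add]
        omega
      · right; left
        refine ⟨rfl, by omega, ?_⟩
        rw [mul_add]
        omega
    · nlinarith
  · obtain ⟨p, hp⟩ : ∃ p, q = p + f + 1 := ⟨q - f - 1, by omega⟩
    subst hp
    have : g + 2 = 2 * (p + 1) + 1 := by omega
    rw [this, koszulDeg_two_mul_add_one] at h ⊢
    have hf : N * f + o ≤ 1 := by nlinarith
    rcases Nat.lt_or_ge f 1 with hf2 | hf2
    · interval_cases f
      right; right
      refine ⟨rfl, by omega, ?_⟩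
      rw [add_zero]
      omega
    · nlinarith

/-- The words of a homogeneous derivation: `N` odd letters, or two letters not both odd. -/
theorem wtW_eq_iff {N : ℕ} (hN : 2 ≤ N) (l : List ℕ) (hl : ∀ x ∈ l, 1 ≤ x) :
    wtW N id l = koszulDeg N (degW id l + 2) ↔
      (l.length = N ∧ ∀ x ∈ l, ¬ Even x) ∨ (l.length = 2 ∧ ∃ x ∈ l, Even x) := by
  have hlen := length_eq_countP_even l
  have h0 : (∀ x ∈ l, ¬ Even x) ↔ l.countP (fun x => Even x) = 0 := by
    simp [List.countP_eq_zero]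
  have h0' : (∃ x ∈ l, Even x) ↔ 0 < l.countP (fun x => Even x) := by
    simp [List.countP_pos_iff]
  rw [h0, h0']
  constructor
  · intro h
    rcases count_of_wtW_le hN l hl h.le with ⟨h1, h2, h3⟩ | ⟨h1, h2, h3⟩ | ⟨h1, h2, h3⟩
    · have := h3.1 h
      omega
    · omega
    · have := h3.1 h
      omega
  · obtain ⟨q, h1, h2⟩ := exists_wtW_degW N l hl
    generalize l.countP (fun x => Even x) = e at *
    generalize l.countP (fun x => ¬ Even x) = o at *
    generalize degW id l = g at *
    rw [h1]
    rintro (⟨h3, h4⟩ | ⟨h3, h4⟩)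
    · have : g + 2 = 2 * (q + 1) := by omega
      rw [this, koszulDeg_two_mul, mul_add]
      omega
    · have : e = 1 ∨ e = 2 := by omega
      rcases this with rfl | rfl
      · have : g + 2 = 2 * q + 1 := by omega
        rw [this, koszulDeg_two_mul_add_one]
        omega
      · have : g + 2 = 2 * q := by omega
        rw [this, koszulDeg_two_mul]
        omega

/-- Words in the square of a homogeneous derivation lose two in degree and nothing in weight. With
`e = 2f` or `e = 2f + 1` even letters and `o` odd ones this forces `N * f + o` to be `N + 1` or `N`.
-/
theorem count_of_wtW_eq_add_three {N : ℕ} (hN : 2 ≤ N) (l : List ℕ) (hl : ∀ x ∈ l, 1 ≤ x)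
    (h : wtW N id l = koszulDeg N (degW id l + 3)) :
    (l.length = N + 1 ∧ l.countP (fun x => Even x) ≤ 1) ∨
      (l.length = 3 ∧ 2 ≤ l.countP (fun x => Even x)) := by
  have hlen := length_eq_countP_even l
  obtain ⟨q, h1, h2⟩ := exists_wtW_degW N l hl
  generalize l.countP (fun x => Even x) = e at *
  generalize l.countP (fun x => ¬ Even x) = o at *
  generalize degW id l = g at *
  rw [h1] at h
  rcases Nat.even_or_odd' e with ⟨f, rfl | rfl⟩
  · obtain ⟨p, hp⟩ : ∃ p, q = p + f := ⟨q - f, by omega⟩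
    subst hp
    have : g + 3 = 2 * (p + 1) + 1 := by omega
    rw [this, koszulDeg_two_mul_add_one] at h
    have hf : N * f + o = N + 1 := by nlinarith
    rcases Nat.lt_or_ge f 2 with hf2 | hf2
    · interval_cases f <;> omega
    · nlinarith
  · obtain ⟨p, hp⟩ : ∃ p, q = p + f + 1 := ⟨q - f - 1, by omega⟩
    subst hp
    have : g + 3 = 2 * (p + 2) := by omega
    rw [this, koszulDeg_two_mul] at h
    have hf : N * f + o = N := by nlinarith
    rcases Nat.lt_or_ge f 2 with hf2 | hf2
    · interval_cases f <;> omega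
    · nlinarith

theorem wtW_take_drop_eq_iff {N : ℕ} (hN : 2 ≤ N) (l : List ℕ) (hl : ∀ x ∈ l, 1 ≤ x) {r s : ℕ}
    (hrs : r + s ≤ l.length) :
    wtW N id ((l.drop r).take s) = koszulDeg N (degW id ((l.drop r).take s) + 2) ↔
      (s = N ∧ ∀ j (hj : j < l.length), r ≤ j → j < r + s → ¬ Even l[j]) ∨
      (s = 2 ∧ ∃ j, ∃ hj : j < l.length, r ≤ j ∧ j < r + s ∧ Even l[j]) := by
  have hmem : ∀ x, x ∈ (l.drop r).take s ↔
      ∃ j, ∃ hj : j < l.length, r ≤ j ∧ j < r + s ∧ l[j] = x := by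
    intro x
    rw [List.mem_take_iff_getElem]
    constructor
    · rintro ⟨j, hj, rfl⟩
      simp at hj
      exact ⟨r + j, by omega, by omega, by omega, by simp⟩
    · rintro ⟨j, hj, h1, h2, rfl⟩
      refine ⟨j - r, by simp; omega, ?_⟩
      simp only [List.getElem_drop]
      congr 1
      omega
  rw [wtW_eq_iff hN _ fun x hx => hl x (List.mem_of_mem_drop (List.mem_of_mem_take hx))]
  have : ((l.drop r).take s).length = s := by simp; omega
  rw [this]
  refine or_congr (and_congr_right fun _ => ?_) (and_congr_right fun _ => ?_)
  · constructor
    · intro H j hj h1 h2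
      exact H _ ((hmem _).2 ⟨j, hj, h1, h2, rfl⟩)
    · intro H x hx
      obtain ⟨j, hj, h1, h2, rfl⟩ := (hmem x).1 hx
      exact H j hj h1 h2
  · constructor
    · rintro ⟨x, hx, he⟩
      obtain ⟨j, hj, h1, h2, rfl⟩ := (hmem x).1 hx
      exact ⟨j, hj, h1, h2, he⟩
    · rintro ⟨j, hj, h1, h2, he⟩
      exact ⟨_, (hmem _).2 ⟨j, hj, h1, h2, rfl⟩, he⟩

/-- The signed sum over the homogeneous operations in a Stasheff identity vanishes if there are
exactly two of them, with opposite signs. -/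
theorem stasheff_sign_sum_of_two (k : Type*) [Field k] {N : ℕ} (hN : 2 ≤ N) (l : List ℕ)
    (hl : ∀ x ∈ l, 1 ≤ x) (a a' b b' : ℕ) (hab : ¬ (a = b ∧ a' = b')) (ha : a + a' ≤ l.length)
    (hb : b + b' ≤ l.length) (ha1 : 1 ≤ a') (hb1 : 1 ≤ b')
    (H : ∀ r s, r + s ≤ l.length → 1 ≤ s →
      (((s = N ∧ ∀ j (hj : j < l.length), r ≤ j → j < r + s → ¬ Even l[j]) ∨
      (s = 2 ∧ ∃ j, ∃ hj : j < l.length, r ≤ j ∧ j < r + s ∧ Even l[j])) ↔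
        (r = a ∧ s = a') ∨ (r = b ∧ s = b')))
    (hs : (a + a' * (l.length - a - a') + a' * (l.take a).sum + 1) % 2 =
      (b + b' * (l.length - b - b') + b' * (l.take b).sum) % 2) :
    ∑ r ∈ Finset.range l.length, ∑ s ∈ Finset.Icc 1 (l.length - r),
      (if wtW N id ((l.drop r).take s) = koszulDeg N (degW id ((l.drop r).take s) + 2) then
        (-1 : k) ^ (r + s * (l.length - r - s) + s * (l.take r).sum) else 0) = 0 := by
  rw [Finset.sum_sigma']
  have hne : (⟨a, a'⟩ : (_ : ℕ) × ℕ) ≠ ⟨b, b'⟩ := by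
    intro h
    injection h with h1 h2
    exact hab ⟨h1, h2⟩
  rw [Finset.sum_eq_add_of_mem (⟨a, a'⟩ : (_ : ℕ) × ℕ) ⟨b, b'⟩
    (by rw [Finset.mem_sigma, Finset.mem_range, Finset.mem_Icc]; dsimp only; omega)
    (by rw [Finset.mem_sigma, Finset.mem_range, Finset.mem_Icc]; dsimp only; omega) hne]
  · rw [if_pos, if_pos, ← neg_one_pow_congr k hs, pow_succ]
    · ring
    · exact (wtW_take_drop_eq_iff hN l hl hb).2 ((H _ _ hb hb1).2 (Or.inr ⟨rfl, rfl⟩))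
    · exact (wtW_take_drop_eq_iff hN l hl ha).2 ((H _ _ ha ha1).2 (Or.inl ⟨rfl, rfl⟩))
  · rintro ⟨r, s⟩ hx ⟨hxa, hxb⟩
    rw [Finset.mem_sigma, Finset.mem_range, Finset.mem_Icc] at hx
    dsimp only at hx ⊢
    refine if_neg fun hv => ?_
    rcases (H r s (by omega) (by omega)).1
      ((wtW_take_drop_eq_iff hN l hl (by omega)).1 hv) with h | h
    · exact hxa (by rw [h.1, h.2])
    · exact hxb (by rw [h.1, h.2])

/-- In the Stasheff identities for the products of `A^!` the terms cancel in pairs. -/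
theorem stasheff_sign_sum (k : Type*) [Field k] {N : ℕ} (hN : 2 ≤ N) (l : List ℕ)
    (hl : ∀ x ∈ l, 1 ≤ x) (h : wtW N id l = koszulDeg N (degW id l + 3)) :
    ∑ r ∈ Finset.range l.length, ∑ s ∈ Finset.Icc 1 (l.length - r),
      (if wtW N id ((l.drop r).take s) = koszulDeg N (degW id ((l.drop r).take s) + 2) then
        (-1 : k) ^ (r + s * (l.length - r - s) + s * (l.take r).sum) else 0) = 0 := by
  have hlen : l.length = N + 1 ∨ l.length = 3 := by
    rcases count_of_wtW_eq_add_three hN l hl h with h | h <;> omega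
  by_cases hl3 : l.length = 3
  · have hor : N = 2 ∨ ((∃ j, ∃ hj : j < l.length, j < 2 ∧ Even l[j]) ∧
        (∃ j, ∃ hj : j < l.length, 1 ≤ j ∧ Even l[j])) := by
      rcases count_of_wtW_eq_add_three hN _ hl h with ⟨h1, _⟩ | ⟨_, h2⟩
      · left
        omega
      · right
        obtain ⟨a, b, c, rfl⟩ := List.length_eq_three.1 hl3
        simp only [List.countP_cons, List.countP_nil] at h2
        have h12 : (Even a ∨ Even b) ∧ (Even b ∨ Even c) := by
          by_cases ha : Even a <;> by_cases hb : Even b <;> by_cases hc : Even c <;>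
            simp_all
        constructor
        · rcases h12.1 with h3 | h3
          · exact ⟨0, by simp, by simp, h3⟩
          · exact ⟨1, by simp, by simp, h3⟩
        · rcases h12.2 with h3 | h3
          · exact ⟨1, by simp, by simp, h3⟩
          · exact ⟨2, by simp, by simp, h3⟩
    -- Length three: both operations are binary, and the two terms are the two bracketings.
    refine stasheff_sign_sum_of_two k hN l hl 0 2 1 2 (by simp) (by omega) (by omega) (by simp)
      (by simp) ?_ ?_
    · intro r s hrs hs
      constructor
      · rintro (⟨h1, h2⟩ | ⟨h1, h2⟩)
        · rcases hor with h | ⟨⟨j, hj, hj2, hje⟩, h4⟩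
          · omega
          · by_contra hne
            exact h2 j hj (by omega) (by omega) hje
        · omega
      · intro h
        have hs2 : s = 2 := by omega
        subst hs2
        by_cases hex : ∃ j, ∃ hj : j < l.length, r ≤ j ∧ j < r + 2 ∧ Even l[j]
        · exact Or.inr ⟨rfl, hex⟩
        · rcases hor with h5 | ⟨⟨j, hj, hj2, hje⟩, ⟨i, hi, hi2, hie⟩⟩
          · exact Or.inl ⟨h5.symm, fun j hj h6 h7 h8 => hex ⟨j, hj, h6, h7, h8⟩⟩
          · rcases h with ⟨rfl, _⟩ | ⟨rfl, _⟩
            · exact absurd ⟨j, hj, by omega, by omega, hje⟩ hex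
            · exact absurd ⟨i, hi, by omega, by omega, hie⟩ hex
    · simp only [hl3]
      omega
  · have hlN : l.length = N + 1 := by omega
    have hN3 : 3 ≤ N := by omega
    have hcount : l.countP (fun x => Even x) ≤ 1 := by
      rcases count_of_wtW_eq_add_three hN l hl h with h | h <;> omega
    have hhead : ∀ hp : 0 < l.length, (l.take 1).sum = l[0] := by
      intro hp
      obtain ⟨x, m, rfl⟩ := List.exists_cons_of_length_pos hp
      simp
    rcases Nat.eq_zero_or_pos (l.countP fun x => Even x) with h0 | h1
    · have hodd : ∀ j (hj : j < l.length), ¬ Even l[j] := by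
        intro j hj
        have := List.countP_eq_zero.1 h0 l[j] (List.getElem_mem hj)
        simpa using this
      -- All letters odd: the inner operation takes the first or the last `N` of the `N + 1`
      -- letters, and its value is even, so that the outer operation is binary.
      refine stasheff_sign_sum_of_two k hN l hl 0 N 1 N (by simp) (by omega) (by omega)
        (by omega) (by omega) ?_ ?_
      · intro r s hrs hs
        constructor
        · rintro (⟨h1, h2⟩ | ⟨h1, j, hj, h2, h3, h4⟩)
          · omega
          · exact absurd h4 (hodd j hj)
        · intro h
          exact Or.inl ⟨by omega, fun j hj _ _ => hodd j hj⟩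
      · have h1 : (l.take 1).sum % 2 = 1 := by
          rw [hhead (by omega), ← Nat.not_even_iff]
          exact hodd 0 (by omega)
        have h2 : l.length - 0 - N = 1 := by omega
        have h3 : l.length - 1 - N = 0 := by omega
        rw [h2, h3, List.take_zero, List.sum_nil]
        obtain ⟨c, hc⟩ : ∃ c, (l.take 1).sum = 2 * c + 1 := ⟨(l.take 1).sum / 2, by omega⟩
        rw [hc]
        have : N * (2 * c + 1) = 2 * (N * c) + N := by ring
        omega
    · obtain ⟨p, hp, hpe⟩ : ∃ p, ∃ hp : p < l.length, ∀ j (hj : j < l.length),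
          Even l[j] ↔ j = p := by
        obtain ⟨x, hx, hxe⟩ := List.countP_pos_iff.1 h1
        obtain ⟨A, B, rfl⟩ := List.append_of_mem hx
        have hxe' : Even x := by simpa using hxe
        rw [List.countP_append, List.countP_cons] at hcount
        simp only [hxe', decide_true, if_true] at hcount
        have hA : A.countP (fun x => Even x) = 0 := by omega
        have hB : B.countP (fun x => Even x) = 0 := by omega
        refine ⟨A.length, by simp, fun j hj => ?_⟩
        constructor
        · intro he
          by_contra hne
          rcases Nat.lt_or_gt_of_ne hne with hlt | hgt
          · rw [List.getElem_append_left hlt] at he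
            have := List.countP_eq_zero.1 hA _ (List.getElem_mem hlt)
            simp only [decide_eq_true_eq] at this
            exact this he
          · rw [List.getElem_append_right (by omega)] at he
            obtain ⟨m, hm⟩ : ∃ m, j - A.length = m + 1 := ⟨j - A.length - 1, by omega⟩
            simp only [hm, List.getElem_cons_succ] at he
            have := List.countP_eq_zero.1 hB _ (List.getElem_mem (l := B) (n := m) (by
              simp at hj; omega))
            simp only [decide_eq_true_eq] at this
            exact this he
        · rintro rfl
          simpa using hxe'
      have hex : ∀ r s, (∃ j, ∃ hj : j < l.length, r ≤ j ∧ j < r + s ∧ Even l[j]) ↔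
          r ≤ p ∧ p < r + s := by
        intro r s
        constructor
        · rintro ⟨j, hj, h2, h3, h4⟩
          have := (hpe j hj).1 h4
          omega
        · rintro ⟨h2, h3⟩
          exact ⟨p, hp, h2, h3, (hpe p hp).2 rfl⟩
      have hall : ∀ r s, (∀ j (hj : j < l.length), r ≤ j → j < r + s → ¬ Even l[j]) ↔
          ¬ (r ≤ p ∧ p < r + s) := by
        intro r s
        rw [← hex]
        push Not
        rfl
      rcases Nat.eq_zero_or_pos p with rfl | hp0
      -- The even letter comes first: either it is absorbed by its right neighbour, or the `N` odd
      -- letters after it are multiplied first.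
      · refine stasheff_sign_sum_of_two k hN l hl 0 2 1 N (by simp) (by omega) (by omega)
          (by omega) (by omega) ?_ ?_
        · intro r s hrs hs
          rw [hex, hall]
          omega
        · have h1 : (l.take 1).sum % 2 = 0 := by
            rw [hhead (by omega), ← Nat.even_iff]
            exact (hpe 0 (by omega)).2 rfl
          have h3 : l.length - 1 - N = 0 := by omega
          rw [h3, List.take_zero, List.sum_nil]
          obtain ⟨c, hc⟩ : ∃ c, (l.take 1).sum = 2 * c := ⟨(l.take 1).sum / 2, by omega⟩
          rw [hc]
          have : N * (2 * c) = 2 * (N * c) := by ring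
          omega
      · by_cases hpN : p = N
        · subst hpN
          -- The even letter comes last, the mirror image of the previous case; here `p = N`.
          refine stasheff_sign_sum_of_two k hN l hl (p - 1) 2 0 p (by omega) (by omega) (by omega)
            (by omega) (by omega) ?_ ?_
          · intro r s hrs hs
            rw [hex, hall]
            omega
          · have h2 : l.length - (p - 1) - 2 = 0 := by omega
            have h3 : l.length - 0 - p = 1 := by omega
            rw [h2, h3, List.take_zero, List.sum_nil]
            omega
        -- The even letter is in the interior and can be absorbed by its left or by its right
        -- neighbour.
        · refine stasheff_sign_sum_of_two k hN l hl (p - 1) 2 p 2 (by omega) (by omega) (by omega)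
            (by omega) (by omega) ?_ ?_
          · intro r s hrs hs
            rw [hex, hall]
            omega
          · omega

end Shapes

/-! ### The free algebra on a dual basis of `B`, and the differential `d₀` -/

section Letters

variable {k : Type*} [Field k] {L : Type*}

/-- The elements of degree `n` that are orthogonal to `K`. -/
def orthPart (K : Submodule k (FreeAlgebra k L)) (n : ℕ) : Submodule k (FreeAlgebra k L) where
  carrier := {t | t ∈ len k L n ∧ ∀ s ∈ K, pair k L s t = 0}
  add_mem' := fun ha hb => ⟨add_mem ha.1 hb.1, fun s hs => by simp [ha.2 s hs, hb.2 s hs]⟩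
  zero_mem' := ⟨zero_mem _, fun s _ => by simp⟩
  smul_mem' := fun c _ ha => ⟨Submodule.smul_mem _ c ha.1, fun s hs => by simp [ha.2 s hs]⟩

/-- `K` is a two-sided ideal. -/
structure IsIdeal (K : Submodule k (FreeAlgebra k L)) : Prop where
  mul_left : ∀ a, ∀ s ∈ K, a * s ∈ K
  mul_right : ∀ a, ∀ s ∈ K, s * a ∈ K

variable {K : Submodule k (FreeAlgebra k L)}

/-- Contraction is the transpose of multiplication, under which the ideal `K` is stable. So tensors
orthogonal to `K` stay so when a factor is removed at an end. -/
theorem contrL_mem_orthPart (hK : IsIdeal K) {a b : ℕ} {s y : FreeAlgebra k L}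
    (hs : s ∈ len k L a) (hy : y ∈ orthPart K (a + b)) : contrL s y ∈ orthPart K b := by
  refine ⟨fun l hl => ?_, fun z hz => ?_⟩
  · rw [← pair_wd_left, pair_contrL]
    exact pair_eq_zero_of_len (len_mul hs (wd_mem_len l)) hy.1 (by omega)
  · rw [pair_contrL]
    exact hy.2 _ (hK.mul_left _ _ hz)

theorem contrR_mem_orthPart (hK : IsIdeal K) {a b : ℕ} {s y : FreeAlgebra k L}
    (hs : s ∈ len k L b) (hy : y ∈ orthPart K (a + b)) : contrR s y ∈ orthPart K a := by
  refine ⟨fun l hl => ?_, fun z hz => ?_⟩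
  · rw [← pair_wd_left, pair_contrR]
    exact pair_eq_zero_of_len (len_mul (wd_mem_len l) hs) hy.1 (by omega)
  · rw [pair_contrR]
    exact hy.2 _ (hK.mul_right _ _ hz)

variable {Γ : Type*}

/-- A family of bases `c` of the spaces `orthPart K (n(i))`, `i ≥ 1`, and dual elements `t`. The
letters of index `i` form the set `fib i`. -/
structure DualLetters (N : ℕ) (K : Submodule k (FreeAlgebra k L)) (idx : Γ → ℕ)
    (c t : Γ → FreeAlgebra k L) (fib : ℕ → Finset Γ) : Prop where
  two_le : 2 ≤ N
  isIdeal : IsIdeal K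
  one_le : ∀ x, 1 ≤ idx x
  mem_fib : ∀ i x, x ∈ fib i ↔ idx x = i
  c_mem : ∀ x, c x ∈ orthPart K (koszulDeg N (idx x))
  t_mem : ∀ x, t x ∈ len k L (koszulDeg N (idx x))
  dual_self : ∀ x, pair k L (t x) (c x) = 1
  dual_ne : ∀ x z, idx x = idx z → x ≠ z → pair k L (t x) (c z) = 0
  expand : ∀ i, 1 ≤ i → ∀ y ∈ orthPart K (koszulDeg N i),
    y = ∑ x ∈ fib i, pair k L (t x) y • c x

theorem wtW_map (N : ℕ) (idx : Γ → ℕ) (l : List Γ) :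
    wtW N id (l.map idx) = wtW N idx l := by simp [wtW, Function.comp_def]

theorem degW_map (idx : Γ → ℕ) (l : List Γ) : degW id (l.map idx) = degW idx l := by
  simp [degW, Function.comp_def]

/-- The homomorphism of free algebras with given values on the letters. -/
def evalHom (c : Γ → FreeAlgebra k L) : FreeAlgebra k Γ →ₐ[k] FreeAlgebra k L :=
  FreeAlgebra.lift k c

@[simp] theorem evalHom_ι (c : Γ → FreeAlgebra k L) (x : Γ) :
    evalHom c (FreeAlgebra.ι k x) = c x := by simp [evalHom]

@[simp] theorem evalHom_wd_nil (c : Γ → FreeAlgebra k L) : evalHom c (wd k []) = 1 := by simp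

theorem evalHom_wd_cons (c : Γ → FreeAlgebra k L) (x : Γ) (l : List Γ) :
    evalHom c (wd k (x :: l)) = c x * evalHom c (wd k l) := by simp [wd_cons]

theorem evalHom_wd_append (c : Γ → FreeAlgebra k L) (l m : List Γ) :
    evalHom c (wd k (l ++ m)) = evalHom c (wd k l) * evalHom c (wd k m) := by simp [wd_append]

theorem evalHom_wd_mem_len {N : ℕ} {idx : Γ → ℕ} {c : Γ → FreeAlgebra k L}
    (hc : ∀ x, c x ∈ len k L (koszulDeg N (idx x))) (l : List Γ) :
    evalHom c (wd k l) ∈ len k L (wtW N idx l) := by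
  induction l with
  | nil => simpa using wd_mem_len (k := k) ([] : List L)
  | cons x l ih =>
    rw [wd_cons, map_mul, evalHom_ι, wtW_cons]
    exact len_mul (hc x) ih

theorem evalHom_mem_len {N : ℕ} {idx : Γ → ℕ} {c : Γ → FreeAlgebra k L}
    (hc : ∀ x, c x ∈ len k L (koszulDeg N (idx x))) {w : ℕ} {y : FreeAlgebra k Γ}
    (hy : y ∈ supp k fun l => wtW N idx l = w) : evalHom c y ∈ len k L w :=
  supp_map_mem (evalHom c).toLinearMap _ (fun l hl => hl ▸ evalHom_wd_mem_len hc l) hy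

namespace DualLetters

variable {N : ℕ} {idx : Γ → ℕ} {c t : Γ → FreeAlgebra k L} {fib : ℕ → Finset Γ}
  (D : DualLetters N K idx c t fib)

include D

theorem c_mem_len (x : Γ) : c x ∈ len k L (koszulDeg N (idx x)) := (D.c_mem x).1

/-- With equal indices letter by letter, the pairing of the products factors into pairings of `t`
and `c` for the single letters. Equal weight would not suffice: words of different shapes can have
the same weight, and their values are not dual to each other. -/
theorem pair_evalHom {l m : List Γ} (h : l.map idx = m.map idx) :
    pair k L (evalHom t (wd k l)) (evalHom c (wd k m)) = co l (wd k m) := by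
  induction l generalizing m with
  | nil =>
    cases m with
    | nil =>
      have : co [] (1 : FreeAlgebra k L) = 1 := by rw [← wd_nil, co_wd_self]
      rw [co_wd_self, evalHom_wd_nil, evalHom_wd_nil, ← this, ← wd_nil, pair_wd_left, wd_nil]
    | cons => simp at h
  | cons x l ih =>
    cases m with
    | nil => simp at h
    | cons z m =>
      simp only [List.map_cons, List.cons.injEq] at h
      rw [evalHom_wd_cons, evalHom_wd_cons,
        pair_mul (D.t_mem x) (h.1 ▸ D.c_mem_len z), ih h.2]
      by_cases hx : x = z
      · subst hx
        rw [D.dual_self, one_mul, wd_cons, ← wd_singleton, ← List.singleton_append,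
          co_mul_append (u := [x]) (wd_mem_len [x]), co_wd_self, one_mul]
      · rw [D.dual_ne x z h.1 hx, zero_mul, co_wd_ne]
        simp [hx]

theorem co_eq_pair {l : List Γ} {y : FreeAlgebra k Γ}
    (hy : y ∈ supp k fun m => m.map idx = l.map idx) :
    co l y = pair k L (evalHom t (wd k l)) (evalHom c y) :=
  supp_ext (f := co l)
    (g := pair k L (evalHom t (wd k l)) ∘ₗ (evalHom c).toLinearMap)
    (fun _ hm => (D.pair_evalHom hm.symm).symm) hy

/-- `evalHom c` is injective on the span of the words of a given shape. -/
theorem eq_zero_of_evalHom {s : List ℕ} {y : FreeAlgebra k Γ}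
    (hy : y ∈ supp k fun m => m.map idx = s) (h : evalHom c y = 0) : y = 0 :=
  ext_co fun l => by
    rw [map_zero]
    by_cases hl : l.map idx = s
    · subst hl
      rw [D.co_eq_pair hy, h, map_zero]
    · exact hy l hl

/-- Fixing the last `m` letters of `y` leaves an element of `orthPart K (n(i))`, which expands in
the `c x`. The coefficients, collected over all endings, form the contraction with `t x`. -/
theorem sum_contrL {i m : ℕ} (hi : 1 ≤ i) {y : FreeAlgebra k L}
    (hy : y ∈ orthPart K (koszulDeg N i + m)) :
    y = ∑ x ∈ fib i, c x * contrL (t x) y := by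
  have hmem : ∀ x ∈ fib i, c x ∈ len k L (koszulDeg N i) ∧ t x ∈ len k L (koszulDeg N i) := by
    intro x hx
    rw [D.mem_fib] at hx
    exact ⟨hx ▸ D.c_mem_len x, hx ▸ D.t_mem x⟩
  refine ext_co fun l => ?_
  rw [map_sum]
  by_cases hl : l.length = koszulDeg N i + m
  · obtain ⟨u, v, rfl, hu⟩ : ∃ u v, l = u ++ v ∧ u.length = koszulDeg N i :=
      ⟨l.take (koszulDeg N i), l.drop (koszulDeg N i), by simp, by simp; omega⟩
    have hv : v.length = m := by simp at hl; omega
    have h1 : contrR (wd k v) y ∈ orthPart K (koszulDeg N i) :=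
      contrR_mem_orthPart D.isIdeal (hv ▸ wd_mem_len v) hy
    have h2 := congrArg (co u) (D.expand i hi _ h1)
    rw [← pair_wd_left, pair_contrR, ← wd_append, pair_wd_left, map_sum] at h2
    rw [h2]
    refine Finset.sum_congr rfl fun x hx => ?_
    rw [map_smul, co_mul_append (hu ▸ (hmem x hx).1), pair_contrR, ← pair_wd_left (l := v),
      pair_contrL, smul_eq_mul, mul_comm]
  · rw [hy.1 l hl, eq_comm]
    refine Finset.sum_eq_zero fun x hx => ?_
    exact len_mul (hmem x hx).1 (contrL_mem_orthPart D.isIdeal (hmem x hx).2 hy).1 l hl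

/-- An element of `orthPart K n` is in the image of the words of any given shape of weight `n`. -/
theorem exists_evalHom (s : List ℕ) (hs : ∀ i ∈ s, 1 ≤ i) {y : FreeAlgebra k L}
    (hy : y ∈ orthPart K (wtW N id s)) :
    ∃ z ∈ supp k fun m : List Γ => m.map idx = s, evalHom c z = y := by
  induction s generalizing y with
  | nil =>
    refine ⟨co [] y • 1, Submodule.smul_mem _ _ ?_, ?_⟩
    · rw [← wd_nil]
      exact wd_mem_supp rfl
    · rw [map_smul, map_one]
      refine ext_co fun l => ?_
      by_cases hl : l = []
      · subst hl
        rw [map_smul, ← wd_nil, co_wd_self, smul_eq_mul, mul_one]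
      · rw [hy.1 l (by simpa using hl), map_smul, ← wd_nil, co_wd_ne hl, smul_zero]
  | cons i s ih =>
    rw [wtW_cons] at hy
    have hx : ∀ x ∈ fib i, ∃ z ∈ supp k fun m : List Γ => m.map idx = s,
        evalHom c z = contrL (t x) y := by
      intro x hx
      rw [D.mem_fib] at hx
      exact ih (fun j hj => hs j (by simp [hj])) (contrL_mem_orthPart D.isIdeal
        (hx ▸ D.t_mem x) hy)
    choose! z hz hz' using hx
    refine ⟨∑ x ∈ fib i, FreeAlgebra.ι k x * z x, Submodule.sum_mem _ fun x hx => ?_, ?_⟩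
    · rw [← wd_singleton]
      refine supp_mul (p := fun m => m = [x]) ?_ (wd_mem_supp rfl) (hz x hx)
      rintro _ m rfl hm
      simp [hm, (D.mem_fib i x).1 hx]
    · rw [map_sum]
      refine (Finset.sum_congr rfl fun x hx => ?_).trans (D.sum_contrL (hs i (by simp)) hy).symm
      rw [map_mul, evalHom_ι, hz' x hx]

/-- In the pairing with elements orthogonal to `K`, the middle part of a product may be expanded. -/
theorem sum_pair_mul {i a b : ℕ} (hi : 1 ≤ i) {p s q y : FreeAlgebra k L} (hp : p ∈ len k L a)
    (hq : q ∈ len k L b) (hy : y ∈ orthPart K (a + koszulDeg N i + b)) :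
    ∑ x ∈ fib i, pair k L s (c x) * pair k L (p * t x * q) y = pair k L (p * s * q) y := by
  have h1 := D.expand i hi _ (contrL_mem_orthPart D.isIdeal hp
    (contrR_mem_orthPart D.isIdeal hq hy))
  have h2 : ∀ s, pair k L s (contrL p (contrR q y)) = pair k L (p * s * q) y := fun s => by
    rw [pair_contrL, pair_contrR]
  refine Eq.trans (Finset.sum_congr rfl fun x _ => ?_)
    ((congrArg (pair k L s) h1).symm.trans (h2 s) |>.symm ▸ (map_sum _ _ _).symm)
  rw [map_smul, smul_eq_mul, h2, mul_comm]

/-- Every letter has positive weight and there are finitely many of each index. This finiteness is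
what lets products be dualized to elements of the free algebra instead of infinite sums. -/
theorem finite_words (w : ℕ) : {l : List Γ | wtW N idx l ≤ w}.Finite := by
  classical
  induction w with
  | zero =>
    refine (Set.finite_singleton []).subset fun l hl => ?_
    have := length_le_wtW D.two_le D.one_le l
    simp at hl
    rw [Set.mem_singleton_iff, ← List.length_eq_zero_iff]
    omega
  | succ w ih =>
    refine ((Set.finite_singleton []).union (Set.Finite.biUnion
      ((Finset.range (w + 2)).biUnion fib).finite_toSet
      fun x _ => ih.image (List.cons x))).subset fun l hl => ?_
    cases l with
    | nil => exact Or.inl rfl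
    | cons x l =>
      right
      have h1 := le_koszulDeg D.two_le (idx x)
      have h2 := D.one_le x
      simp at hl
      refine Set.mem_biUnion (x := x) ?_ ⟨l, ?_, rfl⟩
      · simp only [Finset.mem_coe, Finset.mem_biUnion, Finset.mem_range]
        exact ⟨idx x, by omega, (D.mem_fib _ _).2 rfl⟩
      · simp
        omega

open scoped Classical in
/-- The values on the letters of the differential that is dual to the products of `A^!`. -/
def d₀ (x : Γ) : FreeAlgebra k Γ :=
  ofCo (Finsupp.ofSupportFinite (fun l : List Γ =>
    if degW idx l + 2 = idx x ∧ wtW N idx l = koszulDeg N (idx x) then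
      suspSign k (l.map idx) * pair k L (evalHom t (wd k l)) (c x) else 0)
    ((D.finite_words (koszulDeg N (idx x))).subset fun l hl => by
      rw [Function.mem_support] at hl
      by_contra h
      refine hl (if_neg fun h' => h ?_)
      exact h'.2.le))

open scoped Classical in
theorem co_d₀ (l : List Γ) (x : Γ) :
    co l (D.d₀ x) = if degW idx l + 2 = idx x ∧ wtW N idx l = koszulDeg N (idx x) then
      suspSign k (l.map idx) * pair k L (evalHom t (wd k l)) (c x) else 0 := by
  rw [d₀, co_ofCo]
  rfl

theorem isHomogeneous_d₀ : IsHomogeneous N idx D.d₀ := fun x l hl => by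
  rw [D.co_d₀, if_neg hl]

theorem isFiltered_d₀ : IsFiltered N idx D.d₀ D.d₀ where
  deg := fun x => supp_mono (fun _ h => h.1) (D.isHomogeneous_d₀ x)
  wt := fun x => by rw [sub_self]; exact zero_mem _
  co_nil := fun x => D.isHomogeneous_d₀ x [] (by
    have h1 := le_koszulDeg D.two_le (idx x)
    have h2 := D.one_le x
    simp
    omega)

theorem mem_fib_of_co_ne {f : Γ → FreeAlgebra k Γ}
    (hf : ∀ x, f x ∈ supp k fun l => degW idx l + 2 = idx x) (l : List Γ) (x : Γ)
    (h : co l (f x) ≠ 0) : x ∈ fib (degW idx l + 2) := by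
  rw [D.mem_fib]
  by_contra hx
  exact h (hf x l (Ne.symm hx))

/-- The coefficient of `l` in the square is a sum over the subwords of `l` that are contracted
first. By associativity in `A^!` each nonzero term is, up to sign, the pairing of the full product
along `l` with `c x`. This common factor splits off and leaves the sign sum of `stasheff_sign_sum`.
-/
theorem der_d₀ (x : Γ) : der (degSign k idx) D.d₀ (D.d₀ x) = 0 := by
  refine ext_co fun l => ?_
  classical
  rw [map_zero, co_der (T := fun l => fib (degW idx l + 2)) _ _
    (D.mem_fib_of_co_ne D.isFiltered_d₀.deg) D.isFiltered_d₀.co_nil, bar, map_sum,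
    LinearMap.sum_apply]
  by_cases hl : degW idx l + 3 = idx x ∧ wtW N idx l = koszulDeg N (idx x)
  · have hterm : ∀ r ∈ Finset.range l.length, ∀ s ∈ Finset.Icc 1 (l.length - r),
        pair k Γ (sgn (degSign k idx) (l.take r) • (wd k (l.take r) *
          transLetter D.d₀ (fun l => fib (degW idx l + 2)) ((l.drop r).take s) *
          wd k (l.drop (r + s)))) (D.d₀ x) =
        (suspSign k (l.map idx) * pair k L (evalHom t (wd k l)) (c x)) *
        (if wtW N id (((l.map idx).drop r).take s) =
            koszulDeg N (degW id (((l.map idx).drop r).take s) + 2) then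
          (-1 : k) ^ (r + s * ((l.map idx).length - r - s) + s * ((l.map idx).take r).sum)
          else 0) := by
      intro r hr s hs
      simp only [Finset.mem_range, Finset.mem_Icc] at hr hs
      set p := l.take r with hp
      set m := (l.drop r).take s with hm
      set q := l.drop (r + s) with hq
      have hlpmq : l = p ++ m ++ q := by
        rw [hp, hm, hq, ← List.drop_drop, List.append_assoc, List.take_append_drop,
          List.take_append_drop]
      have hplen : p.length = r := by rw [hp]; simp; omega
      have hmlen : m.length = s := by rw [hm]; simp; omega
      have hqlen : q.length = l.length - r - s := by rw [hq]; simp; omega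
      have hmap : ((l.map idx).drop r).take s = m.map idx := by rw [hm]; simp
      have hmap' : (l.map idx).take r = p.map idx := by rw [hp]; simp
      rw [hmap, hmap', wtW_map, degW_map, List.length_map, map_smul, LinearMap.smul_apply,
        transLetter, Finset.mul_sum, Finset.sum_mul, map_sum, LinearMap.sum_apply, smul_eq_mul]
      have hsum : ∀ z ∈ fib (degW idx m + 2), pair k Γ (wd k p * (co m (D.d₀ z) •
          FreeAlgebra.ι k z) * wd k q) (D.d₀ x) = co m (D.d₀ z) * co (p ++ z :: q) (D.d₀ x) := by
        intro z _
        rw [mul_smul_comm, smul_mul_assoc, map_smul, LinearMap.smul_apply, ← wd_singleton,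
          ← wd_append, ← wd_append, pair_wd_left, smul_eq_mul]
        simp
      rw [Finset.sum_congr rfl hsum]
      split_ifs with hw
      · have hz : ∀ z ∈ fib (degW idx m + 2), co m (D.d₀ z) * co (p ++ z :: q) (D.d₀ x) =
            suspSign k (m.map idx) * suspSign k (p.map idx ++ (degW idx m + 2) :: q.map idx) *
            (pair k L (evalHom t (wd k m)) (c z) *
              pair k L (evalHom t (wd k p) * t z * evalHom t (wd k q)) (c x)) := by
          intro z hz
          rw [D.mem_fib] at hz
          have h1 : degW idx (p ++ z :: q) + 2 = idx x ∧
              wtW N idx (p ++ z :: q) = koszulDeg N (idx x) := by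
            have h3 := congrArg (degW idx) hlpmq
            have h4 := congrArg (wtW N idx) hlpmq
            simp only [degW_append, wtW_append, degW_cons, wtW_cons, hz] at h3 h4 ⊢
            omega
          rw [D.co_d₀, if_pos ⟨hz.symm, by rw [hz, hw]⟩, D.co_d₀, if_pos h1]
          rw [evalHom_wd_append, evalHom_wd_cons, List.map_append, List.map_cons, hz,
            mul_assoc (evalHom t (wd k p))]
          ring
        -- Summing over the intermediate letters `z` undoes the expansion in dual bases: the inner
        -- product is inserted in the outer one.
        rw [Finset.sum_congr rfl hz, ← Finset.mul_sum,
          D.sum_pair_mul (by omega) (evalHom_wd_mem_len D.t_mem p) (evalHom_wd_mem_len D.t_mem q)]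
        · have hst := suspSign_stasheff k (p.map idx) (m.map idx) (q.map idx) (degW idx m + 2) (by
            have : ∀ m : List Γ, degW idx m + m.length = (m.map idx).sum := by
              intro m
              induction m with
              | nil => simp
              | cons z m ih =>
                have := D.one_le z
                simp
                omega
            rw [List.length_map]
            have := this m
            omega)
          have hsgn : sgn (degSign k idx) p = sgn (fun d : ℕ => (-1 : k) ^ (d + 1)) (p.map idx) := by
            rw [sgn, sgn, List.map_map]
            rfl
          simp only [List.length_map, hplen, hmlen, hqlen] at hst
          rw [← map_mul, ← map_mul, ← wd_append, ← wd_append, ← hlpmq, ← mul_assoc, ← mul_assoc,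
            hsgn, hst, ← List.map_append, ← List.map_append, ← hlpmq]
          ring
        · have : wtW N idx p + koszulDeg N (degW idx m + 2) + wtW N idx q =
              koszulDeg N (idx x) := by
            rw [← hw, ← hl.2, hlpmq, wtW_append, wtW_append]
          rw [this]
          exact D.c_mem x
      · rw [mul_zero, Finset.sum_eq_zero, mul_zero]
        intro z hz
        rw [D.mem_fib] at hz
        rw [D.co_d₀, if_neg (fun h => hw (by rw [h.2, hz])), zero_mul]
    simp only [map_sum, LinearMap.sum_apply]
    rw [Finset.sum_congr rfl fun r hr => Finset.sum_congr rfl (hterm r hr)]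
    simp only [← Finset.mul_sum]
    have := stasheff_sign_sum k D.two_le (l.map idx) (by
      intro i hi
      obtain ⟨z, _, rfl⟩ := List.mem_map.1 hi
      exact D.one_le z) (by rw [wtW_map, degW_map, hl.1, hl.2])
    rw [List.length_map] at this ⊢
    rw [this, mul_zero]
  · have h0 : ∀ y ∈ supp k fun m => ¬ (degW idx m + 2 = idx x ∧ wtW N idx m = koszulDeg N (idx x)),
        pair k Γ y (D.d₀ x) = 0 := fun y hy =>
      pair_eq_zero_of_supp hy (D.isHomogeneous_d₀ x) fun _ h => h
    refine Finset.sum_eq_zero fun r hr => ?_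
    rw [map_sum, LinearMap.sum_apply]
    refine Finset.sum_eq_zero fun s hs => h0 _ ?_
    simp only [Finset.mem_range, Finset.mem_Icc] at hr hs
    refine Submodule.smul_mem _ _ ?_
    rw [transLetter, Finset.mul_sum, Finset.sum_mul]
    refine Submodule.sum_mem _ fun z hz => ?_
    rw [D.mem_fib] at hz
    by_cases hw : co ((l.drop r).take s) (D.d₀ z) = 0
    · rw [hw, zero_smul, mul_zero, zero_mul]
      exact zero_mem _
    · rw [mul_smul_comm, smul_mul_assoc, ← wd_singleton, ← wd_append, ← wd_append]
      refine Submodule.smul_mem _ _ (wd_mem_supp fun h => hl ?_)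
      have h1 : wtW N idx ((l.drop r).take s) = koszulDeg N (idx z) := by
        by_contra h1
        exact hw (D.isHomogeneous_d₀ z _ (fun h => h1 h.2))
      have h2 : l = l.take r ++ (l.drop r).take s ++ l.drop (r + s) := by
        rw [← List.drop_drop, List.append_assoc, List.take_append_drop, List.take_append_drop]
      have h3 := congrArg (degW idx) h2
      have h4 := congrArg (wtW N idx) h2
      simp only [degW_append, wtW_append, degW_cons, wtW_cons, degW_nil, wtW_nil] at h h3 h4
      omega

end DualLetters

end Letters

/-! ### Acyclicity of `d₀` in positive degrees -/

section Acyclicity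

variable {k : Type*} [Field k] {L : Type*}

/-- The two-sided ideal generated by a space of relations. -/
def relIdeal (R : Submodule k (FreeAlgebra k L)) : Submodule k (FreeAlgebra k L) :=
  Submodule.span k {x | ∃ u v : List L, ∃ r ∈ R, x = wd k u * r * wd k v}

theorem isIdeal_relIdeal (R : Submodule k (FreeAlgebra k L)) : IsIdeal (relIdeal R) := by
  constructor
  · intro a s hs
    refine Submodule.span_induction (p := fun s _ => a * s ∈ relIdeal R) ?_ (by simp)
      (fun x y _ _ hx hy => by rw [mul_add]; exact add_mem hx hy)
      (fun b x _ hx => by rw [mul_smul_comm]; exact Submodule.smul_mem _ _ hx) hs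
    rintro _ ⟨u, v, r, hr, rfl⟩
    rw [← sum_co a, Finset.sum_mul]
    refine Submodule.sum_mem _ fun l _ => ?_
    rw [smul_mul_assoc, ← mul_assoc, ← mul_assoc, ← wd_append]
    exact Submodule.smul_mem _ _ (Submodule.subset_span ⟨_, _, r, hr, rfl⟩)
  · intro a s hs
    refine Submodule.span_induction (p := fun s _ => s * a ∈ relIdeal R) ?_ (by simp)
      (fun x y _ _ hx hy => by rw [add_mul]; exact add_mem hx hy)
      (fun b x _ hx => by rw [smul_mul_assoc]; exact Submodule.smul_mem _ _ hx) hs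
    rintro _ ⟨u, v, r, hr, rfl⟩
    rw [← sum_co a, Finset.mul_sum]
    refine Submodule.sum_mem _ fun l _ => ?_
    rw [mul_smul_comm, mul_assoc, ← wd_append]
    exact Submodule.smul_mem _ _ (Submodule.subset_span ⟨_, _, r, hr, rfl⟩)

theorem subset_relIdeal {R : Submodule k (FreeAlgebra k L)} {r : FreeAlgebra k L} (hr : r ∈ R) :
    r ∈ relIdeal R :=
  Submodule.subset_span ⟨[], [], r, hr, by simp⟩

variable {Γ : Type*} {N : ℕ} {K : Submodule k (FreeAlgebra k L)} {idx : Γ → ℕ}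
  {c t : Γ → FreeAlgebra k L} {fib : ℕ → Finset Γ}

theorem forall_idx_eq_one {idx : Γ → ℕ} (hidx : ∀ x, 1 ≤ idx x) {l : List Γ}
    (h : degW idx l = 0) : l.map idx = List.replicate l.length 1 := by
  refine List.eq_replicate_iff.2 ⟨by simp, fun i hi => ?_⟩
  obtain ⟨x, hx, rfl⟩ := List.mem_map.1 hi
  have := idx_le_of_mem (idx := idx) hx
  have := hidx x
  omega

theorem wtW_replicate_one (N m : ℕ) : wtW N id (List.replicate m 1) = m := by
  simp [wtW, koszulDeg]

theorem degW_replicate_one (m : ℕ) : degW id (List.replicate m 1) = 0 := by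
  simp [degW]

/-- The quadratic complex of an `N`-Koszul algebra is exact in homological degrees `i ≥ 2`. -/
def IsKoszulExact (R : Submodule k (FreeAlgebra k L)) (c : Γ → FreeAlgebra k L)
    (fib : ℕ → Finset Γ) : Prop :=
  ∀ i, 2 ≤ i → ∀ y y' : Γ → FreeAlgebra k L, (∀ x, y' x ∈ relIdeal R) →
    ∑ x ∈ fib i, c x * y x = ∑ x ∈ fib (i - 1), c x * y' x →
      ∃ a b : Γ → FreeAlgebra k L, (∀ x, a x ∈ relIdeal R) ∧
        ∑ x ∈ fib i, c x * y x = ∑ x ∈ fib i, c x * a x + ∑ x ∈ fib (i + 1), c x * b x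

theorem slice_der {f : Γ → FreeAlgebra k Γ} (h0 : ∀ x, co [] (f x) = 0) (z x : Γ) (σ : Γ → k)
    (y : FreeAlgebra k Γ) : slice [z] [] (der σ f (FreeAlgebra.ι k x * y)) =
      slice [z] [] (f x) * y + σ x • slice [z] [] (FreeAlgebra.ι k x * der σ f y) := by
  rw [der_ι_mul, map_add, map_smul, slice_mul, h0, zero_smul, add_zero]

theorem mem_supp_of_slice {i : ℕ} {y : FreeAlgebra k Γ}
    (h : ∀ x, i < idx x → slice [x] [] y = 0) :
    y ∈ supp k fun l => ∀ x m, l = x :: m → idx x ≤ i := fun l hl => by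
  push Not at hl
  obtain ⟨x, m, rfl, hx⟩ := hl
  simpa using congrArg (co m) (h x hx)

namespace DualLetters

variable (D : DualLetters N K idx c t fib)

include D

theorem evalHom_mem_len' {w : ℕ} {y : FreeAlgebra k Γ}
    (hy : y ∈ supp k fun l => wtW N idx l = w) : evalHom c y ∈ len k L w :=
  evalHom_mem_len D.c_mem_len hy

/-- Every tensor is the image of words in the letters of index one. -/
theorem exists_evalHom_deg_zero (h1 : len k L 1 ≤ orthPart K 1) {m : ℕ} {y : FreeAlgebra k L}
    (hy : y ∈ len k L m) :
    ∃ z ∈ supp k fun l : List Γ => degW idx l = 0 ∧ wtW N idx l = m, evalHom c z = y := by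
  have : len k L m ≤ (supp k fun l : List Γ => degW idx l = 0 ∧ wtW N idx l = m).map
      (evalHom c).toLinearMap := by
    clear hy
    refine supp_le fun u hu => ?_
    induction u generalizing m with
    | nil =>
      subst hu
      exact ⟨1, wd_mem_supp (l := []) (by simp), by simp⟩
    | cons a u ih =>
      subst hu
      obtain ⟨z, hz, hz'⟩ := ih rfl
      obtain ⟨w, hw, hw'⟩ := D.exists_evalHom [1] (by simp) (y := wd k [a])
        (by rw [show wtW N id [1] = 1 from wtW_replicate_one N 1]; exact h1 (wd_mem_len [a]))
      refine ⟨w * z, supp_mul ?_ hw hz, ?_⟩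
      · intro l m hl hm
        rw [degW_append, wtW_append, hm.1, hm.2, ← degW_map, ← wtW_map, hl]
        simp [degW, wtW, koszulDeg, add_comm]
      · rw [AlgHom.toLinearMap_apply] at hz' ⊢
        rw [map_mul, hw', hz', ← wd_append]
        rfl
  obtain ⟨z, hz, hz'⟩ := this hy
  exact ⟨z, hz, hz'⟩

/-- In degree zero all letters have index one, so the weight fixes the shape of a word. Together
with `exists_evalHom_deg_zero` this identifies degree zero with the tensor algebra. -/
theorem eq_zero_of_evalHom_deg_zero {w : ℕ} {y : FreeAlgebra k Γ}
    (hy : y ∈ supp k fun l => degW idx l = 0 ∧ wtW N idx l = w) (h : evalHom c y = 0) : y = 0 := by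
  refine D.eq_zero_of_evalHom (s := List.replicate w 1) (supp_mono (fun l hl => ?_) hy) h
  have h1 := forall_idx_eq_one D.one_le hl.1
  rw [h1]
  congr 1
  rw [← hl.2, ← wtW_map, h1, wtW_replicate_one]

theorem eq_zero_of_evalHom_deg_zero' {y : FreeAlgebra k Γ}
    (hy : y ∈ supp k fun l => degW idx l = 0) (h : evalHom c y = 0) : y = 0 := by
  have hpart : ∀ w, part (fun l => wtW N idx l = w) y = 0 := by
    intro w
    refine D.eq_zero_of_evalHom_deg_zero (w := w) (supp_and (fun l hl => ?_) (part_mem _ _)) ?_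
    · by_cases hw : wtW N idx l = w
      · rw [co_part_of hw, hy l hl]
      · rw [co_part_of_not hw]
    · have key : evalHom c (part (fun l => wtW N idx l = w) y) =
          part (fun l => l.length = w) (evalHom c y) := by
        refine LinearMap.congr_fun
          (f := (evalHom c).toLinearMap ∘ₗ part (fun l => wtW N idx l = w))
          (g := part (fun l => l.length = w) ∘ₗ (evalHom c).toLinearMap) (lin_ext fun l => ?_) y
        simp only [LinearMap.comp_apply, AlgHom.toLinearMap_apply]
        by_cases hw : wtW N idx l = w
        · rw [part_wd_of hw, part_of_mem (hw ▸ evalHom_wd_mem_len D.c_mem_len l)]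
        · rw [part_wd_of_not hw, part_of_disjoint (evalHom_wd_mem_len D.c_mem_len l)
            (fun m hm h => hw (hm ▸ h)), map_zero]
      rw [key, h, map_zero]
  refine ext_co fun l => ?_
  rw [map_zero, ← co_part_of (p := fun m => wtW N idx m = wtW N idx l) rfl, hpart, map_zero]

/-- The image of the elements of degree one under a filtered derivation. -/
theorem evalHom_der_mem {f : Γ → FreeAlgebra k Γ}
    (hf : ∀ x, f x ∈ supp k fun l => degW idx l + 2 = idx x)
    {P : Submodule k (FreeAlgebra k L)} (hP : ∀ x, idx x = 2 → evalHom c (f x) ∈ P)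
    {y : FreeAlgebra k Γ} (hy : y ∈ supp k fun l => degW idx l = 1) :
    evalHom c (der (degSign k idx) f y) ∈ relIdeal P := by
  refine supp_map_mem ((evalHom c).toLinearMap ∘ₗ der (degSign k idx) f) _ (fun l => ?_) hy
  simp only [LinearMap.comp_apply, AlgHom.toLinearMap_apply]
  induction l with
  | nil => simp
  | cons x l ih =>
    intro hl
    have hx := D.one_le x
    rw [wd_cons, der_ι_mul]
    rw [degW_cons] at hl
    -- A word of degree one contains one letter of index two, whose value generates the ideal; the
    -- derivation annihilates the others, which have index one.
    by_cases hx2 : idx x = 2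
    · rw [der_eq_zero_of_deg_zero (y := wd k l) D.one_le hf (wd_mem_supp (by omega)), mul_zero,
        smul_zero, add_zero, map_mul]
      exact (isIdeal_relIdeal P).mul_right _ _ (subset_relIdeal (hP x hx2))
    · have hfx : f x = 0 := ext_co fun m => by
        rw [map_zero]
        exact hf x m (by omega)
      rw [hfx, zero_mul, zero_add, map_smul, map_mul]
      exact Submodule.smul_mem _ _ ((isIdeal_relIdeal P).mul_left _ _ (ih (by omega)))

/-- Degree zero and weight `N` leave only words of `N` letters of index one. Their coefficients in
`d₀ x` are those of the expansion of `c x` in dual bases, up to the sign attached to this one shape.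
-/
theorem evalHom_d₀ (x : Γ) (hx : idx x = 2) :
    evalHom c (D.d₀ x) = suspSign k (List.replicate N 1) • c x := by
  have hN : koszulDeg N 2 = N := by simp [koszulDeg]
  obtain ⟨z, hz, hz'⟩ := D.exists_evalHom (List.replicate N 1) (by simp) (y := c x)
    (by rw [wtW_replicate_one]; have := D.c_mem x; rwa [hx, hN] at this)
  have : D.d₀ x = suspSign k (List.replicate N 1) • z := ext_co fun l => by
    rw [D.co_d₀, map_smul]
    by_cases hl : degW idx l + 2 = idx x ∧ wtW N idx l = koszulDeg N (idx x)
    · have h1 := forall_idx_eq_one D.one_le (l := l) (by omega)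
      have h2 : l.length = N := by
        rw [hx, hN] at hl
        rw [← hl.2, ← wtW_map, h1, wtW_replicate_one]
      rw [h2] at h1
      rw [if_pos hl, h1, ← hz', ← D.co_eq_pair (by rw [h1]; exact hz)]
      rfl
    · rw [if_neg hl, hz l, smul_zero]
      intro h
      refine hl ⟨?_, ?_⟩
      · rw [← degW_map, h, degW_replicate_one, hx]
      · rw [← wtW_map, h, wtW_replicate_one, hx, hN]
  rw [this, map_smul, hz']

/-- If `p` is the image of the boundary of `z`, then `u * p * v` is that of `u' * z * v'`, with
lifts `u'`, `v'` of degree zero: these are even and closed, so the derivation acts on `z` alone and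
without sign. -/
theorem exists_evalHom_der (h1 : len k L 1 ≤ orthPart K 1) {f : Γ → FreeAlgebra k Γ}
    (hf : ∀ x, f x ∈ supp k fun l => degW idx l + 2 = idx x)
    {P : Submodule k (FreeAlgebra k L)}
    (hP : ∀ p ∈ P, ∃ z ∈ supp k fun l => degW idx l = 1, evalHom c (der (degSign k idx) f z) = p)
    {a : FreeAlgebra k L} (ha : a ∈ relIdeal P) :
    ∃ z ∈ supp k fun l => degW idx l = 1, evalHom c (der (degSign k idx) f z) = a := by
  have : relIdeal P ≤ (supp k fun l => degW idx l = 1).map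
      ((evalHom c).toLinearMap ∘ₗ der (degSign k idx) f) := by
    refine Submodule.span_le.2 ?_
    rintro _ ⟨u, v, r, hr, rfl⟩
    obtain ⟨z, hz, rfl⟩ := hP r hr
    obtain ⟨u', hu, hu'⟩ := D.exists_evalHom_deg_zero h1 (wd_mem_len (k := k) u)
    obtain ⟨v', hv, hv'⟩ := D.exists_evalHom_deg_zero h1 (wd_mem_len (k := k) v)
    have hu0 := supp_mono (fun l hl => hl.1) hu
    have hv0 := supp_mono (fun l hl => hl.1) hv
    refine ⟨u' * z * v', supp_mul (p := fun l => degW idx l = 1) (fun l m h h' => ?_)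
      (supp_mul (fun l m h h' => ?_) hu0 hz) hv0, ?_⟩
    · rw [degW_append, h, h']
    · rw [degW_append, h, h']
    · rw [LinearMap.comp_apply, AlgHom.toLinearMap_apply,
        der_mul _ _ (c := -1) (a := u' * z), der_mul _ _ (c := 1) (a := u'),
        der_eq_zero_of_deg_zero D.one_le hf hu0, der_eq_zero_of_deg_zero D.one_le hf hv0]
      · simp [hu', hv']
      · refine supp_mono (fun l hl => ?_) hu0
        rw [sgn_degSign D.one_le, hl, pow_zero]
      · refine supp_mul (fun l m h h' => ?_) hu0 hz
        rw [sgn_append, sgn_degSign D.one_le, sgn_degSign D.one_le, h, h']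
        simp
  obtain ⟨z, hz, hz'⟩ := this ha
  exact ⟨z, hz, hz'⟩

/-- The part of weight `w` of an element of the ideal generated by the relations. -/
theorem exists_evalHom_der_part (h1 : len k L 1 ≤ orthPart K 1)
    {a : FreeAlgebra k L} (ha : a ∈ relIdeal (orthPart K N)) (w : ℕ) :
    ∃ z ∈ supp k fun l => degW idx l = 1 ∧ wtW N idx l = w,
      evalHom c (der (degSign k idx) D.d₀ z) = part (fun l => l.length = w) a := by
  have hN : koszulDeg N 2 = N := by simp [koszulDeg]
  obtain ⟨z, hz, hz'⟩ := D.exists_evalHom_der h1 D.isFiltered_d₀.deg (P := orthPart K N) (by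
    intro p hp
    rw [← hN] at hp
    refine ⟨∑ x ∈ fib 2, (pair k L (t x) p * suspSign k (List.replicate N 1)) •
      FreeAlgebra.ι k x, Submodule.sum_mem _ fun x hx => Submodule.smul_mem _ _ ?_, ?_⟩
    · rw [← wd_singleton]
      exact wd_mem_supp (by simp [(D.mem_fib _ _).1 hx])
    · conv_rhs => rw [D.expand 2 (by simp) p hp]
      rw [map_sum, map_sum]
      refine Finset.sum_congr rfl fun x hx => ?_
      rw [map_smul, map_smul, der_ι, D.evalHom_d₀ x ((D.mem_fib _ _).1 hx), smul_smul, mul_assoc,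
        suspSign_mul_self, mul_one]) ha
  refine ⟨part (fun l => wtW N idx l = w) z, supp_and (fun l hl => ?_) (part_mem _ _), ?_⟩
  · by_cases h : wtW N idx l = w
    · rw [co_part_of h, hz l hl]
    · rw [co_part_of_not h]
  · rw [← hz']
    have hwd : ∀ l : List Γ, evalHom c (der (degSign k idx) D.d₀ (wd k l)) ∈
        len k L (wtW N idx l) := fun l => by
      refine D.evalHom_mem_len' (der_mem_supp _ _ (wd_mem_supp (p := fun m => m = l) rfl) ?_)
      intro u x v h
      refine supp_mono (fun m hm => ?_) (D.isHomogeneous_d₀ x)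
      rw [← h]
      simp [hm.2]
    refine LinearMap.congr_fun
      (f := (evalHom c).toLinearMap ∘ₗ der (degSign k idx) D.d₀ ∘ₗ part (fun l => wtW N idx l = w))
      (g := part (fun l => l.length = w) ∘ₗ (evalHom c).toLinearMap ∘ₗ der (degSign k idx) D.d₀)
      (lin_ext fun l => ?_) z
    simp only [LinearMap.comp_apply, AlgHom.toLinearMap_apply]
    by_cases h : wtW N idx l = w
    · rw [part_wd_of h, part_of_mem (h ▸ hwd l)]
    · rw [part_wd_of_not h, part_of_disjoint (hwd l) (fun m hm h' => h (hm ▸ h'))]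
      simp

theorem slice_d₀_of_le {x z : Γ} (h : idx x ≤ idx z) : slice [z] [] (D.d₀ x) = 0 :=
  ext_co fun l => by
    rw [co_slice, map_zero]
    refine D.isHomogeneous_d₀ x _ fun hl => ?_
    have := D.one_le z
    simp at hl
    omega

/-- Letters in `d₀ x` have smaller index than `x`. Replacing the first letter of a word of `y`
therefore never creates a first letter of index `i` or more, and only the differential of the
remainder contributes. -/
theorem slice_der_d₀ {i : ℕ} {y : FreeAlgebra k Γ} (hy : ∀ x, i < idx x → slice [x] [] y = 0)
    {z : Γ} (hz : i ≤ idx z) : slice [z] [] (der (degSign k idx) D.d₀ y) =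
      degSign k idx z • der (degSign k idx) D.d₀ (slice [z] [] y) := by
  refine supp_ext (f := slice [z] [] ∘ₗ der (degSign k idx) D.d₀)
    (g := degSign k idx z • (der (degSign k idx) D.d₀ ∘ₗ slice [z] []))
    (fun l hl => ?_) (mem_supp_of_slice hy)
  simp only [LinearMap.comp_apply, LinearMap.smul_apply]
  cases l with
  | nil =>
    have : slice [z] [] (wd k ([] : List Γ)) = 0 := ext_co fun m => by
      rw [co_slice, co_wd_ne (by simp), map_zero]
    rw [this, wd_nil]
    simp
  | cons x l =>
    have hx := hl x l rfl
    rw [wd_cons, slice_der D.isFiltered_d₀.co_nil, D.slice_d₀_of_le (hx.trans hz), zero_mul,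
      zero_add]
    by_cases h : z = x
    · subst h
      rw [slice_ι_mul_self, slice_ι_mul_self]
    · rw [slice_ι_mul_ne h, slice_ι_mul_ne h]
      simp

/-- One index below the maximum there is a second source of first letters `z`: a first letter of
index `i + 1` may be replaced by a word that begins with `z`. -/
theorem slice_der_d₀_pred {i : ℕ} {y : FreeAlgebra k Γ}
    (hy : ∀ x, i + 1 < idx x → slice [x] [] y = 0)
    {z : Γ} (hz : idx z = i) : slice [z] [] (der (degSign k idx) D.d₀ y) =
      degSign k idx z • der (degSign k idx) D.d₀ (slice [z] [] y) +
        ∑ x ∈ fib (i + 1), slice [z] [] (D.d₀ x) * slice [x] [] y := by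
  refine (supp_ext (f := slice [z] [] ∘ₗ der (degSign k idx) D.d₀)
    (g := degSign k idx z • (der (degSign k idx) D.d₀ ∘ₗ slice [z] []) +
      ∑ x ∈ fib (i + 1), LinearMap.mulLeft k (slice [z] [] (D.d₀ x)) ∘ₗ slice [x] [])
    (fun l hl => ?_) (mem_supp_of_slice hy)).trans ?_
  · simp only [LinearMap.comp_apply, LinearMap.smul_apply, LinearMap.add_apply,
      LinearMap.sum_apply, LinearMap.mulLeft_apply]
    cases l with
    | nil =>
      have : ∀ z : Γ, slice [z] [] (wd k ([] : List Γ)) = 0 := fun z => ext_co fun m => by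
        rw [co_slice, co_wd_ne (by simp), map_zero]
      rw [Finset.sum_eq_zero fun x _ => by rw [this, mul_zero], this, wd_nil]
      simp
    | cons x l =>
      have hx := hl x l rfl
      rw [wd_cons, slice_der D.isFiltered_d₀.co_nil, add_comm]
      congr 1
      · by_cases h : z = x
        · subst h
          rw [slice_ι_mul_self, slice_ι_mul_self]
        · rw [slice_ι_mul_ne h, slice_ι_mul_ne h]
          simp
      · by_cases hxi : idx x = i + 1
        · rw [Finset.sum_eq_single_of_mem x ((D.mem_fib _ _).2 hxi), slice_ι_mul_self]
          intro x' _ hne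
          rw [slice_ι_mul_ne hne, mul_zero]
        · rw [D.slice_d₀_of_le (by omega), zero_mul, Finset.sum_eq_zero]
          intro x' hx'
          rw [slice_ι_mul_ne, mul_zero]
          rintro rfl
          exact hxi ((D.mem_fib _ _).1 hx')
  · simp only [LinearMap.comp_apply, LinearMap.smul_apply, LinearMap.add_apply,
      LinearMap.sum_apply, LinearMap.mulLeft_apply]

/-- The part of `d₀ x` in which the first letter has the largest possible index is the inclusion
of `orthPart K (n(i + 1))` in `orthPart K (n(i)) ⊗ V^{⊗ m}`. -/
theorem sum_evalHom_slice_d₀ {i : ℕ} (hi : 1 ≤ i) :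
    ∃ ε : k, ε * ε = 1 ∧ ∀ x, idx x = i + 1 →
      ∑ z ∈ fib i, c z * evalHom c (slice [z] [] (D.d₀ x)) = ε • c x := by
  set m := koszulDeg N (i + 1) - koszulDeg N i with hm
  have hlt := koszulDeg_lt_succ D.two_le i
  -- A word of `d₀ x` whose first letter has index `i` has a remainder of degree zero, thus `m`
  -- letters of index one. All these words share one shape and hence one sign `ε`.
  set s := i :: List.replicate m 1 with hs
  have hws : wtW N id s = koszulDeg N (i + 1) := by
    rw [hs, wtW_cons, wtW_replicate_one]
    simp
    omega
  have hds : degW id s + 2 = i + 1 := by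
    rw [hs, degW_cons, degW_replicate_one]
    simp
    omega
  refine ⟨suspSign k s, suspSign_mul_self k s, fun x hx => ?_⟩
  obtain ⟨y, hy, hy'⟩ := D.exists_evalHom s (by
    intro j hj
    rw [hs, List.mem_cons, List.mem_replicate] at hj
    omega) (y := c x) (by rw [hws, ← hx]; exact D.c_mem x)
  have key : ∑ z ∈ fib i, FreeAlgebra.ι k z * slice [z] [] (D.d₀ x) = suspSign k s • y := by
    refine ext_co fun l => ?_
    rw [map_smul, map_sum]
    have hsl : ∀ z l, co (z :: l) (FreeAlgebra.ι k z * slice [z] [] (D.d₀ x)) =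
        co (z :: l) (D.d₀ x) := fun z l => by
      have := congrArg (co l) (slice_ι_mul_self z (slice [z] [] (D.d₀ x)))
      simpa using this
    have hsl' : ∀ z z' l, z' ≠ z → co (z' :: l) (FreeAlgebra.ι k z * slice [z] [] (D.d₀ x)) = 0 :=
      fun z z' l h => by
      have := congrArg (co l) (slice_ι_mul_ne h (slice [z] [] (D.d₀ x)))
      simpa using this
    by_cases hl : l.map idx = s
    · cases l with
      | nil => simp [hs] at hl
      | cons z l =>
        have hz : idx z = i := by
          rw [hs] at hl
          simp at hl
          exact hl.1
        rw [Finset.sum_eq_single_of_mem z ((D.mem_fib _ _).2 hz), hsl, D.co_d₀, if_pos, hl, ← hy',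
          ← D.co_eq_pair (by rw [hl]; exact hy)]
        · rfl
        · rw [← degW_map, ← wtW_map, hl, hx]
          exact ⟨hds, hws⟩
        · intro z' _ hne
          exact hsl' z' z l hne.symm
    · rw [hy l hl, smul_zero]
      refine Finset.sum_eq_zero fun z hz => ?_
      rw [D.mem_fib] at hz
      cases l with
      | nil =>
        rw [co_nil_mul, ← wd_singleton, co_wd_ne (by simp), zero_mul]
      | cons z' l =>
        by_cases hne : z' = z
        · subst hne
          rw [hsl]
          refine D.isHomogeneous_d₀ x _ fun h => hl ?_
          beta_reduce at h
          rw [degW_cons, wtW_cons, hz, hx] at h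
          have h1 := forall_idx_eq_one D.one_le (l := l) (by omega)
          have h2 : wtW N idx l = m := by omega
          rw [← wtW_map, h1, wtW_replicate_one] at h2
          rw [List.map_cons, hz, h1, h2]
        · exact hsl' z z' l hne
  have := congrArg (evalHom c) key
  rw [map_sum, map_smul, hy'] at this
  rw [← this]
  exact Finset.sum_congr rfl fun z _ => by rw [map_mul, evalHom_ι]

theorem sum_ι_mul_mem {j w i : ℕ} {z : Γ → FreeAlgebra k Γ}
    (hz : ∀ x ∈ fib i, z x ∈ supp k fun l => degW idx l + (i - 1) = j ∧
      wtW N idx l + koszulDeg N i = w) :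
    ∑ x ∈ fib i, FreeAlgebra.ι k x * z x ∈ supp k fun l => degW idx l = j ∧ wtW N idx l = w := by
  refine Submodule.sum_mem _ fun x hx => ?_
  rw [← wd_singleton]
  refine supp_mul (p := fun l => l = [x]) ?_ (wd_mem_supp rfl) (hz x hx)
  rw [D.mem_fib] at hx
  rintro _ l rfl h
  simp [hx]
  omega

theorem slice_sum_ι_mul {i : ℕ} (z : Γ → FreeAlgebra k Γ) (x : Γ) (hx : idx x = i) :
    slice [x] [] (∑ x ∈ fib i, FreeAlgebra.ι k x * z x) = z x := by
  rw [map_sum, Finset.sum_eq_single_of_mem x ((D.mem_fib _ _).2 hx), slice_ι_mul_self]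
  intro x' _ hne
  exact slice_ι_mul_ne hne.symm _

theorem slice_sum_ι_mul_ne {i : ℕ} (z : Γ → FreeAlgebra k Γ) (x : Γ) (hx : idx x ≠ i) :
    slice [x] [] (∑ x ∈ fib i, FreeAlgebra.ι k x * z x) = 0 := by
  rw [map_sum]
  refine Finset.sum_eq_zero fun x' hx' => slice_ι_mul_ne ?_ _
  rintro rfl
  exact hx ((D.mem_fib _ _).1 hx')

omit D in
theorem slice_mem_supp {j w : ℕ} {y : FreeAlgebra k Γ}
    (hy : y ∈ supp k fun l => degW idx l = j ∧ wtW N idx l = w) (x : Γ) :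
    slice [x] [] y ∈ supp k fun l => degW idx l + (idx x - 1) = j ∧
      wtW N idx l + koszulDeg N (idx x) = w := fun l hl => by
  rw [co_slice]
  refine hy _ fun h => hl ?_
  simp at h
  omega

/-- The cycles in which no first letter has the largest possible index are boundaries, if this
holds in smaller weights. -/
theorem exists_der_eq_of_slice {w : ℕ}
    (ih : ∀ w' < w, ∀ j, 1 ≤ j → ∀ y ∈ supp k fun l => degW idx l = j ∧ wtW N idx l = w',
      der (degSign k idx) D.d₀ y = 0 →
      ∃ z ∈ supp k fun l => degW idx l = j + 1 ∧ wtW N idx l = w',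
        der (degSign k idx) D.d₀ z = y) {j : ℕ} (i : ℕ) (hij : i ≤ j) {y : FreeAlgebra k Γ}
    (hy : y ∈ supp k fun l => degW idx l = j ∧ wtW N idx l = w) (hj : 1 ≤ j)
    (hyi : ∀ x, i < idx x → slice [x] [] y = 0) (hy0 : der (degSign k idx) D.d₀ y = 0) :
    ∃ z ∈ supp k fun l => degW idx l = j + 1 ∧ wtW N idx l = w,
      der (degSign k idx) D.d₀ z = y := by
  induction i generalizing y with
  | zero =>
    refine ⟨0, zero_mem _, ?_⟩
    rw [map_zero, eq_comm]
    exact eq_zero_of_slice (hy [] (by simp; omega)) fun x => hyi x (D.one_le x)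
  | succ i ihi =>
    -- A slice at a letter of the top index is a cycle of smaller weight, of degree `j - i`. This is
    -- positive by `hij`, so `ih` applies.
    have hz : ∀ x ∈ fib (i + 1), ∃ z ∈ supp k fun l => degW idx l + i = j + 1 ∧
        wtW N idx l + koszulDeg N (i + 1) = w, der (degSign k idx) D.d₀ z = slice [x] [] y := by
      intro x hx
      rw [D.mem_fib] at hx
      have h1 := slice_mem_supp hy x
      have h2 : der (degSign k idx) D.d₀ (slice [x] [] y) = 0 := by
        have := D.slice_der_d₀ hyi (z := x) hx.ge
        rw [hy0, map_zero] at this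
        have h3 := congrArg (fun a => degSign k idx x • a) this
        simpa [smul_smul, degSign_mul_self] using h3.symm
      rw [hx] at h1
      by_cases hw : koszulDeg N (i + 1) ≤ w
      · have h4 := le_koszulDeg D.two_le (i + 1)
        obtain ⟨z, hz, hz'⟩ := ih (w - koszulDeg N (i + 1)) (by omega) (j - i) (by omega)
          (slice [x] [] y) (supp_mono (fun l hl => by omega) h1) h2
        exact ⟨z, supp_mono (fun l hl => by omega) hz, hz'⟩
      · refine ⟨0, zero_mem _, ?_⟩
        rw [map_zero]
        exact (ext_co fun l => by rw [map_zero]; exact h1 l (by omega)).symm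
    choose! z hz hz' using hz
    -- The letter `x` followed by the primitive of its slice has a boundary with the prescribed top
    -- slices; subtracting it lowers the largest first index. The sign undoes the one from moving
    -- the differential past `x`.
    set u := ∑ x ∈ fib (i + 1), FreeAlgebra.ι k x * (degSign k idx x • z x) with hu
    have hmem : u ∈ supp k fun l => degW idx l = j + 1 ∧ wtW N idx l = w :=
      D.sum_ι_mul_mem fun x hx => Submodule.smul_mem _ _
        (supp_mono (fun l hl => by omega) (hz x hx))
    have hui : ∀ x, i + 1 < idx x → slice [x] [] u = 0 := fun x hx =>
      D.slice_sum_ι_mul_ne _ x (by omega)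
    obtain ⟨v, hv, hv'⟩ := ihi (by omega) (y := y - der (degSign k idx) D.d₀ u)
      (sub_mem hy (der_mem_of_homogeneous D.one_le D.isHomogeneous_d₀ hmem))
      (by
        intro x hx
        rw [map_sub]
        by_cases hxi : idx x = i + 1
        · rw [D.slice_der_d₀ hui hxi.ge, D.slice_sum_ι_mul _ x hxi, map_smul, smul_smul,
            degSign_mul_self, one_smul, hz' x ((D.mem_fib _ _).2 hxi), sub_self]
        · rw [hyi x (by omega), D.slice_der_d₀ hui (by omega), hui x (by omega)]
          simp)
      (by
        rw [map_sub, hy0, D.isFiltered_d₀.der_der D.one_le (i := j + 2) (fun x _ => D.der_d₀ x)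
          (supp_mono (fun l hl => by omega) hmem), sub_self])
    exact ⟨u + v, add_mem hmem hv, by rw [map_add, hv', add_sub_cancel]⟩

theorem part_sum_mul {i n : ℕ} (y : Γ → FreeAlgebra k L) :
    part (fun l => l.length = n + koszulDeg N i) (∑ x ∈ fib i, c x * y x) =
      ∑ x ∈ fib i, c x * part (fun l => l.length = n) (y x) := by
  rw [map_sum]
  refine Finset.sum_congr rfl fun x hx => ?_
  rw [D.mem_fib] at hx
  refine part_mul_left (hx ▸ D.c_mem_len x) fun l m hl => ?_
  simp
  omega

theorem part_sum_mul_of_lt {i n : ℕ} (hn : n < koszulDeg N i) (y : Γ → FreeAlgebra k L) :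
    part (fun l => l.length = n) (∑ x ∈ fib i, c x * y x) = 0 := by
  rw [map_sum]
  refine Finset.sum_eq_zero fun x hx => ?_
  rw [D.mem_fib] at hx
  refine part_of_disjoint (supp_mul (p := fun l => l.length = koszulDeg N i) (q := fun _ => True)
    (r := fun l => koszulDeg N i ≤ l.length) ?_ (hx ▸ D.c_mem_len x) ?_) ?_
  · intro l m hl _
    simp
    omega
  · exact fun l hl => absurd trivial hl
  · intro l hl
    omega

/-- The differential that is dual to the products of `A^!` is acyclic in positive degrees. -/
theorem isAcyclic (h1 : len k L 1 ≤ orthPart K 1) (hex : IsKoszulExact (orthPart K N) c fib) :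
    IsAcyclic N idx D.d₀ := by
  suffices H : ∀ w j, 1 ≤ j → ∀ y ∈ supp k fun l => degW idx l = j ∧ wtW N idx l = w,
      der (degSign k idx) D.d₀ y = 0 →
        ∃ z ∈ supp k fun l => degW idx l = j + 1 ∧ wtW N idx l = w,
          der (degSign k idx) D.d₀ z = y from fun j hj w => H w j hj
  intro w
  induction w using Nat.strong_induction_on with
  | _ w ih =>
    intro j hj y hy hy0
    have hyj : ∀ x, j + 1 < idx x → slice [x] [] y = 0 := fun x hx => ext_co fun l => by
      rw [map_zero]
      exact slice_mem_supp hy x l (by omega)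
    obtain ⟨ε, hε, hεc⟩ := D.sum_evalHom_slice_d₀ hj
    have hpred : ∀ z ∈ fib j, ∑ x ∈ fib (j + 1), slice [z] [] (D.d₀ x) * slice [x] [] y =
        -(degSign k idx z • der (degSign k idx) D.d₀ (slice [z] [] y)) := by
      intro z hz
      have := D.slice_der_d₀_pred hyj ((D.mem_fib _ _).1 hz)
      rw [hy0, map_zero] at this
      rw [eq_neg_iff_add_eq_zero, add_comm]
      exact this.symm
    classical
    have hR : ∀ x, idx x = 2 → evalHom c (D.d₀ x) ∈ orthPart K N := fun x hx => by
      rw [D.evalHom_d₀ x hx]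
      have := D.c_mem x
      rw [hx, show koszulDeg N 2 = N by simp [koszulDeg]] at this
      exact Submodule.smul_mem _ _ this
    -- First letters of index `j + 1` leave remainders of degree zero, that is, tensors. The cycle
    -- condition at first letters of index `j` rewrites this leading part over the `c z`, with
    -- coefficients that are images of boundaries of degree one, hence in the ideal of relations.
    have heq : ∑ x ∈ fib (j + 1), c x * evalHom c (slice [x] [] y) =
        ∑ z ∈ fib j, c z * (if z ∈ fib j then -((ε * degSign k idx z) •
          evalHom c (der (degSign k idx) D.d₀ (slice [z] [] y))) else 0) := by
      have h2 : ∀ x ∈ fib (j + 1), c x * evalHom c (slice [x] [] y) =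
          ∑ z ∈ fib j, ε • (c z * (evalHom c (slice [z] [] (D.d₀ x) * slice [x] [] y))) := by
        intro x hx
        have := hεc x ((D.mem_fib _ _).1 hx)
        rw [← one_smul k (c x), ← hε, mul_smul, ← this, Finset.smul_sum, Finset.sum_mul]
        exact Finset.sum_congr rfl fun z _ => by rw [map_mul, smul_mul_assoc, mul_assoc]
      rw [Finset.sum_congr rfl h2, Finset.sum_comm]
      refine Finset.sum_congr rfl fun z hz => ?_
      rw [if_pos hz, ← Finset.smul_sum, ← Finset.mul_sum, ← map_sum, hpred z hz, map_neg, map_smul,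
        mul_smul, mul_neg, mul_neg, mul_smul_comm, mul_smul_comm, smul_neg, mul_smul_comm]
    -- Exactness splits the leading part into a piece with coefficients in the ideal and a piece
    -- coming from index `j + 2`. Both are leading parts of boundaries: of `u`, where a letter of
    -- index `j + 1` precedes an element of degree one, and of `v`, where a letter of index `j + 2`
    -- precedes a tensor.
    obtain ⟨a, b, ha, hab⟩ := hex (j + 1) (by omega) _ _ (by
      intro z
      split_ifs with hz
      · refine neg_mem (Submodule.smul_mem _ _ (D.evalHom_der_mem D.isFiltered_d₀.deg hR ?_))
        refine supp_mono (fun l hl => ?_) (slice_mem_supp hy z)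
        have := (D.mem_fib _ _).1 hz
        omega
      · exact zero_mem _) heq
    by_cases hw : koszulDeg N (j + 1) ≤ w
    swap
    · refine D.exists_der_eq_of_slice ih j le_rfl hy hj (fun x hx => ?_) hy0
      refine ext_co fun l => ?_
      rw [map_zero]
      refine slice_mem_supp hy x l fun h => ?_
      by_cases hxj : idx x = j + 1
      · rw [hxj] at h
        omega
      · omega
    obtain ⟨m, rfl⟩ := Nat.exists_eq_add_of_le' hw
    have hab' := congrArg (part fun l => l.length = m + koszulDeg N (j + 1)) hab
    rw [map_add, D.part_sum_mul, D.part_sum_mul] at hab'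
    have hyx : ∀ x ∈ fib (j + 1), part (fun l => l.length = m) (evalHom c (slice [x] [] y)) =
        evalHom c (slice [x] [] y) := fun x hx => by
      refine part_of_mem (D.evalHom_mem_len' (supp_mono (fun l hl => ?_) (slice_mem_supp hy x)))
      rw [(D.mem_fib _ _).1 hx] at hl
      omega
    have hq : ∀ x, ∃ q ∈ supp k fun l => degW idx l = 1 ∧ wtW N idx l = m,
        evalHom c (der (degSign k idx) D.d₀ q) = part (fun l => l.length = m) (a x) :=
      fun x => D.exists_evalHom_der_part h1 (ha x) m
    choose q hqm hq using hq
    -- the part in which the first letter has index `j + 2`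
    obtain ⟨g, hg, hg'⟩ : ∃ g : Γ → FreeAlgebra k Γ,
        (∀ x ∈ fib (j + 2), g x ∈ supp k fun l => degW idx l + (j + 2 - 1) = j + 1 ∧
          wtW N idx l + koszulDeg N (j + 2) = m + koszulDeg N (j + 1)) ∧
        part (fun l => l.length = m + koszulDeg N (j + 1)) (∑ x ∈ fib (j + 2), c x * b x) =
          ∑ x ∈ fib (j + 2), c x * evalHom c (g x) := by
      by_cases hw2 : koszulDeg N (j + 2) ≤ m + koszulDeg N (j + 1)
      · obtain ⟨n, hn⟩ := Nat.exists_eq_add_of_le' hw2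
        have : ∀ x, ∃ g ∈ supp k fun l : List Γ => degW idx l = 0 ∧ wtW N idx l = n,
            evalHom c g = part (fun l => l.length = n) (b x) := fun x =>
          D.exists_evalHom_deg_zero h1 (part_mem _ _)
        choose g hg hg' using this
        refine ⟨g, fun x _ => supp_mono (fun l hl => by omega) (hg x), ?_⟩
        rw [hn, D.part_sum_mul]
        exact Finset.sum_congr rfl fun x _ => by rw [hg']
      · refine ⟨0, fun _ _ => zero_mem _, ?_⟩
        rw [D.part_sum_mul_of_lt (by omega)]
        simp
    rw [Finset.sum_congr rfl fun x hx => by rw [hyx x hx], hg'] at hab'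
    obtain ⟨ε', hε', hεc'⟩ := D.sum_evalHom_slice_d₀ (i := j + 1) (by omega)
    set u := ∑ x ∈ fib (j + 1), FreeAlgebra.ι k x * (degSign k idx x • q x) with hu
    set v := ∑ x ∈ fib (j + 2), FreeAlgebra.ι k x * (ε' • g x) with hv
    have hum : u ∈ supp k fun l => degW idx l = j + 1 ∧ wtW N idx l = m + koszulDeg N (j + 1) :=
      D.sum_ι_mul_mem fun x hx => Submodule.smul_mem _ _
        (supp_mono (fun l hl => by omega) (hqm x))
    have hvm : v ∈ supp k fun l => degW idx l = j + 1 ∧ wtW N idx l = m + koszulDeg N (j + 1) :=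
      D.sum_ι_mul_mem fun x hx => Submodule.smul_mem _ _ (hg x hx)
    have hui : ∀ x, j + 1 < idx x → slice [x] [] u = 0 := fun x hx =>
      D.slice_sum_ι_mul_ne _ x (by omega)
    have hvi : ∀ x, j + 1 + 1 < idx x → slice [x] [] v = 0 := fun x hx =>
      D.slice_sum_ι_mul_ne _ x (by omega)
    have hsu : ∀ x ∈ fib (j + 1), slice [x] [] (der (degSign k idx) D.d₀ u) =
        der (degSign k idx) D.d₀ (q x) := fun x hx => by
      rw [D.mem_fib] at hx
      rw [D.slice_der_d₀ hui hx.ge, D.slice_sum_ι_mul _ x hx, map_smul, smul_smul,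
        degSign_mul_self, one_smul]
    have hsv : ∀ x ∈ fib (j + 1), slice [x] [] (der (degSign k idx) D.d₀ v) =
        ∑ z ∈ fib (j + 2), slice [x] [] (D.d₀ z) * (ε' • g z) := fun x hx => by
      rw [D.mem_fib] at hx
      rw [D.slice_der_d₀_pred hvi hx, D.slice_sum_ι_mul_ne _ x (by omega)]
      rw [map_zero, smul_zero, zero_add]
      exact Finset.sum_congr rfl fun z hz => by
        rw [D.slice_sum_ι_mul _ z ((D.mem_fib _ _).1 hz)]
    have hsum : ∑ x ∈ fib (j + 1), c x * evalHom c
        (slice [x] [] (y - der (degSign k idx) D.d₀ u - der (degSign k idx) D.d₀ v)) = 0 := by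
      have hv2 : ∑ x ∈ fib (j + 1), c x * evalHom c (slice [x] [] (der (degSign k idx) D.d₀ v)) =
          ∑ z ∈ fib (j + 2), c z * evalHom c (g z) := by
        rw [Finset.sum_congr rfl fun x hx => by rw [hsv x hx, map_sum, Finset.mul_sum],
          Finset.sum_comm]
        refine Finset.sum_congr rfl fun z hz => ?_
        have h5 : ∀ x ∈ fib (j + 1), c x * evalHom c (slice [x] [] (D.d₀ z) * (ε' • g z)) =
            ε' • ((c x * evalHom c (slice [x] [] (D.d₀ z))) * evalHom c (g z)) := fun x _ => by
          rw [mul_smul_comm, map_smul, map_mul, mul_smul_comm, mul_assoc]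
        rw [Finset.sum_congr rfl h5, ← Finset.smul_sum, ← Finset.sum_mul,
          hεc' z ((D.mem_fib _ _).1 hz), smul_mul_assoc, smul_smul, hε', one_smul]
      simp only [map_sub, mul_sub, Finset.sum_sub_distrib]
      have hu2 : ∑ x ∈ fib (j + 1), c x * evalHom c (slice [x] [] (der (degSign k idx) D.d₀ u)) =
          ∑ x ∈ fib (j + 1), c x * part (fun l => l.length = m) (a x) :=
        Finset.sum_congr rfl fun x hx => by rw [hsu x hx, hq x]
      rw [hv2, hu2, hab']
      abel
    -- The leading part of the corrected cycle has a single shape, on which evaluation is injective;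
    -- by `hsum` it vanishes. All remaining first letters then have index at most `j`, as
    -- `exists_der_eq_of_slice` requires.
    have hzero : ∀ x ∈ fib (j + 1),
        slice [x] [] (y - der (degSign k idx) D.d₀ u - der (degSign k idx) D.d₀ v) = 0 := by
      set y' := y - der (degSign k idx) D.d₀ u - der (degSign k idx) D.d₀ v with hy'
      have hy'm : y' ∈ supp k fun l => degW idx l = j ∧ wtW N idx l = m + koszulDeg N (j + 1) :=
        sub_mem (sub_mem hy (der_mem_of_homogeneous D.one_le D.isHomogeneous_d₀ hum))
          (der_mem_of_homogeneous D.one_le D.isHomogeneous_d₀ hvm)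
      have : ∑ x ∈ fib (j + 1), FreeAlgebra.ι k x * slice [x] [] y' = 0 := by
        refine D.eq_zero_of_evalHom (s := (j + 1) :: List.replicate m 1)
          (Submodule.sum_mem _ fun x hx => ?_) ?_
        · rw [← wd_singleton]
          refine supp_mul (p := fun l => l = [x]) ?_ (wd_mem_supp rfl) (slice_mem_supp hy'm x)
          rw [D.mem_fib] at hx
          rintro _ l rfl h
          rw [hx] at h
          have h6 := forall_idx_eq_one D.one_le (l := l) (by omega)
          have h7 : wtW N idx l = m := by omega
          rw [← wtW_map, h6, wtW_replicate_one] at h7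
          simp [hx, h6, h7]
        · rw [map_sum, ← hsum]
          exact Finset.sum_congr rfl fun x _ => by rw [map_mul, evalHom_ι]
      intro x hx
      have h8 := congrArg (slice [x] []) this
      rwa [D.slice_sum_ι_mul _ x ((D.mem_fib _ _).1 hx), map_zero] at h8
    have hdd : ∀ z ∈ supp k fun l => degW idx l = j + 1 ∧ wtW N idx l = m + koszulDeg N (j + 1),
        der (degSign k idx) D.d₀ (der (degSign k idx) D.d₀ z) = 0 := fun z hz =>
      D.isFiltered_d₀.der_der D.one_le (i := j + 2) (fun x _ => D.der_d₀ x)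
          (supp_mono (fun l hl => by omega) hz)
    obtain ⟨r, hr, hr'⟩ := D.exists_der_eq_of_slice ih j le_rfl
      (y := y - der (degSign k idx) D.d₀ u - der (degSign k idx) D.d₀ v)
      (sub_mem (sub_mem hy (der_mem_of_homogeneous D.one_le D.isHomogeneous_d₀ hum))
        (der_mem_of_homogeneous D.one_le D.isHomogeneous_d₀ hvm)) hj
      (fun x hx => by
        by_cases hxj : idx x = j + 1
        · exact hzero x ((D.mem_fib _ _).2 hxj)
        · refine ext_co fun l => ?_
          rw [map_zero]
          refine slice_mem_supp (sub_mem (sub_mem hy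
            (der_mem_of_homogeneous D.one_le D.isHomogeneous_d₀ hum))
            (der_mem_of_homogeneous D.one_le D.isHomogeneous_d₀ hvm)) x l ?_
          omega)
      (by rw [map_sub, map_sub, hy0, hdd u hum, hdd v hvm]; simp)
    refine ⟨u + v + r, add_mem (add_mem hum hvm) hr, ?_⟩
    rw [map_add, map_add, hr']
    abel

end DualLetters

end Acyclicity

/-! ### Double orthogonals -/

section Orthogonality

variable {k : Type*} [Field k] {L : Type*}

theorem pair_comm (a b : FreeAlgebra k L) : pair k L a b = pair k L b a := by
  refine LinearMap.congr_fun (f := (pair k L).flip b) (g := pair k L b) (lin_ext fun l => ?_) a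
  rw [LinearMap.flip_apply, pair_wd_left, pair_wd_right]

theorem len_eq_span (n : ℕ) :
    len k L n = Submodule.span k (Set.range fun f : Fin n → L => wd k (List.ofFn f)) := by
  refine le_antisymm (supp_le fun l hl => ?_) (Submodule.span_le.2 ?_)
  · subst hl
    exact Submodule.subset_span ⟨l.get, by simp⟩
  · rintro _ ⟨f, rfl⟩
    exact wd_mem_supp (by simp)

instance [Finite L] (n : ℕ) : FiniteDimensional k (len k L n) := by
  rw [len_eq_span]
  exact FiniteDimensional.span_of_finite k (Set.finite_range _)

theorem len_zero_eq (y : FreeAlgebra k L) (hy : y ∈ len k L 0) : y = co [] y • 1 := by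
  refine ext_co fun l => ?_
  cases l with
  | nil => rw [map_smul, ← wd_nil, co_wd_self, smul_eq_mul, mul_one]
  | cons x l => rw [hy _ (by simp), map_smul, ← wd_nil, co_wd_ne (by simp), smul_zero]

/-- The elements of degree `N` that are orthogonal to `R`. -/
def relPerp (N : ℕ) (R : Submodule k (FreeAlgebra k L)) : Submodule k (FreeAlgebra k L) where
  carrier := {s | s ∈ len k L N ∧ ∀ r ∈ R, pair k L s r = 0}
  add_mem' := fun ha hb => ⟨add_mem ha.1 hb.1, fun r hr => by simp [ha.2 r hr, hb.2 r hr]⟩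
  zero_mem' := ⟨zero_mem _, fun r _ => by simp⟩
  smul_mem' := fun c _ ha => ⟨Submodule.smul_mem _ c ha.1, fun r hr => by simp [ha.2 r hr]⟩

variable {N : ℕ} {R : Submodule k (FreeAlgebra k L)}

theorem relPerp_le_len : relPerp N R ≤ len k L N := fun _ h => h.1

theorem part_relIdeal_mem {S : Submodule k (FreeAlgebra k L)} (hS : S ≤ len k L N) (n : ℕ)
    {s : FreeAlgebra k L} (hs : s ∈ relIdeal S) :
    part (fun l => l.length = n) s ∈ relIdeal S := by
  refine Submodule.span_induction
    (p := fun s _ => part (fun l => l.length = n) s ∈ relIdeal S) ?_ (by simp)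
    (fun x y _ _ hx hy => by rw [map_add]; exact add_mem hx hy)
    (fun a x _ hx => by rw [map_smul]; exact Submodule.smul_mem _ _ hx) hs
  rintro _ ⟨u, v, r, hr, rfl⟩
  have h := len_mul (len_mul (wd_mem_len (k := k) u) (hS hr)) (wd_mem_len v)
  by_cases hn : u.length + N + v.length = n
  · subst hn
    rw [part_of_mem h]
    exact Submodule.subset_span ⟨u, v, r, hr, rfl⟩
  · rw [part_of_disjoint h fun l hl hl' => hn (hl.symm.trans hl')]
    exact zero_mem _

theorem relIdeal_le_supp {S : Submodule k (FreeAlgebra k L)} (hS : S ≤ len k L N) :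
    relIdeal S ≤ supp k fun l => N ≤ l.length := by
  refine Submodule.span_le.2 ?_
  rintro _ ⟨u, v, r, hr, rfl⟩
  exact supp_mono (fun l hl => by omega)
    (len_mul (len_mul (wd_mem_len (k := k) u) (hS hr)) (wd_mem_len v))

theorem len_le_orthPart {S : Submodule k (FreeAlgebra k L)} (hS : S ≤ len k L N) {n : ℕ}
    (hn : n < N) : len k L n ≤ orthPart (relIdeal S) n := fun y hy =>
  ⟨hy, fun _ hs => pair_eq_zero_of_supp (relIdeal_le_supp hS hs) hy fun l hl hl' => by omega⟩

theorem mem_orthPart_relIdeal {S : Submodule k (FreeAlgebra k L)} {n : ℕ} {y : FreeAlgebra k L} :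
    y ∈ orthPart (relIdeal S) n ↔
      y ∈ len k L n ∧ ∀ u v, ∀ s ∈ S, pair k L s (slice u v y) = 0 := by
  refine and_congr_right fun _ => ⟨fun h u v s hs => ?_, fun h s hs => ?_⟩
  · rw [pair_slice]
    exact h _ (Submodule.subset_span ⟨u, v, s, hs, rfl⟩)
  · refine Submodule.span_induction (p := fun s _ => pair k L s y = 0) ?_ (by simp)
      (fun a b _ _ ha hb => by simp [ha, hb]) (fun a x _ hx => by simp [hx]) hs
    rintro _ ⟨u, v, r, hr, rfl⟩
    rw [← pair_slice]
    exact h u v r hr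

variable [Fintype L]

/-- A linear form that separates `y` from `R` is, in degree `N`, the pairing with a tensor, and this
tensor is orthogonal to `R`. -/
theorem mem_of_relPerp (hR : R ≤ len k L N) {y : FreeAlgebra k L} (hy : y ∈ len k L N)
    (h : ∀ s ∈ relPerp N R, pair k L s y = 0) : y ∈ R := by
  by_contra hyR
  obtain ⟨φ, hφ, hle⟩ := Submodule.exists_le_ker_of_notMem hyR
  obtain ⟨t, ht, ht'⟩ := exists_pair_eq N φ
  refine hφ ?_
  rw [← ht' y hy, pair_comm]
  exact h t ⟨ht, fun r hr => by rw [pair_comm, ht' r (hR hr)]; exact hle hr⟩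

/-- The orthogonal of an ideal generated in degree `N` is tested one position at a time. In terms of
subspaces it is the intersection of all `V^{⊗a} R V^{⊗b}` with `a + N + b = n`. -/
theorem mem_orthPart_relPerp (hR : R ≤ len k L N) {n : ℕ} {y : FreeAlgebra k L} :
    y ∈ orthPart (relIdeal (relPerp N R)) n ↔
      y ∈ len k L n ∧ ∀ u v : List L, u.length + N + v.length = n → slice u v y ∈ R := by
  rw [mem_orthPart_relIdeal]
  refine and_congr_right fun hy => ⟨fun h u v huv => ?_, fun h u v s hs => ?_⟩
  · exact mem_of_relPerp hR (slice_mem_len (huv ▸ hy)) (h u v)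
  · by_cases huv : u.length + N + v.length = n
    · exact hs.2 _ (h u v huv)
    · rw [pair_slice]
      exact pair_eq_zero_of_len (len_mul (len_mul (wd_mem_len u) hs.1) (wd_mem_len v)) hy huv

theorem orthPart_relPerp (hR : R ≤ len k L N) :
    orthPart (relIdeal (relPerp N R)) N = R := by
  ext y
  rw [mem_orthPart_relPerp hR]
  constructor
  · rintro ⟨-, h⟩
    simpa [slice_nil_nil] using h [] [] (by simp)
  · intro hy
    refine ⟨hR hy, fun u v huv => ?_⟩
    obtain rfl : u = [] := List.length_eq_zero_iff.1 (by omega)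
    obtain rfl : v = [] := List.length_eq_zero_iff.1 (by omega)
    rwa [slice_nil_nil]

/-- The degree `n` part of an ideal generated in degree `N` is determined by its orthogonal. -/
theorem mem_relIdeal_of_orthPart {S : Submodule k (FreeAlgebra k L)} (hS : S ≤ len k L N) {n : ℕ}
    {s : FreeAlgebra k L} (hs : s ∈ len k L n)
    (h : ∀ y ∈ orthPart (relIdeal S) n, pair k L s y = 0) : s ∈ relIdeal S := by
  by_contra hsS
  obtain ⟨φ, hφ, hle⟩ := Submodule.exists_le_ker_of_notMem hsS
  obtain ⟨t, ht, ht'⟩ := exists_pair_eq n φ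
  refine hφ ?_
  rw [← ht' s hs]
  refine h t ⟨ht, fun z hz => ?_⟩
  -- The tensor `t` sees only the degree `n` part of `z`, and this part stays in the ideal because
  -- the relations are homogeneous.
  have h1 : pair k L z t = pair k L (part (fun l => l.length = n) z) t := by
    rw [pair_comm, pair_comm _ t]
    refine supp_ext (f := (pair k L).flip z)
      (g := (pair k L).flip (part (fun l => l.length = n) z)) (fun l hl => ?_) ht
    rw [LinearMap.flip_apply, LinearMap.flip_apply, pair_wd_left, pair_wd_left,
      co_part_of (p := fun l => l.length = n) hl]
  rw [h1, ht' _ (part_mem _ _)]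
  exact hle (part_relIdeal_mem hS n hz)

end Orthogonality

/-! ### Existence of the dual bases -/

section Letters

variable {k : Type*} [Field k] {L : Type*}

/-- The letters: they enumerate bases of the spaces `orthPart K (n(i))`, `i ≥ 1`. -/
abbrev Letter (N : ℕ) (K : Submodule k (FreeAlgebra k L)) : Type :=
  Σ i : ℕ, Fin (Module.finrank k (orthPart K (koszulDeg N (i + 1))))

variable (N : ℕ) (K : Submodule k (FreeAlgebra k L))

/-- The index of a letter. -/
def letterIdx (x : Letter N K) : ℕ := x.1 + 1

/-- The letters of index `i`. -/
def letterFib : ℕ → Finset (Letter N K)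
  | 0 => ∅
  | i + 1 => Finset.univ.map (Function.Embedding.sigmaMk i)

instance finiteDimensional_orthPart [Finite L] (n : ℕ) : FiniteDimensional k (orthPart K n) :=
  Submodule.finiteDimensional_of_le (S₂ := len k L n) fun _ h => h.1

theorem exists_dualLetters [Fintype L] (hN : 2 ≤ N) (hK : IsIdeal K) :
    ∃ c t : Letter N K → FreeAlgebra k L,
      DualLetters N K (letterIdx N K) c t (letterFib N K) := by
  let b := fun i => Module.finBasis k (orthPart K (koszulDeg N (i + 1)))
  have ht : ∀ x : Letter N K, ∃ t ∈ len k L (koszulDeg N (letterIdx N K x)),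
      ∀ y : orthPart K (koszulDeg N (x.1 + 1)), pair k L t y = (b x.1).coord x.2 y := by
    intro x
    -- A coordinate is defined on a subspace of tensors only; extended to the whole free algebra it
    -- is represented by a tensor of the right degree.
    obtain ⟨φ, hφ⟩ := LinearMap.exists_extend ((b x.1).coord x.2)
    obtain ⟨t, ht, ht'⟩ := exists_pair_eq (koszulDeg N (x.1 + 1)) φ
    refine ⟨t, ht, fun y => ?_⟩
    rw [pair_comm, ht' _ y.2.1, ← hφ]
    rfl
  choose t ht ht' using ht
  refine ⟨fun x => b x.1 x.2, t, hN, hK, fun x => Nat.succ_pos _, ?_, fun x => (b x.1 x.2).2, ht,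
    ?_, ?_, ?_⟩
  · rintro (_ | i) ⟨j, a⟩
    · simp [letterFib, letterIdx]
    · simp only [letterFib, letterIdx, Finset.mem_map, Finset.mem_univ, true_and,
        Function.Embedding.sigmaMk_apply, Nat.add_right_cancel_iff]
      constructor
      · rintro ⟨a', h⟩
        exact (congrArg Sigma.fst h).symm
      · rintro rfl
        exact ⟨a, rfl⟩
  · intro x
    rw [ht']
    simp
  · rintro ⟨i, a⟩ ⟨j, a'⟩ h hne
    obtain rfl : i = j := Nat.succ_injective h
    rw [ht' ⟨i, a⟩]
    rw [Module.Basis.coord_apply, Module.Basis.repr_self, Finsupp.single_apply, if_neg]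
    rintro rfl
    exact hne rfl
  · rintro (_ | i) hi y hy
    · omega
    · have h := congrArg Subtype.val ((b i).sum_repr ⟨y, hy⟩)
      rw [letterFib, Finset.sum_map]
      simp only [Submodule.coe_sum, Submodule.coe_smul] at h
      refine h.symm.trans (Finset.sum_congr rfl fun a _ => ?_)
      exact congrArg (fun z => z • (b i a : FreeAlgebra k L)) (ht' ⟨i, a⟩ ⟨y, hy⟩).symm

end Letters

/-! ### Transfer of `T(V)`, its quotients and the pairing to a free algebra -/

section Coordinates

variable {k : Type*} {V : Type*} [Field k] [AddCommGroup V] [Module k V] {L : Type*}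
  (b : Module.Basis L k V)

/-- A basis of `V` identifies `T(V)` with a free algebra. -/
abbrev coordEquiv : TensorAlgebra k V ≃ₐ[k] FreeAlgebra k L := TensorAlgebra.equivFreeAlgebra b

theorem coordEquiv_symm_wd (l : List L) :
    (coordEquiv b).symm (wd k l) = (l.map fun x => TensorAlgebra.ι k (b x)).prod := by
  induction l with
  | nil => simp
  | cons x l ih => rw [wd_cons, map_mul, ih, TensorAlgebra.equivFreeAlgebra_symm_ι]; simp

theorem coordEquiv_tprod {n : ℕ} (f : Fin n → L) :
    coordEquiv b (TensorAlgebra.tprod k V n fun i => b (f i)) = wd k (List.ofFn f) := by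
  rw [← AlgEquiv.eq_symm_apply, coordEquiv_symm_wd, TensorAlgebra.tprod_apply, List.map_ofFn]
  rfl

theorem coordEquiv_ι_mem (v : V) : coordEquiv b (TensorAlgebra.ι k v) ∈ len k L 1 := by
  rw [← b.linearCombination_repr v, Finsupp.linearCombination_apply, Finsupp.sum, map_sum, map_sum]
  refine Submodule.sum_mem _ fun x _ => ?_
  rw [map_smul, map_smul, TensorAlgebra.equivFreeAlgebra_ι_apply, ← wd_singleton]
  exact Submodule.smul_mem _ _ (wd_mem_len [x])

theorem one_mem_len : (1 : FreeAlgebra k L) ∈ len k L 0 := wd_mem_len []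

theorem coordEquiv_mem_len {n : ℕ} {a : TensorAlgebra k V} :
    coordEquiv b a ∈ len k L n ↔ a ∈ tensorDeg k V n := by
  constructor
  · intro h
    rw [← (coordEquiv b).symm_apply_apply a]
    refine supp_map_mem (coordEquiv b).symm.toLinearMap _ (fun l hl => ?_) h
    clear h
    subst hl
    rw [AlgEquiv.toLinearMap_apply, coordEquiv_symm_wd]
    induction l with
    | nil => simp [tensorDeg]
    | cons x l ih =>
      rw [List.map_cons, List.prod_cons, List.length_cons, tensorDeg, pow_succ']
      exact Submodule.mul_mem_mul ⟨_, rfl⟩ ih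
  · intro h
    have : tensorDeg k V n ≤ (len k L n).comap (coordEquiv b).toLinearMap := by
      clear h
      induction n with
      | zero =>
        rw [tensorDeg, pow_zero, Submodule.one_le, Submodule.mem_comap, AlgEquiv.toLinearMap_apply,
          map_one]
        exact one_mem_len
      | succ n ih =>
        rw [tensorDeg, pow_succ, Submodule.mul_le]
        rintro u hu _ ⟨v, rfl⟩
        rw [Submodule.mem_comap, AlgEquiv.toLinearMap_apply, map_mul]
        exact len_mul (ih hu) (coordEquiv_ι_mem b v)
    exact this h

theorem coordEquiv_mem_supp_lt {n : ℕ} {a : TensorAlgebra k V} :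
    coordEquiv b a ∈ supp k (fun l : List L => l.length < n) ↔ a ∈ tensorFilLT k V n := by
  constructor
  · intro h
    rw [← (coordEquiv b).symm_apply_apply a]
    refine supp_map_mem (coordEquiv b).symm.toLinearMap _ (fun l hl => ?_) h
    refine le_iSup (fun j : Fin n => tensorDeg k V j) ⟨l.length, hl⟩ ?_
    rw [← coordEquiv_mem_len b]
    simpa using wd_mem_len l
  · intro h
    have : tensorFilLT k V n ≤ (supp k fun l : List L => l.length < n).comap
        (coordEquiv b).toLinearMap := by
      refine iSup_le fun j a ha => ?_
      exact supp_mono (fun l hl => hl.trans_lt j.2) ((coordEquiv_mem_len b).2 ha)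
    exact this h

theorem coordEquiv_tensorProj (n : ℕ) (a : TensorAlgebra k V) :
    coordEquiv b (tensorProj k V n a) = part (fun l => l.length = n) (coordEquiv b a) := by
  obtain ⟨y, rfl⟩ := (coordEquiv b).symm.surjective a
  rw [AlgEquiv.apply_symm_apply]
  refine LinearMap.congr_fun (f := (coordEquiv b).toLinearMap ∘ₗ tensorProj k V n ∘ₗ
    (coordEquiv b).symm.toLinearMap) (lin_ext fun l => ?_) y
  have hl : (coordEquiv b).symm (wd k l) ∈ tensorDeg k V l.length := by
    rw [← coordEquiv_mem_len b]
    simpa using wd_mem_len l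
  simp only [LinearMap.comp_apply, AlgEquiv.toLinearMap_apply, tensorProj,
    GradedAlgebra.proj_apply]
  by_cases hn : l.length = n
  · subst hn
    rw [DirectSum.decompose_of_mem_same _ hl, AlgEquiv.apply_symm_apply,
      part_wd_of (p := fun m => m.length = l.length) rfl]
  · rw [DirectSum.decompose_of_mem_ne _ hl hn, map_zero, part_wd_of_not hn]

theorem tensorPairing_eq [Finite L] [DecidableEq L] (a : TensorAlgebra k (Module.Dual k V))
    (z : TensorAlgebra k V) :
    tensorPairing k V a z = pair k L (coordEquiv b.dualBasis a) (coordEquiv b z) := by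
  obtain ⟨y, rfl⟩ := (coordEquiv b.dualBasis).symm.surjective a
  obtain ⟨x, rfl⟩ := (coordEquiv b).symm.surjective z
  rw [AlgEquiv.apply_symm_apply, AlgEquiv.apply_symm_apply]
  refine LinearMap.congr_fun (f := (tensorPairing k V).flip ((coordEquiv b).symm x) ∘ₗ
    (coordEquiv b.dualBasis).symm.toLinearMap) (g := (pair k L).flip x) (lin_ext fun l => ?_) y
  refine LinearMap.congr_fun (f := tensorPairing k V ((coordEquiv b.dualBasis).symm (wd k l)) ∘ₗ
    (coordEquiv b).symm.toLinearMap) (g := pair k L (wd k l)) (lin_ext fun m => ?_) x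
  obtain ⟨n, f, rfl⟩ : ∃ (n : ℕ) (f : Fin n → L), l = List.ofFn f := ⟨_, l.get, by simp⟩
  obtain ⟨n', g, rfl⟩ : ∃ (n : ℕ) (f : Fin n → L), m = List.ofFn f := ⟨_, m.get, by simp⟩
  rw [LinearMap.comp_apply, AlgEquiv.toLinearMap_apply, ← coordEquiv_tprod b.dualBasis,
    AlgEquiv.symm_apply_apply, ← coordEquiv_tprod b, AlgEquiv.symm_apply_apply, coordEquiv_tprod b,
    coordEquiv_tprod b.dualBasis, pair_wd_left]
  by_cases hn : n = n'
  · subst hn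
    rw [tensorPairing_tprod]
    by_cases hfg : f = g
    · subst hfg
      simp [co_wd_self]
    · obtain ⟨i, hi⟩ := Function.ne_iff.1 hfg
      rw [co_wd_ne (by simpa using hfg), Finset.prod_eq_zero (Finset.mem_univ i)]
      simp [hi]
  · rw [tensorPairing_tprod_of_ne hn, co_wd_ne]
    intro h
    exact hn (by simpa using congrArg List.length h)

theorem quotHom_eq_zero {P : Submodule k (TensorAlgebra k V)} {a : TensorAlgebra k V} :
    quotHom P a = 0 ↔ coordEquiv b a ∈ relIdeal (P.map (coordEquiv b).toLinearMap) := by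
  rw [quotHom, Ideal.Quotient.mkₐ_eq_mk, Ideal.Quotient.eq_zero_iff_mem, TwoSidedIdeal.mem_asIdeal]
  set I := relIdeal (P.map (coordEquiv b).toLinearMap)
  have hI : IsIdeal I := isIdeal_relIdeal _
  constructor
  · intro h
    have : TwoSidedIdeal.span (P : Set (TensorAlgebra k V)) ≤ TwoSidedIdeal.mk'
        {a | coordEquiv b a ∈ I} (by simp) (fun {x y} hx hy => by
          rw [Set.mem_ofPred_eq, map_add]; exact add_mem hx hy) (fun {x} hx => by
          rw [Set.mem_ofPred_eq, map_neg]; exact neg_mem hx) (fun {x y} hy => by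
          rw [Set.mem_ofPred_eq, map_mul]; exact hI.mul_left _ _ hy) (fun {x y} hx => by
          rw [Set.mem_ofPred_eq, map_mul]; exact hI.mul_right _ _ hx) := by
      rw [TwoSidedIdeal.span_le]
      intro p hp
      rw [SetLike.mem_coe, TwoSidedIdeal.mem_mk']
      exact subset_relIdeal (Submodule.mem_map_of_mem hp)
    have := this h
    rwa [TwoSidedIdeal.mem_mk'] at this
  · intro h
    set T := TwoSidedIdeal.span (P : Set (TensorAlgebra k V))
    have hle : I ≤ (T.asIdeal.restrictScalars k).map (coordEquiv b).toLinearMap := by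
      refine Submodule.span_le.2 ?_
      rintro _ ⟨u, v, _, ⟨r, hr, rfl⟩, rfl⟩
      refine ⟨(coordEquiv b).symm (wd k u) * r * (coordEquiv b).symm (wd k v), ?_, by simp⟩
      exact TwoSidedIdeal.mul_mem_right _ _ _
        (TwoSidedIdeal.mul_mem_left _ _ _ (TwoSidedIdeal.subset_span hr))
    obtain ⟨a', ha', he⟩ := hle h
    rw [← (coordEquiv b).injective he]
    exact ha'

end Coordinates

/-! ### The terms of an `N`-Koszul resolution as intersections of the spaces `V^{⊗a} R V^{⊗b}` -/

section KoszulSpaces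

variable {k : Type*} [Field k] {L : Type*}

theorem koszulDeg_add_two (N i : ℕ) : koszulDeg N (i + 2) = koszulDeg N i + N := by
  simp only [koszulDeg, Nat.add_mod_right, Nat.add_div_right i (show 0 < 2 by omega), mul_add]
  omega

theorem orthPart_le_len {K : Submodule k (FreeAlgebra k L)} (n : ℕ) :
    orthPart K n ≤ len k L n := fun _ h => h.1

theorem part_mul_top_mem {G : Submodule k (FreeAlgebra k L)} {a s : ℕ} (hG : G ≤ len k L a)
    {y : FreeAlgebra k L} (hy : y ∈ G * ⊤) :
    part (fun l => l.length = a + s) y ∈ G * len k L s := by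
  refine Submodule.mul_induction_on hy (fun u hu v _ => ?_) (fun x y hx hy => ?_)
  · rw [part_mul_left (q := fun l => l.length = s) (hG hu) fun l m hl => by simp [hl]]
    exact Submodule.mul_mem_mul hu (part_mem _ _)
  · rw [map_add]
    exact add_mem hx hy

/-- A product with an ideal that begins in degree `N` contributes nothing below degree `a + N`. In
low degrees this removes the error term from the exactness condition. -/
theorem part_mul_eq_zero {G I : Submodule k (FreeAlgebra k L)} {a N n : ℕ} (hG : G ≤ len k L a)
    (hI : I ≤ supp k fun l => N ≤ l.length) (hn : n < a + N) {y : FreeAlgebra k L}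
    (hy : y ∈ G * I) : part (fun l => l.length = n) y = 0 := by
  refine Submodule.mul_induction_on hy (fun u hu v hv => ?_) (fun x y hx hy => ?_)
  · refine part_of_disjoint (q := fun l => a + N ≤ l.length)
      (supp_mul (fun l m hl hm => ?_) (hG hu) (hI hv)) fun l hl hl' => by omega
    rw [List.length_append]
    omega
  · rw [map_add, hx, hy, add_zero]

theorem mul_len_zero_le (G : Submodule k (FreeAlgebra k L)) : G * len k L 0 ≤ G := by
  refine Submodule.mul_le.2 fun u hu v hv => ?_
  rw [len_zero_eq v hv, mul_smul_comm, mul_one]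
  exact Submodule.smul_mem _ _ hu

theorem part_relIdeal_mem_self {N : ℕ} {R : Submodule k (FreeAlgebra k L)} (hR : R ≤ len k L N)
    {s : FreeAlgebra k L} (hs : s ∈ relIdeal R) : part (fun l => l.length = N) s ∈ R := by
  refine Submodule.span_induction
    (p := fun s _ => part (fun l => l.length = N) s ∈ R) ?_ (by simp)
    (fun x y _ _ hx hy => by rw [map_add]; exact add_mem hx hy)
    (fun a x _ hx => by rw [map_smul]; exact Submodule.smul_mem _ _ hx) hs
  rintro _ ⟨u, v, r, hr, rfl⟩
  have h := len_mul (len_mul (wd_mem_len (k := k) u) (hR hr)) (wd_mem_len v)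
  by_cases hn : u.length + N + v.length = N
  · obtain rfl : u = [] := List.length_eq_zero_iff.1 (by omega)
    obtain rfl : v = [] := List.length_eq_zero_iff.1 (by omega)
    simpa [part_of_mem (hR hr)] using hr
  · rw [part_of_disjoint h fun l hl hl' => hn (hl.symm.trans hl')]
    exact zero_mem _

/-- The spaces on which the terms of an `N`-Koszul resolution are built. -/
structure KoszulSpaces (N : ℕ) (R : Submodule k (FreeAlgebra k L))
    (G : ℕ → Submodule k (FreeAlgebra k L)) : Prop where
  le_len : ∀ i, G i ≤ len k L (koszulDeg N i)
  zero : G 0 = len k L 0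
  one : G 1 = len k L 1
  succ_le : ∀ i, G (i + 1) ≤ G i * len k L (koszulDeg N (i + 1) - koszulDeg N i)
  le_mul : ∀ i, G (i + 2) ≤ G i * relIdeal R
  exact : ∀ i, (G (i + 1) * ⊤) ⊓ (G i * relIdeal R) ≤ G (i + 2) * ⊤ ⊔ G (i + 1) * relIdeal R

variable {N : ℕ} {R : Submodule k (FreeAlgebra k L)} {G : ℕ → Submodule k (FreeAlgebra k L)}

theorem slice_mem_of_mul_len [Fintype L] (hR : R ≤ len k L N) {a s : ℕ} {y : FreeAlgebra k L}
    (hy : y ∈ orthPart (relIdeal (relPerp N R)) a * len k L s) {u v : List L}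
    (h : u.length + N + v.length = a + s) (hs : s ≤ v.length) : slice u v y ∈ R := by
  obtain ⟨v', v'', rfl, hv⟩ : ∃ v' v'', v = v' ++ v'' ∧ v''.length = s :=
    ⟨v.take (v.length - s), v.drop (v.length - s), by simp, by simp; omega⟩
  subst hv
  refine Submodule.mul_induction_on hy (fun y hy z hz => ?_) (fun x y hx hy => ?_)
  · rw [← List.nil_append u, ← slice_slice, slice_mul_right hz, map_smul]
    refine Submodule.smul_mem _ _ (((mem_orthPart_relPerp hR).1 hy).2 u v' ?_)
    rw [List.length_append] at h
    omega
  · rw [map_add]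
    exact add_mem hx hy

/-- Removing the first `a` letters lands in the ideal, which in degree `N` is just `R`. -/
theorem slice_mem_of_mul_relIdeal (hR : R ≤ len k L N) {H : Submodule k (FreeAlgebra k L)} {a : ℕ}
    (hH : H ≤ len k L a) {y : FreeAlgebra k L} (hy : y ∈ H * relIdeal R)
    (hy' : y ∈ len k L (a + N)) {u : List L} (h : u.length = a) : slice u [] y ∈ R := by
  subst h
  have : slice u [] y ∈ relIdeal R := by
    refine Submodule.mul_induction_on hy (fun y hy z hz => ?_) (fun x y hx hy => ?_)
    · rw [slice_mul_left (hH hy)]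
      exact Submodule.smul_mem _ _ hz
    · rw [map_add]
      exact add_mem hx hy
  have h2 := part_relIdeal_mem_self hR this
  rwa [part_of_mem (slice_mem_len (by simpa using hy'))] at h2

variable {Γ : Type*} {idx : Γ → ℕ} {c t : Γ → FreeAlgebra k L} {fib : ℕ → Finset Γ}

namespace DualLetters

theorem exists_sum_of_mem_mul {K : Submodule k (FreeAlgebra k L)}
    (D : DualLetters N K idx c t fib) {i : ℕ} (hi : 1 ≤ i) {M : Submodule k (FreeAlgebra k L)}
    {y : FreeAlgebra k L} (hy : y ∈ orthPart K (koszulDeg N i) * M) :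
    ∃ a : Γ → FreeAlgebra k L, (∀ x, a x ∈ M) ∧ y = ∑ x ∈ fib i, c x * a x := by
  refine Submodule.mul_induction_on hy (fun y hy z hz => ?_) ?_
  · refine ⟨fun x => pair k L (t x) y • z, fun x => Submodule.smul_mem _ _ hz, ?_⟩
    conv_lhs => rw [D.expand i hi y hy, Finset.sum_mul]
    exact Finset.sum_congr rfl fun x _ => by rw [smul_mul_assoc, mul_smul_comm]
  · rintro y z ⟨a, ha, rfl⟩ ⟨b, hb, rfl⟩
    exact ⟨a + b, fun x => add_mem (ha x) (hb x), by simp [mul_add, Finset.sum_add_distrib]⟩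

theorem mem_mul_of_mem_orthPart {K : Submodule k (FreeAlgebra k L)}
    (D : DualLetters N K idx c t fib) {i m : ℕ} (hi : 1 ≤ i) {y : FreeAlgebra k L}
    (hy : y ∈ orthPart K (koszulDeg N i + m)) :
    y ∈ orthPart K (koszulDeg N i) * orthPart K m := by
  rw [D.sum_contrL hi hy]
  refine Submodule.sum_mem _ fun x hx => ?_
  rw [D.mem_fib] at hx
  subst hx
  exact Submodule.mul_mem_mul (D.c_mem x) (contrL_mem_orthPart D.isIdeal (D.t_mem x) hy)

end DualLetters

namespace KoszulSpaces

variable [Fintype L] (H : KoszulSpaces N R G) (hR : R ≤ len k L N) (hN : 2 ≤ N)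

include H hR

/-- The extra condition of an `N`-Koszul algebra. -/
theorem mem_orthPart_of_slices (h2 : G 2 = R)
    (h3 : G 3 = orthPart (relIdeal (relPerp N R)) (koszulDeg N 3)) {m : ℕ} (hm : m < N)
    {y : FreeAlgebra k L} (hy : y ∈ len k L (N + m))
    (hl : ∀ v : List L, v.length = m → slice [] v y ∈ R)
    (hr : ∀ u : List L, u.length = m → slice u [] y ∈ R) :
    y ∈ orthPart (relIdeal (relPerp N R)) (N + m) := by
  induction m generalizing y with
  | zero =>
    rw [add_zero, orthPart_relPerp hR]
    simpa [slice_nil_nil] using hl [] rfl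
  | succ m ih =>
    have hy1 : y ∈ G 2 * ⊤ := by
      rw [sum_slice_right hy, h2]
      exact Submodule.sum_mem _ fun f _ =>
        Submodule.mul_mem_mul (hl _ (by simp)) Submodule.mem_top
    have hy2 : y ∈ G 1 * relIdeal R := by
      rw [sum_slice_left (show y ∈ len k L (m + 1 + N) by rwa [add_comm]), H.one]
      refine Submodule.sum_mem _ fun f _ => ?_
      rw [List.ofFn_succ, wd_cons, mul_assoc, ← wd_singleton]
      refine Submodule.mul_mem_mul (wd_mem_len [f 0]) ((isIdeal_relIdeal R).mul_left _ _ ?_)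
      exact subset_relIdeal (hr _ (by simp))
    have hy3 : y ∈ orthPart (relIdeal (relPerp N R)) (N + 1) * len k L m := by
      -- The degree of `y` is below `2N`, where `G 2 * relIdeal R` is zero; so `y` comes from `G 3`,
      -- whose positions are already understood.
      obtain ⟨p, hp, q, hq, hpq⟩ := Submodule.mem_sup.1 (H.exact 1 ⟨hy1, hy2⟩)
      have h := congrArg (part fun l => l.length = N + 1 + m) hpq
      have hn2 : koszulDeg N 2 = N := by simp [koszulDeg]
      have hn3 : koszulDeg N 3 = N + 1 := by simp [koszulDeg]
      rw [map_add, part_mul_eq_zero (by simpa [hn2] using H.le_len 2) (relIdeal_le_supp hR)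
        (by omega) hq, add_zero, part_of_mem (show y ∈ len k L _ from by convert hy using 2; omega)]
        at h
      rw [← h]
      rw [show 1 + 2 = 3 from rfl, h3, hn3] at hp
      exact part_mul_top_mem (orthPart_le_len _) hp
    rw [mem_orthPart_relPerp hR]
    refine ⟨hy, fun u v huv => ?_⟩
    cases u with
    | nil => exact hl v (by simp at huv; omega)
    | cons x u =>
      -- Removing the first letter keeps both hypotheses with `m` in place of `m + 1`: the right end
      -- is inherited, and the left end is controlled by `hy3`.
      have hx : slice [x] [] y ∈ orthPart (relIdeal (relPerp N R)) (N + m) := by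
        refine ih (by omega) (slice_mem_len (by convert hy using 2; simp; omega))
          (fun v hv => ?_) fun u hu => ?_
        · rw [slice_slice]
          refine slice_mem_of_mul_len hR hy3 ?_ ?_ <;> simp [hv]
          omega
        · rw [slice_slice]
          exact hr _ (by simp [hu])
      have := ((mem_orthPart_relPerp hR).1 hx).2 u v (by simp at huv; omega)
      rwa [slice_slice, List.append_nil, List.singleton_append] at this

include hN

/-- One inclusion checks every position of `R` in an element of `G (i + 2)`: membership in `G (i +
1) * V^{⊗s}` handles positions away from the right end, membership in `G i * relIdeal R` the
rightmost one, and `mem_orthPart_of_slices` those in between. The other is exactness, read in degree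
`n(i + 2)`. The hypothesis `h23` is conditional because the first two steps are what establishes it.
-/
theorem eq_orthPart_step (D : DualLetters N (relIdeal (relPerp N R)) idx c t fib) {i : ℕ}
    (hi : G i = orthPart (relIdeal (relPerp N R)) (koszulDeg N i))
    (hi' : G (i + 1) = orthPart (relIdeal (relPerp N R)) (koszulDeg N (i + 1)))
    (h23 : 2 ≤ i → G 2 = R ∧ G 3 = orthPart (relIdeal (relPerp N R)) (koszulDeg N 3)) :
    G (i + 2) = orthPart (relIdeal (relPerp N R)) (koszulDeg N (i + 2)) := by
  have hlt := koszulDeg_lt_succ hN i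
  have hlt' := koszulDeg_lt_succ hN (i + 1)
  have h2 := koszulDeg_add_two N i
  simp only [add_assoc, Nat.reduceAdd] at hlt'
  refine le_antisymm (fun y hy => ?_) (fun y hy => ?_)
  · have hlen := H.le_len _ hy
    have hy1 := H.succ_le (i + 1) hy
    have hy2 := H.le_mul i hy
    rw [hi'] at hy1
    rw [hi] at hy2
    have hright : ∀ u : List L, u.length = koszulDeg N i → slice u [] y ∈ R := fun u hu =>
      slice_mem_of_mul_relIdeal hR (orthPart_le_len _) hy2 (by rwa [← h2]) hu
    rw [mem_orthPart_relPerp hR]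
    refine ⟨hlen, fun u v huv => ?_⟩
    by_cases hv : koszulDeg N (i + 1 + 1) - koszulDeg N (i + 1) ≤ v.length
    · exact slice_mem_of_mul_len hR hy1 (by simp only [add_assoc, Nat.reduceAdd]; omega) hv
    simp only [add_assoc, Nat.reduceAdd] at hv hy1
    -- For odd `i` the last step has length one, so only the rightmost position is open. For even
    -- `i` it has length `N - 1`, and positions between the two known ones remain.
    obtain ⟨q, rfl | rfl⟩ := Nat.even_or_odd' i
    · rw [koszulDeg_two_mul_add_one, h2, koszulDeg_two_mul] at hv
      rw [h2, koszulDeg_two_mul] at huv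
      rcases q with _ | q
      · obtain rfl : u = [] := List.length_eq_zero_iff.1 (by omega)
        obtain rfl : v = [] := List.length_eq_zero_iff.1 (by omega)
        exact hright [] (by simp [koszulDeg])
      -- Dropping `N q + 1` letters leaves a window of length `2N - 1` at the right end. Both its
      -- end positions are known, so the extra condition applies with `m = N - 1`.
      · obtain ⟨u', u'', rfl, hu⟩ : ∃ u' u'', u = u' ++ u'' ∧ u'.length = N * q + 1 :=
          ⟨u.take (N * q + 1), u.drop (N * q + 1), by simp, by
            rw [List.length_take, mul_add] at *; omega⟩
        have hmul : N * (q + 1) = N * q + N := by ring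
        have := H.mem_orthPart_of_slices hR (h23 (by omega)).1 (h23 (by omega)).2
          (m := N - 1) (by omega) (y := slice u' [] y)
          (slice_mem_len (by
            rw [h2, koszulDeg_two_mul] at hlen
            convert hlen using 2
            simp
            omega))
          (fun v' hv' => by
            rw [slice_slice]
            refine slice_mem_of_mul_len hR hy1 ?_ ?_
            · rw [h2, koszulDeg_two_mul_add_one, koszulDeg_two_mul]
              simp
              omega
            · rw [h2, koszulDeg_two_mul_add_one, koszulDeg_two_mul]
              simp
              omega)
          (fun v' hv' => by
            rw [slice_slice]
            refine hright _ ?_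
            rw [koszulDeg_two_mul]
            simp
            omega)
        have := ((mem_orthPart_relPerp hR).1 this).2 u'' v (by
          rw [List.length_append] at huv
          omega)
        rwa [slice_slice, List.append_nil] at this
    · obtain rfl : v = [] := List.length_eq_zero_iff.1 (by
        rw [show 2 * q + 1 + 1 = 2 * q + 2 by ring, h2, koszulDeg_add_two, koszulDeg_two_mul,
          koszulDeg_two_mul_add_one] at hv
        omega)
      refine hright u ?_
      simp at huv
      omega
  · have hy1 : y ∈ G (i + 1) * ⊤ := by
      obtain ⟨m, hm⟩ := Nat.exists_eq_add_of_lt hlt'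
      rw [hi']
      rw [hm, add_assoc] at hy
      exact SetLike.le_def.1 (mul_le_mul' le_rfl le_top) (D.mem_mul_of_mem_orthPart (by omega) hy)
    have hy2 : y ∈ G i * relIdeal R := by
      rw [h2] at hy
      rcases i with _ | i
      · rw [H.zero, ← one_mul y]
        refine Submodule.mul_mem_mul one_mem_len (subset_relIdeal ?_)
        rwa [show koszulDeg N 0 + N = N by simp [koszulDeg], orthPart_relPerp hR] at hy
      · have := D.mem_mul_of_mem_orthPart (by omega) hy
        rw [orthPart_relPerp hR] at this
        rw [hi]
        exact SetLike.le_def.1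
          (mul_le_mul' le_rfl (show R ≤ relIdeal R from fun _ => subset_relIdeal)) this
    -- Since `n(i + 2) = n(i) + N` is less than `n(i + 1) + N`, the summand over the ideal vanishes
    -- in this degree, while `G (i + 2) * ⊤` is in its lowest degree and equals `G (i + 2)`.
    obtain ⟨p, hp, q, hq, hpq⟩ := Submodule.mem_sup.1 (H.exact i ⟨hy1, hy2⟩)
    have h := congrArg (part fun l => l.length = koszulDeg N (i + 2)) hpq
    rw [map_add, part_mul_eq_zero (H.le_len (i + 1)) (relIdeal_le_supp hR) (by omega) hq,
      add_zero, part_of_mem hy.1] at h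
    rw [← h]
    exact mul_len_zero_le _ (part_mul_top_mem (s := 0) (H.le_len _) hp)

theorem eq_orthPart (D : DualLetters N (relIdeal (relPerp N R)) idx c t fib) (i : ℕ) :
    G i = orthPart (relIdeal (relPerp N R)) (koszulDeg N i) := by
  have h0 : G 0 = orthPart (relIdeal (relPerp N R)) (koszulDeg N 0) := by
    rw [H.zero, show koszulDeg N 0 = 0 by simp [koszulDeg]]
    exact le_antisymm (len_le_orthPart relPerp_le_len (by omega)) fun _ h => h.1
  have h1 : G 1 = orthPart (relIdeal (relPerp N R)) (koszulDeg N 1) := by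
    rw [H.one, show koszulDeg N 1 = 1 by simp [koszulDeg]]
    exact le_antisymm (len_le_orthPart relPerp_le_len (by omega)) fun _ h => h.1
  have h2 := H.eq_orthPart_step hR hN D h0 h1 (by omega)
  have h3 := H.eq_orthPart_step hR hN D h1 h2 (by omega)
  have h2' : G 2 = R := by
    have hn2 : koszulDeg N (0 + 2) = N := by simp [koszulDeg]
    rwa [hn2, orthPart_relPerp hR] at h2
  have : ∀ i, G i = orthPart (relIdeal (relPerp N R)) (koszulDeg N i) ∧
      G (i + 1) = orthPart (relIdeal (relPerp N R)) (koszulDeg N (i + 1)) := fun i => by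
    induction i with
    | zero => exact ⟨h0, h1⟩
    | succ i ih => exact ⟨ih.2, H.eq_orthPart_step hR hN D ih.1 ih.2 fun _ => ⟨h2', h3⟩⟩
  exact (this i).1

/-- The `c x` of index `i` span `G i`, so the exactness between the spaces can be restated for
families of coefficients. -/
theorem isKoszulExact (D : DualLetters N (relIdeal (relPerp N R)) idx c t fib) :
    IsKoszulExact R c fib := by
  intro i hi y y' hy' hyy
  obtain ⟨i, rfl⟩ := Nat.exists_eq_add_of_le' hi
  have hG := H.eq_orthPart hR hN D
  have hc : ∀ j, ∀ x ∈ fib j, c x ∈ G j := fun j x hx => by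
    rw [D.mem_fib] at hx
    subst hx
    rw [hG]
    exact D.c_mem x
  obtain ⟨p, hp, q, hq, hpq⟩ := Submodule.mem_sup.1
    (H.exact (i + 1) (x := ∑ x ∈ fib (i + 2), c x * y x)
      ⟨Submodule.sum_mem _ fun x hx => Submodule.mul_mem_mul (hc _ x hx) Submodule.mem_top, by
        rw [hyy]
        exact Submodule.sum_mem _ fun x hx => Submodule.mul_mem_mul (hc _ x hx) (hy' x)⟩)
  rw [hG] at hp hq
  obtain ⟨b, -, rfl⟩ := D.exists_sum_of_mem_mul (by omega) hp
  obtain ⟨a, ha, rfl⟩ := D.exists_sum_of_mem_mul (by omega) hq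
  refine ⟨a, b, ha, ?_⟩
  rw [← hpq, add_comm]

end KoszulSpaces

end KoszulSpaces

/-! ### From a resolution over `A` to subspaces of the tensor algebra -/

section Resolution

variable {k : Type*} [Field k] {L : Type*}

section MulMap

variable {X X' : Type*} [AddCommGroup X] [Module k X] [AddCommGroup X'] [Module k X']

/-- The map `x ⊗ a ↦ g x * a`. -/
def mulMap (g : X →ₗ[k] FreeAlgebra k L) : X ⊗[k] FreeAlgebra k L →ₗ[k] FreeAlgebra k L :=
  TensorProduct.lift ((LinearMap.mul k (FreeAlgebra k L)).comp g)

@[simp] theorem mulMap_tmul (g : X →ₗ[k] FreeAlgebra k L) (x : X) (a : FreeAlgebra k L) :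
    mulMap g (x ⊗ₜ a) = g x * a := by simp [mulMap]

theorem mulMap_lTensor_mulRight (g : X →ₗ[k] FreeAlgebra k L) (a : FreeAlgebra k L)
    (z : X ⊗[k] FreeAlgebra k L) :
    mulMap g (LinearMap.lTensor X (LinearMap.mulRight k a) z) = mulMap g z * a := by
  refine LinearMap.congr_fun (f := mulMap g ∘ₗ LinearMap.lTensor X (LinearMap.mulRight k a))
    (g := LinearMap.mulRight k a ∘ₗ mulMap g) (TensorProduct.ext' fun x y => ?_) z
  simp [mul_assoc]

theorem map_mulMap (g : X →ₗ[k] FreeAlgebra k L) (M : Submodule k (FreeAlgebra k L)) :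
    (LinearMap.range (LinearMap.lTensor X M.subtype)).map (mulMap g) = LinearMap.range g * M := by
  refine le_antisymm ?_ (Submodule.mul_le.2 ?_)
  · rintro _ ⟨_, ⟨z, rfl⟩, rfl⟩
    induction z with
    | zero => simp
    | tmul x a =>
      rw [LinearMap.lTensor_tmul, mulMap_tmul]
      exact Submodule.mul_mem_mul ⟨x, rfl⟩ a.2
    | add x y hx hy =>
      rw [map_add, map_add]
      exact add_mem hx hy
  · rintro _ ⟨x, rfl⟩ a ha
    exact ⟨x ⊗ₜ a, ⟨x ⊗ₜ ⟨a, ha⟩, by simp⟩, by simp⟩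

theorem range_mulMap (g : X →ₗ[k] FreeAlgebra k L) :
    LinearMap.range (mulMap g) = LinearMap.range g * ⊤ := by
  rw [← map_mulMap, LinearMap.range_eq_map]
  congr 1
  refine (LinearMap.range_eq_top.2 (LinearMap.lTensor_surjective X fun a => ⟨⟨a, ?_⟩, rfl⟩)).symm
  exact Submodule.mem_top

theorem part_slice_mul {n : ℕ} {a : FreeAlgebra k L} (ha : a ∈ len k L n) (l : List L)
    (u : FreeAlgebra k L) : part (fun m => m.length = n) (slice [] l (a * u)) = co l u • a := by
  refine ext_co fun m => ?_
  by_cases hm : m.length = n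
  · subst hm
    rw [co_part_of (p := fun m' => m'.length = m.length) rfl, co_slice, List.nil_append,
      co_mul_append ha, map_smul, smul_eq_mul, mul_comm]
  · rw [co_part_of_not hm, map_smul, ha _ hm, smul_zero]

/-- All values of `g` have the same degree `n`, so in `g x * a` the first `n` letters belong to `g
x`. Removing a word `l` on the right and keeping degree `n` recovers `g` of the coefficient at `l`.
-/
theorem mulMap_injective {g : X →ₗ[k] FreeAlgebra k L} (hg : Function.Injective g) {n : ℕ}
    (hn : LinearMap.range g ≤ len k L n) : Function.Injective (mulMap g) := by
  rw [injective_iff_map_eq_zero]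
  intro z hz
  have key : ∀ l, g (TensorProduct.rid k X (LinearMap.lTensor X (co l) z)) =
      part (fun m => m.length = n) (slice [] l (mulMap g z)) := fun l => by
    refine LinearMap.congr_fun (f := g ∘ₗ (TensorProduct.rid k X).toLinearMap ∘ₗ
      LinearMap.lTensor X (co l)) (g := part (fun m => m.length = n) ∘ₗ slice [] l ∘ₗ mulMap g)
      (TensorProduct.ext' fun x y => ?_) z
    simp only [LinearMap.comp_apply, LinearMap.lTensor_tmul, LinearEquiv.coe_coe,
      TensorProduct.rid_tmul, map_smul, mulMap_tmul]
    rw [part_slice_mul (hn ⟨x, rfl⟩)]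
  classical
  refine (TensorProduct.equivFinsuppOfBasisRight (M := X) (wordBasis k L)).injective ?_
  ext l
  have h := key l
  rw [hz, map_zero, map_zero] at h
  have h2 := hg (h.trans (map_zero g).symm)
  rw [map_zero, Finsupp.zero_apply, TensorProduct.equivFinsuppOfBasisRight_apply]
  exact h2

/-- The extension of a map `X' → X ⊗ F` to a map of right modules `X' ⊗ F → X ⊗ F`. -/
def extendRight (δ : X' →ₗ[k] X ⊗[k] FreeAlgebra k L) :
    X' ⊗[k] FreeAlgebra k L →ₗ[k] X ⊗[k] FreeAlgebra k L :=
  TensorProduct.lift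
    ((LinearMap.lTensorHom X ∘ₗ (LinearMap.mul k (FreeAlgebra k L)).flip).flip ∘ₗ δ)

@[simp] theorem extendRight_tmul (δ : X' →ₗ[k] X ⊗[k] FreeAlgebra k L) (x : X')
    (a : FreeAlgebra k L) :
    extendRight δ (x ⊗ₜ a) = LinearMap.lTensor X (LinearMap.mulRight k a) (δ x) := by
  simp only [extendRight, TensorProduct.lift.tmul, LinearMap.comp_apply, LinearMap.flip_apply,
    LinearMap.coe_lTensorHom]
  rfl

end MulMap

variable {N : ℕ} {R : Submodule k (FreeAlgebra k L)} {A : Type*} [Ring A] [Algebra k A]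
  {X : ℕ → Type*} [∀ i, AddCommGroup (X i)] [∀ i, Module k (X i)]

/-- Lift the differentials from `A` to the free algebra in their prescribed degrees and compose the
lifts: this maps `X i` to tensors of degree `n(i)`, and `G i` is the image. The maps are injective
because the resolution is minimal. Exactness over `A` becomes exactness modulo the ideal, as the
kernel of `X i ⊗ F → X i ⊗ A` is `X i ⊗ relIdeal R`. -/
theorem exists_koszulSpaces (hN : 2 ≤ N) (hR : R ≤ len k L N) (p : FreeAlgebra k L →ₐ[k] A)
    (hp : Function.Surjective p) (hker : ∀ a, p a = 0 ↔ a ∈ relIdeal R) (e₀ : X 0 ≃ₗ[k] k)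
    (aug : A →ₐ[k] k) (haug : ∀ x, aug (p (FreeAlgebra.ι k x)) = 0)
    (d : ∀ i, X (i + 1) ⊗[k] A →ₗ[k] X i ⊗[k] A)
    (right_linear : ∀ i (b : A) (z : X (i + 1) ⊗[k] A),
      d i (LinearMap.lTensor (X (i + 1)) (LinearMap.mulRight k b) z) =
        LinearMap.lTensor (X i) (LinearMap.mulRight k b) (d i z))
    (graded : ∀ i x, d i (x ⊗ₜ 1) ∈ LinearMap.range (LinearMap.lTensor (X i)
      ((len k L (koszulDeg N (i + 1) - koszulDeg N i)).map p.toLinearMap).subtype))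
    (exact_zero : Function.Exact (d 0)
      (aug.toLinearMap ∘ₗ (TensorProduct.lid k A).toLinearMap ∘ₗ
        LinearMap.rTensor A e₀.toLinearMap))
    (exact_succ : ∀ i, Function.Exact (d (i + 1)) (d i)) :
    ∃ G, KoszulSpaces N R G := by
  set s : ℕ → ℕ := fun i => koszulDeg N (i + 1) - koszulDeg N i with hs
  have hs1 : ∀ i, 1 ≤ s i := fun i => by
    have := koszulDeg_lt_succ hN i
    simp only [hs]
    omega
  have hlift : ∀ i, ∃ δ : X (i + 1) →ₗ[k] X i ⊗[k] FreeAlgebra k L,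
      (∀ x, δ x ∈ LinearMap.range (LinearMap.lTensor (X i) (len k L (s i)).subtype)) ∧
      ∀ x, LinearMap.lTensor (X i) p.toLinearMap (δ x) = d i (x ⊗ₜ 1) := by
    intro i
    set f := LinearMap.lTensor (X i) (p.toLinearMap ∘ₗ (len k L (s i)).subtype) with hf
    have hmem : ∀ x, d i (x ⊗ₜ 1) ∈ LinearMap.range f := fun x => by
      obtain ⟨w, hw⟩ := graded i x
      obtain ⟨w', rfl⟩ := LinearMap.lTensor_surjective (X i)
        (p.toLinearMap.submoduleMap_surjective (len k L (s i))) w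
      refine ⟨w', ?_⟩
      rw [← hw, ← LinearMap.comp_apply, ← LinearMap.lTensor_comp, hf]
      rfl
    obtain ⟨h, hh⟩ := Module.projective_lifting_property f.rangeRestrict
      ((d i ∘ₗ (TensorProduct.mk k (X (i + 1)) A).flip 1).codRestrict (LinearMap.range f) hmem)
      f.surjective_rangeRestrict
    refine ⟨LinearMap.lTensor (X i) (len k L (s i)).subtype ∘ₗ h, fun x => ⟨h x, rfl⟩, fun x => ?_⟩
    have : f (h x) = d i (x ⊗ₜ 1) := congrArg Subtype.val (LinearMap.congr_fun hh x)
    rwa [hf, LinearMap.lTensor_comp] at this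
  choose δ hδ hδ' using hlift
  let g : ∀ i, X i →ₗ[k] FreeAlgebra k L := fun i =>
    Nat.rec (Algebra.linearMap k (FreeAlgebra k L) ∘ₗ e₀.toLinearMap)
      (fun i g => mulMap g ∘ₗ δ i) i
  have hg0 : ∀ x, g 0 x = algebraMap k _ (e₀ x) := fun _ => rfl
  have hgs : ∀ i x, g (i + 1) x = mulMap (g i) (δ i x) := fun _ _ => rfl
  clear_value g
  have hmul : ∀ i z, mulMap (g (i + 1)) z = mulMap (g i) (extendRight (δ i) z) := fun i z => by
    refine LinearMap.congr_fun (g := mulMap (g i) ∘ₗ extendRight (δ i))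
      (TensorProduct.ext' fun x y => ?_) z
    simp [mulMap_lTensor_mulRight, hgs]
  have hpd : ∀ i z, LinearMap.lTensor (X i) p.toLinearMap (extendRight (δ i) z) =
      d i (LinearMap.lTensor (X (i + 1)) p.toLinearMap z) := fun i z => by
    refine LinearMap.congr_fun (f := LinearMap.lTensor (X i) p.toLinearMap ∘ₗ extendRight (δ i))
      (g := d i ∘ₗ LinearMap.lTensor (X (i + 1)) p.toLinearMap)
      (TensorProduct.ext' fun x y => ?_) z
    simp only [LinearMap.comp_apply, extendRight_tmul, LinearMap.lTensor_tmul]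
    have h1 : x ⊗ₜ[k] p.toLinearMap y =
        LinearMap.lTensor (X (i + 1)) (LinearMap.mulRight k (p y)) (x ⊗ₜ[k] (1 : A)) := by simp
    have h2 : p.toLinearMap ∘ₗ LinearMap.mulRight k y =
        LinearMap.mulRight k (p y) ∘ₗ p.toLinearMap := by
      ext
      simp
    rw [h1, right_linear, ← hδ' i x, ← LinearMap.comp_apply (LinearMap.lTensor _ _),
      ← LinearMap.comp_apply (LinearMap.lTensor (X i) (LinearMap.mulRight k (p y))),
      ← LinearMap.lTensor_comp, ← LinearMap.lTensor_comp, h2]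
  have hkerX : ∀ i z, LinearMap.lTensor (X i) p.toLinearMap z = 0 ↔
      z ∈ LinearMap.range (LinearMap.lTensor (X i) (relIdeal R).subtype) := fun i =>
    lTensor_exact (X i) (f := (relIdeal R).subtype) (g := p.toLinearMap)
      (fun a => by simp [hker]) hp
  have hrange : ∀ i, LinearMap.range (g (i + 1)) ≤ LinearMap.range (g i) * len k L (s i) := by
    rintro i _ ⟨x, rfl⟩
    rw [hgs, ← map_mulMap]
    exact Submodule.mem_map_of_mem (hδ i x)
  have hlen : ∀ i, LinearMap.range (g i) ≤ len k L (koszulDeg N i) := by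
    intro i
    induction i with
    | zero =>
      rintro _ ⟨x, rfl⟩
      rw [hg0, Algebra.algebraMap_eq_smul_one]
      exact Submodule.smul_mem _ _ one_mem_len
    | succ i ih =>
      refine (hrange i).trans (Submodule.mul_le.2 fun a ha b hb => ?_)
      have := len_mul (ih ha) hb
      rwa [show koszulDeg N i + s i = koszulDeg N (i + 1) from
        Nat.add_sub_cancel' (koszulDeg_lt_succ hN i).le] at this
  have haug' : ∀ n, 1 ≤ n → ∀ a ∈ len k L n, aug (p a) = 0 := fun n hn a ha => by
    refine supp_ext (f := aug.toLinearMap ∘ₗ p.toLinearMap) (g := 0) (fun l hl => ?_) ha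
    cases l with
    | nil => simp at hl; omega
    | cons x l => simp [wd_cons, haug]
  -- Minimality: each differential raises the degree in `A` by at least one, so it vanishes modulo
  -- the augmentation ideal.
  have haugd : ∀ i z, LinearMap.lTensor (X i) aug.toLinearMap (d i z) = 0 := fun i z => by
    refine LinearMap.congr_fun (f := LinearMap.lTensor (X i) aug.toLinearMap ∘ₗ d i) (g := 0)
      (TensorProduct.ext' fun x y => ?_) z
    have h1 : x ⊗ₜ[k] y =
        LinearMap.lTensor (X (i + 1)) (LinearMap.mulRight k y) (x ⊗ₜ[k] (1 : A)) := by simp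
    have h2 : aug.toLinearMap ∘ₗ LinearMap.mulRight k y = aug y • aug.toLinearMap := by
      ext a
      simp [mul_comm]
    obtain ⟨w, hw⟩ := graded i x
    have h3 : aug.toLinearMap ∘ₗ ((len k L (s i)).map p.toLinearMap).subtype = 0 := by
      ext ⟨_, a, ha, rfl⟩
      exact haug' _ (hs1 i) a ha
    rw [LinearMap.comp_apply, h1, right_linear, ← LinearMap.comp_apply, ← LinearMap.lTensor_comp,
      h2, LinearMap.lTensor_smul, LinearMap.smul_apply, ← hw, ← LinearMap.comp_apply,
      ← LinearMap.lTensor_comp]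
    erw [h3]
    simp
  have hinj : ∀ i, Function.Injective (g i) := by
    intro i
    induction i with
    | zero =>
      intro x y hxy
      rw [hg0, hg0] at hxy
      exact e₀.injective (FaithfulSMul.algebraMap_injective k (FreeAlgebra k L) hxy)
    | succ i ih =>
      rw [injective_iff_map_eq_zero]
      intro x hx
      rw [hgs] at hx
      have h0 := mulMap_injective ih (hlen i) (hx.trans (map_zero _).symm)
      -- An element of the kernel gives a cycle `x ⊗ 1`, hence a boundary; minimality then makes its
      -- image `x` under the augmentation zero.
      have h1 : d i (x ⊗ₜ 1) = 0 := by rw [← hδ', h0, map_zero]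
      obtain ⟨w, hw⟩ := (exact_succ i _).1 h1
      have h2 := haugd (i + 1) w
      rw [hw] at h2
      simpa using congrArg (TensorProduct.rid k (X (i + 1))) h2
  have hinj' := fun i => mulMap_injective (hinj i) (hlen i)
  have hzero : LinearMap.range (g 0) = len k L 0 := by
    refine le_antisymm (by simpa [koszulDeg] using hlen 0) fun y hy => ?_
    rw [len_zero_eq y hy]
    exact ⟨e₀.symm (co [] y), by rw [hg0, e₀.apply_symm_apply, Algebra.algebraMap_eq_smul_one]⟩
  have hI : relIdeal R ≤ supp k fun l => N ≤ l.length := relIdeal_le_supp hR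
  have hk1 : koszulDeg N 1 = 1 := by simp [koszulDeg]
  refine ⟨fun i => LinearMap.range (g i), hlen, hzero, le_antisymm ?_ fun y hy => ?_, hrange,
    fun i => ?_, fun i => ?_⟩
  · simpa [hk1] using hlen 1
  -- Exactness at `A` writes `y` as an image from `X 1` modulo relations; these begin in degree `N ≥
  -- 2` and do not affect degree one.
  · have h1 : aug (p y) = 0 := haug' 1 le_rfl y hy
    obtain ⟨w, hw⟩ := (exact_zero (e₀.symm 1 ⊗ₜ p y)).1 (by simp [h1])
    obtain ⟨w, rfl⟩ := LinearMap.lTensor_surjective (X 1) (g := p.toLinearMap) hp w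
    have h2 : e₀.symm 1 ⊗ₜ y - extendRight (δ 0) w ∈
        LinearMap.range (LinearMap.lTensor (X 0) (relIdeal R).subtype) := by
      rw [← hkerX, map_sub, hpd, hw]
      simp
    have h3 := Submodule.mem_map_of_mem (f := mulMap (g 0)) h2
    rw [map_mulMap, map_sub, ← hmul, mulMap_tmul, hg0, e₀.apply_symm_apply, map_one, one_mul] at h3
    have h4 := part_mul_eq_zero (hlen 0) hI (n := 1) (by simp [koszulDeg]; omega) h3
    rw [map_sub, part_of_mem hy, sub_eq_zero] at h4
    rw [h4]
    have h5 : mulMap (g 1) w ∈ LinearMap.range (g 1) * ⊤ := by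
      rw [← range_mulMap]
      exact ⟨w, rfl⟩
    have h6 := part_mul_top_mem (s := 0) (hlen 1) h5
    rw [hk1] at h6
    exact mul_len_zero_le _ h6
  · rintro _ ⟨x, rfl⟩
    have h1 : g (i + 2) x = mulMap (g i) (extendRight (δ i) (δ (i + 1) x)) := by
      rw [hgs, hmul]
    rw [h1, ← map_mulMap]
    refine Submodule.mem_map_of_mem ((hkerX i _).1 ?_)
    rw [hpd, hδ']
    exact (exact_succ i _).2 ⟨_, rfl⟩
  · rintro y ⟨hy1, hy2⟩
    rw [SetLike.mem_coe, ← range_mulMap] at hy1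
    rw [SetLike.mem_coe, ← map_mulMap] at hy2
    obtain ⟨z, rfl⟩ := hy1
    obtain ⟨z', hz', hzz⟩ := hy2
    rw [hmul] at hzz
    -- The two descriptions of the element agree already in `X i ⊗ F`. Hence `z` reduces to a cycle
    -- over `A`, and exactness there provides `w`.
    obtain rfl := hinj' i hzz
    rw [SetLike.mem_coe, ← hkerX, hpd] at hz'
    obtain ⟨w, hw⟩ := (exact_succ i _).1 hz'
    obtain ⟨w, rfl⟩ := LinearMap.lTensor_surjective (X (i + 2)) (g := p.toLinearMap) hp w
    have h2 : z - extendRight (δ (i + 1)) w ∈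
        LinearMap.range (LinearMap.lTensor (X (i + 1)) (relIdeal R).subtype) := by
      rw [← hkerX, map_sub, hpd, hw, sub_self]
    have h3 := Submodule.mem_map_of_mem (f := mulMap (g (i + 1))) h2
    rw [map_mulMap, map_sub, ← hmul] at h3
    refine Submodule.mem_sup.2 ⟨mulMap (g (i + 2)) w, ?_, _, h3, by abel⟩
    rw [← range_mulMap]
    exact ⟨w, rfl⟩

end Resolution

/-! ### Koszul spaces of `T(V)/(R)` -/

section IsNKoszul

universe u v

variable {k : Type u} {V : Type v} [Field k] [AddCommGroup V] [Module k V] {L : Type*}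

theorem IsNKoszul.exists_koszulSpaces {N : ℕ} (hN : 2 ≤ N) {R : Submodule k (TensorAlgebra k V)}
    (hR : R ≤ tensorDeg k V N) (hA : IsNKoszul N R) (b : Module.Basis L k V) :
    ∃ G, KoszulSpaces N (R.map (coordEquiv b).toLinearMap) G := by
  obtain ⟨C⟩ := hA
  let _ := C.addCommGroup
  let _ := C.module
  have hlen : ∀ n, (len k L n).map ((quotHom R).comp (coordEquiv b).symm.toAlgHom).toLinearMap =
      quotDeg R n := fun n => by
    refine le_antisymm ?_ ?_
    · rintro _ ⟨y, hy, rfl⟩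
      exact ⟨(coordEquiv b).symm y, (coordEquiv_mem_len b).1 (by simpa using hy), rfl⟩
    · rintro _ ⟨y, hy, rfl⟩
      exact ⟨coordEquiv b y, (coordEquiv_mem_len b).2 hy, by simp⟩
  refine NKoszul.exists_koszulSpaces hN ?_ ((quotHom R).comp (coordEquiv b).symm.toAlgHom) ?_ ?_
    C.e₀ C.aug (fun x => ?_) C.d C.right_linear (fun i x => ?_) C.exact_zero C.exact_succ
  · rintro _ ⟨r, hr, rfl⟩
    exact (coordEquiv_mem_len b).2 (hR hr)
  · exact (Ideal.Quotient.mkₐ_surjective k _).comp (coordEquiv b).symm.surjective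
  · intro a
    rw [AlgHom.comp_apply, quotHom_eq_zero b]
    simp
  · simpa using C.aug_ι (b x)
  · rw [hlen]
    rw [← zero_add (koszulDeg N (i + 1) - koszulDeg N i)]
    have := C.graded i 0 ⟨x ⊗ₜ 1, ⟨x ⊗ₜ ⟨1, ?_⟩, by simp⟩, rfl⟩
    · exact this
    · exact ⟨1, by simp [tensorDeg], by simp⟩

end IsNKoszul

/-! ### Augmented PBW-deformations and filtered differentials -/

section FilteredPBW

variable {k : Type*} [Field k] {L : Type*}

/-- An augmented PBW-deformation, in terms of a basis of `V`. -/
structure IsCoordPBW (N : ℕ) (R P : Submodule k (FreeAlgebra k L)) : Prop where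
  le_supp : P ≤ supp k fun l => l.length < N + 1
  eq_zero : ∀ p ∈ P, p ∈ supp k (fun l => l.length < N) → p = 0
  part_mem : ∀ p ∈ P, part (fun l => l.length = N) p ∈ R
  exists_part : ∀ r ∈ R, ∃ p ∈ P, part (fun l => l.length = N) p = r
  gr : ∀ l, ∀ a ∈ len k L l, ∀ u ∈ supp k fun m => m.length < l,
    a + u ∈ relIdeal P → a ∈ relIdeal R
  co_nil : ∀ p ∈ P, co [] p = 0

theorem sub_part_mem {X : Type*} {f : List X → ℕ} {n : ℕ} {y : FreeAlgebra k X}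
    (hy : y ∈ supp k fun l => f l < n + 1) :
    y - part (fun l => f l = n) y ∈ supp k fun l => f l < n := fun l hl => by
  rw [map_sub]
  by_cases h : f l = n
  · rw [co_part_of (p := fun l => f l = n) h, sub_self]
  · rw [co_part_of_not h, hy l (by omega), sub_zero]

theorem exists_mem_supp_lt {X : Type*} (f : List X → ℕ) (y : FreeAlgebra k X) :
    ∃ n, y ∈ supp k fun l => f l < n := by
  refine ⟨(((wordBasis k X).repr y).support.sup f) + 1, fun l hl => ?_⟩
  by_contra h
  exact hl (Nat.lt_succ_of_le (Finset.le_sup (f := f) (mem_support_iff.2 h)))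

variable {N : ℕ} {R P P' : Submodule k (FreeAlgebra k L)}

namespace IsCoordPBW

/-- By the PBW condition, the top part of an element of the ideal of `P` lies in the ideal of `R`,
which is zero below degree `N`. The element is thus peeled off degree by degree. -/
theorem eq_zero_of_lt (hR : R ≤ len k L N) (hP : IsCoordPBW N R P) {n : ℕ} (hn : n ≤ N)
    {a : FreeAlgebra k L} (ha : a ∈ relIdeal P) (ha' : a ∈ supp k fun l => l.length < n) :
    a = 0 := by
  induction n with
  | zero => exact ext_co fun l => by rw [map_zero, ha' l (by simp)]
  | succ n ih =>
    refine ih (by omega) ?_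
    have h1 := sub_part_mem ha'
    have h2 := hP.gr n _ (NKoszul.part_mem (fun l => l.length = n) a) _ h1 (by simpa using ha)
    have h3 : part (fun l => l.length = n) a = 0 :=
      supp_inf_eq_zero (fun l hl hl' => by omega) (NKoszul.part_mem (fun l => l.length = n) a)
        (relIdeal_le_supp hR h2)
    rwa [h3, sub_zero] at h1

/-- The top part lies in `R` and is matched by some `p ∈ P`; the difference has filtration below `N`
and vanishes. That the ideal of `P` has no new elements in filtration `N` is the form in which the
PBW condition kills the obstruction at index three. -/
theorem mem_of_lt (hR : R ≤ len k L N) (hP : IsCoordPBW N R P) {a : FreeAlgebra k L}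
    (ha : a ∈ relIdeal P) (ha' : a ∈ supp k fun l => l.length < N + 1) : a ∈ P := by
  have h1 := sub_part_mem ha'
  have h2 := hP.gr N _ (NKoszul.part_mem (fun l => l.length = N) a) _ h1 (by simpa using ha)
  have h3 := part_relIdeal_mem_self hR h2
  rw [part_of_mem (NKoszul.part_mem _ a)] at h3
  obtain ⟨p, hp, hpa⟩ := hP.exists_part _ h3
  have h4 : a - p = 0 := by
    refine hP.eq_zero_of_lt hR le_rfl (sub_mem ha (subset_relIdeal hp)) ?_
    have h5 := sub_mem h1 (sub_part_mem (hP.le_supp hp))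
    rwa [hpa, sub_sub_sub_cancel_right] at h5
  rwa [sub_eq_zero.1 h4]

theorem eq_of_part_eq (hP : IsCoordPBW N R P) {p q : FreeAlgebra k L} (hp : p ∈ P) (hq : q ∈ P)
    (h : part (fun l => l.length = N) p = part (fun l => l.length = N) q) : p = q := by
  refine sub_eq_zero.1 (hP.eq_zero _ (sub_mem hp hq) ?_)
  have h5 := sub_mem (sub_part_mem (hP.le_supp hp)) (sub_part_mem (hP.le_supp hq))
  rwa [h, sub_sub_sub_cancel_right] at h5

/-- This half of the comparison with the associated graded algebra is formal: in an expression by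
relations, each `r ∈ R` is replaced by an element of `P` with leading part `r`. -/
theorem exists_add_mem (hP : IsCoordPBW N R P) (hR : R ≤ len k L N) {n : ℕ} {a : FreeAlgebra k L}
    (ha : a ∈ len k L n) (haR : a ∈ relIdeal R) :
    ∃ u ∈ supp k fun m => m.length < n, a + u ∈ relIdeal P := by
  rw [← part_of_mem ha]
  clear ha
  refine Submodule.span_induction (p := fun a _ => ∃ u ∈ supp k fun m => m.length < n,
    part (fun l => l.length = n) a + u ∈ relIdeal P) ?_ ⟨0, zero_mem _, by simp⟩ ?_ ?_ haR
  · rintro _ ⟨u, v, r, hr, rfl⟩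
    have h := len_mul (len_mul (wd_mem_len (k := k) u) (hR hr)) (wd_mem_len v)
    by_cases hn : u.length + N + v.length = n
    · obtain ⟨p, hp, rfl⟩ := hP.exists_part r hr
      refine ⟨wd k u * (p - part (fun l => l.length = N) p) * wd k v, ?_, ?_⟩
      · refine supp_mul (q := fun l => l.length = v.length)
          (p := fun l => l.length < u.length + N) (fun l m hl hm => ?_) (supp_mul
          (fun l m hl hm => ?_) (wd_mem_len u) (sub_part_mem (hP.le_supp hp))) (wd_mem_len v)
        · rw [List.length_append]
          omega
        · rw [List.length_append]
          omega
      · rw [part_of_mem (supp_mono (fun l hl => by omega) h), ← add_mul, ← mul_add,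
          add_sub_cancel]
        exact Submodule.subset_span ⟨u, v, p, hp, rfl⟩
    · exact ⟨0, zero_mem _, by
        rw [part_of_disjoint h fun l hl hl' => hn (hl.symm.trans hl'), add_zero]
        exact zero_mem _⟩
  · rintro x y _ _ ⟨u, hu, hxu⟩ ⟨v, hv, hyv⟩
    refine ⟨u + v, add_mem hu hv, ?_⟩
    rw [map_add, add_add_add_comm]
    exact add_mem hxu hyv
  · rintro s x _ ⟨u, hu, hxu⟩
    refine ⟨s • u, Submodule.smul_mem _ _ hu, ?_⟩
    rw [map_smul, ← smul_add]
    exact Submodule.smul_mem _ _ hxu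

end IsCoordPBW

variable {Γ : Type*} {K : Submodule k (FreeAlgebra k L)} {idx : Γ → ℕ}
  {c t : Γ → FreeAlgebra k L} {fib : ℕ → Finset Γ}

namespace DualLetters

variable (D : DualLetters N K idx c t fib)

include D

theorem co_nil_evalHom (y : FreeAlgebra k Γ) : co [] (evalHom c y) = co [] y := by
  refine LinearMap.congr_fun (f := co [] ∘ₗ (evalHom c).toLinearMap) (lin_ext fun l => ?_) y
  cases l with
  | nil => simp [← wd_nil, co_wd_self]
  | cons x l =>
    rw [LinearMap.comp_apply, AlgHom.toLinearMap_apply, evalHom_wd_cons, co_nil_mul,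
      co_wd_ne (by simp), D.c_mem_len x [] ?_, zero_mul]
    have h1 := le_koszulDeg D.two_le (idx x)
    have h2 := D.one_le x
    simp
    omega

theorem evalHom_mem_lt {w : ℕ} {y : FreeAlgebra k Γ} (hy : y ∈ supp k fun l => wtW N idx l < w) :
    evalHom c y ∈ supp k fun l => l.length < w := by
  refine supp_map_mem (evalHom c).toLinearMap _ (fun l hl => ?_) hy
  exact supp_mono (fun m hm => by omega) (evalHom_wd_mem_len D.c_mem_len l)

theorem part_evalHom (w : ℕ) (y : FreeAlgebra k Γ) :
    part (fun l => l.length = w) (evalHom c y) = evalHom c (part (fun l => wtW N idx l = w) y) := by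
  refine LinearMap.congr_fun (f := part (fun l => l.length = w) ∘ₗ (evalHom c).toLinearMap)
    (g := (evalHom c).toLinearMap ∘ₗ part (fun l => wtW N idx l = w)) (lin_ext fun l => ?_) y
  simp only [LinearMap.comp_apply, AlgHom.toLinearMap_apply]
  have h := evalHom_wd_mem_len D.c_mem_len l
  by_cases hl : wtW N idx l = w
  · rw [part_wd_of (p := fun l => wtW N idx l = w) hl, part_of_mem]
    exact supp_mono (fun m hm => by omega) h
  · rw [part_wd_of_not (p := fun l => wtW N idx l = w) hl, map_zero, part_of_disjoint h]
    intro m hm hm'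
    exact hl (hm.symm.trans hm')

theorem exists_evalHom_lt (h1 : len k L 1 ≤ orthPart K 1) {w : ℕ} {y : FreeAlgebra k L}
    (hy : y ∈ supp k fun l => l.length < w) :
    ∃ z ∈ supp k fun l => degW idx l = 0 ∧ wtW N idx l < w, evalHom c z = y := by
  have : (supp k fun l : List L => l.length < w) ≤
      (supp k fun l : List Γ => degW idx l = 0 ∧ wtW N idx l < w).map
        (evalHom c).toLinearMap := by
    refine supp_le fun u hu => ?_
    obtain ⟨z, hz, hz'⟩ := D.exists_evalHom_deg_zero h1 (wd_mem_len u)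
    exact ⟨z, supp_mono (fun l hl => ⟨hl.1, by omega⟩) hz, hz'⟩
  obtain ⟨z, hz, hz'⟩ := this hy
  exact ⟨z, hz, hz'⟩

/-- The sign in the leading term of the values of the differential on the letters of index two. -/
abbrev leadSign (k : Type*) [Field k] (N : ℕ) : k := suspSign k (List.replicate N 1)

omit D in
theorem koszulDeg_two (N : ℕ) : koszulDeg N 2 = N := by simp [koszulDeg]

theorem part_evalHom_of_isFiltered {d : Γ → FreeAlgebra k Γ} (hd : IsFiltered N idx D.d₀ d) {x : Γ}
    (hx : idx x = 2) : part (fun l => l.length = N) (evalHom c (d x)) = leadSign k N • c x := by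
  rw [← sub_add_cancel (d x) (D.d₀ x), map_add, map_add, D.evalHom_d₀ x hx]
  have h1 := hd.wt x
  have h2 := D.c_mem_len x
  rw [hx, koszulDeg_two] at h1 h2
  rw [part_of_disjoint (D.evalHom_mem_lt h1) fun l hl hl' => by omega, zero_add,
    part_of_mem (Submodule.smul_mem _ _ h2)]

/-- The deformation that belongs to a differential. -/
def relSpace (c : Γ → FreeAlgebra k L) (idx : Γ → ℕ) (d : Γ → FreeAlgebra k Γ) :
    Submodule k (FreeAlgebra k L) :=
  Submodule.span k {p | ∃ x, idx x = 2 ∧ p = evalHom c (d x)}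

/-- Up to a common sign, the leading parts of the values at letters of index two are the basis `c`
of `R`. Since an element of `P` is determined by its leading part, these values span `P`. -/
theorem eq_relSpace (hR : orthPart K N = R) (hP : IsCoordPBW N R P) {d : Γ → FreeAlgebra k Γ}
    (hd : IsFiltered N idx D.d₀ d) (hdP : ∀ x, idx x = 2 → evalHom c (d x) ∈ P) :
    P = relSpace c idx d := by
  have hle : relSpace c idx d ≤ P := by
    refine Submodule.span_le.2 ?_
    rintro _ ⟨x, hx, rfl⟩
    exact hdP x hx
  refine le_antisymm (fun p hp => ?_) hle
  have h1 := hP.part_mem p hp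
  rw [← hR, ← koszulDeg_two N] at h1
  have h2 := D.expand 2 (by omega) _ h1
  rw [koszulDeg_two] at h2
  set q := part (fun l => l.length = N) p with hq
  have h3 : ∑ x ∈ fib 2, (pair k L (t x) q * leadSign k N) • evalHom c (d x) ∈
      relSpace c idx d := Submodule.sum_mem _ fun x hx => Submodule.smul_mem _ _
        (Submodule.subset_span ⟨x, (D.mem_fib _ _).1 hx, rfl⟩)
  rw [hP.eq_of_part_eq hp (hle h3) ?_]
  · exact h3
  · rw [map_sum, ← hq]
    conv_lhs => rw [h2]
    refine Finset.sum_congr rfl fun x hx => ?_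
    rw [map_smul, D.part_evalHom_of_isFiltered hd ((D.mem_fib _ _).1 hx), smul_smul, mul_assoc,
      suspSign_mul_self, mul_one]

/-- At letters of index two the values are lifts, up to sign, of the elements of `P` with leading
part `c x`; augmentedness excludes a constant term. Only the extension to index three has to be
checked, and there the PBW condition is used. -/
theorem exists_isFiltered (h1 : len k L 1 ≤ orthPart K 1) (hR : orthPart K N = R)
    (hac : IsAcyclic N idx D.d₀) (hP : IsCoordPBW N R P) :
    ∃ d, IsFiltered N idx D.d₀ d ∧ (∀ x, der (degSign k idx) d (d x) = 0) ∧
      ∀ x, idx x = 2 → evalHom c (d x) ∈ P := by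
  classical
  have hRlen : R ≤ len k L N := hR ▸ orthPart_le_len N
  have hη : leadSign k N * leadSign k N = 1 := suspSign_mul_self (k := k) _
  have hz : ∀ x, ∃ z : FreeAlgebra k Γ, idx x = 2 →
      z ∈ (supp k fun l => degW idx l = 0 ∧ wtW N idx l < N) ∧ c x + evalHom c z ∈ P := by
    intro x
    by_cases hx : idx x = 2
    · have hc := D.c_mem x
      rw [hx, koszulDeg_two, hR] at hc
      obtain ⟨p, hp, hpc⟩ := hP.exists_part _ hc
      have h2 := sub_part_mem (hP.le_supp hp)
      obtain ⟨z, hz, hz'⟩ := D.exists_evalHom_lt h1 h2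
      refine ⟨z, fun _ => ⟨hz, ?_⟩⟩
      rwa [hz', hpc, add_sub_cancel]
    · exact ⟨0, fun h => absurd h hx⟩
  choose z hz using hz
  set e : Γ → FreeAlgebra k Γ := fun x =>
    if idx x = 2 then D.d₀ x + leadSign k N • z x else D.d₀ x with he
  have he2 : ∀ x, idx x = 2 → e x = D.d₀ x + leadSign k N • z x := fun x hx => if_pos hx
  have hen : ∀ x, idx x ≠ 2 → e x = D.d₀ x := fun x hx => if_neg hx
  have hee : ∀ x, idx x = 2 → evalHom c (e x) = leadSign k N • (c x + evalHom c (z x)) :=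
    fun x hx => by rw [he2 x hx, map_add, map_smul, D.evalHom_d₀ x hx, smul_add]
  have heP : ∀ x, idx x = 2 → evalHom c (e x) ∈ P := fun x hx => by
    rw [hee x hx]
    exact Submodule.smul_mem _ _ (hz x hx).2
  have hf : IsFiltered N idx D.d₀ e := by
    refine ⟨fun x => ?_, fun x => ?_, fun x => ?_⟩
    · by_cases hx : idx x = 2
      · rw [he2 x hx]
        exact add_mem (D.isFiltered_d₀.deg x) (Submodule.smul_mem _ _
          (supp_mono (fun l hl => by omega) (hz x hx).1))
      · rw [hen x hx]
        exact D.isFiltered_d₀.deg x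
    · by_cases hx : idx x = 2
      · rw [he2 x hx, add_sub_cancel_left, hx, koszulDeg_two]
        exact Submodule.smul_mem _ _ (supp_mono (fun l hl => hl.2) (hz x hx).1)
      · rw [hen x hx]
        exact D.isFiltered_d₀.wt x
    · by_cases hx : idx x = 2
      · rw [← D.co_nil_evalHom]
        exact hP.co_nil _ (heP x hx)
      · rw [hen x hx]
        exact D.isFiltered_d₀.co_nil x
  obtain ⟨d, hd, hdd, hde⟩ := hf.exists_extension D.isHomogeneous_d₀ D.two_le D.one_le hac D.der_d₀
    (fun x hx => by
      have hN3 : koszulDeg N 3 = N + 1 := by simp [koszulDeg]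
      set y := der (degSign k idx) e (D.d₀ x) with hy
      have hd1 : D.d₀ x ∈ supp k fun l => degW idx l = 0 + 1 ∧ wtW N idx l = N + 1 :=
        supp_mono (fun l hl => by rw [hx, hN3] at hl; omega) (D.isHomogeneous_d₀ x)
      have hy0 : y ∈ supp k fun l => degW idx l = 0 ∧ wtW N idx l < N + 1 := by
        have h2 : y = der (degSign k idx) (fun x => e x - D.d₀ x) (D.d₀ x) := by
          rw [der_sub, D.der_d₀, sub_zero]
        rw [h2]
        exact der_mem_of_wt_lt D.one_le (fun x => hf.diff_mem D.isHomogeneous_d₀ x) hd1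
      -- The boundary `y` has weight at most `N` because `d₀` has square zero. It represents an
      -- element of the ideal of `P` of filtration at most `N`, hence an element of `P`.
      have hyP : evalHom c y ∈ P := by
        refine hP.mem_of_lt hRlen (D.evalHom_der_mem hf.deg heP
          (supp_mono (fun l hl => hl.1) hd1)) ?_
        exact D.evalHom_mem_lt (supp_mono (fun l hl => hl.2) hy0)
      -- So `y` evaluates to a combination of values at letters of index two. The same combination
      -- of letters is the primitive `u`, as evaluation is injective in degree zero.
      rw [D.eq_relSpace hR hP hf heP] at hyP
      have hu : ∃ u ∈ supp k fun l => degW idx l = 1 ∧ wtW N idx l < koszulDeg N 3,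
          evalHom c (der (degSign k idx) e u) = evalHom c y := by
        refine Submodule.span_induction (p := fun a _ =>
          ∃ u ∈ supp k fun l => degW idx l = 1 ∧ wtW N idx l < koszulDeg N 3,
            evalHom c (der (degSign k idx) e u) = a) ?_ ⟨0, zero_mem _, by simp⟩ ?_ ?_ hyP
        · rintro _ ⟨x, hx, rfl⟩
          refine ⟨FreeAlgebra.ι k x, ?_, by rw [der_ι]⟩
          rw [← wd_singleton]
          refine wd_mem_supp ?_
          simp [hx, koszulDeg_two, hN3]
        · rintro _ _ _ _ ⟨u, hu, rfl⟩ ⟨v, hv, rfl⟩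
          exact ⟨u + v, add_mem hu hv, by simp⟩
        · rintro a _ _ ⟨u, hu, rfl⟩
          exact ⟨a • u, Submodule.smul_mem _ _ hu, by simp⟩
      obtain ⟨u, hu, hu'⟩ := hu
      refine ⟨u, hu, sub_eq_zero.1 (D.eq_zero_of_evalHom_deg_zero' ?_ (by
        rw [map_sub, hu', sub_self]))⟩
      refine sub_mem ?_ (supp_mono (fun l hl => hl.1) hy0)
      exact supp_mono (fun l hl => hl.1) (der_mem_of_wt_le D.one_le
        (hf.deg_wt D.isHomogeneous_d₀) (j := 0) hu))
  exact ⟨d, hd, hdd, fun x hx => by rw [hde x hx.le]; exact heP x hx⟩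

/-- Values at index one vanish for degree reasons. At index two the values of both differentials
evaluate to elements of `P` with the same leading part. `IsFiltered.unique` does the rest. -/
theorem isFiltered_unique (hac : IsAcyclic N idx D.d₀) (hP : IsCoordPBW N R P)
    {d d' : Γ → FreeAlgebra k Γ} (hd : IsFiltered N idx D.d₀ d) (hd' : IsFiltered N idx D.d₀ d')
    (hdd : ∀ x, der (degSign k idx) d (d x) = 0) (hdd' : ∀ x, der (degSign k idx) d' (d' x) = 0)
    (hdP : ∀ x, idx x = 2 → evalHom c (d x) ∈ P) (hdP' : ∀ x, idx x = 2 → evalHom c (d' x) ∈ P) :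
    d = d' := by
  funext x
  refine hd.unique D.isHomogeneous_d₀ D.two_le D.one_le hac hd' hdd hdd' (fun x hx => ?_) x
  have h := D.one_le x
  obtain hx1 | hx2 : idx x = 1 ∨ idx x = 2 := by omega
  · have : ∀ {f : Γ → FreeAlgebra k Γ}, IsFiltered N idx D.d₀ f → f x = 0 := fun hf =>
      ext_co fun l => by rw [map_zero, hf.deg x l (by omega)]
    rw [this hd, this hd']
  · refine sub_eq_zero.1 (D.eq_zero_of_evalHom_deg_zero'
      (supp_mono (fun l hl => by omega) (sub_mem (hd.deg x) (hd'.deg x))) ?_)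
    rw [map_sub, sub_eq_zero]
    refine hP.eq_of_part_eq (hdP x hx2) (hdP' x hx2) ?_
    rw [D.part_evalHom_of_isFiltered hd hx2, D.part_evalHom_of_isFiltered hd' hx2]

theorem der_sub_der_part_mem {d : Γ → FreeAlgebra k Γ} (hd : IsFiltered N idx D.d₀ d) {j w : ℕ}
    {z : FreeAlgebra k Γ} (hz : z ∈ supp k fun l => degW idx l = j + 1 ∧ wtW N idx l < w + 1) :
    der (degSign k idx) d z - der (degSign k idx) D.d₀ (part (fun l => wtW N idx l = w) z) ∈
      supp k fun l => degW idx l = j ∧ wtW N idx l < w := by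
  have hz1 : part (fun l => wtW N idx l = w) z ∈
      supp k fun l => degW idx l = j + 1 ∧ wtW N idx l = w := by
    refine supp_and (fun l hl => ?_) (part_mem _ _)
    by_cases hw : wtW N idx l = w
    · rw [co_part_of (p := fun l => wtW N idx l = w) hw, hz l fun h => hl h.1]
    · rw [co_part_of_not hw]
  have hz2 : z - part (fun l => wtW N idx l = w) z ∈
      supp k fun l => degW idx l = j + 1 ∧ wtW N idx l < w :=
    supp_and (sub_mem (supp_mono (fun l hl => hl.1) hz) (supp_mono (fun l hl => hl.1) hz1))
      (sub_part_mem (supp_mono (fun l hl => hl.2) hz))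
  have h1 := der_mem_of_wt_le D.one_le (hd.deg_wt D.isHomogeneous_d₀) hz2
  have h2 := der_mem_of_wt_lt D.one_le (fun x => hd.diff_mem D.isHomogeneous_d₀ x) hz1
  rw [der_sub] at h2
  have h3 := add_mem h1 h2
  rwa [map_sub, sub_add_sub_cancel] at h3

/-- If `z` has weight above `n`, the top part of its boundary must vanish, so the top part of `z` is
a `d₀`-cycle of degree one and equals `d₀ y`. Replacing `z` by `z - d y` keeps the boundary and
lowers the weight. Once the weight is at most `n`, `a` is the image of a `d₀`-boundary. -/
theorem mem_relIdeal_of_isFiltered (hR : orthPart K N = R) (hac : IsAcyclic N idx D.d₀)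
    {d : Γ → FreeAlgebra k Γ} (hd : IsFiltered N idx D.d₀ d)
    (hdd : ∀ x, der (degSign k idx) d (d x) = 0) {n m : ℕ} {z : FreeAlgebra k Γ}
    (hz : z ∈ supp k fun l => degW idx l = 0 + 1 ∧ wtW N idx l < n + m + 1)
    {a u : FreeAlgebra k L}
    (ha : a ∈ len k L n) (hu : u ∈ supp k fun l => l.length < n)
    (h : evalHom c (der (degSign k idx) d z) = a + u) : a ∈ relIdeal R := by
  have hpart : ∀ {w : ℕ} {z : FreeAlgebra k Γ},
      (z ∈ supp k fun l => degW idx l = 0 + 1 ∧ wtW N idx l < w + 1) →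
      part (fun l => wtW N idx l = w) z ∈ supp k fun l => degW idx l = 0 + 1 ∧ wtW N idx l = w :=
    fun {w z} hz => by
      refine supp_and (fun l hl => ?_) (part_mem _ _)
      by_cases hw : wtW N idx l = w
      · rw [co_part_of (p := fun l => wtW N idx l = w) hw, hz l fun h => hl h.1]
      · rw [co_part_of_not hw]
  have htop : ∀ {w : ℕ} {z : FreeAlgebra k Γ},
      (z ∈ supp k fun l => degW idx l = 0 + 1 ∧ wtW N idx l < w + 1) →
      part (fun l => l.length = w) (evalHom c (der (degSign k idx) d z)) =
        evalHom c (der (degSign k idx) D.d₀ (part (fun l => wtW N idx l = w) z)) :=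
    fun {w z} hz => by
      have h1 := D.der_sub_der_part_mem hd hz
      have h2 := der_mem_of_homogeneous D.one_le D.isHomogeneous_d₀ (hpart hz)
      rw [D.part_evalHom, ← sub_add_cancel (der (degSign k idx) d z)
        (der (degSign k idx) D.d₀ (part (fun l => wtW N idx l = w) z)), map_add,
        part_of_disjoint h1 fun l hl hl' => by omega, zero_add,
        part_of_mem (supp_mono (fun l hl => hl.2) h2)]
  induction m generalizing z with
  | zero =>
    have h1 := htop hz
    rw [h, map_add, part_of_mem (p := fun l => l.length = n) ha,
      part_of_disjoint hu fun l hl hl' => by omega, add_zero] at h1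
    rw [h1, ← hR]
    refine D.evalHom_der_mem D.isFiltered_d₀.deg (fun x hx => ?_)
      (supp_mono (fun l hl => hl.1) (hpart hz))
    rw [D.evalHom_d₀ x hx]
    have := D.c_mem x
    rw [hx, koszulDeg_two] at this
    exact Submodule.smul_mem _ _ this
  | succ m ih =>
    have h1 := htop hz
    set z' := part (fun l => wtW N idx l = n + (m + 1)) z with hz'
    rw [h, map_add, part_of_disjoint ha fun l hl hl' => by omega,
      part_of_disjoint hu fun l hl hl' => by omega, add_zero] at h1
    have h2 := D.eq_zero_of_evalHom_deg_zero
      (der_mem_of_homogeneous D.one_le D.isHomogeneous_d₀ (hpart hz)) h1.symm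
    obtain ⟨y, hy, hy'⟩ := hac 1 le_rfl _ z' (hpart hz) h2
    have hy1 : y ∈ supp k fun l => degW idx l = 1 + 1 ∧ wtW N idx l < n + (m + 1) + 1 :=
      supp_mono (fun l hl => ⟨hl.1, by omega⟩) hy
    refine ih (z := z - der (degSign k idx) d y) ?_ ?_
    · have h3 := D.der_sub_der_part_mem hd hy1
      rw [part_of_mem (supp_mono (fun l hl => hl.2) hy), hy'] at h3
      have h4 : z - z' ∈ supp k fun l => degW idx l = 0 + 1 ∧ wtW N idx l < n + (m + 1) :=
        supp_and (sub_mem (supp_mono (fun l hl => hl.1) hz)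
          (supp_mono (fun l hl => hl.1) (hpart hz)))
          (sub_part_mem (supp_mono (fun l hl => hl.2) hz))
      have h5 := sub_mem h4 h3
      rwa [sub_sub_sub_cancel_right] at h5
    · rw [map_sub, hd.der_der D.one_le (i := 3) (fun x _ => hdd x)
        (supp_mono (fun l hl => by omega) hy), sub_zero, h]

/-- Elements of the ideal of `P` are images of boundaries of degree one, so the condition on the
associated graded algebra is `mem_relIdeal_of_isFiltered`. The other conditions follow from the
leading parts `± c x` and the absence of empty words in `d`. -/
theorem isCoordPBW_relSpace (h1 : len k L 1 ≤ orthPart K 1) (hR : orthPart K N = R)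
    (hac : IsAcyclic N idx D.d₀) {d : Γ → FreeAlgebra k Γ} (hd : IsFiltered N idx D.d₀ d)
    (hdd : ∀ x, der (degSign k idx) d (d x) = 0) : IsCoordPBW N R (relSpace c idx d) := by
  have hc : ∀ x, idx x = 2 → c x ∈ R := fun x hx => by
    have := D.c_mem x
    rwa [hx, koszulDeg_two, hR] at this
  have hη : leadSign k N * leadSign k N = 1 := suspSign_mul_self (k := k) _
  have hsum : ∀ r ∈ R, ∑ x ∈ fib 2, pair k L (t x) r • c x = r := fun r hr => by
    rw [← hR, ← koszulDeg_two N] at hr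
    exact (D.expand 2 (by omega) r hr).symm
  refine ⟨?_, fun p hp hpN => ?_, fun p hp => ?_, fun r hr => ?_, fun n a ha u hu h => ?_,
    fun p hp => ?_⟩
  · refine Submodule.span_le.2 ?_
    rintro _ ⟨x, hx, rfl⟩
    refine D.evalHom_mem_lt (supp_mono (fun l hl => ?_) (hd.deg_wt D.isHomogeneous_d₀ x))
    rw [hx, koszulDeg_two] at hl
    omega
  · have key : p = ∑ x ∈ fib 2, (pair k L (t x) (part (fun l => l.length = N) p) *
        leadSign k N) • evalHom c (d x) := by
      clear hpN
      refine Submodule.span_induction (p := fun p _ =>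
        p = ∑ x ∈ fib 2, (pair k L (t x) (part (fun l => l.length = N) p) *
        leadSign k N) • evalHom c (d x)) ?_ (by simp) ?_ ?_ hp
      · rintro _ ⟨x, hx, rfl⟩
        rw [Finset.sum_eq_single_of_mem x ((D.mem_fib _ _).2 hx),
          D.part_evalHom_of_isFiltered hd hx, map_smul, D.dual_self, smul_eq_mul, mul_one, hη,
          one_smul]
        intro z hz hzx
        rw [D.mem_fib] at hz
        rw [D.part_evalHom_of_isFiltered hd hx, map_smul, D.dual_ne z x (by omega) hzx, smul_zero,
          zero_mul, zero_smul]
      · intro p q _ _ hp hq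
        conv_lhs => rw [hp, hq]
        simp only [map_add, add_mul, add_smul, Finset.sum_add_distrib]
      · intro s p _ hp
        conv_lhs => rw [hp]
        simp only [map_smul, smul_eq_mul, mul_assoc, mul_smul, Finset.smul_sum]
    rw [key]
    rw [part_of_disjoint hpN fun l hl hl' => by omega]
    simp
  · refine Submodule.span_induction (p := fun p _ => part (fun l => l.length = N) p ∈ R) ?_
      (by simp) (fun p q _ _ hp hq => by rw [map_add]; exact add_mem hp hq)
      (fun s p _ hp => by rw [map_smul]; exact Submodule.smul_mem _ _ hp) hp
    rintro _ ⟨x, hx, rfl⟩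
    rw [D.part_evalHom_of_isFiltered hd hx]
    exact Submodule.smul_mem _ _ (hc x hx)
  · refine ⟨∑ x ∈ fib 2, (pair k L (t x) r * leadSign k N) • evalHom c (d x),
      Submodule.sum_mem _ fun x hx => Submodule.smul_mem _ _
        (Submodule.subset_span ⟨x, (D.mem_fib _ _).1 hx, rfl⟩), ?_⟩
    rw [map_sum]
    refine Eq.trans (Finset.sum_congr rfl fun x hx => ?_) (hsum r hr)
    rw [map_smul, D.part_evalHom_of_isFiltered hd ((D.mem_fib _ _).1 hx), smul_smul, mul_assoc,
      hη, mul_one]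
  · obtain ⟨z, hz, hz'⟩ := D.exists_evalHom_der h1 hd.deg (P := relSpace c idx d) (fun p hp => by
      refine Submodule.span_induction (p := fun p _ => ∃ z ∈ supp k fun l => degW idx l = 1,
        evalHom c (der (degSign k idx) d z) = p) ?_ ⟨0, zero_mem _, by simp⟩ ?_ ?_ hp
      · rintro _ ⟨x, hx, rfl⟩
        refine ⟨FreeAlgebra.ι k x, ?_, by rw [der_ι]⟩
        rw [← wd_singleton]
        exact wd_mem_supp (by simp [hx])
      · rintro _ _ _ _ ⟨u, hu, rfl⟩ ⟨v, hv, rfl⟩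
        exact ⟨u + v, add_mem hu hv, by simp⟩
      · rintro a _ _ ⟨u, hu, rfl⟩
        exact ⟨a • u, Submodule.smul_mem _ _ hu, by simp⟩) h
    obtain ⟨m, hm⟩ := exists_mem_supp_lt (wtW N idx) z
    exact D.mem_relIdeal_of_isFiltered hR hac hd hdd
      (supp_and (supp_mono (fun l hl => by omega) hz) (supp_mono (fun l hl => by omega) hm) :
        z ∈ supp k fun l => degW idx l = 0 + 1 ∧ wtW N idx l < n + m + 1) ha hu hz'
  · refine Submodule.span_induction (p := fun p _ => co [] p = 0) ?_ (by simp)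
      (fun p q _ _ hp hq => by rw [map_add, hp, hq, add_zero])
      (fun s p _ hp => by rw [map_smul, hp, smul_zero]) hp
    rintro _ ⟨x, -, rfl⟩
    rw [D.co_nil_evalHom, hd.co_nil]

end DualLetters

end FilteredPBW

/-! ### PBW-deformations in coordinates -/

section PBWCoordinates

variable {k : Type*} {V : Type*} [Field k] [AddCommGroup V] [Module k V] {L : Type*}
  (b : Module.Basis L k V) {N : ℕ} {R P : Submodule k (TensorAlgebra k V)}

theorem toQuotDeg_eq_zero {l : ℕ} {a : tensorDeg k V l} :
    toQuotDeg R l a = 0 ↔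
      coordEquiv b a ∈ relIdeal (R.map (coordEquiv b).toLinearMap) := by
  rw [← quotHom_eq_zero b, ← Submodule.coe_eq_zero]
  rfl

theorem toGrPiece_eq_zero {l : ℕ} {a : tensorDeg k V l} :
    toGrPiece P l a = 0 ↔ ∃ u ∈ supp k fun m : List L => m.length < l,
      coordEquiv b a + u ∈ relIdeal (P.map (coordEquiv b).toLinearMap) := by
  have h1 : toGrPiece P l a = 0 ↔ quotHom P a ∈ quotFilLT P l := by
    rw [toGrPiece, LinearMap.comp_apply, Submodule.mkQ_apply, Submodule.Quotient.mk_eq_zero,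
      Submodule.submoduleOf, Submodule.mem_comap]
    rfl
  rw [h1]
  constructor
  · rintro ⟨u, hu, hu'⟩
    refine ⟨-coordEquiv b u, neg_mem ((coordEquiv_mem_supp_lt b).2 hu), ?_⟩
    rw [← sub_eq_add_neg, ← map_sub, ← quotHom_eq_zero b, map_sub, sub_eq_zero]
    exact hu'.symm
  · rintro ⟨u, hu, hu'⟩
    refine ⟨-(coordEquiv b).symm u, neg_mem ?_, ?_⟩
    · rw [← coordEquiv_mem_supp_lt b]
      simpa using hu
    · rw [← (coordEquiv b).apply_symm_apply u, ← map_add, ← quotHom_eq_zero b, map_add] at hu'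
      rw [AlgHom.toLinearMap_apply, map_neg]
      exact (eq_neg_of_add_eq_zero_left hu').symm

theorem toQuotDeg_surjective (l : ℕ) : Function.Surjective (toQuotDeg R l) :=
  LinearMap.submoduleMap_surjective _ _

theorem toGrPiece_surjective (l : ℕ) : Function.Surjective (toGrPiece P l) := by
  intro y
  obtain ⟨⟨_, a, ha, rfl⟩, rfl⟩ := Submodule.Quotient.mk_surjective _ y
  let b := Module.Free.chooseBasis k V
  have ha' := (coordEquiv_mem_supp_lt b).2 ha
  have h1 := sub_part_mem ha'
  refine ⟨⟨tensorProj k V l a, ?_⟩, ?_⟩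
  · rw [← coordEquiv_mem_len b, coordEquiv_tensorProj]
    exact part_mem _ _
  · rw [toGrPiece, LinearMap.comp_apply, Submodule.mkQ_apply, Submodule.Quotient.eq,
      Submodule.submoduleOf, Submodule.mem_comap]
    refine ⟨tensorProj k V l a - a, ?_, by simp; rfl⟩
    rw [SetLike.mem_coe, ← coordEquiv_mem_supp_lt b, ← neg_sub, map_neg, map_sub, coordEquiv_tensorProj]
    exact neg_mem h1

/-- The spaces `A_l` and `gr_l U` are quotients of the same space of tensors. An isomorphism
compatible with the projections exists if and only if the kernels agree, and one inclusion of
kernels is `exists_add_mem`. -/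
theorem isAugmentedPBWDeformation_iff (hR : R ≤ tensorDeg k V N) :
    IsAugmentedPBWDeformation N R P ↔
      IsCoordPBW N (R.map (coordEquiv b).toLinearMap) (P.map (coordEquiv b).toLinearMap) := by
  have hR' : R.map (coordEquiv b).toLinearMap ≤ len k L N := by
    rintro _ ⟨r, hr, rfl⟩
    exact (coordEquiv_mem_len b).2 (hR hr)
  constructor
  · intro h
    refine ⟨?_, ?_, ?_, ?_, fun l a ha u hu hau => ?_, ?_⟩
    · rintro _ ⟨p, hp, rfl⟩
      exact (coordEquiv_mem_supp_lt b).2 (h.le_fil hp)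
    · rintro _ ⟨p, hp, rfl⟩ hpN
      have : p ∈ P ⊓ tensorFilLT k V N := ⟨hp, (coordEquiv_mem_supp_lt b).1 hpN⟩
      rw [h.inf_eq_bot, Submodule.mem_bot] at this
      simp [this]
    · rintro _ ⟨p, hp, rfl⟩
      refine ⟨tensorProj k V N p, ?_, coordEquiv_tensorProj b N p⟩
      rw [SetLike.mem_coe, ← h.map_proj]
      exact Submodule.mem_map_of_mem hp
    · rintro _ ⟨r, hr, rfl⟩
      rw [SetLike.mem_coe, ← h.map_proj] at hr
      obtain ⟨p, hp, rfl⟩ := hr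
      exact ⟨_, Submodule.mem_map_of_mem hp, (coordEquiv_tensorProj b N p).symm⟩
    · obtain ⟨e, he⟩ := h.gr_iso l
      obtain ⟨a, rfl⟩ := (coordEquiv b).surjective a
      have h1 : toGrPiece P l ⟨a, (coordEquiv_mem_len b).1 ha⟩ = 0 :=
        (toGrPiece_eq_zero b).2 ⟨u, hu, hau⟩
      rw [← he, LinearEquiv.map_eq_zero_iff, toQuotDeg_eq_zero b] at h1
      exact h1
    · rintro _ ⟨p, hp, rfl⟩
      have h1 := congrArg (co []) (coordEquiv_tensorProj b 0 p)
      rw [h.proj_zero p hp, co_part_of (p := fun l => l.length = 0) rfl, map_zero, map_zero] at h1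
      exact h1.symm
  · intro h
    refine ⟨⟨?_, ?_, ?_, fun l => ?_⟩, ?_⟩
    · intro p hp
      exact (coordEquiv_mem_supp_lt b).1 (h.le_supp (Submodule.mem_map_of_mem hp))
    · rw [eq_bot_iff]
      rintro p ⟨hp, hpN⟩
      have := h.eq_zero _ (Submodule.mem_map_of_mem hp) ((coordEquiv_mem_supp_lt b).2 hpN)
      rw [AlgEquiv.toLinearMap_apply, EmbeddingLike.map_eq_zero_iff] at this
      exact this
    · refine le_antisymm ?_ fun r hr => ?_
      · rintro _ ⟨p, hp, rfl⟩
        obtain ⟨r, hr, hrp⟩ := h.part_mem _ (Submodule.mem_map_of_mem hp)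
        rw [AlgEquiv.toLinearMap_apply, AlgEquiv.toLinearMap_apply, ← coordEquiv_tensorProj] at hrp
        rwa [← (coordEquiv b).injective hrp]
      · obtain ⟨_, ⟨p, hp, rfl⟩, hrp⟩ := h.exists_part _ (Submodule.mem_map_of_mem hr)
        rw [AlgEquiv.toLinearMap_apply, AlgEquiv.toLinearMap_apply, ← coordEquiv_tensorProj] at hrp
        rw [← (coordEquiv b).injective hrp]
        exact Submodule.mem_map_of_mem hp
    · have hker : LinearMap.ker (toQuotDeg R l) = LinearMap.ker (toGrPiece P l) := by
        ext a
        rw [LinearMap.mem_ker, LinearMap.mem_ker, toQuotDeg_eq_zero b, toGrPiece_eq_zero b]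
        constructor
        · intro ha
          exact h.exists_add_mem hR' ((coordEquiv_mem_len b).2 a.2) ha
        · rintro ⟨u, hu, hau⟩
          exact h.gr l _ ((coordEquiv_mem_len b).2 a.2) u hu hau
      refine ⟨((toQuotDeg R l).quotKerEquivOfSurjective (toQuotDeg_surjective l)).symm.trans
        ((Submodule.quotEquivOfEq _ _ hker).trans
          ((toGrPiece P l).quotKerEquivOfSurjective (toGrPiece_surjective l))), fun a => ?_⟩
      have : ((toQuotDeg R l).quotKerEquivOfSurjective (toQuotDeg_surjective l)).symm
          (toQuotDeg R l a) = Submodule.Quotient.mk a := by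
        rw [LinearEquiv.symm_apply_eq]
        rfl
      rw [LinearEquiv.trans_apply, this]
      rfl
    · intro p hp
      refine (coordEquiv b).injective (ext_co fun l => ?_)
      rw [coordEquiv_tensorProj, map_zero, map_zero]
      by_cases hl : l.length = 0
      · rw [co_part_of (p := fun l => l.length = 0) hl, List.length_eq_zero_iff.1 hl]
        exact h.co_nil _ (Submodule.mem_map_of_mem hp)
      · rw [co_part_of_not hl]

end PBWCoordinates

/-! ### Operations and derivations -/

section Operations

variable {k : Type*} [Field k] {B : ℕ → Type*} [∀ i, AddCommGroup (B i)] [∀ i, Module k (B i)]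
  {X : Type*}

/-- A basis of a graded space that consists of homogeneous elements. -/
structure GradedBasis (idx : X → ℕ) (fib : ℕ → Finset X) (e : Module.Basis X k (⨁ i, B i)) :
    Prop where
  mem_fib : ∀ i x, x ∈ fib i ↔ idx x = i
  repr_lof : ∀ i (y : B i) x, idx x ≠ i → e.repr (DirectSum.lof k ℕ B i y) x = 0
  homogeneous : ∀ x, ∃ y : B (idx x), e x = DirectSum.lof k ℕ B (idx x) y

/-- The letters whose index is the degree of the value of an operation. -/
def outLetters (idx : X → ℕ) (fib : ℕ → Finset X) (l : List X) : Finset X :=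
  fib ((l.map idx).sum + 2 - l.length)

/-- The element of degree one of the free algebra that belongs to an element with given
coordinates. -/
def letterMap (e : Module.Basis X k (⨁ i, B i)) : (⨁ i, B i) →ₗ[k] FreeAlgebra k X :=
  e.constr k (FreeAlgebra.ι k)

/-- The values of the operations that belong to a derivation, as a map on words. -/
def opVal (idx : X → ℕ) (fib : ℕ → Finset X) (e : Module.Basis X k (⨁ i, B i))
    (f : X → FreeAlgebra k X) : FreeAlgebra k X →ₗ[k] ⨁ i, B i :=
  wordLift fun l => suspSign k (l.map idx) • ∑ x ∈ outLetters idx fib l, co l (f x) • e x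

/-- The operations that belong to a derivation. -/
def op (idx : X → ℕ) (fib : ℕ → Finset X) (e : Module.Basis X k (⨁ i, B i))
    (f : X → FreeAlgebra k X) (n : ℕ) :
    MultilinearMap k (fun _ : Fin n => ⨁ i, B i) (⨁ i, B i) :=
  (opVal idx fib e f).compMultilinearMap
    ((MultilinearMap.mkPiAlgebraFin k n (FreeAlgebra k X)).compLinearMap fun _ => letterMap e)

/-- The values of a derivation on the letters have the degree of the operations of an
`A∞`-structure. -/
def IsOperadic (idx : X → ℕ) (f : X → FreeAlgebra k X) : Prop :=
  ∀ x l, co l (f x) ≠ 0 → idx x + l.length = (l.map idx).sum + 2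

variable {idx : X → ℕ} {fib : ℕ → Finset X} {e : Module.Basis X k (⨁ i, B i)}
  {f : X → FreeAlgebra k X}

@[simp] theorem letterMap_basis (x : X) : letterMap e (e x) = FreeAlgebra.ι k x := by
  simp [letterMap]

theorem op_apply (n : ℕ) (x : Fin n → ⨁ i, B i) :
    op idx fib e f n x = opVal idx fib e f (List.ofFn fun j => letterMap e (x j)).prod := by
  simp [op, MultilinearMap.mkPiAlgebraFin_apply]

theorem op_basis (n : ℕ) (x : Fin n → X) :
    op idx fib e f n (fun j => e (x j)) = opVal idx fib e f (wd k (List.ofFn x)) := by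
  rw [op_apply]
  simp only [letterMap_basis]
  rw [wd, List.map_ofFn]
  rfl

namespace GradedBasis

variable (H : GradedBasis idx fib e)

include H

theorem mem_outLetters (hf : IsOperadic idx f) (l : List X) (x : X) (h : co l (f x) ≠ 0) :
    x ∈ outLetters idx fib l := by
  rw [outLetters, H.mem_fib]
  have := hf x l h
  omega

theorem repr_opVal (hf : IsOperadic idx f) (l : List X) (x : X) :
    e.repr (opVal idx fib e f (wd k l)) x = suspSign k (l.map idx) * co l (f x) := by
  classical
  rw [opVal, wordLift_wd, map_smul, map_sum, Finsupp.smul_apply, Finsupp.finsetSum_apply,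
    smul_eq_mul]
  congr 1
  simp only [map_smul, Module.Basis.repr_self, Finsupp.smul_apply, Finsupp.single_apply, smul_eq_mul,
    mul_ite, mul_one, mul_zero]
  rw [Finset.sum_ite_eq' (outLetters idx fib l) x]
  split_ifs with h
  · rfl
  · by_contra h0
    exact h (H.mem_outLetters hf l x (Ne.symm h0))

omit H in
theorem letterMap_opVal (l : List X) :
    letterMap e (opVal idx fib e f (wd k l)) =
      suspSign k (l.map idx) • transLetter f (outLetters idx fib) l := by
  rw [opVal, wordLift_wd, map_smul, map_sum, transLetter]
  simp

theorem letterMap_lof_mem (i : ℕ) (y : B i) :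
    letterMap e (DirectSum.lof k ℕ B i y) ∈ supp k fun l => l.map idx = [i] := by
  rw [letterMap, Module.Basis.constr_apply]
  refine Submodule.sum_mem _ fun x hx => Submodule.smul_mem _ _ ?_
  rw [← wd_singleton]
  refine wd_mem_supp ?_
  by_contra h
  refine Finsupp.mem_support_iff.1 hx (H.repr_lof i y x fun h' => h ?_)
  simp [h']

theorem prod_letterMap_mem (d : ℕ → ℕ) (x : ∀ j, B (d j)) (n : ℕ) :
    ((List.range n).map fun j => letterMap e (DirectSum.lof k ℕ B (d j) (x j))).prod ∈
      supp k fun l => l.map idx = (List.range n).map d := by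
  induction n with
  | zero => exact wd_mem_supp (l := []) rfl
  | succ n ih =>
    simp only [List.range_succ, List.map_append, List.prod_append, List.map_singleton,
      List.prod_singleton]
    refine supp_mul (fun l m hl hm => ?_) ih (H.letterMap_lof_mem (d n) (x n))
    rw [List.map_append, hl, hm]

theorem prod_letterMap_ofFn_mem {n : ℕ} (d : Fin n → ℕ) (x : ∀ j, B (d j)) :
    (List.ofFn fun j => letterMap e (DirectSum.lof k ℕ B (d j) (x j))).prod ∈
      supp k fun l => l.map idx = List.ofFn d := by
  induction n with
  | zero => exact wd_mem_supp (l := []) (by simp)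
  | succ n ih =>
    simp only [List.ofFn_succ, List.prod_cons]
    refine supp_mul (fun l m hl hm => ?_) (H.letterMap_lof_mem (d 0) (x 0))
      (ih (fun j => d j.succ) fun j => x j.succ)
    rw [List.map_append, hl, hm]
    rfl

theorem op_degree (hf : IsOperadic idx f) (n : ℕ) (d : Fin n → ℕ) (x : ∀ j, B (d j)) (i : ℕ)
    (hi : (i : ℤ) ≠ (∑ j, (d j : ℤ)) + 2 - n) :
    op idx fib e f n (fun j => DirectSum.lof k ℕ B (d j) (x j)) i = 0 := by
  rw [op_apply]
  refine supp_map_mem (DirectSum.component k ℕ B i ∘ₗ opVal idx fib e f) ⊥ (fun l hl => ?_)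
    (H.prod_letterMap_ofFn_mem d x)
  have hlen : l.length = n := by simpa using congrArg List.length hl
  have hsum : ((l.map idx).sum : ℤ) = ∑ j, (d j : ℤ) := by rw [hl, List.sum_ofFn]; push_cast; rfl
  rw [Submodule.mem_bot, LinearMap.comp_apply, opVal, wordLift_wd, map_smul, map_sum,
    Finset.sum_eq_zero, smul_zero]
  intro z _
  rw [map_smul]
  by_cases h : co l (f z) = 0
  · rw [h, zero_smul]
  · have h1 := hf z l h
    obtain ⟨y, hy⟩ := H.homogeneous z
    rw [hy, DirectSum.component.of, dif_neg, smul_zero]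
    intro h2
    apply hi
    rw [← hsum]
    omega

end GradedBasis

variable (idx fib e f) in
/-- The value of an operation, inserted in a word. -/
def substOp (r s : ℕ) : FreeAlgebra k X →ₗ[k] FreeAlgebra k X :=
  wordLift fun l => wd k (l.take r) *
    letterMap e (opVal idx fib e f (wd k ((l.drop r).take s))) * wd k (l.drop (r + s))

theorem substOp_mul {r s : ℕ} {a b c : FreeAlgebra k X} (ha : a ∈ len k X r) (hb : b ∈ len k X s) :
    substOp idx fib e f r s (a * b * c) = a * letterMap e (opVal idx fib e f b) * c := by
  refine supp_ext (f := substOp idx fib e f r s ∘ₗ LinearMap.mulRight k c ∘ₗ LinearMap.mulRight k b)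
    (g := LinearMap.mulRight k c ∘ₗ LinearMap.mulRight k (letterMap e (opVal idx fib e f b)))
    (fun l hl => ?_) ha
  refine supp_ext (f := substOp idx fib e f r s ∘ₗ LinearMap.mulRight k c ∘ₗ
      LinearMap.mulLeft k (wd k l))
    (g := LinearMap.mulRight k c ∘ₗ LinearMap.mulLeft k (wd k l) ∘ₗ letterMap e ∘ₗ
      opVal idx fib e f) (fun m hm => ?_) hb
  refine LinearMap.congr_fun (f := substOp idx fib e f r s ∘ₗ LinearMap.mulLeft k (wd k l * wd k m))
    (g := LinearMap.mulLeft k (wd k l * letterMap e (opVal idx fib e f (wd k m))))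
    (lin_ext fun p => ?_) c
  subst hl hm
  simp only [LinearMap.comp_apply, LinearMap.mulLeft_apply]
  rw [← wd_append, ← wd_append, substOp, wordLift_wd]
  congr 2
  · simp
  · simp
  · simp [← List.drop_drop]

theorem ofFn_prod_eq (g : ℕ → FreeAlgebra k X) (n : ℕ) :
    (List.ofFn fun j : Fin n => g j).prod = ((List.range n).map g).prod := by
  congr 1
  refine List.ext_getElem (by simp) fun i h1 h2 => by simp

theorem range_map_prod_add (g : ℕ → FreeAlgebra k X) (a b : ℕ) :
    ((List.range (a + b)).map g).prod =
      ((List.range a).map g).prod * ((List.range b).map fun j => g (a + j)).prod := by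
  rw [List.range_add, List.map_append, List.prod_append, List.map_map]
  rfl

theorem range_map_prod_mem {g : ℕ → FreeAlgebra k X} (hg : ∀ j, g j ∈ len k X 1) (n : ℕ) :
    ((List.range n).map g).prod ∈ len k X n := by
  induction n with
  | zero => exact one_mem_len
  | succ n ih =>
    rw [List.range_succ, List.map_append, List.prod_append, List.map_singleton, List.prod_singleton]
    exact len_mul ih (hg n)

theorem letterMap_mem_len (y : ⨁ i, B i) : letterMap e y ∈ len k X 1 := by
  rw [letterMap, Module.Basis.constr_apply]
  refine Submodule.sum_mem _ fun x hx => Submodule.smul_mem _ _ ?_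
  rw [← wd_singleton]
  exact wd_mem_len [x]

theorem op_insertArg (x : ℕ → ⨁ i, B i) {n r s : ℕ} (h : r + s ≤ n) :
    op idx fib e f (n - s + 1) (fun j : Fin (n - s + 1) =>
      insertArg x r s (op idx fib e f s fun i : Fin s => x (r + i)) j) =
    opVal idx fib e f (substOp idx fib e f r s
      ((List.range n).map fun j => letterMap e (x j)).prod) := by
  obtain ⟨p, rfl⟩ := Nat.exists_eq_add_of_le h
  rw [op_apply, op_apply, ofFn_prod_eq (fun j => letterMap e (insertArg x r s _ j)),
    ofFn_prod_eq (fun j => letterMap e (x (r + j))), show r + s + p - s + 1 = r + 1 + p by omega,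
    range_map_prod_add, range_map_prod_add, range_map_prod_add, range_map_prod_add,
    substOp_mul (range_map_prod_mem (fun _ => letterMap_mem_len _) r)
      (range_map_prod_mem (fun _ => letterMap_mem_len _) s)]
  congr 2
  · congr 1
    · congr 1
      refine List.map_congr_left fun j hj => ?_
      rw [insertArg, if_pos (by simpa using hj)]
    · simp [insertArg]
  · congr 1
    refine List.map_congr_left fun j _ => ?_
    rw [insertArg, if_neg (by omega), if_neg (by omega)]
    congr 2
    omega

namespace GradedBasis

variable (H : GradedBasis idx fib e)

include H

omit H in
theorem sgn_degSign_map (l : List X) :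
    sgn (degSign k idx) l = sgn (fun d : ℕ => (-1 : k) ^ (d + 1)) (l.map idx) := by
  induction l with
  | nil => simp
  | cons x l ih => simp [ih, degSign]

/-- Each term of a Stasheff identity corresponds to the contraction of one subword in the transposed
derivation. The signs are matched by `suspSign_stasheff`, whose degree condition is available
wherever the inner coefficient is nonzero. -/
theorem repr_opVal_substOp (hf : IsOperadic idx f) (l : List X) {r s : ℕ} (h : r + s ≤ l.length)
    (z : X) :
    (-1 : k) ^ (r + s * (l.length - r - s) + s * ((l.take r).map idx).sum) *
      e.repr (opVal idx fib e f (substOp idx fib e f r s (wd k l))) z =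
    suspSign k (l.map idx) * pair k X (sgn (degSign k idx) (l.take r) • (wd k (l.take r) *
      transLetter f (outLetters idx fib) ((l.drop r).take s) * wd k (l.drop (r + s)))) (f z) := by
  set p := l.take r with hp
  set m := (l.drop r).take s with hm
  set q := l.drop (r + s) with hq
  have hpl : p.length = r := by simp [hp]; omega
  have hml : m.length = s := by simp [hm]; omega
  have hql : q.length = l.length - r - s := by simp [hq]; omega
  have hl : l = p ++ m ++ q := by
    rw [hp, hm, hq, List.append_assoc, ← List.drop_drop, List.take_append_drop,
      List.take_append_drop]
  rw [substOp, wordLift_wd, ← hp, ← hm, ← hq, letterMap_opVal, transLetter]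
  simp only [Finset.mul_sum, Finset.sum_mul, map_smul, mul_smul_comm, smul_mul_assoc, map_sum,
    Finsupp.smul_apply, Finsupp.finsetSum_apply, smul_eq_mul, LinearMap.sum_apply,
    LinearMap.smul_apply]
  refine Finset.sum_congr rfl fun x _ => ?_
  by_cases hx : co m (f x) = 0
  · simp [hx]
  · have h1 := hf x m hx
    have h2 := suspSign_stasheff k (p.map idx) (m.map idx) (q.map idx) (idx x)
      (by rw [List.length_map]; exact h1)
    rw [← sgn_degSign_map, ← List.map_append, ← List.map_append, ← hl] at h2
    simp only [List.length_map, hpl, hml, hql] at h2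
    rw [← wd_singleton, mul_assoc, ← wd_append, ← wd_append, H.repr_opVal hf, pair_wd_left,
      List.map_append, List.map_append, List.map_singleton, List.singleton_append]
    have h3 : sgn (degSign k idx) p * sgn (degSign k idx) p = 1 := by
      rw [sgn_degSign_map, sgn_eq_pow, ← mul_pow]
      simp
    have h4 : ((-1 : k) ^ (r + s * (l.length - r - s) + s * (p.map idx).sum)) *
        (-1) ^ (r + s * (l.length - r - s) + s * (p.map idx).sum) = 1 := by
      rw [← mul_pow]
      simp
    simp only [List.singleton_append]
    set E := (-1 : k) ^ (r + s * (l.length - r - s) + s * (p.map idx).sum)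
    set A := suspSign k (m.map idx)
    set A' := suspSign k (p.map idx ++ idx x :: q.map idx)
    set S := suspSign k (l.map idx)
    set G := sgn (degSign k idx) p
    have h5 : E * A * A' = S * G := by
      calc E * A * A' = E * (G * G) * A * A' := by rw [h3, mul_one]
        _ = E * G * (G * A * A') := by ring
        _ = (E * E) * (S * G) := by rw [h2]; ring
        _ = S * G := by rw [h4, one_mul]
    linear_combination (co m (f x) * co (p ++ x :: q) (f z)) * h5

/-- This is the dictionary used in both directions: up to an invertible sign, the entries of a
Stasheff expression are the coefficients of the square of the derivation. -/
theorem repr_stasheff_sum (hf : IsOperadic idx f) (hnil : ∀ x, co [] (f x) = 0) (l : List X)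
    (z : X) :
    e.repr (∑ r ∈ Finset.range l.length, ∑ s ∈ Finset.Icc 1 (l.length - r),
      (-1 : k) ^ (r + s * (l.length - r - s) + s * ((l.take r).map idx).sum) •
        opVal idx fib e f (substOp idx fib e f r s (wd k l))) z =
    suspSign k (l.map idx) * co l (der (degSign k idx) f (f z)) := by
  rw [co_der (T := outLetters idx fib) _ _ (H.mem_outLetters hf) hnil, bar]
  simp only [map_sum, Finsupp.finsetSum_apply, LinearMap.sum_apply, Finset.mul_sum]
  refine Finset.sum_congr rfl fun r hr => Finset.sum_congr rfl fun s hs => ?_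
  rw [Finset.mem_range] at hr
  rw [Finset.mem_Icc] at hs
  rw [← H.repr_opVal_substOp hf l (by omega), map_smul, Finsupp.smul_apply, smul_eq_mul]

/-- The `A∞`-structure that belongs to a differential. -/
def aInfinity (hf : IsOperadic idx f) (hnil : ∀ x, co [] (f x) = 0)
    (hd : ∀ x, der (degSign k idx) f (f x) = 0) : AInfinityStructure k B where
  m := op idx fib e f
  m_zero := by
    refine MultilinearMap.ext fun x => ?_
    rw [op_apply, zero_apply]
    simp [opVal, ← wd_nil, hnil]
  degree := H.op_degree hf
  stasheff := fun n hn d x => by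
    have hterm : ∀ r ∈ Finset.range n, ∀ s ∈ Finset.Icc 1 (n - r),
        op idx fib e f (n - s + 1) (fun j : Fin (n - s + 1) =>
          insertArg (fun i => DirectSum.lof k ℕ B (d i) (x i)) r s
            (op idx fib e f s fun i : Fin s => DirectSum.lof k ℕ B (d (r + i)) (x (r + i))) j) =
        opVal idx fib e f (substOp idx fib e f r s ((List.range n).map fun j =>
          letterMap e (DirectSum.lof k ℕ B (d j) (x j))).prod) := fun r hr s hs => by
      rw [Finset.mem_range] at hr
      rw [Finset.mem_Icc] at hs
      exact op_insertArg (fun i => DirectSum.lof k ℕ B (d i) (x i)) (by omega)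
    rw [Finset.sum_congr rfl fun r hr => Finset.sum_congr rfl fun s hs => by rw [hterm r hr s hs]]
    have key : (∑ r ∈ Finset.range n, ∑ s ∈ Finset.Icc 1 (n - r),
        (-1 : k) ^ (r + s * (n - r - s) + s * ∑ j ∈ Finset.range r, d j) •
          (opVal idx fib e f ∘ₗ substOp idx fib e f r s)) ((List.range n).map fun j =>
            letterMap e (DirectSum.lof k ℕ B (d j) (x j))).prod = 0 := by
      refine supp_ext (g := 0) (fun l hl => ?_) (H.prod_letterMap_mem d x n)
      have hlen : l.length = n := by simpa using congrArg List.length hl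
      refine e.ext_elem fun z => ?_
      have h1 := H.repr_stasheff_sum hf hnil l z
      rw [hd, map_zero, mul_zero] at h1
      rw [LinearMap.zero_apply, map_zero, Finsupp.zero_apply, ← h1]
      simp only [LinearMap.sum_apply, LinearMap.smul_apply, LinearMap.comp_apply, hlen]
      congr 2
      refine Finset.sum_congr rfl fun r hr => Finset.sum_congr rfl fun s _ => ?_
      have hr' : ((l.take r).map idx).sum = ∑ j ∈ Finset.range r, d j := by
        rw [Finset.mem_range] at hr
        rw [List.map_take, hl, ← List.map_take, List.take_range, min_eq_left hr.le]
        rfl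
      rw [hr']
    simpa only [LinearMap.sum_apply, LinearMap.smul_apply, LinearMap.comp_apply] using key

/-- The operations of an `A∞`-structure come from a derivation of square zero. -/
theorem der_der_of_aInfinity (hf : IsOperadic idx f) (hnil : ∀ x, co [] (f x) = 0)
    (μ : AInfinityStructure k B) (hμ : ∀ n, μ.m n = op idx fib e f n) (z : X) :
    der (degSign k idx) f (f z) = 0 := by
  refine ext_co fun l => ?_
  rw [map_zero]
  rcases l.eq_nil_or_concat with rfl | hne
  · rw [co_der (T := outLetters idx fib) _ _ (H.mem_outLetters hf) hnil]
    simp [bar]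
  have hpos : 1 ≤ l.length := by
    obtain ⟨l', a, rfl⟩ := hne
    simp
  clear hne
  have : Nonempty X := ⟨z⟩
  choose y hy using H.homogeneous
  have h := μ.stasheff l.length hpos (fun j => idx (l.getD j z)) fun j => y (l.getD j z)
  simp only [← hy, hμ] at h
  have hterm : ∀ r ∈ Finset.range l.length, ∀ s ∈ Finset.Icc 1 (l.length - r),
      op idx fib e f (l.length - s + 1) (fun j : Fin (l.length - s + 1) =>
        insertArg (fun i => e (l.getD i z)) r s
          (op idx fib e f s fun i : Fin s => e (l.getD (r + i) z)) j) =
      opVal idx fib e f (substOp idx fib e f r s (wd k l)) := fun r hr s hs => by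
    rw [Finset.mem_range] at hr
    rw [Finset.mem_Icc] at hs
    rw [op_insertArg (fun i => e (l.getD i z)) (by omega)]
    congr 2
    rw [wd]
    congr 1
    refine List.ext_getElem (by simp) fun i h1 h2 => ?_
    simp only [List.length_map, List.length_range] at h1
    simp [h1]
  rw [Finset.sum_congr rfl fun r hr => Finset.sum_congr rfl fun s hs => by rw [hterm r hr s hs]] at h
  have h1 := H.repr_stasheff_sum hf hnil l z
  have h2 : ∀ r ∈ Finset.range l.length,
      ((l.take r).map idx).sum = ∑ j ∈ Finset.range r, idx (l.getD j z) := fun r hr => by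
    rw [Finset.mem_range] at hr
    have h3 : (l.take r).map idx = (List.range r).map fun j => idx (l.getD j z) := by
      refine List.ext_getElem (by simp; omega) fun i h1 h2 => ?_
      simp only [List.length_map, List.length_range] at h2
      have : i < l.length := by omega
      simp [this]
    rw [h3]
    rfl
  rw [Finset.sum_congr rfl fun r hr => Finset.sum_congr rfl fun s hs => by rw [h2 r hr], h, map_zero,
    Finsupp.zero_apply] at h1
  have h3 := suspSign_mul_self k (l.map idx)
  rcases mul_eq_zero.1 h1.symm with h4 | h4
  · rw [h4, zero_mul] at h3
    exact absurd h3 zero_ne_one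
  · exact h4

end GradedBasis

end Operations

/-! ### The derivation that belongs to an `A∞`-structure -/

section Derivation

variable {k : Type*} [Field k] {B : ℕ → Type*} [∀ i, AddCommGroup (B i)] [∀ i, Module k (B i)]
  {X : Type*} {idx : X → ℕ} {fib : ℕ → Finset X} {e : Module.Basis X k (⨁ i, B i)}

/-- The matrix entries of the operations. -/
def opCoeff (idx : X → ℕ) (e : Module.Basis X k (⨁ i, B i)) (μ : AInfinityStructure k B) (x : X)
    (l : List X) : k :=
  suspSign k (l.map idx) * e.repr (μ.m l.length fun j => e (l.get j)) x

theorem opCoeff_ofFn (μ : AInfinityStructure k B) (x : X) {n : ℕ} (v : Fin n → X) :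
    opCoeff idx e μ x (List.ofFn v) =
      suspSign k ((List.ofFn v).map idx) * e.repr (μ.m n fun j => e (v j)) x := by
  have aux : ∀ (l : List X) (n : ℕ) (h : l.length = n), (μ.m l.length fun j => e (l.get j)) =
      μ.m n fun j => e (l.get (Fin.cast h.symm j)) := by
    rintro l n rfl
    rfl
  rw [opCoeff, aux _ n (by simp)]
  simp

theorem finite_words_of_length (Y : Finset X) (n : ℕ) :
    {l : List X | l.length ≤ n ∧ ∀ x ∈ l, x ∈ Y}.Finite := by
  induction n with
  | zero =>
    refine (Set.finite_singleton []).subset fun l hl => ?_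
    exact List.length_eq_zero_iff.1 (Nat.le_zero.1 hl.1)
  | succ n ih =>
    refine ((Set.finite_singleton []).union (Set.Finite.biUnion Y.finite_toSet
      fun x _ => ih.image (List.cons x))).subset fun l hl => ?_
    cases l with
    | nil => exact Or.inl rfl
    | cons x l =>
      refine Or.inr (Set.mem_biUnion (hl.2 x (by simp)) ⟨l, ⟨?_, fun z hz => ?_⟩, rfl⟩)
      · simpa using hl.1
      · exact hl.2 z (by simp [hz])

namespace GradedBasis

variable (H : GradedBasis idx fib e)

include H

theorem repr_eq_zero_of_component {x : X} {m : ⨁ i, B i} (h : m (idx x) = 0) : e.repr m x = 0 := by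
  have : e.coord x = e.coord x ∘ₗ DirectSum.lof k ℕ B (idx x) ∘ₗ
      DirectSum.component k ℕ B (idx x) := by
    refine DirectSum.linearMap_ext k fun i => LinearMap.ext fun y => ?_
    simp only [LinearMap.comp_apply, Module.Basis.coord_apply]
    by_cases hi : i = idx x
    · subst hi
      rw [DirectSum.component.lof_self]
    · rw [DirectSum.component.of, dif_neg hi, map_zero, map_zero, Finsupp.zero_apply,
        H.repr_lof i y x (Ne.symm hi)]
  have h2 := LinearMap.congr_fun this m
  simp only [LinearMap.comp_apply, Module.Basis.coord_apply] at h2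
  rw [h2, show DirectSum.component k ℕ B (idx x) m = 0 from h, map_zero, map_zero,
    Finsupp.zero_apply]

theorem opCoeff_degree (μ : AInfinityStructure k B) {x : X} {l : List X}
    (h : opCoeff idx e μ x l ≠ 0) : idx x + l.length = (l.map idx).sum + 2 := by
  by_contra hne
  refine h ?_
  choose y hy using H.homogeneous
  rw [opCoeff, H.repr_eq_zero_of_component, mul_zero]
  have h1 := μ.degree l.length (fun j => idx (l.get j)) (fun j => y (l.get j)) (idx x) (by
    have : ((l.map idx).sum : ℤ) = ∑ j : Fin l.length, (idx (l.get j) : ℤ) := by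
      conv_lhs => rw [← List.ofFn_get l, List.map_ofFn, List.sum_ofFn]
      push_cast
      rfl
    rw [← this]
    omega)
  simp only [← hy] at h1
  exact h1

/-- The arity is at most `N`, and the degree of the value bounds the indices of the arguments. There
are finitely many letters of each index, so finitely many words remain. -/
theorem finite_opCoeff {N : ℕ} {μ : AInfinityStructure k B} (hμ : ∀ n, N < n → μ.m n = 0) (x : X) :
    (Function.support (opCoeff idx e μ x)).Finite := by
  classical
  refine (finite_words_of_length ((Finset.range (idx x + N + 1)).biUnion fib) N).subset
    fun l hl => ?_
  have h1 := H.opCoeff_degree μ hl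
  have h2 : l.length ≤ N := by
    by_contra h
    rw [Function.mem_support, opCoeff, hμ _ (by omega)] at hl
    simp at hl
  refine ⟨h2, fun z hz => ?_⟩
  have h3 := List.single_le_sum (l := l.map idx) (by simp) (idx z) (List.mem_map_of_mem hz)
  simp only [Finset.mem_biUnion, Finset.mem_range, H.mem_fib]
  exact ⟨idx z, by omega, rfl⟩

/-- The derivation that belongs to the operations of an `A∞`-structure. -/
def derOf {N : ℕ} {μ : AInfinityStructure k B} (hμ : ∀ n, N < n → μ.m n = 0) (x : X) :
    FreeAlgebra k X :=
  ofCo (Finsupp.ofSupportFinite (opCoeff idx e μ x) (H.finite_opCoeff hμ x))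

variable {N : ℕ} {μ : AInfinityStructure k B} (hμ : ∀ n, N < n → μ.m n = 0)

theorem co_derOf (x : X) (l : List X) : co l (H.derOf hμ x) = opCoeff idx e μ x l := by
  rw [derOf, co_ofCo]
  rfl

theorem isOperadic_derOf : IsOperadic idx (H.derOf hμ) := fun x l h =>
  H.opCoeff_degree μ (by rwa [H.co_derOf] at h)

theorem co_nil_derOf (x : X) : co [] (H.derOf hμ x) = 0 := by
  rw [H.co_derOf, opCoeff]
  have := μ.m_zero
  simp only [List.length_nil]
  rw [this]
  simp

theorem m_eq_op (n : ℕ) : μ.m n = op idx fib e (H.derOf hμ) n := by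
  refine Module.Basis.ext_multilinear (fun _ => e) fun v => e.ext_elem fun x => ?_
  rw [op_basis, H.repr_opVal (H.isOperadic_derOf hμ), H.co_derOf, opCoeff_ofFn, ← mul_assoc,
    suspSign_mul_self, one_mul]

theorem der_derOf (x : X) : der (degSign k idx) (H.derOf hμ) (H.derOf hμ x) = 0 :=
  H.der_der_of_aInfinity (H.isOperadic_derOf hμ) (H.co_nil_derOf hμ) μ (H.m_eq_op hμ) x

end GradedBasis

end Derivation

/-! ### The additional letter for the unit -/

section OptionLetters

variable {k : Type*} [Field k] {L Γ : Type*}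

/-- The index of a letter, where the additional letter `none` stands for the unit. -/
def optIdx (idx : Γ → ℕ) : Option Γ → ℕ
  | none => 0
  | some x => idx x

/-- A family of elements of an algebra, extended by the unit. -/
def optVal (c : Γ → FreeAlgebra k L) : Option Γ → FreeAlgebra k L
  | none => 1
  | some x => c x

/-- The letters of index `i`, including the unit. -/
def optFib (fib : ℕ → Finset Γ) : ℕ → Finset (Option Γ)
  | 0 => {none}
  | i + 1 => (fib (i + 1)).map Function.Embedding.some

theorem koszulDeg_zero (N : ℕ) : koszulDeg N 0 = 0 := by simp [koszulDeg]

theorem koszulDeg_strictMono {N : ℕ} (hN : 2 ≤ N) : StrictMono (koszulDeg N) :=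
  strictMono_nat_of_lt_succ (koszulDeg_lt_succ hN)

namespace DualLetters

variable {N : ℕ} {K : Submodule k (FreeAlgebra k L)} {idx : Γ → ℕ}
  {c t : Γ → FreeAlgebra k L} {fib : ℕ → Finset Γ} (D : DualLetters N K idx c t fib)

include D

theorem mem_optFib (i : ℕ) (x : Option Γ) : x ∈ optFib fib i ↔ optIdx idx x = i := by
  cases x with
  | none => cases i <;> simp [optFib, optIdx]
  | some x =>
    have := D.one_le x
    cases i with
    | zero =>
      simp [optFib, optIdx]
      omega
    | succ i => simp [optFib, optIdx, D.mem_fib]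

theorem optVal_mem (h0 : len k L 0 ≤ orthPart K 0) (x : Option Γ) :
    optVal c x ∈ orthPart K (koszulDeg N (optIdx idx x)) := by
  cases x with
  | none =>
    rw [optIdx, koszulDeg_zero]
    exact h0 one_mem_len
  | some x => exact D.c_mem x

theorem optVal_mem_len (x : Option Γ) : optVal t x ∈ len k L (koszulDeg N (optIdx idx x)) := by
  cases x with
  | none =>
    rw [optIdx, koszulDeg_zero]
    exact one_mem_len
  | some x => exact D.t_mem x

omit D in
theorem pair_one_one : pair k L 1 1 = 1 := by
  rw [← wd_nil, pair_wd_left, co_wd_self]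

theorem pair_optVal_self (x : Option Γ) : pair k L (optVal t x) (optVal c x) = 1 := by
  cases x with
  | none => exact pair_one_one
  | some x => exact D.dual_self x

theorem pair_optVal_ne {x z : Option Γ} (h : x ≠ z) :
    pair k L (optVal t x) (optVal c z) = 0 := by
  by_cases hi : optIdx idx x = optIdx idx z
  · cases x with
    | none =>
      cases z with
      | none => exact absurd rfl h
      | some z =>
        have := D.one_le z
        simp only [optIdx] at hi
        omega
    | some x =>
      cases z with
      | none =>
        have := D.one_le x
        simp only [optIdx] at hi
        omega
      | some z => exact D.dual_ne x z hi (by simpa using h)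
  · refine pair_eq_zero_of_len (D.optVal_mem_len x) (n := koszulDeg N (optIdx idx z)) ?_
      fun h' => hi ((koszulDeg_strictMono D.two_le).injective h')
    cases z with
    | none =>
      rw [optIdx, koszulDeg_zero]
      exact one_mem_len
    | some z => exact D.c_mem_len z

theorem optVal_expand (i : ℕ) {y : FreeAlgebra k L} (hy : y ∈ orthPart K (koszulDeg N i)) :
    y = ∑ x ∈ optFib fib i, pair k L (optVal t x) y • optVal c x := by
  cases i with
  | zero =>
    rw [koszulDeg_zero] at hy
    rw [optFib, Finset.sum_singleton]
    conv_lhs => rw [len_zero_eq y hy.1]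
    rw [optVal, optVal, ← wd_nil, pair_wd_left]
  | succ i =>
    rw [optFib, Finset.sum_map]
    exact D.expand (i + 1) (by omega) y hy

end DualLetters

end OptionLetters

/-! ### The homogeneous basis of `B` -/

section DualAlgebra

universe u v w

variable {k : Type u} {V : Type v} [Field k] [AddCommGroup V] [Module k V] {L : Type w}
  [Fintype L] [DecidableEq L] (b : Module.Basis L k V) (N : ℕ)
  (R : Submodule k (TensorAlgebra k V))

/-- The ideal of relations of `A^!`, in coordinates. -/
abbrev dualIdeal : Submodule k (FreeAlgebra k L) :=
  relIdeal (relPerp N (R.map (coordEquiv b).toLinearMap))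

theorem map_perp : (perp N R).map (coordEquiv b.dualBasis).toLinearMap =
    relPerp N (R.map (coordEquiv b).toLinearMap) := by
  ext y
  constructor
  · rintro ⟨s, ⟨hs, hs'⟩, rfl⟩
    refine ⟨(coordEquiv_mem_len b.dualBasis).2 hs, ?_⟩
    rintro _ ⟨r, hr, rfl⟩
    rw [← hs' r hr, tensorPairing_eq b]
    rfl
  · rintro ⟨hy, hy'⟩
    refine ⟨(coordEquiv b.dualBasis).symm y, ⟨?_, fun r hr => ?_⟩, by simp⟩
    · rw [← coordEquiv_mem_len b.dualBasis, AlgEquiv.apply_symm_apply]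
      exact hy
    · rw [tensorPairing_eq b, AlgEquiv.apply_symm_apply]
      exact hy' _ (Submodule.mem_map_of_mem hr)

/-- The projection of the free algebra onto `A^!`. -/
def dualHom : FreeAlgebra k L →ₐ[k] DualAlg N R :=
  (quotHom (perp N R)).comp (coordEquiv b.dualBasis).symm.toAlgHom

variable {N R}

theorem dualHom_coordEquiv (a : TensorAlgebra k (Module.Dual k V)) :
    dualHom b N R (coordEquiv b.dualBasis a) = quotHom (perp N R) a := by
  simp [dualHom]

theorem dualHom_eq_zero {a : FreeAlgebra k L} : dualHom b N R a = 0 ↔ a ∈ dualIdeal b N R := by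
  obtain ⟨a, rfl⟩ := (coordEquiv b.dualBasis).surjective a
  rw [dualHom_coordEquiv, quotHom_eq_zero b.dualBasis, map_perp]

theorem dualHom_surjective : Function.Surjective (dualHom b N R) :=
  (Ideal.Quotient.mkₐ_surjective k _).comp (coordEquiv b.dualBasis).symm.surjective

theorem map_dualHom_len (n : ℕ) :
    (len k L n).map (dualHom b N R).toLinearMap = quotDeg (perp N R) n := by
  refine le_antisymm ?_ ?_
  · rintro _ ⟨y, hy, rfl⟩
    refine ⟨(coordEquiv b.dualBasis).symm y, (coordEquiv_mem_len b.dualBasis).1 ?_, rfl⟩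
    rw [AlgEquiv.apply_symm_apply]
    exact hy
  · rintro _ ⟨y, hy, rfl⟩
    exact ⟨coordEquiv b.dualBasis y, (coordEquiv_mem_len b.dualBasis).2 hy,
      dualHom_coordEquiv b y⟩

theorem dualHom_mem {n : ℕ} {a : FreeAlgebra k L} (ha : a ∈ len k L n) :
    dualHom b N R a ∈ quotDeg (perp N R) n := by
  rw [← map_dualHom_len b]
  exact Submodule.mem_map_of_mem ha

/-- A functional that vanishes on the relations induces a functional on `A^!`. -/
theorem exists_dual_functional {c : FreeAlgebra k L} {n : ℕ}
    (hc : c ∈ orthPart (dualIdeal b N R) n) :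
    ∃ ψ : DualAlg N R →ₗ[k] k, ∀ a, ψ (dualHom b N R a) = pair k L a c := by
  have hker : LinearMap.ker (dualHom b N R).toLinearMap ≤
      LinearMap.ker ((pair k L).flip c) := fun a ha =>
    hc.2 a ((dualHom_eq_zero b).1 ha)
  refine ⟨(LinearMap.ker (dualHom b N R).toLinearMap).liftQ ((pair k L).flip c) hker ∘ₗ
    ((dualHom b N R).toLinearMap.quotKerEquivOfSurjective (dualHom_surjective b)).symm.toLinearMap,
    fun a => ?_⟩
  have : ((dualHom b N R).toLinearMap.quotKerEquivOfSurjective (dualHom_surjective b)).symm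
      (dualHom b N R a) = Submodule.Quotient.mk a := by
    rw [LinearEquiv.symm_apply_eq]
    rfl
  rw [LinearMap.comp_apply, LinearEquiv.coe_coe, this, Submodule.liftQ_apply,
    LinearMap.flip_apply]

omit [Fintype L] [DecidableEq L] in
theorem toDualAlg_lof (i : ℕ) (y : BPiece N R i) :
    toDualAlg N R (DirectSum.lof k ℕ (BPiece N R) i y) = y := by
  unfold toDualAlg DirectSum.coeLinearMap
  rw [DirectSum.toModule_lof]
  rfl

variable {Γ : Type*} {idx : Γ → ℕ} {c t : Γ → FreeAlgebra k L} {fib : ℕ → Finset Γ}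

/-- The element of `B` that belongs to a letter. -/
def letterVec (D : DualLetters N (dualIdeal b N R) idx c t fib) (x : Option Γ) :
    ⨁ i, BPiece N R i :=
  DirectSum.lof k ℕ (BPiece N R) (optIdx idx x)
    ⟨dualHom b N R (optVal t x), dualHom_mem b (D.optVal_mem_len x)⟩

/-- The tensors `c x` are orthogonal to the relations of `A^!` and so induce linear forms on it,
dual to the classes of the `t x`. They detect every element of `B`, since an ideal generated in
degree `N` is the orthogonal of its orthogonal in each degree. -/
theorem exists_gradedBasis (hN : 2 ≤ N) (D : DualLetters N (dualIdeal b N R) idx c t fib) :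
    ∃ e : Module.Basis (Option Γ) k (⨁ i, BPiece N R i), (∀ x, e x = letterVec b D x) ∧
      ∀ m a, toDualAlg N R m = dualHom b N R a → ∀ x, e.repr m x = pair k L a (optVal c x) := by
  have h0 : len k L 0 ≤ orthPart (dualIdeal b N R) 0 :=
    len_le_orthPart relPerp_le_len (by omega)
  choose ψ hψ using fun x => exists_dual_functional b (D.optVal_mem h0 x)
  have hcomp : ∀ x (m : ⨁ i, BPiece N R i),
      ψ x (toDualAlg N R m) = ψ x (m (optIdx idx x) : DualAlg N R) := by
    intro x m
    have : ψ x ∘ₗ toDualAlg N R = ψ x ∘ₗ (quotDeg (perp N R) (koszulDeg N (optIdx idx x))).subtype ∘ₗ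
        DirectSum.component k ℕ (BPiece N R) (optIdx idx x) := by
      refine DirectSum.linearMap_ext k fun i => LinearMap.ext fun y => ?_
      simp only [LinearMap.comp_apply, toDualAlg_lof]
      by_cases hi : i = optIdx idx x
      · subst hi
        rw [DirectSum.component.lof_self]
        rfl
      · rw [DirectSum.component.of, dif_neg hi, map_zero, map_zero]
        obtain ⟨y, hy⟩ := y
        rw [← map_dualHom_len b] at hy
        obtain ⟨a, ha, rfl⟩ := hy
        exact (hψ x a).trans (pair_eq_zero_of_len ha (orthPart_le_len _ (D.optVal_mem h0 x))
          fun h => hi ((koszulDeg_strictMono hN).injective h))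
    exact LinearMap.congr_fun this m
  have hne : ∀ {x z}, x ≠ z → ψ x (toDualAlg N R (letterVec b D z)) = 0 := fun {x z} h => by
    rw [letterVec, toDualAlg_lof, hψ, D.pair_optVal_ne h.symm]
  have htotal : ∀ m : ⨁ i, BPiece N R i, (∀ x, ψ x (toDualAlg N R m) = 0) → m = 0 := by
    intro m hm
    refine DFinsupp.ext fun i => Subtype.ext ?_
    obtain ⟨a, ha, hai⟩ : (m i : DualAlg N R) ∈
        (len k L (koszulDeg N i)).map (dualHom b N R).toLinearMap := by
      rw [map_dualHom_len]
      exact (m i).2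
    refine hai.symm.trans ((dualHom_eq_zero b).2
      (mem_relIdeal_of_orthPart relPerp_le_len ha fun y hy => ?_))
    rw [D.optVal_expand i hy, map_sum]
    refine Finset.sum_eq_zero fun x hx => ?_
    obtain rfl := (D.mem_optFib i x).1 hx
    have hz := hm x
    rw [hcomp] at hz
    rw [map_smul, ← hψ]
    have : dualHom b N R a = (m (optIdx idx x) : DualAlg N R) := hai
    rw [this, hz, smul_zero]
  have hdual : Module.DualBases (letterVec b D) fun x => ψ x ∘ₗ toDualAlg N R := by
    refine ⟨fun x => ?_, fun x z hxz => hne hxz, fun {m m'} hm => ?_, fun m => ?_⟩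
    · rw [LinearMap.comp_apply, letterVec, toDualAlg_lof, hψ, D.pair_optVal_self]
    · refine sub_eq_zero.1 (htotal _ fun x => ?_)
      rw [map_sub, map_sub, sub_eq_zero]
      exact hm x
    · classical
      refine ((DFinsupp.support m).biUnion (optFib fib)).finite_toSet.subset fun x hx => ?_
      rw [Finset.mem_coe, Finset.mem_biUnion]
      refine ⟨optIdx idx x, ?_, (D.mem_optFib _ x).2 rfl⟩
      rw [DFinsupp.mem_support_iff]
      intro h
      refine hx ?_
      rw [LinearMap.comp_apply, hcomp, h, ZeroMemClass.coe_zero, map_zero]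
  refine ⟨hdual.basis, fun x => ?_, fun m a h x => ?_⟩
  · rw [Module.DualBases.coe_basis]
  · rw [← hψ, ← h]
    rfl

variable {b}

theorem DualLetters.gradedBasis (D : DualLetters N (dualIdeal b N R) idx c t fib)
    {e : Module.Basis (Option Γ) k (⨁ i, BPiece N R i)} (he : ∀ x, e x = letterVec b D x)
    (hrepr : ∀ m a, toDualAlg N R m = dualHom b N R a →
      ∀ x, e.repr m x = pair k L a (optVal c x))
    (h0 : len k L 0 ≤ orthPart (dualIdeal b N R) 0) :
    GradedBasis (optIdx idx) (optFib fib) e := by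
  refine ⟨D.mem_optFib, ?_, fun x => ⟨_, he x⟩⟩
  rintro i ⟨y, hy⟩ x hx
  have hy' := hy
  rw [← map_dualHom_len b] at hy'
  obtain ⟨a, ha, hay⟩ := hy'
  rw [hrepr _ a ((toDualAlg_lof i _).trans hay.symm)]
  exact pair_eq_zero_of_len ha (orthPart_le_len _ (D.optVal_mem h0 x))
    fun h => hx ((koszulDeg_strictMono D.two_le).injective h).symm

theorem DualLetters.dualHom_letterMap (D : DualLetters N (dualIdeal b N R) idx c t fib)
    {e : Module.Basis (Option Γ) k (⨁ i, BPiece N R i)} (he : ∀ x, e x = letterVec b D x)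
    (m : ⨁ i, BPiece N R i) :
    dualHom b N R (evalHom (optVal t) (letterMap e m)) = toDualAlg N R m := by
  have : (dualHom b N R).toLinearMap ∘ₗ (evalHom (optVal t)).toLinearMap ∘ₗ letterMap e =
      toDualAlg N R := by
    refine e.ext fun x => ?_
    simp only [LinearMap.comp_apply, letterMap_basis, AlgHom.toLinearMap_apply]
    rw [he, letterVec, toDualAlg_lof, evalHom, FreeAlgebra.lift_ι_apply]
  exact LinearMap.congr_fun this m

/-- The class in `A^!` of a tensor depends only on its pairings with `orthPart`, and these agree on
both sides by the dual expansion. -/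
theorem DualLetters.toDualAlg_sum (D : DualLetters N (dualIdeal b N R) idx c t fib)
    {e : Module.Basis (Option Γ) k (⨁ i, BPiece N R i)} (he : ∀ x, e x = letterVec b D x)
    {i : ℕ} {a : FreeAlgebra k L} (ha : a ∈ len k L (koszulDeg N i)) :
    toDualAlg N R (∑ x ∈ optFib fib i, pair k L a (optVal c x) • e x) = dualHom b N R a := by
  rw [map_sum, ← sub_eq_zero]
  have : ∀ x, toDualAlg N R (pair k L a (optVal c x) • e x) =
      dualHom b N R (pair k L a (optVal c x) • optVal t x) := fun x => by
    rw [map_smul, map_smul, he, letterVec, toDualAlg_lof]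
  simp only [this]
  rw [← map_sum, ← map_sub, dualHom_eq_zero]
  refine mem_relIdeal_of_orthPart (n := koszulDeg N i) relPerp_le_len
    (sub_mem (sum_mem fun x hx => Submodule.smul_mem _ _ ?_) ha) fun y hy => ?_
  · rw [← (D.mem_optFib i x).1 hx]
    exact D.optVal_mem_len x
  · have h := congrArg (pair k L a) (D.optVal_expand i hy)
    rw [map_sum] at h
    rw [map_sub, LinearMap.sub_apply, h, sub_eq_zero, map_sum, LinearMap.sum_apply]
    refine Finset.sum_congr rfl fun x _ => ?_
    rw [map_smul, map_smul, LinearMap.smul_apply, smul_eq_mul, smul_eq_mul, mul_comm]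

end DualAlgebra

/-! ### Extension of a differential by a strict unit -/

section UnitExtension

variable {k : Type*} [Field k] {Γ : Type*} {idx : Γ → ℕ}

variable (k Γ) in
/-- The inclusion of the free algebra in the free algebra with an additional letter. -/
def emb : FreeAlgebra k Γ →ₐ[k] FreeAlgebra k (Option Γ) :=
  evalHom fun x => FreeAlgebra.ι k (some x)

/-- The extension of a differential by a strict unit, where the additional letter is dual to the
unit. -/
def unitDer (idx : Γ → ℕ) (d : Γ → FreeAlgebra k Γ) : Option Γ → FreeAlgebra k (Option Γ)
  | none => wd k [none, none]
  | some x => emb k Γ (d x) + wd k [none, some x] - degSign k idx x • wd k [some x, none]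

variable (k Γ) in
/-- The projection of the free algebra with an additional letter that annihilates this letter. -/
def res : FreeAlgebra k (Option Γ) →ₐ[k] FreeAlgebra k Γ :=
  evalHom fun x => x.elim 0 (FreeAlgebra.ι k)

theorem emb_wd (l : List Γ) : emb k Γ (wd k l) = wd k (l.map some) := by
  induction l with
  | nil => simp
  | cons x l ih => rw [emb, evalHom_wd_cons, ← emb, ih, List.map_cons, wd_cons]

theorem res_wd_map (l : List Γ) : res k Γ (wd k (l.map some)) = wd k l := by
  induction l with
  | nil => simp
  | cons x l ih => rw [List.map_cons, res, evalHom_wd_cons, ← res, ih, wd_cons]; rfl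

theorem exists_map_some {l : List (Option Γ)} (h : none ∉ l) : ∃ m : List Γ, l = m.map some := by
  induction l with
  | nil => exact ⟨[], rfl⟩
  | cons x l ih =>
    obtain ⟨m, rfl⟩ := ih fun h' => h (by simp [h'])
    cases x with
    | none => simp at h
    | some x => exact ⟨x :: m, rfl⟩

theorem res_wd_of_mem {l : List (Option Γ)} (h : none ∈ l) : res k Γ (wd k l) = 0 := by
  obtain ⟨u, v, rfl⟩ := List.append_of_mem h
  rw [wd_append, wd_cons, map_mul, map_mul, res, evalHom_ι]
  simp

theorem co_res (l : List Γ) (y : FreeAlgebra k (Option Γ)) :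
    co l (res k Γ y) = co (l.map some) y := by
  refine LinearMap.congr_fun (f := co l ∘ₗ (res k Γ).toLinearMap) (lin_ext fun m => ?_) y
  rw [LinearMap.comp_apply, AlgHom.toLinearMap_apply]
  by_cases hm : none ∈ m
  · rw [res_wd_of_mem hm, map_zero, co_wd_ne]
    rintro rfl
    simp at hm
  · obtain ⟨m, rfl⟩ := exists_map_some hm
    classical
    rw [res_wd_map, co_wd, co_wd]
    simp [(Option.some_injective Γ).list_map.eq_iff]

theorem co_map_some_emb (l : List Γ) (y : FreeAlgebra k Γ) :
    co (l.map some) (emb k Γ y) = co l y := by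
  rw [← co_res]
  congr 1
  refine LinearMap.congr_fun (f := (res k Γ).toLinearMap ∘ₗ (emb k Γ).toLinearMap)
    (g := LinearMap.id) (lin_ext fun m => ?_) y
  simp [emb_wd, res_wd_map]

theorem emb_injective : Function.Injective (emb k Γ) := fun a b h =>
  ext_co fun l => by rw [← co_map_some_emb, h, co_map_some_emb]

theorem co_emb_of_mem {l : List (Option Γ)} (h : none ∈ l) (y : FreeAlgebra k Γ) :
    co l (emb k Γ y) = 0 := by
  refine LinearMap.congr_fun (f := co l ∘ₗ (emb k Γ).toLinearMap) (g := 0) (lin_ext fun m => ?_) y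
  rw [LinearMap.comp_apply, AlgHom.toLinearMap_apply, emb_wd, co_wd_ne]
  · rfl
  · rintro rfl
    simp at h

variable (d : Γ → FreeAlgebra k Γ)

theorem co_map_some_unitDer (l : List Γ) (x : Γ) :
    co (l.map some) (unitDer idx d (some x)) = co l (d x) := by
  have h1 : l.map some ≠ [none, some x] := fun h => by
    have : none ∈ l.map some := h ▸ by simp
    simp at this
  have h2 : l.map some ≠ [some x, none] := fun h => by
    have : none ∈ l.map some := h ▸ by simp
    simp at this
  rw [unitDer, map_sub, map_add, map_smul, co_map_some_emb, co_wd_ne h1, co_wd_ne h2]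
  simp

theorem co_map_some_unitDer_none (l : List Γ) : co (l.map some) (unitDer idx d none) = 0 := by
  rw [unitDer, co_wd_ne]
  intro h
  have : none ∈ l.map some := h ▸ by simp
  simp at this

theorem co_unitDer_of_length {l : List (Option Γ)} (h : none ∈ l) (hl : l.length ≠ 2)
    (x : Option Γ) : co l (unitDer idx d x) = 0 := by
  have hne : ∀ a b : Option Γ, co l (wd k [a, b]) = 0 := fun a b => co_wd_ne fun e => hl (by simp [e])
  cases x with
  | none => rw [unitDer, hne]
  | some x => rw [unitDer, map_sub, map_add, map_smul, co_emb_of_mem h, hne, hne]; simp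

open scoped Classical in
theorem co_none_cons_unitDer (z x : Option Γ) :
    co [none, z] (unitDer idx d x) = if z = x then 1 else 0 := by
  cases x with
  | none => rw [unitDer, co_wd]; simp
  | some x =>
    rw [unitDer, map_sub, map_add, map_smul, co_emb_of_mem (by simp), co_wd, co_wd]
    simp

open scoped Classical in
theorem co_cons_none_unitDer (z x : Option Γ) :
    co [z, none] (unitDer idx d x) = if z = x then (-1) ^ optIdx idx x else 0 := by
  cases x with
  | none => rw [unitDer, co_wd]; simp [optIdx]
  | some x =>
    rw [unitDer, map_sub, map_add, map_smul, co_emb_of_mem (by simp), co_wd, co_wd]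
    by_cases h : z = some x <;> simp [h, degSign, optIdx, pow_succ]

/-- On words without the new letter, the extension is `d` plus the graded commutator with the new
letter; a commutator is a derivation, so this propagates from letters to words. -/
theorem der_unitDer_emb {y : FreeAlgebra k Γ} {s : k}
    (hy : y ∈ supp k fun l => sgn (degSign k idx) l = s) :
    der (degSign k (optIdx idx)) (unitDer idx d) (emb k Γ y) =
      emb k Γ (der (degSign k idx) d y) + FreeAlgebra.ι k none * emb k Γ y -
        s • (emb k Γ y * FreeAlgebra.ι k none) := by
  refine supp_ext (f := der (degSign k (optIdx idx)) (unitDer idx d) ∘ₗ (emb k Γ).toLinearMap)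
    (g := (emb k Γ).toLinearMap ∘ₗ der (degSign k idx) d +
      LinearMap.mulLeft k (FreeAlgebra.ι k none) ∘ₗ (emb k Γ).toLinearMap -
      s • LinearMap.mulRight k (FreeAlgebra.ι k none) ∘ₗ (emb k Γ).toLinearMap)
    (fun l hl => ?_) hy
  subst hl
  clear hy
  simp only [LinearMap.comp_apply, LinearMap.sub_apply, LinearMap.add_apply, LinearMap.smul_apply,
    AlgHom.toLinearMap_apply, LinearMap.mulLeft_apply, LinearMap.mulRight_apply]
  induction l with
  | nil => simp
  | cons x l ih =>
    have hx : emb k Γ (FreeAlgebra.ι k x) = FreeAlgebra.ι k (some x) := by rw [emb, evalHom_ι]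
    have hs : degSign k (optIdx idx) (some x) = degSign k idx x := rfl
    rw [wd_cons, map_mul, hx, der_ι_mul, ih, der_ι_mul, map_add, map_mul, map_smul, map_mul, hx,
      unitDer, hs, sgn_cons]
    simp only [wd_cons, wd_nil, mul_one, sub_mul, add_mul, mul_add, mul_sub, smul_add, smul_sub,
      smul_mul_assoc, mul_smul_comm, smul_smul, mul_assoc]
    abel

/-- In the square, the value `none * none` of the new letter cancels the iterated commutator, and
the commutator with `d x` cancels because `d` is odd. -/
theorem der_unitDer_unitDer_some {x : Γ}
    (hx : d x ∈ supp k fun l => sgn (degSign k idx) l = -degSign k idx x) :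
    der (degSign k (optIdx idx)) (unitDer idx d) (unitDer idx d (some x)) =
      emb k Γ (der (degSign k idx) d (d x)) := by
  have hs : degSign k (optIdx idx) (some x) = degSign k idx x := rfl
  have hn : degSign k (optIdx idx) none = -1 := by simp [degSign, optIdx]
  conv_lhs => rw [unitDer]
  rw [map_sub, map_add, map_smul, der_unitDer_emb d hx, wd_cons none, wd_cons (some x) [none],
    wd_singleton, wd_singleton, der_ι_mul, der_ι_mul, der_ι, der_ι, hs, hn]
  have h1 : degSign k idx x * degSign k idx x = 1 := degSign_mul_self x
  simp only [unitDer, wd_cons, wd_nil, mul_one, sub_mul, add_mul, mul_add, mul_sub, smul_add, smul_sub,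
      smul_mul_assoc, mul_smul_comm, smul_smul, mul_assoc, h1, one_smul, neg_smul, neg_mul, one_mul]
  abel

theorem der_unitDer_unitDer_none :
    der (degSign k (optIdx idx)) (unitDer idx d) (unitDer idx d none) = 0 := by
  have hn : degSign k (optIdx idx) none = -1 := by simp [degSign, optIdx]
  conv_lhs => rw [unitDer]
  rw [wd_cons, der_ι_mul, wd_singleton, der_ι, hn, unitDer, wd_cons, wd_singleton]
  simp [mul_assoc]

end UnitExtension

/-! ### Admissible structures as unital filtered differentials -/

section AdmissibleDerivation

variable {k : Type*} [Field k] {L Γ : Type*}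

/-- The degrees of the arguments for which an operation has to be the ordinary product. -/
def IsProductShape (N : ℕ) (l : List ℕ) : Prop :=
  (l.length = N ∧ ∀ i ∈ l, ¬ Even i) ∨ (l.length = 2 ∧ ∃ i ∈ l, Even i)

/-- The admissibility of an `A∞`-structure in terms of the derivation that belongs to it. -/
structure IsAdmissibleDer (N : ℕ) (idx : Γ → ℕ) (c t : Γ → FreeAlgebra k L)
    (f : Option Γ → FreeAlgebra k (Option Γ)) : Prop where
  operadic : IsOperadic (optIdx idx) f
  co_nil : ∀ x, co [] (f x) = 0
  vanish_of_lt : ∀ x l, N < l.length → co l (f x) = 0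
  vanish_of_even : ∀ x l, 3 ≤ l.length → l.length ≤ N → (∃ i ∈ l.map (optIdx idx), Even i) →
    co l (f x) = 0
  product : ∀ x l, IsProductShape N (l.map (optIdx idx)) → co l (f x) =
    suspSign k (l.map (optIdx idx)) * pair k L (evalHom (optVal t) (wd k l)) (optVal c x)

theorem map_some_optIdx (idx : Γ → ℕ) (l : List Γ) :
    (l.map some).map (optIdx idx) = l.map idx := by
  simp [optIdx]

theorem evalHom_map_some (t : Γ → FreeAlgebra k L) (l : List Γ) :
    evalHom (optVal t) (wd k (l.map some)) = evalHom t (wd k l) := by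
  induction l with
  | nil => simp
  | cons x l ih => rw [List.map_cons, evalHom_wd_cons, evalHom_wd_cons, ih, optVal]

theorem degW_add_length {idx : Γ → ℕ} (hidx : ∀ x, 1 ≤ idx x) (l : List Γ) :
    degW idx l + l.length = (l.map idx).sum := by
  induction l with
  | nil => simp
  | cons x l ih =>
    have := hidx x
    simp only [degW_cons, List.length_cons, List.map_cons, List.sum_cons]
    omega

/-- A word to which the admissibility conditions do not apply has small weight. -/
theorem wtW_lt_of_not_isProductShape {N : ℕ} (hN : 2 ≤ N) (l : List ℕ) (hl : ∀ i ∈ l, 1 ≤ i)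
    (h0 : l ≠ []) (h : ¬ IsProductShape N l) (hlN : l.length ≤ N)
    (h3 : 3 ≤ l.length → ∀ i ∈ l, ¬ Even i) : wtW N id l < koszulDeg N (degW id l + 2) := by
  have hlen := length_eq_countP_even l
  have hz : (∀ i ∈ l, ¬ Even i) ↔ l.countP (fun i => Even i) = 0 := by
    simp [List.countP_eq_zero]
  have hz' : (∃ i ∈ l, Even i) ↔ 0 < l.countP (fun i => Even i) := by
    simp [List.countP_pos_iff]
  have h0' : l.length ≠ 0 := by simpa using h0
  rw [IsProductShape, hz, hz'] at h
  rw [hz] at h3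
  obtain ⟨q, h1, h2⟩ := exists_wtW_degW N l hl
  generalize l.countP (fun i => Even i) = e at *
  generalize l.countP (fun i => ¬ Even i) = o at *
  by_cases he : e = 0
  · have : degW id l + 2 = 2 * (q + 1) := by omega
    rw [h1, this, koszulDeg_two_mul, mul_add]
    omega
  · have he1 : e = 1 := by omega
    have ho : o = 0 := by omega
    have : degW id l + 2 = 2 * q + 1 := by omega
    rw [h1, this, koszulDeg_two_mul_add_one]
    omega

theorem not_isProductShape_of_length {N : ℕ} {l : List ℕ} {i : ℕ} (hi : i ∈ l) (h : Even i)
    (hl : IsProductShape N l) : l.length = 2 := by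
  rcases hl with hl | hl
  · exact absurd h (hl.2 i hi)
  · exact hl.1

namespace DualLetters

variable {N : ℕ} {K : Submodule k (FreeAlgebra k L)} {idx : Γ → ℕ}
  {c t : Γ → FreeAlgebra k L} {fib : ℕ → Finset Γ} (D : DualLetters N K idx c t fib)

include D

theorem co_unitDer_of_mem {d : Γ → FreeAlgebra k Γ} {x : Option Γ} {l : List (Option Γ)}
    (hl : none ∈ l) (hl2 : l.length = 2) : co l (unitDer idx d x) =
      suspSign k (l.map (optIdx idx)) * pair k L (evalHom (optVal t) (wd k l)) (optVal c x) := by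
  classical
  have hpair : ∀ z, pair k L (optVal t z) (optVal c x) = if z = x then 1 else 0 := fun z => by
    by_cases h : z = x
    · rw [h, D.pair_optVal_self, if_pos rfl]
    · rw [D.pair_optVal_ne h, if_neg h]
  obtain ⟨a, b, rfl⟩ := List.length_eq_two.1 hl2
  have hab : none = a ∨ none = b := by simpa using hl
  rcases hab with rfl | rfl
  · rw [co_none_cons_unitDer, evalHom_wd_cons, wd_singleton, evalHom_ι]
    simp only [optVal, one_mul]
    have := hpair b
    simp only [optVal] at this
    rw [this]
    simp [suspSign, suspExp, optIdx]
  · rw [co_cons_none_unitDer, evalHom_wd_cons, wd_singleton, evalHom_ι]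
    have := hpair a
    rw [show optVal t none = 1 from rfl, mul_one, this]
    by_cases h : a = x <;> simp [suspSign, suspExp, optIdx, h]

/-- For words without the unit, the weight bound leaves only the shapes of `count_of_wtW_le`, and
product shapes are those of full weight, where `d` agrees with `d₀`. Words containing the unit occur
only in length two, where they express strict unitality. -/
theorem isAdmissibleDer_unitDer {d : Γ → FreeAlgebra k Γ} (hd : IsFiltered N idx D.d₀ d) :
    IsAdmissibleDer N idx c t (unitDer idx d) := by
  classical
  have hcount : ∀ (x : Γ) (m : List Γ), co m (d x) ≠ 0 →
      degW idx m + 2 = idx x ∧ m.length ≤ N ∧ (3 ≤ m.length → ∀ i ∈ m.map idx, ¬ Even i) := by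
    intro x m hm
    have h : degW idx m + 2 = idx x ∧ wtW N idx m ≤ koszulDeg N (idx x) := by
      by_contra h
      exact hm (hd.deg_wt D.isHomogeneous_d₀ x m h)
    refine ⟨h.1, ?_⟩
    have h2 := h.2
    rw [← h.1, ← wtW_map, ← degW_map] at h2
    have h3 := count_of_wtW_le D.two_le (m.map idx) (by simpa using fun x _ => D.one_le x) h2
    have hlen := length_eq_countP_even (m.map idx)
    have hN := D.two_le
    have hz : (∀ i ∈ m.map idx, ¬ Even i) ↔ (m.map idx).countP (fun i => Even i) = 0 := by
      rw [List.countP_eq_zero]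
      simp
    rw [hz]
    rw [List.length_map] at hlen
    omega
  refine ⟨fun x l h => ?_, fun x => ?_, fun x l hl => ?_, fun x l hl3 hl hl' => ?_,
    fun x l hl => ?_⟩
  · by_cases hn : none ∈ l
    · have h2 : l.length = 2 := by
        by_contra h2
        exact h (co_unitDer_of_length d hn h2 x)
      obtain ⟨a, b, rfl⟩ := List.length_eq_two.1 h2
      have hab : none = a ∨ none = b := by simpa using hn
      rcases hab with rfl | rfl
      · rw [co_none_cons_unitDer] at h
        have : b = x := by
          by_contra h'
          simp [h'] at h
        simp [this, optIdx]
      · rw [co_cons_none_unitDer] at h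
        have : a = x := by
          by_contra h'
          simp [h'] at h
        simp [this, optIdx]
    · obtain ⟨m, rfl⟩ := exists_map_some hn
      cases x with
      | none => exact absurd (co_map_some_unitDer_none d m) h
      | some x =>
        rw [co_map_some_unitDer] at h
        have h1 := (hcount x m h).1
        have h2 := degW_add_length D.one_le m
        rw [map_some_optIdx, List.length_map]
        simp only [optIdx]
        omega
  · cases x with
    | none => exact co_map_some_unitDer_none d []
    | some x => exact (co_map_some_unitDer d [] x).trans (hd.co_nil x)
  · by_cases hn : none ∈ l
    · exact co_unitDer_of_length d hn (by have := D.two_le; omega) x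
    · obtain ⟨m, rfl⟩ := exists_map_some hn
      cases x with
      | none => exact co_map_some_unitDer_none d m
      | some x =>
        rw [co_map_some_unitDer]
        by_contra h
        have := (hcount x m h).2.1
        rw [List.length_map] at hl
        omega
  · by_cases hn : none ∈ l
    · exact co_unitDer_of_length d hn (by omega) x
    · obtain ⟨m, rfl⟩ := exists_map_some hn
      cases x with
      | none => exact co_map_some_unitDer_none d m
      | some x =>
        rw [co_map_some_unitDer]
        by_contra h
        rw [List.length_map] at hl3
        rw [map_some_optIdx] at hl'
        obtain ⟨i, hi, hi'⟩ := hl'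
        exact (hcount x m h).2.2 hl3 i hi hi'
  · by_cases hn : none ∈ l
    · exact D.co_unitDer_of_mem hn (by
        have := not_isProductShape_of_length (N := N) (l := l.map (optIdx idx))
          (i := 0) (List.mem_map.2 ⟨none, hn, rfl⟩) (by simp) hl
        simpa using this)
    · obtain ⟨m, rfl⟩ := exists_map_some hn
      rw [map_some_optIdx] at hl ⊢
      rw [evalHom_map_some]
      have hwt := (wtW_eq_iff D.two_le (m.map idx) (by simpa using fun x _ => D.one_le x)).2 hl
      rw [wtW_map, degW_map] at hwt
      have hmem := evalHom_wd_mem_len (k := k) D.t_mem m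
      rw [hwt] at hmem
      cases x with
      | none =>
        rw [co_map_some_unitDer_none, optVal, pair_eq_zero_of_len hmem one_mem_len, mul_zero]
        have := le_koszulDeg D.two_le (degW idx m + 2)
        omega
      | some x =>
        rw [co_map_some_unitDer, optVal]
        by_cases hx : degW idx m + 2 = idx x
        · have h1 := hd.wt x m (by change ¬ wtW N idx m < _; rw [hwt, hx]; exact lt_irrefl _)
          rw [map_sub, sub_eq_zero] at h1
          rw [h1, D.co_d₀, if_pos ⟨hx, by rw [hwt, hx]⟩]
        · rw [hd.deg x m hx, pair_eq_zero_of_len hmem (D.c_mem_len x), mul_zero]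
          exact fun h => hx ((koszulDeg_strictMono D.two_le).injective h)

/-- An admissible derivation of square zero comes from a filtered differential. -/
theorem exists_eq_unitDer {f : Option Γ → FreeAlgebra k (Option Γ)}
    (hf : IsAdmissibleDer N idx c t f) (hff : ∀ x, der (degSign k (optIdx idx)) f (f x) = 0) :
    ∃ d, IsFiltered N idx D.d₀ d ∧ (∀ x, der (degSign k idx) d (d x) = 0) ∧
      f = unitDer idx d := by
  classical
  have hN := D.two_le
  set d : Γ → FreeAlgebra k Γ := fun x => res k Γ (f (some x)) with hd_def
  have hco : ∀ x m, co m (d x) = co (m.map some) (f (some x)) := fun x m => co_res m _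
  have hdeg : ∀ x, d x ∈ supp k fun l => degW idx l + 2 = idx x := by
    intro x m hm
    rw [hco]
    by_contra h
    have h1 := hf.operadic _ _ h
    have h2 := degW_add_length D.one_le m
    rw [map_some_optIdx, List.length_map] at h1
    simp only [optIdx] at h1
    omega
  have hd : IsFiltered N idx D.d₀ d := by
    refine ⟨hdeg, fun x m hm => ?_, fun x => ?_⟩
    · rw [map_sub, sub_eq_zero]
      by_cases hx : degW idx m + 2 = idx x
      · have hiff := wtW_eq_iff D.two_le (m.map idx) (by simpa using fun x _ => D.one_le x)
        rw [wtW_map, degW_map] at hiff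
        rw [D.co_d₀, hco]
        by_cases hs : IsProductShape N (m.map idx)
        · rw [if_pos ⟨hx, by rw [hiff.2 hs, hx]⟩, hf.product _ _ (by rwa [map_some_optIdx]),
            map_some_optIdx, evalHom_map_some, optVal]
        · rw [if_neg fun h => hs (hiff.1 (by rw [h.2, hx]))]
          by_contra h
          have h1 : m ≠ [] := by
            rintro rfl
            exact h (hf.co_nil _)
          have h2 : m.length ≤ N := by
            by_contra h2
            exact h (hf.vanish_of_lt _ _ (by simpa using h2))
          -- Where the product condition does not apply, a nonzero coefficient is possible only on
          -- words of weight below that of `x`, which is exactly what a filtered deformation allows.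
          have h3 := wtW_lt_of_not_isProductShape D.two_le (m.map idx)
            (by simpa using fun x _ => D.one_le x) (by simpa using h1) hs (by simpa using h2) ?_
          · rw [wtW_map, degW_map, hx] at h3
            exact hm h3
          · intro h3 i hi hi'
            exact h (hf.vanish_of_even _ _ (by simpa using h3) (by simpa using h2)
              ⟨i, by rwa [map_some_optIdx], hi'⟩)
      · rw [hdeg x m hx, D.co_d₀, if_neg fun h => hx h.1]
    · rw [hco]
      exact hf.co_nil _
  have h2 : ∀ x l, none ∈ l → l.length = 2 → co l (f x) = co l (unitDer idx d x) := by
    intro x l hl hl2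
    rw [D.co_unitDer_of_mem hl hl2]
    exact hf.product x l (Or.inr ⟨by simpa using hl2, 0, List.mem_map.2 ⟨none, hl, rfl⟩, by simp⟩)
  -- This says `m₁(1) = 0`, which the conditions do not list. It follows from the Stasheff identity
  -- at `(1, 1)`: its three terms are `± m₁(1)`, because binary products with the unit are ordinary,
  -- and they add up to `-m₁(1)`, in any characteristic.
  have hunit : ∀ x, co [none] (f x) = 0 := by
    intro x
    by_contra hne
    have hx1 : optIdx idx x = 1 := by
      have := hf.operadic x _ hne
      have h0 : optIdx idx none = 0 := rfl
      simp only [List.length_singleton, List.map_singleton, List.sum_singleton, h0] at this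
      omega
    set T : List (Option Γ) → Finset (Option Γ) :=
      fun l => optFib fib ((l.map (optIdx idx)).sum + 2 - l.length) with hT_def
    have hT : ∀ l z, co l (f z) ≠ 0 → z ∈ T l := by
      intro l z h
      rw [hT_def, D.mem_optFib]
      have := hf.operadic z l h
      omega
    have h := congrArg (co [none, none]) (hff x)
    have hbar : bar (degSign k (optIdx idx)) f T [none, none] =
        transLetter f T [none] * FreeAlgebra.ι k none + transLetter f T [none, none] -
          FreeAlgebra.ι k none * transLetter f T [none] := by
      have hn : degSign k (optIdx idx) none = -1 := by simp [degSign, optIdx]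
      rw [bar_cons, bar_cons, hn]
      simp [Finset.sum_range_succ, bar, wd_singleton, sub_eq_add_neg]
    have hx : x ∈ T [none] := hT _ _ hne
    have e1 : pair k (Option Γ) (transLetter f T [none] * FreeAlgebra.ι k none) (f x) =
        - co [none] (f x) := by
      rw [transLetter, Finset.sum_mul, map_sum, LinearMap.sum_apply,
        Finset.sum_eq_single_of_mem x hx]
      · rw [smul_mul_assoc, map_smul, LinearMap.smul_apply, ← wd_singleton none, ← wd_cons,
          pair_wd_left, h2 _ [_, none] (by simp) rfl, co_cons_none_unitDer, hx1]
        simp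
      · intro z _ hz
        rw [smul_mul_assoc, map_smul, LinearMap.smul_apply, ← wd_singleton none, ← wd_cons,
          pair_wd_left, h2 _ [_, none] (by simp) rfl, co_cons_none_unitDer, if_neg hz, smul_zero]
    have e2 : pair k (Option Γ) (FreeAlgebra.ι k none * transLetter f T [none]) (f x) =
        co [none] (f x) := by
      rw [transLetter, Finset.mul_sum, map_sum, LinearMap.sum_apply,
        Finset.sum_eq_single_of_mem x hx]
      · rw [mul_smul_comm, map_smul, LinearMap.smul_apply, ← wd_singleton x, ← wd_cons,
          pair_wd_left, h2 _ [none, _] (by simp) rfl, co_none_cons_unitDer]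
        simp
      · intro z _ hz
        rw [mul_smul_comm, map_smul, LinearMap.smul_apply, ← wd_singleton z, ← wd_cons,
          pair_wd_left, h2 _ [none, _] (by simp) rfl, co_none_cons_unitDer, if_neg hz, smul_zero]
    have e3 : pair k (Option Γ) (transLetter f T [none, none]) (f x) = co [none] (f x) := by
      have hmem : none ∈ T [none, none] := hT _ _ (by
        rw [h2 _ _ (by simp) rfl, co_none_cons_unitDer]
        simp)
      rw [transLetter, map_sum, LinearMap.sum_apply, Finset.sum_eq_single_of_mem none hmem]
      · rw [h2 _ _ (by simp) rfl, co_none_cons_unitDer, if_pos rfl, one_smul, ← wd_singleton,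
          pair_wd_left]
      · intro z _ hz
        rw [h2 _ _ (by simp) rfl, co_none_cons_unitDer, if_neg hz.symm, zero_smul, map_zero,
          LinearMap.zero_apply]
    rw [map_zero, co_der (T := T) _ _ hT hf.co_nil, hbar, map_sub, map_add, LinearMap.sub_apply,
      LinearMap.add_apply, e1, e2, e3] at h
    exact hne (by simpa using h)
  have hfd : f = unitDer idx d := by
    refine funext fun x => ext_co fun l => ?_
    by_cases hn : none ∈ l
    · by_cases hl2 : l.length = 2
      · exact h2 x l hn hl2
      · rw [co_unitDer_of_length d hn hl2]
        by_cases hlN : N < l.length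
        · exact hf.vanish_of_lt x l hlN
        · by_cases hl3 : 3 ≤ l.length
          · exact hf.vanish_of_even x l hl3 (by omega) ⟨0, List.mem_map.2 ⟨none, hn, rfl⟩, by simp⟩
          · have hpos := List.length_pos_of_mem hn
            obtain ⟨a, rfl⟩ := List.length_eq_one_iff.1 (show l.length = 1 by omega)
            have ha : none = a := by simpa using hn
            rw [← ha]
            exact hunit x
    · obtain ⟨m, rfl⟩ := exists_map_some hn
      cases x with
      | none =>
        -- No operation on arguments of positive degree takes values in `B_0`: the value has degree
        -- at least two.
        rw [co_map_some_unitDer_none]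
        by_contra h
        have h1 := hf.operadic _ _ h
        have h3 := degW_add_length D.one_le m
        rw [map_some_optIdx, List.length_map] at h1
        simp only [optIdx] at h1
        omega
      | some x => rw [co_map_some_unitDer, hco]
  refine ⟨d, hd, fun x => ?_, hfd⟩
  have h := hff (some x)
  rw [hfd, der_unitDer_unitDer_some d (hd.sgn D.one_le x)] at h
  exact emb_injective (h.trans (map_zero _).symm)

end DualLetters

end AdmissibleDerivation

/-! ### The weight of words of product shape -/

section ProductShape

/-- The operations of admissible shape have the weight of the ordinary product. -/
theorem IsProductShape.wtW_eq {N : ℕ} {l : List ℕ} (h : IsProductShape N l) :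
    wtW N id l = koszulDeg N (l.sum + 2 - l.length) := by
  rcases h with ⟨hl, h⟩ | ⟨hl, h⟩
  · have key : ∀ l : List ℕ, (∀ i ∈ l, ¬ Even i) →
        ∃ q, wtW N id l = N * q + l.length ∧ l.sum = 2 * q + l.length := by
      intro l
      induction l with
      | nil => exact fun _ => ⟨0, by simp⟩
      | cons i l ih =>
        intro h
        obtain ⟨q, h1, h2⟩ := ih fun j hj => h j (by simp [hj])
        obtain ⟨p, rfl⟩ := Nat.not_even_iff_odd.1 (h i (by simp))
        refine ⟨p + q, ?_, ?_⟩
        · rw [wtW_cons, h1, id, koszulDeg_two_mul_add_one, List.length_cons]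
          ring
        · rw [List.sum_cons, h2, List.length_cons]
          ring
    obtain ⟨q, h1, h2⟩ := key l h
    rw [h1, h2, show 2 * q + l.length + 2 - l.length = 2 * (q + 1) by omega, koszulDeg_two_mul, hl]
    ring
  · obtain ⟨i, j, rfl⟩ := List.length_eq_two.1 hl
    simp only [wtW_cons, wtW_nil, id, List.sum_cons, List.sum_nil, List.length_cons,
      List.length_nil, add_zero]
    rw [show i + j + 2 - (0 + 1 + 1) = i + j by omega]
    have h' : Even i ∨ Even j := by simpa using h
    rcases Nat.even_or_odd' i with ⟨p, rfl | rfl⟩ <;> rcases Nat.even_or_odd' j with ⟨q, rfl | rfl⟩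
    · rw [← mul_add, koszulDeg_two_mul, koszulDeg_two_mul, koszulDeg_two_mul, mul_add]
    · rw [← add_assoc, ← mul_add, koszulDeg_two_mul, koszulDeg_two_mul_add_one,
        koszulDeg_two_mul_add_one, mul_add, add_assoc]
    · rw [add_right_comm, ← mul_add, koszulDeg_two_mul, koszulDeg_two_mul_add_one,
        koszulDeg_two_mul_add_one, mul_add, add_right_comm]
    · simp at h'

end ProductShape

/-! ### Values of operations on words -/

section GradedOperations

variable {k : Type*} [Field k] {B : ℕ → Type*} [∀ i, AddCommGroup (B i)] [∀ i, Module k (B i)]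
  {X : Type*} {idx : X → ℕ} {fib : ℕ → Finset X} {e : Module.Basis X k (⨁ i, B i)}
  {f : X → FreeAlgebra k X}

theorem opVal_wd_eq_sum {l : List X} {g : X → k}
    (h : ∀ x, co l (f x) = suspSign k (l.map idx) * g x) :
    opVal idx fib e f (wd k l) = ∑ x ∈ fib ((l.map idx).sum + 2 - l.length), g x • e x := by
  rw [opVal, wordLift_wd, Finset.smul_sum]
  refine Finset.sum_congr rfl fun x _ => ?_
  rw [h x, smul_smul, ← mul_assoc, suspSign_mul_self, one_mul]

theorem opVal_wd_eq_zero {l : List X} (h : ∀ x, co l (f x) = 0) :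
    opVal idx fib e f (wd k l) = 0 := by
  rw [opVal_wd_eq_sum (g := 0) (by simpa using h)]
  simp

theorem op_eq_zero {n : ℕ} (h : ∀ x l, l.length = n → co l (f x) = 0) : op idx fib e f n = 0 := by
  refine Module.Basis.ext_multilinear (fun _ => e) fun v => ?_
  rw [op_basis, opVal_wd_eq_zero fun x => h x _ (by simp)]
  rfl

theorem opCoeff_eq_zero {μ : AInfinityStructure k B} {n : ℕ} {v : Fin n → X}
    (h : (μ.m n fun j => e (v j)) = 0) (x : X) : opCoeff idx e μ x (List.ofFn v) = 0 := by
  rw [opCoeff_ofFn, h, map_zero, Finsupp.zero_apply, mul_zero]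

theorem GradedBasis.op_lof_eq_zero (H : GradedBasis idx fib e) {n : ℕ} {d : Fin n → ℕ}
    (h : ∀ x l, l.map idx = List.ofFn d → co l (f x) = 0) (x : ∀ j, B (d j)) :
    op idx fib e f n (fun j => DirectSum.lof k ℕ B (d j) (x j)) = 0 := by
  rw [op_apply]
  refine supp_ext (g := 0) (fun l hl => ?_) (H.prod_letterMap_ofFn_mem d x)
  rw [LinearMap.zero_apply]
  exact opVal_wd_eq_zero fun x => h x l hl

end GradedOperations

/-! ### Admissibility of structures and of derivations -/

section Admissibility

universe u v w

variable {k : Type u} {V : Type v} [Field k] [AddCommGroup V] [Module k V] {L : Type w}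
  [Fintype L] [DecidableEq L] {b : Module.Basis L k V} {N : ℕ}
  {R : Submodule k (TensorAlgebra k V)} {Γ : Type*} {idx : Γ → ℕ} {c t : Γ → FreeAlgebra k L}
  {fib : ℕ → Finset Γ} {e : Module.Basis (Option Γ) k (⨁ i, BPiece N R i)}

namespace DualLetters

variable (D : DualLetters N (dualIdeal b N R) idx c t fib)

include D

theorem isAdmissibleDer_derOf (he : ∀ x, e x = letterVec b D x)
    (hrepr : ∀ m a, toDualAlg N R m = dualHom b N R a →
      ∀ x, e.repr m x = pair k L a (optVal c x))
    (H : GradedBasis (optIdx idx) (optFib fib) e) {μ : AInfinityStructure k (BPiece N R)}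
    (hμ : IsAdmissible N R μ) : IsAdmissibleDer N idx c t (H.derOf hμ.vanish_of_lt) := by
  have hofFn : ∀ {n} (l : List (Option Γ)), l.length = n → ∃ v : Fin n → Option Γ, l = List.ofFn v :=
    fun {n} l hl => by subst hl; exact ⟨l.get, (List.ofFn_get l).symm⟩
  have hprod : ∀ {n} (v : Fin n → Option Γ),
      (List.ofFn fun j => dualHom b N R (optVal t (v j))).prod =
        dualHom b N R (evalHom (optVal t) (wd k (List.ofFn v))) := fun {n} v => by
    rw [wd, map_list_prod, map_list_prod, List.map_ofFn, List.map_ofFn, List.map_ofFn]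
    congr 2
    funext j
    simp
  have hletter : ∀ {n} (v : Fin n → Option Γ), (μ.m n fun j => e (v j)) =
      μ.m n fun j => DirectSum.lof k ℕ (BPiece N R) (optIdx idx (v j))
        ⟨dualHom b N R (optVal t (v j)), dualHom_mem b (D.optVal_mem_len (v j))⟩ := fun {n} v => by
    simp only [he]
    rfl
  have hvalue : ∀ x {n} (v : Fin n → Option Γ), toDualAlg N R (μ.m n fun j => e (v j)) =
      dualHom b N R (evalHom (optVal t) (wd k (List.ofFn v))) →
      co (List.ofFn v) (H.derOf hμ.vanish_of_lt x) = suspSign k ((List.ofFn v).map (optIdx idx)) *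
        pair k L (evalHom (optVal t) (wd k (List.ofFn v))) (optVal c x) := fun x {n} v h => by
    rw [H.co_derOf, opCoeff_ofFn, hrepr _ _ h]
  refine ⟨H.isOperadic_derOf _, H.co_nil_derOf _, fun x l hl => ?_, fun x l h3 hl h => ?_,
    fun x l hl => ?_⟩
  · obtain ⟨v, hv⟩ := hofFn l rfl
    rw [H.co_derOf, hv]
    refine opCoeff_eq_zero ?_ x
    rw [hμ.vanish_of_lt _ hl]
    rfl
  · obtain ⟨v, hv⟩ := hofFn l rfl
    rw [H.co_derOf, hv]
    refine opCoeff_eq_zero ?_ x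
    rw [hletter, hμ.vanish_of_even _ h3 hl]
    · obtain ⟨i, hi, hi'⟩ := h
      rw [hv, List.map_ofFn, List.mem_ofFn] at hi
      obtain ⟨j, rfl⟩ := hi
      exact ⟨j, hi'⟩
  · rcases hl with ⟨hl, h⟩ | ⟨hl, h⟩
    · obtain ⟨v, rfl⟩ := hofFn l (by simpa using hl)
      refine hvalue x v ?_
      rw [hletter, hμ.odd_product, ← hprod]
      intro j
      rw [← Nat.not_even_iff_odd]
      exact h _ (by rw [List.map_ofFn, List.mem_ofFn]; exact ⟨j, rfl⟩)
    · obtain ⟨v, rfl⟩ := hofFn l (by simpa using hl)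
      refine hvalue x v ?_
      rw [hletter, hμ.two_product, ← hprod]
      · simp
      · obtain ⟨i, hi, hi'⟩ := h
        rw [List.map_ofFn, List.mem_ofFn] at hi
        obtain ⟨j, rfl⟩ := hi
        exact ⟨j, hi'⟩

/-- On words of product shape the value is the expansion of the product of the `t` in the basis of
`B`; its weight is that of the target degree, so `toDualAlg_sum` applies. Multilinearity passes from
words to homogeneous arguments. -/
theorem isAdmissible_of_isAdmissibleDer (he : ∀ x, e x = letterVec b D x)
    (H : GradedBasis (optIdx idx) (optFib fib) e) {f : Option Γ → FreeAlgebra k (Option Γ)}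
    (hf : IsAdmissibleDer N idx c t f) {μ : AInfinityStructure k (BPiece N R)}
    (hμ : ∀ n, μ.m n = op (optIdx idx) (optFib fib) e f n) : IsAdmissible N R μ := by
  have hword : ∀ l : List (Option Γ), IsProductShape N (l.map (optIdx idx)) →
      toDualAlg N R (opVal (optIdx idx) (optFib fib) e f (wd k l)) =
        dualHom b N R (evalHom (optVal t) (wd k l)) := by
    intro l hl
    have hmem := evalHom_wd_mem_len (k := k) D.optVal_mem_len l
    rw [← wtW_map, hl.wtW_eq, List.length_map] at hmem
    rw [← D.toDualAlg_sum he hmem, opVal_wd_eq_sum fun x => hf.product x l hl]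
  have hprod : ∀ {n} (d : Fin n → ℕ) (x : ∀ j, BPiece N R (d j)),
      IsProductShape N (List.ofFn d) →
      toDualAlg N R (μ.m n fun j => DirectSum.lof k ℕ (BPiece N R) (d j) (x j)) =
        (List.ofFn fun j => (x j : DualAlg N R)).prod := by
    intro n d x hs
    rw [hμ, op_apply]
    have h1 := supp_ext (f := toDualAlg N R ∘ₗ opVal (optIdx idx) (optFib fib) e f)
      (g := (dualHom b N R).toLinearMap ∘ₗ (evalHom (optVal t)).toLinearMap)
      (fun l hl => hword l (by rw [hl]; exact hs)) (H.prod_letterMap_ofFn_mem d x)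
    refine h1.trans ?_
    simp only [LinearMap.comp_apply, AlgHom.toLinearMap_apply]
    rw [map_list_prod, map_list_prod, List.map_ofFn, List.map_ofFn]
    congr 2
    funext j
    exact (D.dualHom_letterMap he _).trans (toDualAlg_lof _ _)
  refine ⟨fun n hn => ?_, fun d x h => hprod d x (Or.inl ⟨by simp, ?_⟩),
    fun n h3 hn d x h => ?_, fun d x h => ?_⟩
  · rw [hμ]
    exact op_eq_zero fun x l hl => hf.vanish_of_lt x l (by omega)
  · intro i hi
    rw [List.mem_ofFn] at hi
    obtain ⟨j, rfl⟩ := hi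
    exact Nat.not_even_iff_odd.2 (h j)
  · rw [hμ]
    refine H.op_lof_eq_zero (fun x l hl => ?_) x
    have hlen : l.length = n := by simpa using congrArg List.length hl
    obtain ⟨j, hj⟩ := h
    exact hf.vanish_of_even x l (by omega) (by omega)
      ⟨d j, by rw [hl, List.mem_ofFn]; exact ⟨j, rfl⟩, hj⟩
  · rw [hprod d x (Or.inr ⟨by simp, ?_⟩)]
    · simp
    · obtain ⟨j, hj⟩ := h
      exact ⟨d j, by rw [List.mem_ofFn]; exact ⟨j, rfl⟩, hj⟩

end DualLetters

end Admissibility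

/-! ### The signs `εᵢ` -/

section Signs

variable (k : Type*) [Field k]

theorem suspSign_replicate_succ (n : ℕ) :
    suspSign k (List.replicate (n + 1) 1) = (-1) ^ n * suspSign k (List.replicate n 1) := by
  rw [List.replicate_succ, suspSign, suspExp, List.length_replicate, mul_one, pow_add, suspSign]

/-- The factor for `N - i` arguments of degree one is the suspension sign of `m_{N-i}`, the factor
for `N` is the sign of the leading term. Omitting two arguments changes a suspension sign by `-1`,
whence the recursion. -/
theorem cast_dualSign {N : ℕ} (i : ℕ) (hi : i ≤ N) : (dualSign N i : k) =
    suspSign k (List.replicate (N - i) 1) * suspSign k (List.replicate N 1) := by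
  induction i using dualSign.induct with
  | case1 => simp [dualSign, suspSign_mul_self]
  | case2 =>
    obtain ⟨M, rfl⟩ := Nat.exists_eq_add_of_le' hi
    rw [Nat.add_sub_cancel, suspSign_replicate_succ, mul_left_comm, suspSign_mul_self, dualSign]
    simp
  | case3 i ih =>
    rw [dualSign, Int.cast_neg, ih (by omega)]
    obtain ⟨m, rfl⟩ := Nat.exists_eq_add_of_le' hi
    rw [show m + (i + 2) - i = m + 1 + 1 by omega, Nat.add_sub_cancel, suspSign_replicate_succ k (m + 1),
      suspSign_replicate_succ k m, ← mul_assoc, ← pow_add, ← neg_mul]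
    congr 1
    rw [show m + 1 + m = 2 * m + 1 by ring, pow_succ, pow_mul]
    simp

end Signs

theorem pair_part_right {k : Type*} [Field k] {X : Type*} {n : ℕ} {a : FreeAlgebra k X}
    (ha : a ∈ len k X n) (y : FreeAlgebra k X) :
    pair k X a (part (fun l => l.length = n) y) = pair k X a y :=
  supp_ext (f := (pair k X).flip (part (fun l => l.length = n) y)) (g := (pair k X).flip y)
    (fun l hl => by
      simp only [LinearMap.flip_apply, pair_wd_left]
      exact co_part_of (p := fun l => l.length = n) hl y) ha

/-! ### Relations of the deformation and values of the differential -/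

section Correspondence

universe u v w

variable {k : Type u} {V : Type v} [Field k] [AddCommGroup V] [Module k V] {L : Type w}
  [Fintype L] [DecidableEq L] {b : Module.Basis L k V} {N : ℕ}
  {R P : Submodule k (TensorAlgebra k V)} {Γ : Type*} {idx : Γ → ℕ} {c t : Γ → FreeAlgebra k L}
  {fib : ℕ → Finset Γ} {e : Module.Basis (Option Γ) k (⨁ i, BPiece N R i)}

namespace DualLetters

variable (D : DualLetters N (dualIdeal b N R) idx c t fib)

include D

omit D in
theorem dualHom_injOn (h1 : len k L 1 ≤ orthPart (dualIdeal b N R) 1) {a a' : FreeAlgebra k L}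
    (ha : a ∈ len k L 1) (ha' : a' ∈ len k L 1) (h : dualHom b N R a = dualHom b N R a') :
    a = a' := by
  rw [← sub_eq_zero, ← map_sub, dualHom_eq_zero] at h
  refine sub_eq_zero.1 (ext_co fun l => ?_)
  rw [map_zero]
  by_cases hl : l.length = 1
  · rw [← pair_wd_right]
    exact (h1 (hl ▸ wd_mem_len l)).2 _ h
  · exact sub_mem ha ha' l hl

/-- There are no relations in degree one, since `N ≥ 2`; so a linear form is recovered exactly, and
not only modulo the ideal, from its class in `B₁`. -/
theorem evalHom_prod_linearClass (he : ∀ x, e x = letterVec b D x)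
    (H : GradedBasis (optIdx idx) (optFib fib) e)
    (h1 : len k L 1 ≤ orthPart (dualIdeal b N R) 1) {n : ℕ} (w : Fin n → Module.Dual k V) :
    evalHom (optVal t) (List.ofFn fun j =>
      letterMap e (DirectSum.lof k ℕ (BPiece N R) 1 (linearClass N R (w j)))).prod =
      coordEquiv b.dualBasis (TensorAlgebra.tprod k _ n w) := by
  rw [TensorAlgebra.tprod_apply, map_list_prod, map_list_prod, List.map_ofFn, List.map_ofFn]
  congr 2
  funext j
  refine dualHom_injOn h1 ?_ ?_ ?_
  · have h2 := supp_map_mem (evalHom (optVal t)).toLinearMap (len k L 1) (fun l hl => ?_)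
      (H.letterMap_lof_mem 1 (linearClass N R (w j)))
    · exact h2
    · have h3 := evalHom_wd_mem_len (k := k) D.optVal_mem_len l
      rw [← wtW_map, hl] at h3
      simpa [koszulDeg] using h3
  · rw [Function.comp_apply, coordEquiv_mem_len]
    simp [tensorDeg]
  · refine (D.dualHom_letterMap he _).trans ?_
    rw [toDualAlg_lof, Function.comp_apply, dualHom_coordEquiv]
    rfl

-- A word in `n` letters of index one pairs only with the degree `n` part of the value at `x`. This
-- part comes from words of that same shape, on which `t` and `c` are dual.
omit [Fintype L] [DecidableEq L] in
theorem co_eq_pair_evalHom {d : Γ → FreeAlgebra k Γ} (hd : IsFiltered N idx D.d₀ d) {x : Γ}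
    (hx : idx x = 2) {l : List (Option Γ)} {n : ℕ}
    (hl : l.map (optIdx idx) = List.replicate n 1) :
    co l (unitDer idx d (some x)) = pair k L (evalHom (optVal t) (wd k l)) (evalHom c (d x)) := by
  have hn : none ∉ l := fun h => by
    have : 0 ∈ l.map (optIdx idx) := List.mem_map.2 ⟨none, h, rfl⟩
    rw [hl] at this
    simpa using List.eq_of_mem_replicate this
  obtain ⟨m, rfl⟩ := exists_map_some hn
  rw [map_some_optIdx] at hl
  have hwt : wtW N idx m = n := by
    rw [← wtW_map, hl, wtW_replicate_one]
  have hmem := evalHom_wd_mem_len (k := k) D.t_mem m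
  rw [hwt] at hmem
  have hpart : part (fun l => wtW N idx l = n) (d x) ∈ supp k fun l => l.map idx = m.map idx := by
    intro l' hl'
    by_cases hw : wtW N idx l' = n
    · rw [co_part_of (p := fun l => wtW N idx l = n) hw]
      refine hd.deg x l' fun h => hl' ?_
      have h0 := forall_idx_eq_one D.one_le (show degW idx l' = 0 by omega)
      rw [← wtW_map, h0, wtW_replicate_one] at hw
      change l'.map idx = m.map idx
      rw [h0, hw, hl]
    · exact co_part_of_not hw _
  rw [co_map_some_unitDer, evalHom_map_some, ← co_part_of (p := fun l => wtW N idx l = n) hwt,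
    D.co_eq_pair hpart, ← D.part_evalHom]
  exact pair_part_right hmem _

theorem repr_op_linearClass (he : ∀ x, e x = letterVec b D x)
    (H : GradedBasis (optIdx idx) (optFib fib) e)
    (h1 : len k L 1 ≤ orthPart (dualIdeal b N R) 1)
    {d : Γ → FreeAlgebra k Γ} (hd : IsFiltered N idx D.d₀ d) {x : Γ} (hx : idx x = 2) {n : ℕ}
    (w : Fin n → Module.Dual k V) :
    e.repr (op (optIdx idx) (optFib fib) e (unitDer idx d) n fun j =>
      DirectSum.lof k ℕ (BPiece N R) 1 (linearClass N R (w j))) (some x) =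
      suspSign k (List.replicate n 1) *
        pair k L (coordEquiv b.dualBasis (TensorAlgebra.tprod k _ n w)) (evalHom c (d x)) := by
  rw [← D.evalHom_prod_linearClass he H h1, op_apply]
  have hf := (D.isAdmissibleDer_unitDer hd).operadic
  refine supp_ext (f := e.coord (some x) ∘ₗ opVal (optIdx idx) (optFib fib) e (unitDer idx d))
    (g := suspSign k (List.replicate n 1) • ((pair k L).flip (evalHom c (d x)) ∘ₗ
      (evalHom (optVal t)).toLinearMap)) (fun l hl => ?_)
    (H.prod_letterMap_ofFn_mem (fun _ => 1) fun j => linearClass N R (w j))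
  rw [List.ofFn_const] at hl
  refine (H.repr_opVal hf l (some x)).trans ?_
  rw [hl, D.co_eq_pair_evalHom hd hx hl]
  rfl


theorem toDualAlg_op_linearClass_mem (he : ∀ x, e x = letterVec b D x)
    (H : GradedBasis (optIdx idx) (optFib fib) e) (f : Option Γ → FreeAlgebra k (Option Γ)) {n : ℕ}
    (w : Fin n → Module.Dual k V) :
    toDualAlg N R (op (optIdx idx) (optFib fib) e f n fun j =>
      DirectSum.lof k ℕ (BPiece N R) 1 (linearClass N R (w j))) ∈ quotDeg (perp N R) N := by
  rw [op_apply]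
  refine supp_map_mem (toDualAlg N R ∘ₗ opVal (optIdx idx) (optFib fib) e f) _ (fun l hl => ?_)
    (H.prod_letterMap_ofFn_mem (fun _ => 1) fun j => linearClass N R (w j))
  rw [List.ofFn_const] at hl
  have hlen : l.length = n := by simpa using congrArg List.length hl
  rw [LinearMap.comp_apply, opVal_wd_eq_sum (g := fun x => suspSign k (l.map (optIdx idx)) * co l (f x))
    fun x => by rw [← mul_assoc, suspSign_mul_self, one_mul], map_sum]
  refine Submodule.sum_mem _ fun x hx => ?_
  rw [D.mem_optFib, hl, hlen, List.sum_replicate, smul_eq_mul, mul_one, Nat.add_sub_cancel_left] at hx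
  rw [map_smul, he, letterVec, toDualAlg_lof]
  refine Submodule.smul_mem _ _ ?_
  have := dualHom_mem (N := N) (R := R) b (D.optVal_mem_len x)
  rwa [hx, koszulDeg_two] at this

/-- Pairing the value at a letter of index two with tensors of degree `N - i` gives the transpose of
`m_{N-i}`, up to suspension sign; pairing it with degree `N` gives the leading term. The condition
with the `εᵢ` therefore compares, degree by degree, the elements of `P` with these values. -/
theorem corresponds_iff (hR : R ≤ tensorDeg k V N) (he : ∀ x, e x = letterVec b D x)
    (hrepr : ∀ m a, toDualAlg N R m = dualHom b N R a →
      ∀ x, e.repr m x = pair k L a (optVal c x))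
    (H : GradedBasis (optIdx idx) (optFib fib) e)
    (hP : IsCoordPBW N (R.map (coordEquiv b).toLinearMap) (P.map (coordEquiv b).toLinearMap))
    {d : Γ → FreeAlgebra k Γ} (hd : IsFiltered N idx D.d₀ d)
    {μ : AInfinityStructure k (BPiece N R)}
    (hμ : ∀ n, μ.m n = op (optIdx idx) (optFib fib) e (unitDer idx d) n) :
    Corresponds N R P μ ↔
      ∀ x, idx x = 2 → evalHom c (d x) ∈ P.map (coordEquiv b).toLinearMap := by
  have hR' : R.map (coordEquiv b).toLinearMap ≤ len k L N := by
    rintro _ ⟨r, hr, rfl⟩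
    exact (coordEquiv_mem_len b).2 (hR hr)
  have h1 : len k L 1 ≤ orthPart (dualIdeal b N R) 1 :=
    len_le_orthPart relPerp_le_len (by have := D.two_le; omega)
  have horth : orthPart (dualIdeal b N R) N = R.map (coordEquiv b).toLinearMap :=
    orthPart_relPerp hR'
  have hη : ∀ n, suspSign k (List.replicate n 1) * suspSign k (List.replicate n 1) = 1 :=
    fun n => suspSign_mul_self k _
  have hlead : ∀ x, idx x = 2 → ∀ a ∈ len k L N,
      pair k L a (evalHom c (d x)) = leadSign k N * pair k L a (c x) := fun x hx a ha => by
    rw [← pair_part_right ha, D.part_evalHom_of_isFiltered hd hx, map_smul, smul_eq_mul]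
  have hvalue : ∀ {n} (w : Fin n → Module.Dual k V) (s : TensorAlgebra k (Module.Dual k V)),
      quotHom (perp N R) s = toDualAlg N R
        (μ.m n fun j => DirectSum.lof k ℕ (BPiece N R) 1 (linearClass N R (w j))) →
      ∀ x, idx x = 2 → pair k L (coordEquiv b.dualBasis s) (c x) =
        suspSign k (List.replicate n 1) * pair k L
          (coordEquiv b.dualBasis (TensorAlgebra.tprod k _ n w)) (evalHom c (d x)) := by
    intro n w s hs x hx
    rw [← D.repr_op_linearClass he H h1 hd hx w, ← hμ]
    exact (hrepr _ _ (hs.symm.trans (dualHom_coordEquiv b s).symm) (some x)).symm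
  constructor
  · intro hC x hx
    have hcx := D.c_mem x
    rw [hx, koszulDeg_two, horth] at hcx
    obtain ⟨q, hq, hqx⟩ := hP.exists_part _ hcx
    -- Degrees strictly between `0` and `N` are governed by the correspondence, degree `N` by the
    -- common leading part. In degree zero both sides vanish, as `P` is augmented and `d` has no
    -- constant term.
    have hqe : q = leadSign k N • evalHom c (d x) := by
      refine ext_co fun l => ?_
      rcases lt_trichotomy l.length N with hlN | hlN | hlN
      · by_cases hl0 : l = []
        · rw [hl0, hP.co_nil q hq, map_smul, D.co_nil_evalHom, hd.co_nil, smul_zero]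
        · have hpos := List.length_pos_iff.2 hl0
          obtain ⟨i, hi⟩ : ∃ i, l.length = N - i ∧ 1 ≤ i ∧ i < N := ⟨N - l.length, by omega⟩
          obtain ⟨f, rfl⟩ : ∃ f : Fin (N - i) → L, l = List.ofFn f := by
            rw [← hi.1]
            exact ⟨l.get, (List.ofFn_get l).symm⟩
          obtain ⟨p, hp, rfl⟩ := hq
          obtain ⟨s, hs, hsM⟩ := D.toDualAlg_op_linearClass_mem he H
            (unitDer idx d) fun j => b.dualBasis (f j)
          change quotHom (perp N R) s = _ at hsM
          rw [← hμ] at hsM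
          have h2 := hC i hi.2.1 hi.2.2 (fun j => b.dualBasis (f j)) s hs hsM p hp
          have h3 := hvalue _ s hsM x hx
          have h4 := pair_part_right ((coordEquiv_mem_len b.dualBasis).2 hs) (coordEquiv b p)
          change part _ (coordEquiv b p) = _ at hqx
          rw [hqx, h3] at h4
          rw [tensorPairing_eq b, tensorPairing_eq b, zsmul_eq_mul, cast_dualSign k i hi.2.2.le,
            ← h4, coordEquiv_tprod, pair_wd_left, pair_wd_left] at h2
          rw [map_smul, smul_eq_mul]
          refine h2.trans ?_
          generalize co (List.ofFn f) (evalHom c (d x)) = z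
          have h5 := hη (N - i)
          linear_combination (z * suspSign k (List.replicate N 1)) * h5
      · rw [← co_part_of (p := fun l => l.length = N) hlN, hqx,
          ← co_part_of (p := fun l => l.length = N) hlN (_ • _), map_smul,
          D.part_evalHom_of_isFiltered hd hx, smul_smul, hη, one_smul]
      · have h2 := D.evalHom_mem_lt (w := N + 1) (y := d x) (supp_mono (fun m hm => by
          have := hm.2
          rw [hx, koszulDeg_two] at this
          omega) (hd.deg_wt D.isHomogeneous_d₀ x))
        rw [hP.le_supp hq l (by omega), map_smul, h2 l (by omega), smul_zero]
    have := Submodule.smul_mem _ (leadSign k N) hq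
    rwa [hqe, smul_smul, hη, one_smul] at this
  · intro hdP i hi hiN w s hs hsM p hp
    -- The values at letters of index two span `P`, and the required identity is linear in `p`; it
    -- suffices to check it on these values.
    have hpP : coordEquiv b p ∈ relSpace c idx d := by
      rw [← D.eq_relSpace horth hP hd hdP]
      exact Submodule.mem_map_of_mem hp
    have hs' : coordEquiv b.dualBasis s ∈ len k L N := (coordEquiv_mem_len b.dualBasis).2 hs
    rw [tensorPairing_eq b, tensorPairing_eq b, zsmul_eq_mul, cast_dualSign k i hiN.le]
    refine Submodule.span_induction (p := fun q _ =>
      pair k L (coordEquiv b.dualBasis (TensorAlgebra.tprod k _ (N - i) w)) q =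
        suspSign k (List.replicate (N - i) 1) * suspSign k (List.replicate N 1) *
          pair k L (coordEquiv b.dualBasis s) q) ?_ (by simp) ?_ ?_ hpP
    · rintro _ ⟨x, hx, rfl⟩
      rw [hlead x hx _ hs', hvalue w s hsM x hx]
      generalize pair k L (coordEquiv b.dualBasis (TensorAlgebra.tprod k _ (N - i) w))
        (evalHom c (d x)) = z
      have h2 := hη (N - i)
      have h3 := hη N
      linear_combination (-z * (suspSign k (List.replicate N 1)) ^ 2) * h2 - z * h3
    · intro q q' _ _ h h'
      rw [map_add, map_add, h, h', mul_add]
    · intro a q _ h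
      rw [map_smul, map_smul, h, smul_eq_mul, smul_eq_mul, mul_left_comm]

end DualLetters

end Correspondence

/-- A relation that is bijective is the graph of an equivalence. -/
theorem exists_equiv_of_existsUnique {α β : Type*} {r : α → β → Prop} (h : ∀ a, ∃! b, r a b)
    (h' : ∀ b, ∃! a, r a b) : ∃ Φ : α ≃ β, ∀ a b, Φ a = b ↔ r a b := by
  choose f hf hfu using h
  choose g hg hgu using h'
  exact ⟨⟨f, g, fun a => (hgu _ _ (hf a)).symm, fun b => (hfu _ _ (hg b)).symm⟩,
    fun a b => ⟨fun e => e ▸ hf a, fun e => (hfu _ _ e).symm⟩⟩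

/-! ### Existence and uniqueness in both directions -/

section Bijection

universe u v

variable {k : Type u} {V : Type v} [Field k] [AddCommGroup V] [Module k V]
  [FiniteDimensional k V] {N : ℕ} {R : Submodule k (TensorAlgebra k V)}

/-- Both sides are parametrized by filtered differentials of square zero: structures through the
unital extension and the Stasheff dictionary, deformations through the span of the values on letters
of index two. By `corresponds_iff`, the correspondence is equality of parameters. -/
theorem existsUnique_corresponds (hN : 2 ≤ N) (hR : R ≤ tensorDeg k V N) (hA : IsNKoszul N R) :
    (∀ P, IsAugmentedPBWDeformation N R P → ∃! μ, IsAdmissible N R μ ∧ Corresponds N R P μ) ∧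
      ∀ μ, IsAdmissible N R μ → ∃! P, IsAugmentedPBWDeformation N R P ∧ Corresponds N R P μ := by
  let b := Module.finBasis k V
  set R' := R.map (coordEquiv b).toLinearMap with hR'_def
  have hR' : R' ≤ len k _ N := by
    rintro _ ⟨r, hr, rfl⟩
    exact (coordEquiv_mem_len b).2 (hR hr)
  obtain ⟨idx, fib, c, t, D⟩ : ∃ (idx : Letter N (dualIdeal b N R) → ℕ) (fib : _) (c t : _),
      DualLetters N (dualIdeal b N R) idx c t fib :=
    ⟨_, _, exists_dualLetters N _ hN (isIdeal_relIdeal _)⟩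
  have h0 : len k _ 0 ≤ orthPart (dualIdeal b N R) 0 :=
    len_le_orthPart relPerp_le_len (by omega)
  have h1 : len k _ 1 ≤ orthPart (dualIdeal b N R) 1 :=
    len_le_orthPart relPerp_le_len (by omega)
  have horth : orthPart (dualIdeal b N R) N = R' := orthPart_relPerp hR'
  obtain ⟨G, hG⟩ := hA.exists_koszulSpaces hN hR b
  have hac : IsAcyclic N idx D.d₀ := D.isAcyclic h1 (by
    rw [horth]
    exact hG.isKoszulExact hR' hN D)
  obtain ⟨e, he, hrepr⟩ := exists_gradedBasis b hN D
  have H := D.gradedBasis he hrepr h0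
  have hpbw : ∀ P, IsAugmentedPBWDeformation N R P ↔
      IsCoordPBW N R' (P.map (coordEquiv b).toLinearMap) := fun P =>
    isAugmentedPBWDeformation_iff b hR
  have hstr : ∀ d, IsFiltered N idx D.d₀ d → (∀ x, der (degSign k idx) d (d x) = 0) →
      ∃ μ : AInfinityStructure k (BPiece N R), IsAdmissible N R μ ∧
        ∀ n, μ.m n = op (optIdx idx) (optFib fib) e (unitDer idx d) n := by
    intro d hd hdd
    have hf := D.isAdmissibleDer_unitDer hd
    refine ⟨H.aInfinity hf.operadic hf.co_nil fun x => ?_, ?_⟩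
    · cases x with
      | none => exact der_unitDer_unitDer_none d
      | some x =>
        rw [der_unitDer_unitDer_some d (hd.sgn D.one_le x), hdd, map_zero]
    · exact ⟨D.isAdmissible_of_isAdmissibleDer he H hf fun _ => rfl, fun _ => rfl⟩
  have hder : ∀ μ : AInfinityStructure k (BPiece N R), IsAdmissible N R μ →
      ∃ d, IsFiltered N idx D.d₀ d ∧ (∀ x, der (degSign k idx) d (d x) = 0) ∧
        ∀ n, μ.m n = op (optIdx idx) (optFib fib) e (unitDer idx d) n := by
    intro μ hμ
    obtain ⟨d, hd, hdd, hfd⟩ := D.exists_eq_unitDer (D.isAdmissibleDer_derOf he hrepr H hμ)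
      (H.der_derOf hμ.vanish_of_lt)
    exact ⟨d, hd, hdd, fun n => by rw [H.m_eq_op hμ.vanish_of_lt n, hfd]⟩
  refine ⟨fun P hP => ?_, fun μ hμ => ?_⟩
  · have hP' := (hpbw P).1 hP
    obtain ⟨d, hd, hdd, hdP⟩ := D.exists_isFiltered h1 horth hac hP'
    obtain ⟨μ, hμ, hμd⟩ := hstr d hd hdd
    refine ⟨μ, ⟨hμ, (D.corresponds_iff hR he hrepr H hP' hd hμd).2 hdP⟩, ?_⟩
    rintro μ' ⟨hμ', hC⟩
    obtain ⟨d', hd', hdd', hμd'⟩ := hder μ' hμ'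
    have hdP' := (D.corresponds_iff hR he hrepr H hP' hd' hμd').1 hC
    have := D.isFiltered_unique hac hP' hd hd' hdd hdd' hdP hdP'
    refine AInfinityStructure.ext (funext fun n => ?_)
    rw [hμd, hμd', this]
  · obtain ⟨d, hd, hdd, hμd⟩ := hder μ hμ
    have hinj : Function.Injective (Submodule.map (coordEquiv b).toLinearMap) :=
      Submodule.map_injective_of_injective (coordEquiv b).injective
    -- The deformation of a given structure is the span of the values of its differential on letters
    -- of index two, carried back to `T(V)`.
    set P := (DualLetters.relSpace c idx d).comap (coordEquiv b).toLinearMap with hP_def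
    have hPmap : P.map (coordEquiv b).toLinearMap = DualLetters.relSpace c idx d :=
      Submodule.map_comap_eq_of_surjective (coordEquiv b).surjective _
    have hP' : IsCoordPBW N R' (P.map (coordEquiv b).toLinearMap) := by
      rw [hPmap]
      exact D.isCoordPBW_relSpace h1 horth hac hd hdd
    refine ⟨P, ⟨(hpbw P).2 hP', (D.corresponds_iff hR he hrepr H hP' hd hμd).2 fun x hx => ?_⟩, ?_⟩
    · rw [hPmap]
      exact Submodule.subset_span ⟨x, hx, rfl⟩
    · rintro Q ⟨hQ, hC⟩
      have hQ' := (hpbw Q).1 hQ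
      have hdQ := (D.corresponds_iff hR he hrepr H hQ' hd hμd).1 hC
      exact hinj ((D.eq_relSpace horth hQ' hd hdQ).trans hPmap.symm)

end Bijection

end NKoszul

end

theorem theorem2p1 {k : Type*} {V : Type*} [Field k] [AddCommGroup V] [Module k V]
    [FiniteDimensional k V] (N : ℕ) (hN : 2 ≤ N) (R : Submodule k (TensorAlgebra k V))
    (hR : R ≤ NKoszul.tensorDeg k V N) (hA : NKoszul.IsNKoszul N R) :
    ∃ Φ : {P : Submodule k (TensorAlgebra k V) // NKoszul.IsAugmentedPBWDeformation N R P} ≃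
        {μ : NKoszul.AInfinityStructure k (NKoszul.BPiece N R) // NKoszul.IsAdmissible N R μ},
      ∀ P μ, Φ P = μ ↔ NKoszul.Corresponds N R P.1 μ.1 := by
  obtain ⟨h, h'⟩ := NKoszul.existsUnique_corresponds hN hR hA
  refine NKoszul.exists_equiv_of_existsUnique (fun P => ?_) fun μ => ?_
  · obtain ⟨μ, ⟨hμ, hC⟩, hu⟩ := h P.1 P.2
    exact ⟨⟨μ, hμ⟩, hC, fun ν hν => Subtype.ext (hu _ ⟨ν.2, hν⟩)⟩
  · obtain ⟨P, ⟨hP, hC⟩, hu⟩ := h' μ.1 μ.2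
    exact ⟨⟨P, hP⟩, hC, fun Q hQ => Subtype.ext (hu _ ⟨Q.2, hQ⟩)⟩
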